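/- Let $N\ge 2$. Fix a radial $\varphi\in\mathcal S(\mathbb R^N)$, supported in $\{3/4\le|\xi|\le 8/3\}$, with $\sum_{j\in\mathbb Z}\varphi(2^{-j}\xi)=1$ for $\xi\ne0$, and put $\Delta_j=\varphi(2^{-j}D)$. On tempered distributions modulo polynomials let $$\|f\|_{\dot B^{s}_{p,1}}=\sum_k 2^{ks}\|\Delta_kf\|_{L^p},\qquad \|f\|_{\widetilde L^q_T(\dot B^{s}_{p,1})}=\sum_k2^{ks}\|\Delta_kf\|_{L^q(0,T;L^p)} .$$ For $c>0$ let $e_\ell(t)=(1-e^{-c2^{2\ell}t})^{1/2}$ and $\omega_k(t)=\sum_{\ell\ge k}2^{k-\ell}e_\ell(t)$; the norms of $\dot B^s_{p,1}(\omega)$ and $\widetilde L^q_T(\dot B^s_{p,1}(\omega))$ are obtained from the two above by inserting the factor $\omega_k(T)$ in the $k$-th term. Consider on $(0,T)\times\mathbb R^N$, $0<T<\infty$, the linearized momentum equation $$\partial_tu-\operatorname{div}(\bar\mu\nabla u)-\nabla\big((\bar\lambda+\bar\mu)\operatorname{div}u\big)=G,\qquad u|_{t=0}=u_0,$$ where $\bar\mu=\bar\mu(\rho)$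 and $\bar\lambda=\bar\lambda(\rho)$ depend smoothly on the function $\rho(t,x)$ and $\bar\mu\ge c_1$, $\bar\lambda+2\bar\mu\ge c_1$ for a constant $c_1>0$. Precisely, $\rho$ takes its values in an open interval $J$ on which $\bar\mu,\bar\lambda$ are smooth, with derivatives of orders $1,\dots,[N/p]+4$ bounded by $K$. Let $1<p<\infty$, let $\underline\rho$ be a constant, and assume $G\in L^1_T(\dot B^{s-1}_{p,1})$, $u_0\in\dot B^{s-1}_{p,1}$, and $\rho-\underline\rho\in L^\infty_T(\dot B^{N/p}_{p,1})$ (as a function equal to the sum of its dyadic blocks). Put $$A(T)=\big(1+\|\rho\|_{L^\infty_T(L^\infty)}\big)^{[N/p]+2}.$$ There is $c>0$ depending only on $N,p,c_1$, and, for $s>1-N\min(\frac1p,\frac1{p'})$, a constant $C$ depending only on $N,p,s,c_1,K,\varphi$ such that every solution $u$ of the equation, in the sense of distributions modulo polynomials, satisfies the following. (a) If $p\in(1,N]$, $s\le \frac Np$ and $u\in L^1_T(\dot B^{s+1}_{p,1})$, then for all $q\in[1,\infty]$ $$\|u\|_{\widetilde L^q_T(\dot B^{s-1+2/q}_{p,1})}\le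 C\Big(\|u_0\|_{\dot B^{s-1}_{p,1}}+\|G\|_{\widetilde L^1_T(\dot B^{s-1}_{p,1})}+A(T)\|\rho-\underline\rho\|_{\widetilde L^\infty_T(\dot B^{N/p}_{p,1})}\|u\|_{\widetilde L^1_T(\dot B^{s+1}_{p,1})}\Big).$$ If in addition to the general assumptions $\rho-\underline\rho\in L^\infty_T(\dot B^{N/p+1}_{p,1})$, then for $p\in(1,\infty)$, $s\le\frac Np+1$, $u\in L^1_T(\dot B^{s}_{p,1})$ and all $q\in[1,\infty]$ $$\|u\|_{\widetilde L^q_T(\dot B^{s-1+2/q}_{p,1})}\le C\Big(\|u_0\|_{\dot B^{s-1}_{p,1}}+\|G\|_{\widetilde L^1_T(\dot B^{s-1}_{p,1})}+A(T)\|\rho-\underline\rho\|_{\widetilde L^\infty_T(\dot B^{N/p+1}_{p,1})}\|u\|_{\widetilde L^1_T(\dot B^{s}_{p,1})}\Big).$$ (b) If $p\in(1,N]$, $s\le\frac Np$ and $u\in L^1_T(\dot B^{s+1}_{p,1})$, then $$\|u\|_{\widetilde L^1_T(\dot B^{s+1}_{p,1})}+\|u\|_{\widetilde L^2_T(\dot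 B^{s}_{p,1})}\le C\Big(\|u_0\|_{\dot B^{s-1}_{p,1}(\omega)}+\|G\|_{\widetilde L^1_T(\dot B^{s-1}_{p,1}(\omega))}+A(T)\|\rho-\underline\rho\|_{\widetilde L^\infty_T(\dot B^{N/p}_{p,1}(\omega))}\|u\|_{\widetilde L^1_T(\dot B^{s+1}_{p,1})}\Big).$$ -/

import Mathlib

open MeasureTheory SchwartzMap Set
open scoped ENNReal NNReal ContDiff FourierTransform LineDeriv

noncomputable section

namespace LinMom

/-- The space `ℝ^N` with its Euclidean norm. -/
abbrev Sp (N : ℕ) : Type := EuclideanSpace ℝ (Fin N)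

/-- A Littlewood-Paley function: a radial Schwartz function `φ`, supported in the annulus
`3/4 ≤ |ξ| ≤ 8/3`, with `∑_j φ(2^{-j} ξ) = 1` for all `ξ ≠ 0`. -/
structure LPFunction (N : ℕ) where
  φ : 𝓢(Sp N, ℝ)
  radial : ∀ ξ η : Sp N, ‖ξ‖ = ‖η‖ → φ ξ = φ η
  annulus : ∀ ξ : Sp N, φ ξ ≠ 0 → 3 / 4 ≤ ‖ξ‖ ∧ ‖ξ‖ ≤ 8 / 3
  sum_eq_one : ∀ ξ : Sp N, ξ ≠ 0 → HasSum (fun j : ℤ => φ ((2 : ℝ) ^ (-j) • ξ)) 1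

variable {N : ℕ}

/-- The dyadic block `Δ_j f = φ(2^{-j} D) f`, `D = -i∇`, of a tempered distribution. Mathlib's
Fourier transform uses the character `exp(-2πi x·ξ)`, for which `D` has the symbol `2πξ`.
The block vanishes on polynomials, so it is defined on classes modulo polynomials. -/
def block (Φ : LPFunction N) (j : ℤ) (f : 𝓢'(Sp N, ℂ)) : 𝓢'(Sp N, ℂ) :=
  TemperedDistribution.fourierMultiplierCLM ℂ
    (fun ξ : Sp N => ((Φ.φ ((2 : ℝ) ^ (-j) • (2 * Real.pi) • ξ) : ℝ) : ℂ)) f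

/-- The function `g` and the tempered distribution `f` are the same object:
`⟨f, χ⟩ = ∫ χ g` (absolutely convergent) for all Schwartz functions `χ`. -/
def Represents (g : Sp N → ℂ) (f : 𝓢'(Sp N, ℂ)) : Prop :=
  ∀ χ : 𝓢(Sp N, ℂ), Integrable (fun x => χ x * g x) ∧ f χ = ∫ x, χ x * g x

open Classical in
/-- The function (unique almost everywhere) that represents `f`, if there is one. -/
def density (f : 𝓢'(Sp N, ℂ)) : Sp N → ℂ :=
  if h : ∃ g, Represents g f then h.choose else 0

/-- The `L^p` norm of a tempered distribution; it is `∞` if `f` is not a function. -/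
def lpNorm (p : ℝ) (f : 𝓢'(Sp N, ℂ)) : ℝ≥0∞ :=
  ⨅ (g : Sp N → ℂ) (_ : Represents g f), eLpNorm g (ENNReal.ofReal p) volume

/-! ### Weights -/

/-- `e_ℓ(t) = (1 - exp(-c 2^{2ℓ} t))^{1/2}`. -/
def eWeight (c : ℝ) (l : ℤ) (t : ℝ) : ℝ :=
  Real.sqrt (1 - Real.exp (-(c * (2 : ℝ) ^ (2 * l) * t)))

/-- `ω_k(t) = ∑_{ℓ ≥ k} 2^{k-ℓ} e_ℓ(t)`, summed over `ℓ = k + n` with `n ∈ ℕ`. -/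
def omegaWeight (c : ℝ) (t : ℝ) (k : ℤ) : ℝ :=
  ∑' n : ℕ, ((2 : ℝ) ^ n)⁻¹ * eWeight c (k + n) t

/-- The trivial weight. -/
def oneWeight (_ : ℤ) : ℝ := 1

/-! ### Besov and Chemin-Lerner norms (third index `1`), with a weight `w` -/

/-- `‖f‖ = ∑_k 2^{ks} w_k ‖Δ_k f‖_{L^p}`. The weight `1` gives the norm of `Ḃ^s_{p,1}`,
the weight `k ↦ ω_k(T)` gives the norm of `Ḃ^s_{p,1}(ω)`. -/
def besovNorm (Φ : LPFunction N) (w : ℤ → ℝ) (p s : ℝ) (f : 𝓢'(Sp N, ℂ)) : ℝ≥0∞ :=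
  ∑' k : ℤ, ENNReal.ofReal ((2 : ℝ) ^ ((k : ℝ) * s) * w k) * lpNorm p (block Φ k f)

/-- The `L^q(0,T)` norm of a `[0,∞]`-valued function. -/
def timeNorm (T : ℝ) (q : ℝ≥0∞) (n : ℝ → ℝ≥0∞) : ℝ≥0∞ :=
  eLpNorm n q (volume.restrict (Ioo 0 T))

/-- The norm of `L^q(0,T; Ḃ^s_{p,1})`. -/
def bochnerNorm (Φ : LPFunction N) (T : ℝ) (q : ℝ≥0∞) (p s : ℝ)
    (f : ℝ → 𝓢'(Sp N, ℂ)) : ℝ≥0∞ :=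
  timeNorm T q (fun t => besovNorm Φ oneWeight p s (f t))

/-- `‖f‖ = ∑_k 2^{ks} w_k ‖Δ_k f‖_{L^q(0,T; L^p)}`. The weight `1` gives the norm of
`L̃^q_T(Ḃ^s_{p,1})`, the weight `k ↦ ω_k(T)` gives the norm of `L̃^q_T(Ḃ^s_{p,1}(ω))`. -/
def cheminLernerNorm (Φ : LPFunction N) (w : ℤ → ℝ) (T : ℝ) (q : ℝ≥0∞) (p s : ℝ)
    (f : ℝ → 𝓢'(Sp N, ℂ)) : ℝ≥0∞ :=
  ∑' k : ℤ, ENNReal.ofReal ((2 : ℝ) ^ ((k : ℝ) * s) * w k) *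
    timeNorm T q (fun t => lpNorm p (block Φ k (f t)))

/-! ### Norms of vector fields: sums over the components -/

def besovNormV (Φ : LPFunction N) (w : ℤ → ℝ) (p s : ℝ)
    (f : Fin N → 𝓢'(Sp N, ℂ)) : ℝ≥0∞ :=
  ∑ i, besovNorm Φ w p s (f i)

def bochnerNormV (Φ : LPFunction N) (T : ℝ) (q : ℝ≥0∞) (p s : ℝ)
    (f : ℝ → Fin N → 𝓢'(Sp N, ℂ)) : ℝ≥0∞ :=
  ∑ i, bochnerNorm Φ T q p s (fun t => f t i)

def cheminLernerNormV (Φ : LPFunction N) (w : ℤ → ℝ) (T : ℝ) (q : ℝ≥0∞) (p s : ℝ)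
    (f : ℝ → Fin N → 𝓢'(Sp N, ℂ)) : ℝ≥0∞ :=
  ∑ i, cheminLernerNorm Φ w T q p s (fun t => f t i)

/-! ### The equation -/

/-- The test functions of `𝒵'(ℝ^N)`, the tempered distributions modulo polynomials: Schwartz
functions all of whose derivatives vanish at the frequency `0`. -/
def IsZTest (χ : 𝓢(Sp N, ℂ)) : Prop :=
  ∀ n : ℕ, iteratedFDeriv ℝ n (𝓕 χ : 𝓢(Sp N, ℂ)) 0 = 0

/-- The standard basis vector `e_i`. -/
def basisVec (i : Fin N) : Sp N := EuclideanSpace.single i 1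

/-- The product `m f` of a bounded function `m` and a distribution `f = ∑_k Δ_k f`, tested with
`χ`: `⟨m f, χ⟩ = ∑_k ∫ m χ Δ_k f`. The series converges absolutely if `f ∈ Ḃ^{σ}_{p,1}` and
`m - m₀ ∈ Ḃ^{N/p}_{p,1}` for a constant `m₀`, where `σ ≤ N/p` and `σ + N/p > N max(0, 2/p - 1)`;
there it is Bony's product. -/
def productPairing (Φ : LPFunction N) (m : Sp N → ℝ) (f : 𝓢'(Sp N, ℂ)) (χ : 𝓢(Sp N, ℂ)) : ℂ :=
  ∑' k : ℤ, ∫ x, ((m x : ℝ) : ℂ) * (χ x * density (block Φ k f) x)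

/-- The divergence of a vector field. -/
def divergence (u : Fin N → 𝓢'(Sp N, ℂ)) : 𝓢'(Sp N, ℂ) :=
  ∑ i : Fin N, ∂_{basisVec i} (u i)

/-- The `i`-th component of `div(m∇u) + ∇(l div u)`, tested with `χ`:
`- ∑_j ⟨m ∂_j u_i, ∂_j χ⟩ - ⟨l div u, ∂_i χ⟩`. -/
def viscousPairing (Φ : LPFunction N) (m l : Sp N → ℝ) (u : Fin N → 𝓢'(Sp N, ℂ))
    (i : Fin N) (χ : 𝓢(Sp N, ℂ)) : ℂ :=
  -(∑ j : Fin N, productPairing Φ m (∂_{basisVec j} (u i)) (∂_{basisVec j} χ))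
    - productPairing Φ l (divergence u) (∂_{basisVec i} χ)

/-- `u` is a solution on `(0,T)`, in the sense of distributions (modulo polynomials), of
`∂_t u - div(μ∇u) - ∇((lam + μ) div u) = G` with `u = u₀` at `t = 0`; here `μ`, `lam` are functions
of time and space. The terms of the equation are integrable in time against every test
function, and the equation holds against `θ(t) χ(x)` with `θ` smooth, compactly supported,
vanishing near `[T,∞)`. -/
structure IsWeakSolution (Φ : LPFunction N) (T : ℝ) (μ lam : ℝ → Sp N → ℝ)
    (u G : ℝ → Fin N → 𝓢'(Sp N, ℂ)) (u₀ : Fin N → 𝓢'(Sp N, ℂ)) : Prop where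
  integrable_sol : ∀ i χ, IsZTest χ → IntegrableOn (fun t => u t i χ) (Ioo 0 T)
  integrable_source : ∀ i χ, IsZTest χ → IntegrableOn (fun t => G t i χ) (Ioo 0 T)
  integrable_viscous : ∀ i χ, IsZTest χ →
    IntegrableOn (fun t => viscousPairing Φ (μ t) (fun x => lam t x + μ t x) (u t) i χ) (Ioo 0 T)
  equation : ∀ i χ, IsZTest χ → ∀ θ : ℝ → ℝ, ContDiff ℝ ∞ θ → HasCompactSupport θ →
    tsupport θ ⊆ Iio T →
    -(∫ t in Ioo 0 T, ((deriv θ t : ℝ) : ℂ) * u t i χ) =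
      ((θ 0 : ℝ) : ℂ) * u₀ i χ +
        ∫ t in Ioo 0 T, ((θ t : ℝ) : ℂ) *
          (viscousPairing Φ (μ t) (fun x => lam t x + μ t x) (u t) i χ + G t i χ)

/-- `a(t)` is the function `ρ(t,·) - ρc`, which is the sum of its dyadic blocks. -/
def IsFluctuation (Φ : LPFunction N) (T : ℝ) (ρ : ℝ → Sp N → ℝ) (ρc : ℝ)
    (a : ℝ → 𝓢'(Sp N, ℂ)) : Prop :=
  ∀ᵐ t ∂(volume.restrict (Ioo 0 T)),
    Represents (fun x => ((ρ t x - ρc : ℝ) : ℂ)) (a t) ∧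
      HasSum (fun k : ℤ => block Φ k (a t)) (a t)

/-- The function `F` is smooth on the open interval `J`, with its derivatives of orders
`1, …, m` bounded by `K` there. -/
def SmoothBoundedOn (F : ℝ → ℝ) (J : Set ℝ) (m : ℕ) (K : ℝ) : Prop :=
  ContDiffOn ℝ ∞ F J ∧ ∀ k : ℕ, 1 ≤ k → k ≤ m → ∀ x ∈ J, |iteratedDeriv k F x| ≤ K

/-- `A(T) = (1 + ‖ρ‖_{L^∞(0,T; L^∞)})^{[N/p] + 2}`. -/
def densityFactor (p T : ℝ) (ρ : ℝ → Sp N → ℝ) : ℝ≥0∞ :=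
  (1 + timeNorm T ⊤ (fun t => eLpNorm (ρ t) ⊤ volume)) ^ (⌊(N : ℝ) / p⌋₊ + 2)

/-- The standing assumptions on the data of the linearized momentum equation. -/
structure MomentumData (Φ : LPFunction N) (p s T c₁ K : ℝ) (J : Set ℝ) (mu lam : ℝ → ℝ)
    (ρ : ℝ → Sp N → ℝ) (ρc : ℝ) (a : ℝ → 𝓢'(Sp N, ℂ))
    (u G : ℝ → Fin N → 𝓢'(Sp N, ℂ)) (u₀ : Fin N → 𝓢'(Sp N, ℂ)) : Prop where
  time_pos : 0 < T
  isOpen : IsOpen J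
  ordConnected : J.OrdConnected
  smooth_mu : SmoothBoundedOn mu J (⌊(N : ℝ) / p⌋₊ + 4) K
  smooth_lam : SmoothBoundedOn lam J (⌊(N : ℝ) / p⌋₊ + 4) K
  measurable_density : AEStronglyMeasurable (Function.uncurry ρ)
    ((volume.restrict (Ioo 0 T)).prod (volume : Measure (Sp N)))
  /-- The density takes its values in `J`, and the coefficients are bounded below. -/
  lower_bound : ∀ᵐ t ∂(volume.restrict (Ioo 0 T)), ∀ᵐ x : Sp N,
    ρ t x ∈ J ∧ c₁ ≤ mu (ρ t x) ∧ c₁ ≤ lam (ρ t x) + 2 * mu (ρ t x)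
  fluctuation : IsFluctuation Φ T ρ ρc a
  fluctuation_mem : bochnerNorm Φ T ⊤ p (N / p) a < ⊤
  source_mem : bochnerNormV Φ T 1 p (s - 1) G < ⊤
  initial_mem : besovNormV Φ oneWeight p (s - 1) u₀ < ⊤
  solution : IsWeakSolution Φ T (fun t x => mu (ρ t x)) (fun t x => lam (ρ t x)) u G u₀

end LinMom

end

/-!
# Smoothing estimates for the linearized momentum equation

Apply the block `Δ_k` to the equation and consider the Lamé operator with its coefficients frozen at a
point `x`. Its heat flow splits into the flows of `μ(x) Δ` on divergence free fields and of
`(λ + 2μ)(x) Δ` on gradients. The kernels `heatKap` of these flows, localized at the frequency `2^k`, are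
dominated by an exponential of rate `2^{2k}` times the majorant `maj k` (`exists_kerBd_heatKap`). No
energy identity in `L^p` is needed: the solution at `x` is tested with the kernel centred at the same
point `x`. The coefficient to be frozen is then a scalar function `κ(·, x)` of time, and Duhamel's
formula holds with the kernel taken at the time `∫_s^t κ(σ, x) dσ` (`duhamel_scalar`, `duhamel_estimate`). The rate
of decay is at least `c₁ 2^{2k} / 32`, whence the constant `c = c₁ / 32`.

The error made in freezing is the commutator of the multiplication by a coefficient and the convolution
with a kernel at the scale `2^{-k}`. As the bounds for kernels are pointwise, through averages `avg`
against `maj k`, the error has a bound that is uniform in the kernel, and so in the elapsed time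
(`exists_commutator`, `exists_heatKap_error`). The commutator is split into frequencies, as in Bony's
decomposition: increments of a low block of the coefficient gain a factor `2^{j-k}` against the kernel,
and the remaining interactions have spectra of comparable size. Schur's test sums these bounds
(`exists_tsum_commutator_le`); it is here that `1 - N min(1/p, 1/p') < s` and the upper bounds for `s` enter.
The sum carries any weight that increases with the frequency, but not faster than the frequency
(`SlowWeight`): the weight `1` gives the first estimate of (a), `2^k` moves one derivative from the
solution to the coefficient and gives the second, and `ω_k(T)` gives (b).

The blocks of the coefficients `μ(ρ)`, `λ(ρ)` are bounded by those of `ρ` (`exists_coefficient`): after an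
extension of `μ` and `λ` from the interval `J` to `ℝ` (`exists_extension`), the composition is a
telescoping series in the low frequency parts of `ρ`. The chain rule produces the powers of `‖ρ‖_∞`
in `A(T)`.

Altogether, each block satisfies a Duhamel inequality with damping (`exists_block_estimate`). Its norm
in `L^q(0,T)` gains the factor `2^{-2k/q} (1 - e^{-c 2^{2k} T})^{1/q}` (`exists_timeNorm_le`), where the second
part is at most `1`, and at most `e_k(T) ≤ ω_k(T)` for `q ≤ 2`. Summation over `k`
(`exists_cheminLernerNormV_le`) finishes the proof.
-/

open scoped Real
open ENNReal (ofReal mul_ne_top ofReal_mul ofReal_le_ofReal rpow_one rpow_mul mul_rpow_of_nonneg rpow_le_rpow coe_ne_top coe_toNNReal toReal_mono ofReal_ne_top toReal_nonneg rpow_le_rpow_of_exponent_le rpow_add rpow_add_of_nonneg rpow_zero tsum_le_tsum ofReal_rpow_of_pos ne_top_of_tsum_ne_top)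
open FourierTransform (fourier_fourierInv_eq fourierInv_fourier_eq)
open Function (uncurry)

noncomputable section

namespace LinMom

variable {N : ℕ} (Φ : LPFunction N)

/-! ### Averages against the standard dyadic majorant -/

/-- The standard majorant `2^{kN} (1 + 2^k |z|)^{-(N+1)}` of kernels at frequency `2^k`. -/
def maj (k : ℤ) (z : Sp N) : ℝ≥0∞ :=
  ofReal (((2 : ℝ) ^ k) ^ N * ((1 + (2 : ℝ) ^ k * ‖z‖) ^ (N + 1))⁻¹)

/-- The measure with density `maj k (x - ·)`. -/
def majMeasure (k : ℤ) (x : Sp N) : Measure (Sp N) :=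
  volume.withDensity fun y => maj k (x - y)

/-- The average of `f` against `maj k (x - ·)`. -/
def avg (k : ℤ) (f : Sp N → ℝ≥0∞) (x : Sp N) : ℝ≥0∞ := ∫⁻ y, f y ∂(majMeasure k x)

/-- The `L^p` norm of a `[0,∞]`-valued function, for a finite exponent. -/
def nrm (p : ℝ) (f : Sp N → ℝ≥0∞) : ℝ≥0∞ := (∫⁻ x, f x ^ p) ^ (1 / p)

/-- A finite constant, at least `1`, that dominates the mass of all the majorants `maj k`. -/
def cMaj (N : ℕ) : ℝ≥0∞ := 1 + ∫⁻ z : Sp N, maj 0 z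

@[fun_prop]
theorem measurable_maj (k : ℤ) : Measurable (maj k : Sp N → ℝ≥0∞) := by
  unfold maj; fun_prop

theorem lintegral_comp_two_zpow_smul (k : ℤ) (f : Sp N → ℝ≥0∞) (hf : Measurable f) :
    ofReal (((2 : ℝ) ^ k) ^ N) * ∫⁻ z, f ((2 : ℝ) ^ k • z) = ∫⁻ z, f z := by
  have h2 : (0 : ℝ) < (2 : ℝ) ^ k := by positivity
  have hm := Measure.map_addHaar_smul (volume : Measure (Sp N)) h2.ne'
  have : ∫⁻ z, f z ∂(Measure.map ((2 : ℝ) ^ k • ·) (volume : Measure (Sp N)))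
      = ∫⁻ z, f ((2 : ℝ) ^ k • z) := lintegral_map hf (measurable_const_smul _)
  rw [← this, hm, lintegral_smul_measure]
  simp only [finrank_euclideanSpace, Fintype.card_fin, smul_eq_mul]
  rw [← mul_assoc, ← ofReal_mul (by positivity), abs_of_pos (by positivity),
    mul_inv_cancel₀ (by positivity)]
  simp

theorem lintegral_maj (k : ℤ) : ∫⁻ z : Sp N, maj k z = ∫⁻ z : Sp N, maj 0 z := by
  rw [← lintegral_comp_two_zpow_smul k _ (measurable_maj 0), ← lintegral_const_mul _ (by fun_prop)]
  congr 1; ext z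
  rw [maj, maj, ← ofReal_mul (by positivity)]
  congr 2
  simp [norm_smul]

theorem one_le_cMaj : 1 ≤ cMaj N := le_self_add

theorem cMaj_ne_top : cMaj N ≠ ⊤ := by
  have h := finite_integral_one_add_norm (E := Sp N) (μ := volume) (r := (N + 1 : ℕ))
    (by simp)
  refine ENNReal.add_ne_top.2 ⟨by simp, ne_of_lt (lt_of_eq_of_lt ?_ h)⟩
  congr 1; ext z
  simp only [maj, zpow_zero, one_pow, one_mul]
  rw [Real.rpow_neg (by positivity), Real.rpow_natCast]

theorem lintegral_maj_le (k : ℤ) : ∫⁻ z : Sp N, maj k z ≤ cMaj N := by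
  rw [lintegral_maj]; exact le_add_self

theorem avg_eq (k : ℤ) {f : Sp N → ℝ≥0∞} (hf : Measurable f) (x : Sp N) :
    avg k f x = ∫⁻ y, maj k (x - y) * f y := by
  rw [avg, majMeasure, lintegral_withDensity_eq_lintegral_mul _ (by fun_prop) hf]; rfl

theorem majMeasure_univ_le (k : ℤ) (x : Sp N) : majMeasure k x univ ≤ cMaj N := by
  rw [majMeasure, withDensity_apply _ MeasurableSet.univ, Measure.restrict_univ,
    lintegral_sub_left_eq_self (fun z => maj k z) x]
  exact lintegral_maj_le k

theorem avg_mono (k : ℤ) {f g : Sp N → ℝ≥0∞} (h : ∀ y, f y ≤ g y) (x : Sp N) :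
    avg k f x ≤ avg k g x := lintegral_mono h

theorem avg_const_mul (k : ℤ) (c : ℝ≥0∞) {f : Sp N → ℝ≥0∞} (hf : Measurable f) (x : Sp N) :
    avg k (fun y => c * f y) x = c * avg k f x := lintegral_const_mul _ hf

theorem measurable_avg (k : ℤ) {f : Sp N → ℝ≥0∞} (hf : Measurable f) : Measurable (avg k f) := by
  rw [funext (avg_eq k hf)]
  exact Measurable.lintegral_prod_right' (f := fun q : Sp N × Sp N => maj k (q.1 - q.2) * f q.2)
    (by fun_prop)

theorem maj_le (k : ℤ) (z : Sp N) : maj k z ≤ (2 : ℝ≥0∞) ^ ((k : ℝ) * N) := by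
  have : (2 : ℝ≥0∞) ^ ((k : ℝ) * N) = ofReal (((2 : ℝ) ^ k) ^ N) := by
    rw [← ENNReal.ofReal_ofNat 2, ofReal_rpow_of_pos (by norm_num), Real.rpow_mul (by norm_num),
      Real.rpow_natCast, Real.rpow_intCast]
  rw [this, maj]
  refine ofReal_le_ofReal (mul_le_of_le_one_right (by positivity) (inv_le_one_of_one_le₀ ?_))
  exact one_le_pow₀ (by have := norm_nonneg z; have : (0:ℝ) < 2 ^ k := by positivity
                        nlinarith)

theorem avg_le_lintegral (k : ℤ) {f : Sp N → ℝ≥0∞} (hf : Measurable f) (x : Sp N) :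
    avg k f x ≤ 2 ^ ((k : ℝ) * N) * ∫⁻ y, f y := by
  rw [avg_eq k hf, ← lintegral_const_mul _ hf]
  exact lintegral_mono fun y => mul_le_mul_left (maj_le k _) _

theorem lintegral_avg_le (k : ℤ) {f : Sp N → ℝ≥0∞} (hf : Measurable f) :
    ∫⁻ x, avg k f x ≤ cMaj N * ∫⁻ y, f y := by
  simp_rw [avg_eq k hf]
  rw [lintegral_lintegral_swap (by fun_prop), ← lintegral_const_mul _ hf]
  refine lintegral_mono fun y => ?_
  rw [lintegral_mul_const _ (by fun_prop)]
  refine mul_le_mul_left ?_ _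
  rw [lintegral_sub_right_eq_self (fun z => maj k z) y]
  exact lintegral_maj_le k

theorem avg_le_sup (k : ℤ) {f : Sp N → ℝ≥0∞} {c : ℝ≥0∞} (h : ∀ y, f y ≤ c) (x : Sp N) :
    avg k f x ≤ cMaj N * c := by
  refine (lintegral_mono h).trans ?_
  rw [lintegral_const, mul_comm]
  exact mul_le_mul_left (majMeasure_univ_le k x) _

theorem avg_rpow_le (k : ℤ) {p : ℝ} (hp : 1 ≤ p) {f : Sp N → ℝ≥0∞} (hf : Measurable f)
    (x : Sp N) : avg k f x ^ p ≤ cMaj N ^ p * avg k (fun y => f y ^ p) x := by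
  have hc := one_le_cMaj (N := N)
  rcases hp.eq_or_lt with rfl | hp
  · simp only [rpow_one]
    exact le_mul_of_one_le_left' hc
  have hpq := Real.HolderConjugate.conjExponent hp
  have h := ENNReal.lintegral_mul_le_Lp_mul_Lq (majMeasure k x) hpq hf.aemeasurable
    (g := fun _ => 1) aemeasurable_const
  simp only [Pi.mul_apply, mul_one, ENNReal.one_rpow, lintegral_const, one_mul] at h
  have hp0 : (0 : ℝ) < p := by linarith
  calc avg k f x ^ p ≤ ((∫⁻ a, f a ^ p ∂majMeasure k x) ^ (1 / p) *
        majMeasure k x univ ^ (1 / p.conjExponent)) ^ p := rpow_le_rpow h hp0.le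
    _ = avg k (fun y => f y ^ p) x * (majMeasure k x univ ^ (1 / p.conjExponent)) ^ p := by
        rw [mul_rpow_of_nonneg _ _ hp0.le, ← rpow_mul, one_div_mul_cancel hp0.ne',
          rpow_one]; rfl
    _ ≤ avg k (fun y => f y ^ p) x * cMaj N ^ p := by
        refine mul_le_mul_right (rpow_le_rpow ?_ hp0.le) _
        refine (rpow_le_rpow (majMeasure_univ_le k x) (by have := hpq.symm.pos; positivity)).trans ?_
        refine (rpow_le_rpow_of_exponent_le hc (y := 1/p.conjExponent) (z := 1) ?_).trans (by simp)
        rw [div_le_one hpq.symm.pos]; exact hpq.symm.lt.le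
    _ = _ := mul_comm _ _

theorem nrm_mono {p : ℝ} (hp : 0 ≤ p) {f g : Sp N → ℝ≥0∞} (h : ∀ y, f y ≤ g y) :
    nrm p f ≤ nrm p g :=
  rpow_le_rpow (lintegral_mono fun x => rpow_le_rpow (h x) hp) (by positivity)

theorem nrm_mono_ae {p : ℝ} (hp : 0 ≤ p) {f g : Sp N → ℝ≥0∞} (h : ∀ᵐ y, f y ≤ g y) :
    nrm p f ≤ nrm p g :=
  rpow_le_rpow (lintegral_mono_ae (h.mono fun x hx => rpow_le_rpow hx hp))
    (by positivity)

theorem nrm_rpow {p : ℝ} (hp : 0 < p) (f : Sp N → ℝ≥0∞) : nrm p f ^ p = ∫⁻ x, f x ^ p := by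
  rw [nrm, ← rpow_mul, one_div_mul_cancel hp.ne', rpow_one]

theorem nrm_const_mul {p : ℝ} (hp : 0 < p) (c : ℝ≥0∞) {f : Sp N → ℝ≥0∞} (hf : Measurable f) :
    nrm p (fun x => c * f x) = c * nrm p f := by
  simp_rw [nrm, mul_rpow_of_nonneg _ _ hp.le]
  rw [lintegral_const_mul _ (by fun_prop), mul_rpow_of_nonneg _ _ (by positivity),
    ← rpow_mul, mul_one_div_cancel hp.ne', rpow_one]

theorem nrm_le_of_rpow {p : ℝ} (hp : 0 < p) {f : Sp N → ℝ≥0∞} {c : ℝ≥0∞}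
    (h : ∫⁻ x, f x ^ p ≤ c ^ p) : nrm p f ≤ c := by
  refine (rpow_le_rpow h (by positivity)).trans_eq ?_
  rw [← rpow_mul, mul_one_div_cancel hp.ne', rpow_one]

theorem nrm_avg_le (k : ℤ) {p : ℝ} (hp : 1 ≤ p) {f : Sp N → ℝ≥0∞} (hf : Measurable f) :
    nrm p (avg k f) ≤ cMaj N ^ 2 * nrm p f := by
  have hp0 : (0 : ℝ) < p := by linarith
  have hc := one_le_cMaj (N := N)
  refine nrm_le_of_rpow hp0 ?_
  calc ∫⁻ x, avg k f x ^ p ≤ ∫⁻ x, cMaj N ^ p * avg k (fun y => f y ^ p) x :=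
        lintegral_mono fun x => avg_rpow_le k hp hf x
    _ = cMaj N ^ p * ∫⁻ x, avg k (fun y => f y ^ p) x :=
        lintegral_const_mul _ (measurable_avg k (by fun_prop))
    _ ≤ cMaj N ^ p * (cMaj N * ∫⁻ x, f x ^ p) := by
        gcongr; exact lintegral_avg_le k (by fun_prop)
    _ ≤ cMaj N ^ p * (cMaj N ^ p * ∫⁻ x, f x ^ p) := by
        gcongr
        exact (rpow_one _).symm.trans_le (rpow_le_rpow_of_exponent_le hc hp)
    _ = (cMaj N ^ 2 * nrm p f) ^ p := by
        rw [mul_rpow_of_nonneg _ _ hp0.le, nrm_rpow hp0, ← mul_assoc, pow_two,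
          mul_rpow_of_nonneg _ _ hp0.le]

theorem avg_rpow_sup_le (k : ℤ) {p : ℝ} (hp : 1 ≤ p) {f : Sp N → ℝ≥0∞} (hf : Measurable f)
    (x : Sp N) : avg k (fun y => f y ^ p) x ^ (1 / p) ≤
      2 ^ ((k : ℝ) * (N / p)) * nrm p f := by
  have hp0 : (0 : ℝ) < p := by linarith
  refine (rpow_le_rpow (avg_le_lintegral k (by fun_prop) x) (by positivity)).trans_eq ?_
  rw [mul_rpow_of_nonneg _ _ (by positivity), ← rpow_mul, nrm]
  congr 2; ring

theorem avg_le_avg_rpow (k : ℤ) {p : ℝ} (hp : 1 ≤ p) {f : Sp N → ℝ≥0∞} (hf : Measurable f)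
    (x : Sp N) : avg k f x ≤ cMaj N * avg k (fun y => f y ^ p) x ^ (1 / p) := by
  have hp0 : (0 : ℝ) < p := by linarith
  have := rpow_le_rpow (avg_rpow_le k hp hf x) (z := 1 / p) (by positivity)
  rwa [← rpow_mul, mul_rpow_of_nonneg _ _ (by positivity), ← rpow_mul,
    mul_one_div_cancel hp0.ne', rpow_one, rpow_one] at this

/-- Bernstein's inequality from `L^p` to `L^∞`. -/
theorem avg_le_nrm (k : ℤ) {p : ℝ} (hp : 1 ≤ p) {f : Sp N → ℝ≥0∞} (hf : Measurable f)
    (x : Sp N) : avg k f x ≤ cMaj N * (2 ^ ((k : ℝ) * (N / p)) * nrm p f) :=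
  (avg_le_avg_rpow k hp hf x).trans (by gcongr; exact avg_rpow_sup_le k hp hf x)

/-- The pointwise form of the product estimate: `r` is at least the conjugate exponent of `p`. -/
theorem avg_mul_le (k : ℤ) {p r : ℝ} (hp : 1 < p) (hr : p.conjExponent ≤ r)
    {f g : Sp N → ℝ≥0∞} (hf : Measurable f) (hg : Measurable g) (x : Sp N) :
    avg k (fun y => f y * g y) x ≤ avg k (fun y => f y ^ p) x ^ (1 / p) *
      (cMaj N * (2 ^ ((k : ℝ) * (N / r)) * nrm r g)) := by
  have hpq := Real.HolderConjugate.conjExponent hp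
  set q := p.conjExponent
  have hq0 := hpq.symm.pos
  have hr0 : 0 < r := hq0.trans_le hr
  refine (ENNReal.lintegral_mul_le_Lp_mul_Lq (majMeasure k x) hpq hf.aemeasurable
    hg.aemeasurable).trans ?_
  refine mul_le_mul_right ?_ _
  have hrq : 1 ≤ r / q := (one_le_div hq0).2 hr
  have h1 := avg_le_avg_rpow k hrq (hg.pow_const q) x
  have h2 : avg k (fun y => (g y ^ q) ^ (r / q)) x = avg k (fun y => g y ^ r) x := by
    congr 1; ext y; rw [← rpow_mul, mul_div_cancel₀ _ hq0.ne']
  rw [h2] at h1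
  calc (avg k (fun y => g y ^ q) x) ^ (1 / q)
      ≤ (cMaj N * avg k (fun y => g y ^ r) x ^ (1 / (r / q))) ^ (1 / q) :=
        rpow_le_rpow h1 (by positivity)
    _ = cMaj N ^ (1 / q) * avg k (fun y => g y ^ r) x ^ (1 / r) := by
        rw [mul_rpow_of_nonneg _ _ (by positivity), ← rpow_mul]
        congr 2; field_simp
    _ ≤ cMaj N * (2 ^ ((k : ℝ) * (N / r)) * nrm r g) := by
        refine mul_le_mul' ?_ (avg_rpow_sup_le k (hpq.symm.lt.le.trans hr) hg x)
        refine (rpow_le_rpow_of_exponent_le one_le_cMaj (z := 1) ?_).trans (by simp)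
        rw [div_le_one hq0]; exact hpq.symm.lt.le

theorem nrm_avg_rpow_le (k : ℤ) {p : ℝ} (hp : 1 < p) {f : Sp N → ℝ≥0∞} (hf : Measurable f) :
    nrm p (fun x => avg k (fun y => f y ^ p) x ^ (1 / p)) ≤ cMaj N * nrm p f := by
  have hp0 : (0 : ℝ) < p := by linarith
  refine nrm_le_of_rpow hp0 ?_
  simp_rw [← rpow_mul, one_div_mul_cancel hp0.ne', rpow_one]
  refine (lintegral_avg_le k (by fun_prop)).trans ?_
  rw [mul_rpow_of_nonneg _ _ hp0.le, nrm_rpow hp0]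
  gcongr
  exact (rpow_one _).symm.trans_le (rpow_le_rpow_of_exponent_le one_le_cMaj hp.le)

theorem nrm_avg_mul_le (k : ℤ) {p r : ℝ} (hp : 1 < p) (hr : p.conjExponent ≤ r)
    {f g : Sp N → ℝ≥0∞} (hf : Measurable f) (hg : Measurable g) :
    nrm p (avg k (fun y => f y * g y)) ≤
      cMaj N ^ 2 * (2 ^ ((k : ℝ) * (N / r)) * (nrm p f * nrm r g)) := by
  have hp0 : (0 : ℝ) < p := by linarith
  set c := cMaj N * (2 ^ ((k : ℝ) * (N / r)) * nrm r g)
  calc nrm p (avg k (fun y => f y * g y))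
      ≤ nrm p (fun x => c * avg k (fun y => f y ^ p) x ^ (1 / p)) :=
        nrm_mono hp0.le fun x => (avg_mul_le k hp hr hf hg x).trans_eq (mul_comm _ _)
    _ = c * nrm p (fun x => avg k (fun y => f y ^ p) x ^ (1 / p)) :=
        nrm_const_mul hp0 _ ((measurable_avg k (by fun_prop)).pow_const _)
    _ ≤ c * (cMaj N * nrm p f) := by gcongr; exact nrm_avg_rpow_le k hp hf
    _ = _ := by ring

/-- Bernstein's inequality from `L^p` to `L^r`, `p ≤ r`, for functions dominated by their own
average. -/
theorem nrm_bernstein (l : ℤ) {p r : ℝ} (hp : 1 ≤ p) (hpr : p ≤ r) {g : Sp N → ℝ≥0∞}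
    (hg : Measurable g) {c : ℝ≥0∞} (hc : 1 ≤ c) (h : ∀ x, g x ≤ c * avg l g x) :
    nrm r g ≤ c * cMaj N * (2 ^ ((l : ℝ) * (N / p - N / r)) * nrm p g) := by
  have hp0 : (0 : ℝ) < p := by linarith
  have hr0 : (0 : ℝ) < r := by linarith
  have hrp : 0 ≤ r - p := by linarith
  set S := c * cMaj N * (2 ^ ((l : ℝ) * (N / p)) * nrm p g) with hS
  have hsup : ∀ x, g x ≤ S := fun x => (h x).trans (by
    rw [hS, mul_assoc]; gcongr; exact avg_le_nrm l hp hg x)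
  have h1 : ∫⁻ x, g x ^ r ≤ S ^ (r - p) * nrm p g ^ p := by
    rw [nrm_rpow hp0, ← lintegral_const_mul _ (by fun_prop)]
    refine lintegral_mono fun x => ?_
    calc g x ^ r = g x ^ (r - p) * g x ^ p := by
          rw [← rpow_add_of_nonneg _ _ hrp hp0.le]; simp
      _ ≤ _ := by gcongr; exact hsup x
  refine nrm_le_of_rpow hr0 (h1.trans ?_)
  have hone : 1 ≤ c * cMaj N := one_le_mul hc one_le_cMaj
  rw [hS]
  generalize c * cMaj N = D at hone
  rw [mul_rpow_of_nonneg _ _ hrp, mul_rpow_of_nonneg _ _ hrp,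
    mul_rpow_of_nonneg _ _ hr0.le, mul_rpow_of_nonneg _ _ hr0.le, mul_assoc,
    mul_assoc, ← rpow_add_of_nonneg _ _ hrp hp0.le, ← rpow_mul, ← rpow_mul]
  refine mul_le_mul' (rpow_le_rpow_of_exponent_le hone (by linarith)) ?_
  refine mul_le_mul' (le_of_eq ?_) (by simp)
  congr 1; field_simp

theorem nrm_congr_ae {p : ℝ} {f g : Sp N → ℝ≥0∞} (h : f =ᵐ[volume] g) : nrm p f = nrm p g := by
  have : (fun x => f x ^ p) =ᵐ[volume] fun x => g x ^ p := h.mono fun x hx => by simp only [hx]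
  rw [nrm, nrm, lintegral_congr_ae this]

theorem nrm_lintegral_le_of_measurable {S : Type*} [MeasurableSpace S] {ν : Measure S} [SFinite ν]
    {p : ℝ} (hp : 1 ≤ p) {f : S → Sp N → ℝ≥0∞} (hf : Measurable (uncurry f))
    {e : S → ℝ≥0∞} (he : Measurable e) (h : ∀ᵐ s ∂ν, nrm p (f s) ≤ e s) :
    nrm p (fun x => ∫⁻ s, f s x ∂ν) ≤ ∫⁻ s, e s ∂ν := by
  have hp0 : (0 : ℝ) < p := by linarith
  have hfs : ∀ s, Measurable (f s) := fun s => hf.comp measurable_prodMk_left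
  have hfx : ∀ x, Measurable fun s => f s x := fun x => hf.comp measurable_prodMk_right
  have hswap : ∀ g : S → Sp N → ℝ≥0∞, Measurable (uncurry g) →
      ∫⁻ x : Sp N, ∫⁻ s, g s x ∂ν = ∫⁻ s, (∫⁻ x : Sp N, g s x) ∂ν := fun g hg =>
    (lintegral_lintegral_swap hg.aemeasurable).symm
  rcases hp.eq_or_lt with rfl | hp1
  · simp only [nrm, rpow_one, one_div_one] at h ⊢
    rw [hswap f hf]
    exact lintegral_mono_ae h
  by_cases htop : ∫⁻ s, e s ∂ν = ⊤
  · rw [htop]; exact le_top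
  have hfin : ∀ᵐ s ∂ν, e s < ⊤ := ae_lt_top he htop
  have hpq := Real.HolderConjugate.conjExponent hp1
  set q := p.conjExponent
  have hq0 := hpq.symm.pos
  have hme : Measurable fun z : S × Sp N => e z.1 := he.comp measurable_fst
  have hfm : Measurable fun z : S × Sp N => f z.1 z.2 := hf
  -- Hölder's inequality in `s`, with the weights `e^{1/q}` and `e^{-1/q}`
  have hae : ∀ᵐ x : Sp N, ∀ᵐ s ∂ν, f s x ≤ (f s x * e s ^ (-(1 / q))) * e s ^ (1 / q) := by
    have hms : ∀ᵐ s ∂ν, ∀ᵐ x : Sp N, f s x ≤ (f s x * e s ^ (-(1 / q))) * e s ^ (1 / q) := by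
      filter_upwards [h, hfin] with s hs hsf
      by_cases h0 : e s = 0
      · rw [h0, nonpos_iff_eq_zero, nrm, ENNReal.rpow_eq_zero_iff_of_pos (by positivity),
          lintegral_eq_zero_iff ((hfs s).pow_const _)] at hs
        filter_upwards [hs] with x hx
        have : f s x = 0 := (ENNReal.rpow_eq_zero_iff_of_pos hp0).1 hx
        simp [this]
      · refine .of_forall fun x => ?_
        rw [mul_assoc, ← rpow_add _ _ h0 hsf.ne]; simp
    refine (Measure.ae_ae_comm ?_).1 hms
    exact measurableSet_le hfm ((hfm.mul (hme.pow_const _)).mul (hme.pow_const _))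
  have hx : ∀ᵐ x : Sp N, (∫⁻ s, f s x ∂ν) ^ p ≤
      (∫⁻ s, f s x ^ p * e s ^ (-(p / q)) ∂ν) * (∫⁻ s, e s ∂ν) ^ (p / q) := by
    filter_upwards [hae] with x hx
    have hH := ENNReal.lintegral_mul_le_Lp_mul_Lq ν hpq
      ((hfx x).mul (he.pow_const (-(1 / q)))).aemeasurable (he.pow_const (1 / q)).aemeasurable
    have hle : ∫⁻ s, f s x ∂ν ≤ _ := (lintegral_mono_ae hx).trans hH
    refine (rpow_le_rpow hle hp0.le).trans_eq ?_
    rw [mul_rpow_of_nonneg _ _ hp0.le, ← rpow_mul, ← rpow_mul,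
      one_div_mul_cancel hp0.ne', rpow_one]
    congr 1
    · refine lintegral_congr fun s => ?_
      simp only [Pi.mul_apply]
      rw [mul_rpow_of_nonneg _ _ hp0.le, ← rpow_mul]
      congr 2; ring
    · congr 1
      · refine lintegral_congr fun s => ?_
        rw [← rpow_mul, one_div_mul_cancel hq0.ne', rpow_one]
      · ring
  refine nrm_le_of_rpow hp0 ((lintegral_mono_ae hx).trans ?_)
  have hmm : Measurable (uncurry fun s x => f s x ^ p * e s ^ (-(p / q))) :=
    (hfm.pow_const p).mul (hme.pow_const _)
  have hmm' : Measurable fun x : Sp N => ∫⁻ s, f s x ^ p * e s ^ (-(p / q)) ∂ν :=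
    (hmm.comp measurable_swap).lintegral_prod_right'
  rw [lintegral_mul_const _ hmm', hswap _ hmm]
  have hin : ∀ᵐ s ∂ν, ∫⁻ x : Sp N, f s x ^ p * e s ^ (-(p / q)) ≤ e s := by
    filter_upwards [h, hfin] with s hs hsf
    rw [lintegral_mul_const _ ((hfs s).pow_const _), ← nrm_rpow hp0]
    by_cases h0 : e s = 0
    · rw [h0, nonpos_iff_eq_zero] at hs
      simp [hs, hp0]
    · calc nrm p (f s) ^ p * e s ^ (-(p / q)) ≤ e s ^ p * e s ^ (-(p / q)) := by gcongr
        _ = e s ^ (1 : ℝ) := by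
          rw [← rpow_add _ _ h0 hsf.ne]
          congr 1
          have := hpq.div_conj_eq_sub_one; linarith
        _ = e s := rpow_one _
  refine (mul_le_mul_left (lintegral_mono_ae hin) _).trans_eq ?_
  calc (∫⁻ s, e s ∂ν) * (∫⁻ s, e s ∂ν) ^ (p / q) = (∫⁻ s, e s ∂ν) ^ (1 + p / q) := by
        rw [rpow_add_of_nonneg _ _ (by norm_num) (by positivity), rpow_one]
    _ = _ := by congr 1; have := hpq.div_conj_eq_sub_one; linarith

/-- Minkowski's integral inequality in `L^p`. -/
theorem nrm_lintegral_le {S : Type*} [MeasurableSpace S] {ν : Measure S} [SFinite ν] {p : ℝ}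
    (hp : 1 ≤ p) {f : S → Sp N → ℝ≥0∞} (hf : AEMeasurable (uncurry f) (ν.prod volume))
    {e : S → ℝ≥0∞} (he : AEMeasurable e ν) (h : ∀ᵐ s ∂ν, nrm p (f s) ≤ e s) :
    nrm p (fun x => ∫⁻ s, f s x ∂ν) ≤ ∫⁻ s, e s ∂ν := by
  have h1 : ∀ᵐ s ∂ν, ∀ᵐ x : Sp N, f s x = hf.mk _ (s, x) := Measure.ae_ae_of_ae_prod hf.ae_eq_mk
  have h2 : ∀ᵐ x : Sp N, ∀ᵐ s ∂ν, f s x = hf.mk _ (s, x) :=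
    Measure.ae_ae_of_ae_prod ((Measure.measurePreserving_swap (μ := (volume : Measure (Sp N)))
      (ν := ν)).quasiMeasurePreserving.ae hf.ae_eq_mk)
  have := nrm_lintegral_le_of_measurable hp (f := fun s x => hf.mk _ (s, x))
    (by exact hf.measurable_mk) he.measurable_mk (ν := ν) (by
      filter_upwards [h, h1, he.ae_eq_mk] with s hs hs1 hs2
      rw [← hs2, ← nrm_congr_ae hs1]; exact hs)
  rw [lintegral_congr_ae he.ae_eq_mk]
  refine le_of_eq_of_le (nrm_congr_ae ?_) this
  filter_upwards [h2] with x hx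
  exact lintegral_congr_ae hx

theorem nrm_tsum_le {p : ℝ} (hp : 1 ≤ p) {ι : Type*} [Countable ι] {f : ι → Sp N → ℝ≥0∞}
    (hf : ∀ i, Measurable (f i)) : nrm p (fun x => ∑' i, f i x) ≤ ∑' i, nrm p (f i) := by
  let _ : MeasurableSpace ι := ⊤
  have := nrm_lintegral_le (ν := (Measure.count : Measure ι)) hp (f := f)
    (measurable_from_prod_countable_right hf).aemeasurable (e := fun i => nrm p (f i))
    (measurable_from_top).aemeasurable (.of_forall fun s => le_rfl)
  simpa only [lintegral_count] using this

theorem nrm_add_le {p : ℝ} (hp : 1 ≤ p) {f g : Sp N → ℝ≥0∞}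
    (hf : Measurable f) (hg : Measurable g) :
    nrm p (fun x => f x + g x) ≤ nrm p f + nrm p g := by
  have := nrm_tsum_le hp (ι := Bool) (f := fun b => cond b f g) (by rintro (_ | _) <;> assumption)
  simpa [tsum_fintype] using this

/-! ### Convolution kernels: reflection, dilation, convolution -/

/-- The Schwartz function `α(-y)`. -/
def reflect (α : 𝓢(Sp N, ℂ)) : 𝓢(Sp N, ℂ) :=
  compCLMOfContinuousLinearEquiv ℂ (ContinuousLinearEquiv.neg ℝ) α

/-- The Schwartz function `y ↦ α(x - y)`. -/
def rt (α : 𝓢(Sp N, ℂ)) (x : Sp N) : 𝓢(Sp N, ℂ) := compSubConstCLM ℂ x (reflect α)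

/-- The dilation `2^{kN} α(2^k z)`. -/
def dil (k : ℤ) (α : 𝓢(Sp N, ℂ)) : 𝓢(Sp N, ℂ) :=
  ((((2 : ℝ) ^ k) ^ N : ℝ) : ℂ) • compCLMOfContinuousLinearEquiv ℂ
    (ContinuousLinearEquiv.smulLeft (Units.mk0 ((2 : ℝ) ^ k) (by positivity))) α

/-- Convolution of Schwartz functions. -/
def mconv (α β : 𝓢(Sp N, ℂ)) : 𝓢(Sp N, ℂ) := SchwartzMap.convolution (ContinuousLinearMap.mul ℂ ℂ) α β

/-- The convolution `f * α` of a tempered distribution with a Schwartz function. -/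
def cv (f : 𝓢'(Sp N, ℂ)) (α : 𝓢(Sp N, ℂ)) (x : Sp N) : ℂ := f (rt α x)

@[simp] theorem reflect_apply (α : 𝓢(Sp N, ℂ)) (y : Sp N) : reflect α y = α (-y) := rfl

@[simp] theorem rt_apply (α : 𝓢(Sp N, ℂ)) (x y : Sp N) : rt α x y = α (x - y) := by
  change α (-(y - x)) = _; simp

@[simp] theorem dil_apply (k : ℤ) (α : 𝓢(Sp N, ℂ)) (z : Sp N) :
    dil k α z = ((((2 : ℝ) ^ k) ^ N : ℝ) : ℂ) * α ((2 : ℝ) ^ k • z) := rfl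

theorem fourierInv_eq_neg (β : 𝓢(Sp N, ℂ)) (ξ : Sp N) : 𝓕⁻ β ξ = 𝓕 β (-ξ) := by
  rw [fourierInv_coe, fourier_coe, Real.fourierInv_eq_fourier_neg]

theorem fourier_reflect (β : 𝓢(Sp N, ℂ)) (ξ : Sp N) : 𝓕 (reflect β) ξ = 𝓕 β (-ξ) := by
  rw [fourier_coe, fourier_coe, Real.fourier_eq, Real.fourier_eq,
    ← integral_neg_eq_self]
  congr 1; ext v
  simp [reflect_apply]

theorem fourier_mconv (α β : 𝓢(Sp N, ℂ)) (ξ : Sp N) : 𝓕 (mconv α β) ξ = 𝓕 α ξ * 𝓕 β ξ := by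
  rw [mconv, fourier_convolution]; rfl

theorem mconv_apply (α β : 𝓢(Sp N, ℂ)) (x : Sp N) : mconv α β x = ∫ t, α t * β (x - t) := by
  rw [mconv, convolution_apply]; rfl

theorem fourier_ext {α β : 𝓢(Sp N, ℂ)} (h : ∀ ξ, 𝓕 α ξ = 𝓕 β ξ) : α = β := by
  have : 𝓕 α = 𝓕 β := SchwartzMap.ext h
  simpa using congrArg (fun g : 𝓢(Sp N, ℂ) => (𝓕⁻ g : 𝓢(Sp N, ℂ))) this

theorem mconv_comm (α β : 𝓢(Sp N, ℂ)) : mconv α β = mconv β α :=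
  fourier_ext fun ξ => by simp only [fourier_mconv, mul_comm]

theorem fourier_lineDeriv (v : Sp N) (α : 𝓢(Sp N, ℂ)) (ξ : Sp N) :
    𝓕 (∂_{v} α) ξ = 2 * π * Complex.I * (inner ℝ ξ v : ℝ) * 𝓕 α ξ := by
  have h : (fun x : Sp N => inner ℝ x v).HasTemperateGrowth := by fun_prop
  rw [fourier_lineDerivOp_eq, smul_apply, smulLeftCLM_apply_apply h]
  simp [mul_assoc]

theorem lineDeriv_mconv_right (v : Sp N) (α β : 𝓢(Sp N, ℂ)) :
    ∂_{v} (mconv α β) = mconv α (∂_{v} β) :=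
  fourier_ext fun ξ => by simp only [fourier_mconv, fourier_lineDeriv]; ring

theorem lineDeriv_mconv_left (v : Sp N) (α β : 𝓢(Sp N, ℂ)) :
    ∂_{v} (mconv α β) = mconv (∂_{v} α) β :=
  fourier_ext fun ξ => by simp only [fourier_mconv, fourier_lineDeriv]; ring

theorem fourier_add_apply (α β : 𝓢(Sp N, ℂ)) (ξ : Sp N) : 𝓕 (α + β) ξ = 𝓕 α ξ + 𝓕 β ξ := by
  rw [FourierTransform.fourier_add]; rfl

theorem fourier_smul_apply (c : ℂ) (α : 𝓢(Sp N, ℂ)) (ξ : Sp N) : 𝓕 (c • α) ξ = c * 𝓕 α ξ := by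
  rw [FourierTransform.fourier_smul]; rfl

theorem fourier_sum_apply {ι : Type*} (s : Finset ι) (α : ι → 𝓢(Sp N, ℂ)) (ξ : Sp N) :
    𝓕 (∑ i ∈ s, α i) ξ = ∑ i ∈ s, 𝓕 (α i) ξ := by
  have : 𝓕 (∑ i ∈ s, α i) = ∑ i ∈ s, 𝓕 (α i) := map_sum (FourierTransform.fourierCLM ℂ 𝓢(Sp N, ℂ)) _ _
  rw [this, sum_apply]

theorem fourier_dil (k : ℤ) (α : 𝓢(Sp N, ℂ)) (ξ : Sp N) :
    𝓕 (dil k α) ξ = 𝓕 α (((2 : ℝ) ^ k)⁻¹ • ξ) := by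
  have h2 : (0 : ℝ) < (2 : ℝ) ^ k := by positivity
  rw [fourier_coe, fourier_coe, Real.fourier_eq', Real.fourier_eq']
  have := Measure.integral_comp_smul (volume : Measure (Sp N))
    (fun v => Complex.exp ((↑(-2 * π * inner ℝ v (((2 : ℝ) ^ k)⁻¹ • ξ)) * Complex.I)) • α v) ((2 : ℝ) ^ k)
  rw [finrank_euclideanSpace, Fintype.card_fin, abs_of_pos (by positivity), eq_inv_smul_iff₀ (by positivity)] at this
  rw [← this, ← integral_smul]
  congr 1; ext v
  rw [dil_apply, real_inner_smul_left, real_inner_smul_right, mul_inv_cancel_left₀ h2.ne']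
  simp only [smul_eq_mul, Complex.real_smul]; ring

theorem dil_dil (k l : ℤ) (α : 𝓢(Sp N, ℂ)) : dil k (dil l α) = dil (k + l) α :=
  fourier_ext fun ξ => by
    simp only [fourier_dil]; rw [smul_smul, ← mul_inv, zpow_add₀ (by norm_num), mul_comm]

theorem lineDeriv_dil (k : ℤ) (v : Sp N) (α : 𝓢(Sp N, ℂ)) :
    ∂_{v} (dil k α) = (((2 : ℝ) ^ k : ℝ) : ℂ) • dil k (∂_{v} α) :=
  fourier_ext fun ξ => by
    have h2 : (0 : ℝ) < (2 : ℝ) ^ k := by positivity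
    rw [fourier_smul_apply, fourier_lineDeriv, fourier_dil, fourier_dil, fourier_lineDeriv,
      real_inner_smul_left]
    have h3 : (((2 : ℝ) ^ k : ℝ) : ℂ) ≠ 0 := by exact_mod_cast h2.ne'
    push_cast at h3 ⊢
    field_simp

theorem lineDeriv_rt (v : Sp N) (α : 𝓢(Sp N, ℂ)) (x : Sp N) :
    ∂_{v} (rt α x) = -rt (∂_{v} α) x := by
  ext y
  have h1 : ∂_{v} (rt α x) y = fderiv ℝ (rt α x) y v := lineDerivOp_apply_eq_fderiv _ _ _
  have h2 : (rt α x : Sp N → ℂ) = fun y => α (x - y) := funext (rt_apply α x)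
  have h3 : HasFDerivAt (fun y => α (x - y)) ((fderiv ℝ α (x - y)).comp (-ContinuousLinearMap.id ℝ _)) y :=
    (α.hasFDerivAt (x - y)).comp y (by simpa using! (hasFDerivAt_id y).const_sub x)
  rw [h1, h2, h3.fderiv]
  simp [lineDerivOp_apply_eq_fderiv]

theorem cv_lineDeriv (v : Sp N) (f : 𝓢'(Sp N, ℂ)) (α : 𝓢(Sp N, ℂ)) :
    cv (∂_{v} f) α = cv f (∂_{v} α) := by
  ext x
  rw [cv, cv, TemperedDistribution.lineDerivOp_apply_apply, lineDeriv_rt, neg_neg]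

theorem rt_add (α β : 𝓢(Sp N, ℂ)) (x : Sp N) : rt (α + β) x = rt α x + rt β x := by
  ext y; simp

theorem rt_smul (c : ℂ) (α : 𝓢(Sp N, ℂ)) (x : Sp N) : rt (c • α) x = c • rt α x := by
  ext y; simp

theorem cv_add (f : 𝓢'(Sp N, ℂ)) (α β : 𝓢(Sp N, ℂ)) (x : Sp N) :
    cv f (α + β) x = cv f α x + cv f β x := by simp only [cv, rt_add, map_add]

theorem cv_smul (f : 𝓢'(Sp N, ℂ)) (c : ℂ) (α : 𝓢(Sp N, ℂ)) (x : Sp N) :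
    cv f (c • α) x = c * cv f α x := by simp only [cv, rt_smul, map_smul, smul_eq_mul]

theorem cv_zero (f : 𝓢'(Sp N, ℂ)) (x : Sp N) : cv f 0 x = 0 := by
  have : rt (0 : 𝓢(Sp N, ℂ)) x = 0 := by ext y; simp
  rw [cv, this, map_zero]

theorem cv_sum {ι : Type*} (f : 𝓢'(Sp N, ℂ)) (s : Finset ι) (α : ι → 𝓢(Sp N, ℂ)) (x : Sp N) :
    cv f (∑ i ∈ s, α i) x = ∑ i ∈ s, cv f (α i) x := by
  classical
  induction s using Finset.induction_on with
  | empty => simp [cv_zero]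
  | insert a s ha ih => rw [Finset.sum_insert ha, cv_add, ih, Finset.sum_insert ha]

/-- `χ` averaged against the reflected translates of `β`: the function `y' ↦ ∫ χ(y) β(y - y') dy`. -/
def smear (χ β : 𝓢(Sp N, ℂ)) : 𝓢(Sp N, ℂ) := mconv χ (reflect β)

theorem smear_apply (χ β : 𝓢(Sp N, ℂ)) (y' : Sp N) :
    smear χ β y' = ∫ y, χ y * β (y - y') := by
  rw [smear, mconv_apply]; simp

theorem smear_rt (α β : 𝓢(Sp N, ℂ)) (x : Sp N) : smear (rt α x) β = rt (mconv α β) x := by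
  ext y
  rw [smear_apply, rt_apply, mconv_apply, ← integral_sub_left_eq_self (fun t => α t * β (x - y - t)) _ x]
  congr 1; ext t
  rw [rt_apply]; congr 2; abel

/-! ### Tempered distributions commute with superpositions of translates -/

theorem exists_decay {F : Type*} [NormedAddCommGroup F] [NormedSpace ℝ F] (α : 𝓢(Sp N, F)) (n : ℕ) :
    ∃ C : ℝ, 0 ≤ C ∧ ∀ z, ‖α z‖ ≤ C * ((1 + ‖z‖) ^ n)⁻¹ := by
  refine ⟨2 ^ n * ((Finset.Iic (n, 0)).sup fun m => SchwartzMap.seminorm ℝ m.1 m.2) α,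
    by positivity, fun z => ?_⟩
  have := one_add_le_sup_seminorm_apply (𝕜 := ℝ) (m := (n, 0)) le_rfl le_rfl α z
  rw [norm_iteratedFDeriv_zero] at this
  rw [← div_eq_mul_inv, le_div_iff₀ (by positivity), mul_comm]
  exact this

theorem integrable_decay : Integrable fun z : Sp N => ((1 + ‖z‖) ^ (N + 1))⁻¹ := by
  have := integrable_one_add_norm (E := Sp N) (μ := volume) (r := (N + 1 : ℕ)) (by simp)
  refine this.congr (.of_forall fun z => ?_)
  simp only
  rw [Real.rpow_neg (by positivity), Real.rpow_natCast]

/-- The finite product of spaces of bounded continuous functions in which finitely many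
Schwartz seminorms live. -/
def SemiSpace (N : ℕ) (s : Finset (ℕ × ℕ)) : Type :=
  (i : s) → BoundedContinuousFunction (Sp N) (ContinuousMultilinearMap ℝ (fun _ : Fin i.1.2 => Sp N) ℂ)

instance (s : Finset (ℕ × ℕ)) : NormedAddCommGroup (SemiSpace N s) :=
  inferInstanceAs (NormedAddCommGroup ((i : s) → BoundedContinuousFunction (Sp N)
    (ContinuousMultilinearMap ℝ (fun _ : Fin i.1.2 => Sp N) ℂ)))

instance (s : Finset (ℕ × ℕ)) : NormedSpace ℂ (SemiSpace N s) :=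
  inferInstanceAs (NormedSpace ℂ ((i : s) → BoundedContinuousFunction (Sp N)
    (ContinuousMultilinearMap ℝ (fun _ : Fin i.1.2 => Sp N) ℂ)))

instance (s : Finset (ℕ × ℕ)) : NormedSpace ℝ (SemiSpace N s) :=
  inferInstanceAs (NormedSpace ℝ ((i : s) → BoundedContinuousFunction (Sp N)
    (ContinuousMultilinearMap ℝ (fun _ : Fin i.1.2 => Sp N) ℂ)))

instance (s : Finset (ℕ × ℕ)) : CompleteSpace (SemiSpace N s) :=
  inferInstanceAs (CompleteSpace ((i : s) → BoundedContinuousFunction (Sp N)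
    (ContinuousMultilinearMap ℝ (fun _ : Fin i.1.2 => Sp N) ℂ)))

/-- Evaluation of one component of `SemiSpace` at a point and at vectors. -/
def semiEval (s : Finset (ℕ × ℕ)) (i : s) (y : Sp N) (v : Fin i.1.2 → Sp N) : SemiSpace N s →L[ℝ] ℂ :=
  ((ContinuousMultilinearMap.apply ℝ (fun _ : Fin i.1.2 => Sp N) ℂ v).comp
    ((BoundedContinuousFunction.evalCLM ℝ y).comp (ContinuousLinearMap.proj (R := ℝ)
      (φ := fun i : s => BoundedContinuousFunction (Sp N)
        (ContinuousMultilinearMap ℝ (fun _ : Fin i.1.2 => Sp N) ℂ)) i)) : _)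

theorem semiSpace_norm_le {s : Finset (ℕ × ℕ)} (F : SemiSpace N s) {C : ℝ} (hC : 0 ≤ C) :
    ‖F‖ ≤ C ↔ ∀ i, ‖F i‖ ≤ C :=
  pi_norm_le_iff_of_nonneg (x := (F : (i : s) → BoundedContinuousFunction (Sp N)
    (ContinuousMultilinearMap ℝ (fun _ : Fin i.1.2 => Sp N) ℂ))) hC

/-- The embedding of Schwartz functions by `y ↦ |y|^k D^n η(y)`. -/
def semiEmb (s : Finset (ℕ × ℕ)) : 𝓢(Sp N, ℂ) →ₗ[ℂ] SemiSpace N s where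
  toFun η i := BoundedContinuousFunction.ofNormedAddCommGroup
    (fun y => (‖y‖ ^ i.1.1) • iteratedFDeriv ℝ i.1.2 η y)
    (by
      have h : Continuous (iteratedFDeriv ℝ i.1.2 η) :=
        (η.smooth ⊤).continuous_iteratedFDeriv (mod_cast le_top)
      exact (continuous_norm.pow _).smul h)
    (SchwartzMap.seminorm ℝ i.1.1 i.1.2 η) (fun y => by
      rw [norm_smul, norm_pow, norm_norm]
      exact SchwartzMap.le_seminorm ℝ _ _ η y)
  map_add' η ζ := by
    refine funext fun i => BoundedContinuousFunction.ext fun y => ?_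
    change _ = (‖y‖ ^ i.1.1) • iteratedFDeriv ℝ i.1.2 η y + (‖y‖ ^ i.1.1) • iteratedFDeriv ℝ i.1.2 ζ y
    simp only [BoundedContinuousFunction.coe_ofNormedAddCommGroup]
    rw [show ((η + ζ : 𝓢(Sp N, ℂ)) : Sp N → ℂ) = (η : Sp N → ℂ) + ζ from rfl,
      iteratedFDeriv_add_apply (η.smooth _).contDiffAt (ζ.smooth _).contDiffAt, smul_add]
  map_smul' c η := by
    refine funext fun i => BoundedContinuousFunction.ext fun y => ?_
    change _ = c • (‖y‖ ^ i.1.1) • iteratedFDeriv ℝ i.1.2 η y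
    simp only [BoundedContinuousFunction.coe_ofNormedAddCommGroup]
    rw [show ((c • η : 𝓢(Sp N, ℂ)) : Sp N → ℂ) = c • (η : Sp N → ℂ) from rfl,
      iteratedFDeriv_const_smul_apply (η.smooth _).contDiffAt, smul_comm]

theorem semiEmb_apply (s : Finset (ℕ × ℕ)) (η : 𝓢(Sp N, ℂ)) (i : s) (y : Sp N) :
    semiEmb s η i y = (‖y‖ ^ i.1.1) • iteratedFDeriv ℝ i.1.2 η y := rfl

/-- A tempered distribution is a bounded functional composed with `semiEmb`. -/
theorem exists_factor (f : 𝓢'(Sp N, ℂ)) :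
    ∃ (s : Finset (ℕ × ℕ)) (g : StrongDual ℂ (SemiSpace N s)), ∀ η, f η = g (semiEmb s η) := by
  have hcont : Continuous fun η : 𝓢(Sp N, ℂ) => ‖f η‖ := by
    exact continuous_norm.comp (ContinuousLinearMap.continuous f)
  let q : Seminorm ℂ 𝓢(Sp N, ℂ) := (normSeminorm ℂ ℂ).comp (f : 𝓢(Sp N, ℂ) →ₗ[ℂ] ℂ)
  obtain ⟨s, C, -, hC⟩ := Seminorm.bound_of_continuous (schwartz_withSeminorms ℂ (Sp N) ℂ) q hcont
  have hb : ∀ η : 𝓢(Sp N, ℂ), ‖f η‖ ≤ C * ‖semiEmb s η‖ := fun η => by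
    refine (hC η).trans ?_
    rw [smul_apply, NNReal.smul_def, smul_eq_mul]
    refine mul_le_mul_of_nonneg_left (Seminorm.finset_sup_apply_le (norm_nonneg _) fun i hi => ?_) C.2
    refine (seminorm_le_bound ℂ _ _ η (norm_nonneg (semiEmb s η ⟨i, hi⟩)) fun x => ?_).trans
      ((semiSpace_norm_le _ (norm_nonneg _)).1 le_rfl ⟨i, hi⟩)
    refine le_trans (le_of_eq ?_) ((semiEmb s η ⟨i, hi⟩).norm_coe_le_norm x)
    rw [semiEmb_apply, norm_smul, norm_pow, norm_norm]
  have hker : LinearMap.ker (semiEmb s) ≤ LinearMap.ker (f : 𝓢(Sp N, ℂ) →ₗ[ℂ] ℂ) := fun η hη => by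
    rw [LinearMap.mem_ker] at hη ⊢
    have := hb η
    rw [hη, show ‖(0 : SemiSpace N s)‖ = 0 from norm_zero, mul_zero] at this
    exact norm_le_zero_iff.1 this
  let g0 : LinearMap.range (semiEmb (N := N) s) →ₗ[ℂ] ℂ :=
    ((LinearMap.ker (semiEmb s)).liftQ (f : 𝓢(Sp N, ℂ) →ₗ[ℂ] ℂ) hker) ∘ₗ
      ((semiEmb (N := N) s).quotKerEquivRange.symm).toLinearMap
  have hg0 : ∀ η, g0 ⟨semiEmb s η, η, rfl⟩ = f η := fun η => by
    have : (semiEmb (N := N) s).quotKerEquivRange.symm ⟨semiEmb s η, η, rfl⟩ =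
        (LinearMap.ker (semiEmb s)).mkQ η := LinearMap.quotKerEquivRange_symm_apply_image _ _ _
    simp only [g0, LinearMap.comp_apply, LinearEquiv.coe_coe, this]
    exact Submodule.liftQ_apply _ _ _
  obtain ⟨g, hg, -⟩ := exists_extension_norm_eq (LinearMap.range (semiEmb (N := N) s))
    (g0.mkContinuous C (by rintro ⟨_, η, rfl⟩; rw [hg0]; exact hb η))
  refine ⟨s, g, fun η => ?_⟩
  have := hg ⟨semiEmb s η, η, rfl⟩
  rw [this]
  exact (hg0 η).symm

theorem rt_iteratedFDeriv (β : 𝓢(Sp N, ℂ)) (n : ℕ) (x y : Sp N) :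
    iteratedFDeriv ℝ n (rt β x) y = iteratedFDeriv ℝ n (reflect β) (y - x) := by
  have : (rt β x : Sp N → ℂ) = fun y => reflect β (y - x) := rfl
  rw [this, iteratedFDeriv_comp_sub]

theorem exists_iteratedFDeriv_decay (β : 𝓢(Sp N, ℂ)) (k n : ℕ) :
    ∃ S : ℝ, 0 ≤ S ∧ ∀ z, (1 + ‖z‖) ^ k * ‖iteratedFDeriv ℝ n β z‖ ≤ S :=
  ⟨2 ^ k * ((Finset.Iic (k, n)).sup fun m => SchwartzMap.seminorm ℝ m.1 m.2) β, by positivity,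
    fun z => one_add_le_sup_seminorm_apply (𝕜 := ℝ) (m := (k, n)) le_rfl le_rfl β z⟩

theorem norm_le_one_add_mul {E : Type*} [NormedAddCommGroup E] {R : ℝ} (a c : E)
    (h : ‖a - c‖ ≤ R) : ‖a‖ ≤ (1 + R) * (1 + ‖c‖) := by
  have h1 : ‖a‖ ≤ ‖a - c‖ + ‖c‖ := by simpa using norm_add_le (a - c) c
  have := norm_nonneg c
  have := (norm_nonneg _).trans h
  nlinarith

theorem continuous_semiEmb_rt (s : Finset (ℕ × ℕ)) (β : 𝓢(Sp N, ℂ)) :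
    Continuous fun x => semiEmb s (rt β x) := by
  refine continuous_pi fun i => ?_
  obtain ⟨S, hS0, hS⟩ := exists_iteratedFDeriv_decay (reflect β) i.1.1 (i.1.2 + 1)
  refine continuous_iff_continuousAt.2 fun x₀ => ?_
  refine tendsto_iff_norm_sub_tendsto_zero.2 (squeeze_zero' (.of_forall fun x =>
    norm_nonneg (semiEmb s (rt β x) i - semiEmb s (rt β x₀) i))
    (g := fun x => (1 + (1 + ‖x₀‖)) ^ i.1.1 * S * ‖x - x₀‖) ?_ ?_)
  · filter_upwards [Metric.ball_mem_nhds x₀ one_pos] with x hx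
    rw [mem_ball_iff_norm] at hx
    refine (BoundedContinuousFunction.norm_le (by positivity)).2 fun y => ?_
    simp only [BoundedContinuousFunction.coe_sub, Pi.sub_apply, semiEmb_apply, rt_iteratedFDeriv]
    have hx1 : ‖x‖ ≤ 1 + ‖x₀‖ := by
      have : ‖x‖ ≤ ‖x - x₀‖ + ‖x₀‖ := by simpa using norm_add_le (x - x₀) x₀
      linarith
    have hd : ∀ c, DifferentiableAt ℝ (iteratedFDeriv ℝ i.1.2 (reflect β)) c := fun c =>
      ((reflect β).smooth ⊤).differentiable_iteratedFDeriv (mod_cast ENat.natCast_lt_top _) c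
    have hmv := (convex_segment (𝕜 := ℝ) (y - x₀) (y - x)).norm_image_sub_le_of_norm_hasFDerivWithin_le
      (f := fun c => (‖y‖ ^ i.1.1) • iteratedFDeriv ℝ i.1.2 (reflect β) c)
      (f' := fun c => (‖y‖ ^ i.1.1) • fderiv ℝ (iteratedFDeriv ℝ i.1.2 (reflect β)) c)
      (C := (1 + (1 + ‖x₀‖)) ^ i.1.1 * S)
      (fun c _ => (HasFDerivAt.fun_const_smul (hd c).hasFDerivAt (‖y‖ ^ i.1.1)).hasFDerivWithinAt) (fun c hc => by
        have hyc : ‖y - c‖ ≤ 1 + ‖x₀‖ := by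
          have hc' : y - c ∈ Metric.closedBall (0 : Sp N) (1 + ‖x₀‖) := by
            obtain ⟨a, b, ha, hb, hab, rfl⟩ := hc
            have : y - (a • (y - x₀) + b • (y - x)) = a • x₀ + b • x := by
              have : y = a • y + b • y := by rw [← add_smul, hab, one_smul]
              nth_rewrite 1 [this]; simp only [smul_sub]; abel
            rw [this]
            exact convex_closedBall (0 : Sp N) _ (by simp) (by simpa using hx1) ha hb hab
          simpa using hc'
        rw [norm_smul, norm_pow, norm_norm, norm_fderiv_iteratedFDeriv]
        calc ‖y‖ ^ i.1.1 * ‖iteratedFDeriv ℝ (i.1.2 + 1) (reflect β) c‖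
            ≤ ((1 + (1 + ‖x₀‖)) * (1 + ‖c‖)) ^ i.1.1 * ‖iteratedFDeriv ℝ (i.1.2 + 1) (reflect β) c‖ := by
              gcongr; exact norm_le_one_add_mul y c hyc
          _ ≤ _ := by rw [mul_pow, mul_assoc]; gcongr; exact hS c)
      (left_mem_segment ℝ _ _) (right_mem_segment ℝ _ _)
    refine hmv.trans_eq ?_
    rw [show y - x - (y - x₀) = -(x - x₀) by abel, norm_neg]
  · have : Continuous fun x : Sp N => (1 + (1 + ‖x₀‖)) ^ i.1.1 * S * ‖x - x₀‖ := by fun_prop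
    simpa using this.tendsto x₀

theorem continuous_cv (f : 𝓢'(Sp N, ℂ)) (β : 𝓢(Sp N, ℂ)) : Continuous (cv f β) := by
  obtain ⟨s, g, hg⟩ := exists_factor f
  have : cv f β = fun x => g (semiEmb s (rt β x)) := funext fun x => hg _
  rw [this]
  exact g.continuous.comp (continuous_semiEmb_rt s β)

theorem integrable_smul_semiEmb (s : Finset (ℕ × ℕ)) (χ β : 𝓢(Sp N, ℂ)) :
    Integrable fun y => χ y • semiEmb s (rt β y) := by
  have h1 : ∀ i : s, ∃ S : ℝ, 0 ≤ S ∧ ∀ y, ‖semiEmb s (rt β y) i‖ ≤ S * (1 + ‖y‖) ^ i.1.1 := fun i => by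
    obtain ⟨S, hS0, hS⟩ := exists_iteratedFDeriv_decay (reflect β) i.1.1 i.1.2
    refine ⟨S, hS0, fun y => (BoundedContinuousFunction.norm_le (by positivity)).2 fun y' => ?_⟩
    rw [semiEmb_apply, rt_iteratedFDeriv, norm_smul, norm_pow, norm_norm]
    calc ‖y'‖ ^ i.1.1 * ‖iteratedFDeriv ℝ i.1.2 (reflect β) (y' - y)‖
        ≤ ((1 + ‖y‖) * (1 + ‖y' - y‖)) ^ i.1.1 * ‖iteratedFDeriv ℝ i.1.2 (reflect β) (y' - y)‖ := by
          gcongr; exact norm_le_one_add_mul y' (y' - y) (by simp)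
      _ ≤ _ := by rw [mul_pow, mul_assoc, mul_comm S]; gcongr; exact hS _
  choose S hS0 hS using h1
  obtain ⟨K, hK⟩ : ∃ K : ℕ, ∀ i ∈ s, i.1 ≤ K := ⟨s.sup (fun i => i.1), fun i hi => Finset.le_sup (f := fun i : ℕ × ℕ => i.1) hi⟩
  have h2 : ∀ y, ‖semiEmb s (rt β y)‖ ≤ (∑ i, S i) * (1 + ‖y‖) ^ K := fun y => by
    refine (semiSpace_norm_le _ (mul_nonneg (Finset.sum_nonneg fun i _ => hS0 i) (by positivity))).2 fun i => (hS i y).trans ?_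
    refine mul_le_mul (Finset.single_le_sum (fun i _ => hS0 i) (Finset.mem_univ i))
      (pow_le_pow_right₀ (by have := norm_nonneg y; linarith) (hK i.1 i.2)) (by positivity) (Finset.sum_nonneg fun i _ => hS0 i)
  obtain ⟨C, hC0, hC⟩ := exists_decay χ (K + (N + 1))
  refine (integrable_decay.const_mul (C * ∑ i, S i)).mono'
    (χ.continuous.smul (continuous_semiEmb_rt s β)).aestronglyMeasurable
    (.of_forall fun y => ?_)
  rw [norm_smul]
  refine (mul_le_mul (hC y) (h2 y) (norm_nonneg _) (by positivity)).trans_eq ?_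
  have : (1 + ‖y‖) ^ K ≠ 0 := by positivity
  rw [pow_add]; field_simp

theorem iteratedLineDeriv_mconv_right {n : ℕ} (v : Fin n → Sp N) (α β : 𝓢(Sp N, ℂ)) :
    ∂^{v} (mconv α β) = mconv α (∂^{v} β) := by
  induction n with
  | zero => simp
  | succ n ih => rw [LineDeriv.iteratedLineDerivOp_succ_left, LineDeriv.iteratedLineDerivOp_succ_left, ih, lineDeriv_mconv_right]

theorem integral_smul_semiEmb (s : Finset (ℕ × ℕ)) (χ β : 𝓢(Sp N, ℂ)) :
    ∫ y, χ y • semiEmb s (rt β y) = semiEmb s (smear χ β) := by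
  have hint := integrable_smul_semiEmb s χ β
  refine funext fun i => BoundedContinuousFunction.ext fun y' => ContinuousMultilinearMap.ext fun v => ?_
  let ev : SemiSpace N s →L[ℝ] ℂ := semiEval s i y' v
  have h1 := ev.integral_comp_comm hint
  have h2 : ev (∫ y, χ y • semiEmb s (rt β y)) = (∫ y, χ y • semiEmb s (rt β y)) i y' v := rfl
  rw [← h2, ← h1]
  have h3 : ∀ η : 𝓢(Sp N, ℂ), ev (semiEmb s η) = (‖y'‖ ^ i.1.1) • (∂^{v} η) y' := fun η => by
    rw [iteratedLineDerivOp_eq_iteratedFDeriv]; rfl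
  have h4 : ∀ η : 𝓢(Sp N, ℂ), semiEmb s η i y' v = (‖y'‖ ^ i.1.1) • (∂^{v} η) y' := h3
  have h5 : ∀ y, ev (χ y • semiEmb s (rt β y)) = (‖y'‖ ^ i.1.1) • (χ y * (∂^{v} (reflect β)) (y' - y)) := fun y => by
    have : ev (χ y • semiEmb s (rt β y)) = χ y * ev (semiEmb s (rt β y)) := rfl
    rw [this, h3, iteratedLineDerivOp_eq_iteratedFDeriv, rt_iteratedFDeriv,
      ← iteratedLineDerivOp_eq_iteratedFDeriv, mul_smul_comm]
  simp_rw [h5]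
  rw [integral_smul, h4, smear, iteratedLineDeriv_mconv_right, mconv_apply]

/-- Superposition: `∫ χ(y) (f * β)(y) dy = ⟨f, ∫ χ(y) β(y - ·) dy⟩`. -/
theorem integral_mul_cv (f : 𝓢'(Sp N, ℂ)) (χ β : 𝓢(Sp N, ℂ)) :
    Integrable (fun y => χ y * cv f β y) ∧ ∫ y, χ y * cv f β y = f (smear χ β) := by
  obtain ⟨s, g, hg⟩ := exists_factor f
  have h : ∀ y, χ y * cv f β y = g (χ y • semiEmb s (rt β y)) := fun y => by
    rw [map_smul, ← hg]; rfl
  simp_rw [h]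
  refine ⟨g.integrable_comp (integrable_smul_semiEmb s χ β), ?_⟩
  rw [g.integral_comp_comm (integrable_smul_semiEmb s χ β), integral_smul_semiEmb, ← hg]

theorem integral_mul_cv' (f : 𝓢'(Sp N, ℂ)) (α β : 𝓢(Sp N, ℂ)) (x : Sp N) :
    ∫ y, α (x - y) * cv f β y = cv f (mconv α β) x := by
  have := (integral_mul_cv f (rt α x) β).2
  rw [smear_rt] at this
  simp only [rt_apply] at this
  exact this

/-! ### Dyadic blocks as convolutions -/

/-- The symbol of `Δ_0` in the variable of Mathlib's Fourier transform. -/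
def symb : 𝓢(Sp N, ℂ) :=
  compCLMOfContinuousLinearEquiv ℂ (ContinuousLinearEquiv.smulLeft
    (Units.mk0 (2 * π) (by positivity))) (Φ.φ.postcompCLM Complex.ofRealCLM)

/-- The convolution kernel of `Δ_k`. -/
def kap (k : ℤ) : 𝓢(Sp N, ℂ) := dil k (𝓕⁻ (symb Φ))

/-- The convolution kernel of `Δ_{k-1} + Δ_k + Δ_{k+1}`. -/
def fatKap (k : ℤ) : 𝓢(Sp N, ℂ) :=
  dil k (∑ i ∈ ({-1, 0, 1} : Finset ℤ), kap Φ i)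

theorem symb_apply (ξ : Sp N) : symb Φ ξ = (Φ.φ ((2 * π) • ξ) : ℂ) := rfl

theorem fourier_kap (k : ℤ) (ξ : Sp N) :
    𝓕 (kap Φ k) ξ = (Φ.φ ((2 : ℝ) ^ (-k) • (2 * π) • ξ) : ℂ) := by
  rw [kap, fourier_dil, fourier_fourierInv_eq, symb_apply, zpow_neg, smul_comm]

theorem dil_kap (k l : ℤ) : dil k (kap Φ l) = kap Φ (k + l) := by
  rw [kap, dil_dil, kap]

theorem dil_sum {ι : Type*} (k : ℤ) (s : Finset ι) (α : ι → 𝓢(Sp N, ℂ)) :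
    dil k (∑ i ∈ s, α i) = ∑ i ∈ s, dil k (α i) := by
  refine fourier_ext fun ξ => ?_
  simp only [fourier_dil, fourier_sum_apply]

theorem fatKap_eq (k : ℤ) :
    fatKap Φ k = ∑ i ∈ ({-1, 0, 1} : Finset ℤ), kap Φ (k + i) := by
  simp only [fatKap, dil_sum, dil_kap]

theorem LPFunction.annulus_scaled {k : ℤ} {ξ : Sp N}
    (h : Φ.φ ((2 : ℝ) ^ (-k) • ξ) ≠ 0) : 3 / 4 * 2 ^ k ≤ ‖ξ‖ ∧ ‖ξ‖ ≤ 8 / 3 * 2 ^ k := by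
  have := Φ.annulus _ h
  have h2 : (0 : ℝ) < 2 ^ k := by positivity
  rw [norm_smul, Real.norm_of_nonneg (by positivity), zpow_neg, inv_mul_eq_div, le_div_iff₀ h2,
    div_le_iff₀ h2] at this
  exact this

theorem LPFunction.eq_zero_of_far {k l : ℤ} (hkl : 2 ≤ |k - l|) {ξ : Sp N}
    (h : Φ.φ ((2 : ℝ) ^ (-k) • ξ) ≠ 0) : Φ.φ ((2 : ℝ) ^ (-l) • ξ) = 0 := by
  by_contra h'
  obtain ⟨a1, a2⟩ := Φ.annulus_scaled h
  obtain ⟨b1, b2⟩ := Φ.annulus_scaled h'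
  have key : ∀ m n : ℤ, m + 2 ≤ n → (2 : ℝ) ^ m * 4 ≤ 2 ^ n := fun m n hmn => by
    calc (2 : ℝ) ^ m * 4 = 2 ^ (m + 2) := by rw [zpow_add₀ (by norm_num)]; norm_num
      _ ≤ 2 ^ n := zpow_le_zpow_right₀ (by norm_num) hmn
  have hk : (0 : ℝ) < 2 ^ k := by positivity
  have hl : (0 : ℝ) < 2 ^ l := by positivity
  rcases le_abs'.1 hkl with h1 | h1
  · have := key k l (by omega); linarith
  · have := key l k (by omega); linarith

theorem LPFunction.sum_near {k : ℤ} {ξ : Sp N}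
    (h : Φ.φ ((2 : ℝ) ^ (-k) • ξ) ≠ 0) :
    ∑ i ∈ ({-1, 0, 1} : Finset ℤ), Φ.φ ((2 : ℝ) ^ (-(k + i)) • ξ) = 1 := by
  have hξ : ξ ≠ 0 := by
    rintro rfl
    have := (Φ.annulus_scaled h).1
    have h2 : (0 : ℝ) < 2 ^ k := by positivity
    rw [norm_zero] at this; linarith
  have h1 := Φ.sum_eq_one ξ hξ
  rw [← (Equiv.addLeft k).hasSum_iff] at h1
  refine HasSum.unique (hasSum_sum_of_ne_finset_zero fun i hi => ?_) h1
  refine Φ.eq_zero_of_far ?_ h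
  simp only [Finset.mem_insert, Finset.mem_singleton, not_or] at hi
  simp only [sub_add_cancel_left, abs_neg]
  by_contra hcon
  have := abs_lt.1 (not_le.1 hcon)
  omega

theorem mconv_fatKap_kap (k : ℤ) : mconv (fatKap Φ k) (kap Φ k) = kap Φ k := by
  refine fourier_ext fun ξ => ?_
  rw [fourier_mconv, fatKap_eq, fourier_sum_apply]
  simp only [fourier_kap]
  by_cases h : Φ.φ ((2 : ℝ) ^ (-k) • (2 * π) • ξ) = 0
  · rw [h]; simp
  · have := Φ.sum_near h
    rw [← Complex.ofReal_sum, this]; simp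

theorem block_apply (k : ℤ) (f : 𝓢'(Sp N, ℂ)) (χ : 𝓢(Sp N, ℂ)) :
    block Φ k f χ = f (smear χ (kap Φ k)) := by
  rw [block, TemperedDistribution.fourierMultiplierCLM_apply_apply]
  congr 1
  have : smulLeftCLM ℂ (fun ξ : Sp N => ((Φ.φ ((2 : ℝ) ^ (-k) • (2 * π) • ξ) : ℝ) : ℂ))
      (𝓕⁻ χ) = 𝓕⁻ (smear χ (kap Φ k)) := by
    ext ξ
    rw [smulLeftCLM_apply_apply, fourierInv_eq_neg, fourierInv_eq_neg, smear, fourier_mconv, fourier_reflect, neg_neg,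
      fourier_kap, smul_eq_mul, mul_comm]
    have h1 := (𝓕 (kap Φ k) : 𝓢(Sp N, ℂ)).hasTemperateGrowth
    refine (funext (fourier_kap Φ k)) ▸ h1
  rw [this, fourier_fourierInv_eq]

theorem represents_block (k : ℤ) (f : 𝓢'(Sp N, ℂ)) :
    Represents (cv f (kap Φ k)) (block Φ k f) := fun χ => by
  rw [block_apply]
  exact ⟨(integral_mul_cv f χ _).1, (integral_mul_cv f χ _).2.symm⟩

theorem Represents.locallyIntegrable {g : Sp N → ℂ} {f : 𝓢'(Sp N, ℂ)} (h : Represents g f) :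
    LocallyIntegrable g := fun x => by
  let B : ContDiffBump x := ⟨1, 2, one_pos, one_lt_two⟩
  have hc : HasCompactSupport fun y => (B y : ℂ) := B.hasCompactSupport.comp_left (g := Complex.ofReal) rfl
  have hs : ContDiff ℝ ∞ fun y => (B y : ℂ) := Complex.ofRealCLM.contDiff.comp B.contDiff
  have := (h (hc.toSchwartzMap hs)).1
  refine ⟨Metric.closedBall x 1, Metric.closedBall_mem_nhds x one_pos, ?_⟩
  refine (this.integrableOn (s := Metric.closedBall x 1)).congr_fun (fun y hy => ?_) measurableSet_closedBall
  change (B y : ℂ) * g y = g y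
  rw [B.one_of_mem_closedBall hy]; simp

theorem Represents.ae_eq {g g' : Sp N → ℂ} {f : 𝓢'(Sp N, ℂ)} (h : Represents g f)
    (h' : Represents g' f) : g =ᵐ[volume] g' := by
  refine ae_eq_of_integral_contDiff_smul_eq h.locallyIntegrable h'.locallyIntegrable fun θ hθ hc => ?_
  have hc' : HasCompactSupport fun y => (θ y : ℂ) := hc.comp_left (g := Complex.ofReal) rfl
  have hs : ContDiff ℝ ∞ fun y => (θ y : ℂ) := Complex.ofRealCLM.contDiff.comp hθ
  simp only [Complex.real_smul]
  exact (h (hc'.toSchwartzMap hs)).2.symm.trans (h' (hc'.toSchwartzMap hs)).2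

theorem density_block (k : ℤ) (f : 𝓢'(Sp N, ℂ)) :
    density (block Φ k f) =ᵐ[volume] cv f (kap Φ k) := by
  have h : ∃ g, Represents g (block Φ k f) := ⟨_, represents_block Φ k f⟩
  rw [density, dif_pos h]
  exact h.choose_spec.ae_eq (represents_block Φ k f)

theorem eLpNorm_eq_nrm {p : ℝ} (hp : 1 ≤ p) (g : Sp N → ℂ) :
    eLpNorm g (ofReal p) volume = nrm p fun x => ‖g x‖ₑ := by
  have h0 : ofReal p ≠ 0 := by simpa using by linarith
  rw [eLpNorm_eq_lintegral_rpow_enorm_toReal h0 ofReal_ne_top,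
    ENNReal.toReal_ofReal (by linarith), nrm]

theorem lpNorm_block (k : ℤ) {p : ℝ} (hp : 1 ≤ p) (f : 𝓢'(Sp N, ℂ)) :
    lpNorm p (block Φ k f) = nrm p fun x => ‖cv f (kap Φ k) x‖ₑ := by
  rw [← eLpNorm_eq_nrm hp]
  refine le_antisymm (iInf₂_le (cv f (kap Φ k)) (represents_block Φ k f)) (le_iInf₂ fun g hg => ?_)
  exact (eLpNorm_congr_ae ((represents_block Φ k f).ae_eq hg)).le

theorem measurable_enorm_cv (f : 𝓢'(Sp N, ℂ)) (α : 𝓢(Sp N, ℂ)) :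
    Measurable fun x => ‖cv f α x‖ₑ := (continuous_cv f α).enorm.measurable

/-- Schwartz functions whose Fourier transform vanishes near `0` are tests modulo polynomials. -/
theorem isZTest_of_ball {χ : 𝓢(Sp N, ℂ)} {r : ℝ} (hr : 0 < r) (h : ∀ ξ, ‖ξ‖ < r → 𝓕 χ ξ = 0) :
    IsZTest χ := fun n => by
  have : (𝓕 χ : 𝓢(Sp N, ℂ)) =ᶠ[nhds 0] (fun _ => (0 : ℂ)) := by
    filter_upwards [Metric.ball_mem_nhds (0 : Sp N) hr] with ξ hξ
    exact h ξ (by simpa using hξ)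
  rw [(this.iteratedFDeriv ℝ n).eq_of_nhds, iteratedFDeriv_fun_zero]
  rfl

theorem fourier_rt (α : 𝓢(Sp N, ℂ)) (x ξ : Sp N) :
    ∃ c : ℂ, 𝓕 (rt α x) ξ = c * 𝓕 α (-ξ) := by
  refine ⟨Complex.exp (↑(-2 * π * inner ℝ x ξ) * Complex.I), ?_⟩
  rw [fourier_coe, fourier_coe, Real.fourier_eq', Real.fourier_eq',
    ← integral_sub_left_eq_self (fun v : Sp N => Complex.exp (↑(-2 * π * inner ℝ v ξ) * Complex.I) • (rt α x) v) _ x,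
    ← integral_const_mul]
  congr 1; ext v
  simp only [rt_apply, sub_sub_cancel, smul_eq_mul]
  rw [← mul_assoc, ← Complex.exp_add]
  congr 2
  rw [inner_sub_left, inner_neg_right]; push_cast; ring

/-! ### Size and spectrum of kernels -/

/-- `α` is dominated by `C` times the majorant at the scale `2^{-k}`, also after multiplication
with `2^k |z|`. -/
def KerBd (k : ℤ) (C : ℝ≥0∞) (α : Sp N → ℂ) : Prop :=
  ∀ z, ‖α z‖ₑ ≤ C * maj k z ∧ ofReal ((2 : ℝ) ^ k * ‖z‖) * ‖α z‖ₑ ≤ C * maj k z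

/-- The Fourier transform of `α` lives in the annulus `2^{k-2} ≤ |2πξ| ≤ 2^{k+3}`. -/
def SpecIn (k : ℤ) (α : 𝓢(Sp N, ℂ)) : Prop :=
  ∀ ξ, 𝓕 α ξ ≠ 0 → (2 : ℝ) ^ (k - 2) ≤ 2 * π * ‖ξ‖ ∧ 2 * π * ‖ξ‖ ≤ 2 ^ (k + 3)

theorem kerBd_of_bound {k : ℤ} {C : ℝ} (hC : 0 ≤ C) {α : Sp N → ℂ}
    (h : ∀ z, ‖α z‖ ≤ C * ((2 : ℝ) ^ k) ^ N * ((1 + (2 : ℝ) ^ k * ‖z‖) ^ (N + 2))⁻¹) :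
    KerBd k (ofReal C) α := fun z => by
  have h2 : (0 : ℝ) < 2 ^ k := by positivity
  have hm : 0 ≤ ‖z‖ := norm_nonneg z
  have h1 : 0 < 1 + (2 : ℝ) ^ k * ‖z‖ := by positivity
  have e : ∀ r : ℝ, 0 ≤ r → r ≤ 1 + (2 : ℝ) ^ k * ‖z‖ → ofReal r * ‖α z‖ₑ ≤ ofReal C * maj k z := by
    intro r hr0 hr
    rw [maj, ← ofReal_norm, ← ofReal_mul hr0, ← ofReal_mul hC]
    refine ofReal_le_ofReal ?_
    calc r * ‖α z‖ ≤ (1 + (2 : ℝ) ^ k * ‖z‖) * (C * ((2 : ℝ) ^ k) ^ N * ((1 + (2 : ℝ) ^ k * ‖z‖) ^ (N + 2))⁻¹) := by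
          gcongr; exact h z
      _ = _ := by rw [pow_succ _ (N + 1)]; field_simp
  refine ⟨by simpa using e 1 zero_le_one (by simp; positivity), e _ (by positivity) (by linarith)⟩

theorem exists_kerBd (α : 𝓢(Sp N, ℂ)) : ∃ C : ℝ≥0, ∀ k, KerBd k C (dil k α) := by
  obtain ⟨C, hC0, hC⟩ := exists_decay α (N + 2)
  refine ⟨C.toNNReal, fun k => ?_⟩
  change KerBd k (ofReal C) _
  refine kerBd_of_bound hC0 fun z => ?_
  have h2 : (0 : ℝ) < 2 ^ k := by positivity
  rw [dil_apply, norm_mul, Complex.norm_of_nonneg (by positivity)]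
  have := hC ((2 : ℝ) ^ k • z)
  rw [norm_smul, Real.norm_of_nonneg h2.le] at this
  rw [mul_comm C, mul_assoc]
  gcongr

theorem enorm_integral_mul_le {k : ℤ} {C : ℝ≥0∞} {α : Sp N → ℂ} (h : KerBd k C α) {w : Sp N → ℂ}
    (hw : Measurable fun y => ‖w y‖ₑ) (x : Sp N) :
    ‖∫ y, α (x - y) * w y‖ₑ ≤ C * avg k (fun y => ‖w y‖ₑ) x := by
  rw [avg_eq k hw, ← lintegral_const_mul _ (by fun_prop)]
  refine (enorm_integral_le_lintegral_enorm _).trans (lintegral_mono fun y => ?_)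
  simp only [enorm_mul]
  rw [← mul_assoc]
  gcongr
  exact (h _).1

/-- Change of the kernel in a convolution, `f * (α * κ)` in terms of `f * κ`. -/
theorem enorm_cv_mconv_le {k : ℤ} {C : ℝ≥0∞} {α : 𝓢(Sp N, ℂ)} (h : KerBd k C α)
    (f : 𝓢'(Sp N, ℂ)) (κ : 𝓢(Sp N, ℂ)) (x : Sp N) :
    ‖cv f (mconv α κ) x‖ₑ ≤ C * avg k (fun y => ‖cv f κ y‖ₑ) x := by
  rw [← integral_mul_cv']
  exact enorm_integral_mul_le h (measurable_enorm_cv f κ) x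

theorem exists_enorm_cv_le : ∃ C : ℝ≥0, 1 ≤ C ∧ ∀ (f : 𝓢'(Sp N, ℂ)) (k : ℤ) (x : Sp N),
    ‖cv f (kap Φ k) x‖ₑ ≤ C * avg k (fun y => ‖cv f (kap Φ k) y‖ₑ) x := by
  obtain ⟨C, hC⟩ := exists_kerBd (∑ i ∈ ({-1, 0, 1} : Finset ℤ), kap Φ i)
  refine ⟨max C 1, le_max_right _ _, fun f k x => ?_⟩
  have := enorm_cv_mconv_le (hC k) f (kap Φ k) x
  rw [← fatKap, mconv_fatKap_kap] at this
  refine this.trans ?_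
  gcongr
  exact le_max_left _ _

/-- Bernstein's inequality for derivatives of blocks, pointwise. -/
theorem exists_enorm_cv_lineDeriv_le : ∃ C : ℝ≥0, ∀ (i : Fin N)
    (f : 𝓢'(Sp N, ℂ)) (k : ℤ) (x : Sp N),
    ‖cv (∂_{basisVec i} f) (kap Φ k) x‖ₑ ≤
      C * (2 ^ (k : ℝ) * avg k (fun y => ‖cv f (kap Φ k) y‖ₑ) x) := by
  choose C hC using fun i : Fin N => exists_kerBd (∂_{basisVec i} (∑ i ∈ ({-1, 0, 1} : Finset ℤ), kap Φ i))
  refine ⟨∑ i, C i, fun i f k x => ?_⟩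
  have h1 : ∂_{basisVec i} (kap Φ k) = (((2 : ℝ) ^ k : ℝ) : ℂ) • mconv (dil k (∂_{basisVec i} (∑ i ∈ ({-1, 0, 1} : Finset ℤ), kap Φ i))) (kap Φ k) := by
    conv_lhs => rw [← mconv_fatKap_kap, lineDeriv_mconv_left, fatKap, lineDeriv_dil]
    refine fourier_ext fun ξ => ?_
    simp only [fourier_mconv, fourier_smul_apply]
    ring
  rw [cv_lineDeriv, h1, cv_smul, enorm_mul]
  have h2 : ‖(((2 : ℝ) ^ k : ℝ) : ℂ)‖ₑ = (2 : ℝ≥0∞) ^ (k : ℝ) := by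
    rw [← ofReal_norm, Complex.norm_of_nonneg (by positivity), ← Real.rpow_intCast,
      ← ofReal_rpow_of_pos (by norm_num)]
    norm_num
  rw [h2, mul_left_comm]
  gcongr
  refine (enorm_cv_mconv_le (hC i k) f (kap Φ k) x).trans ?_
  gcongr
  exact Finset.single_le_sum (f := C) (fun _ _ => zero_le) (Finset.mem_univ i)

theorem specIn_kap (k i : ℤ) (hi : |i| ≤ 1) : SpecIn k (kap Φ (k + i)) := fun ξ h => by
  rw [fourier_kap] at h
  obtain ⟨h1, h2⟩ := Φ.annulus_scaled (ξ := (2 * π) • ξ) (k := k + i) (by exact_mod_cast h)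
  rw [norm_smul, Real.norm_of_nonneg (by positivity)] at h1 h2
  have h0 : (0 : ℝ) < 2 ^ k := by positivity
  rw [zpow_add₀ (by norm_num)] at h1 h2
  rw [zpow_sub₀ (by norm_num), zpow_add₀ (by norm_num)]
  have hi' := abs_le.1 hi
  have : i = -1 ∨ i = 0 ∨ i = 1 := by omega
  rcases this with rfl | rfl | rfl <;> norm_num at h1 h2 ⊢ <;> constructor <;> linarith

theorem specIn_kap_self (k : ℤ) : SpecIn k (kap Φ k) := by
  simpa using specIn_kap Φ k 0 (by simp)

theorem specIn_fatKap (k : ℤ) : SpecIn k (fatKap Φ k) := fun ξ h => by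
  rw [fatKap_eq, fourier_sum_apply] at h
  obtain ⟨i, hi, h'⟩ := Finset.exists_ne_zero_of_sum_ne_zero h
  refine specIn_kap Φ k i ?_ ξ h'
  simp only [Finset.mem_insert, Finset.mem_singleton] at hi
  rcases hi with rfl | rfl | rfl <;> simp

theorem SpecIn.lineDeriv {k : ℤ} {α : 𝓢(Sp N, ℂ)} (h : SpecIn k α) (v : Sp N) :
    SpecIn k (∂_{v} α) := fun ξ hξ => by
  rw [fourier_lineDeriv] at hξ
  exact h ξ (right_ne_zero_of_mul hξ)

theorem SpecIn.rt {k : ℤ} {α : 𝓢(Sp N, ℂ)} (h : SpecIn k α) (x ξ : Sp N) (hξ : 𝓕 (rt α x) ξ ≠ 0) :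
    (2 : ℝ) ^ (k - 2) ≤ 2 * π * ‖ξ‖ ∧ 2 * π * ‖ξ‖ ≤ 2 ^ (k + 3) := by
  obtain ⟨c, hc⟩ := fourier_rt α x ξ
  rw [hc] at hξ
  simpa using h (-ξ) (right_ne_zero_of_mul hξ)

theorem SpecIn.isZTest {k : ℤ} {α : 𝓢(Sp N, ℂ)} (h : SpecIn k α) (x : Sp N) :
    IsZTest (LinMom.rt α x) := by
  refine isZTest_of_ball (r := (2 : ℝ) ^ (k - 2) / (2 * π)) (by positivity) fun ξ hξ => ?_
  by_contra hne
  have := (h.rt x ξ hne).1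
  rw [lt_div_iff₀ (by positivity)] at hξ
  linarith

/-- The product of Schwartz functions, through the Fourier transform. -/
def schwartzMul (α β : 𝓢(Sp N, ℂ)) : 𝓢(Sp N, ℂ) := 𝓕⁻ (mconv (𝓕 α) (𝓕 β))

theorem schwartzMul_apply (α β : 𝓢(Sp N, ℂ)) (y : Sp N) : schwartzMul α β y = α y * β y := by
  rw [schwartzMul, fourierInv_eq_neg, fourier_mconv, ← fourierInv_eq_neg, ← fourierInv_eq_neg,
    fourierInv_fourier_eq, fourierInv_fourier_eq]

theorem annulus_gap {m n : ℤ} (h : m + 7 ≤ n) : (2 : ℝ) ^ (m + 3) * 4 ≤ 2 ^ (n - 2) := by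
  calc (2 : ℝ) ^ (m + 3) * 4 = 2 ^ (m + 3 + 2) := by rw [zpow_add₀ (by norm_num) (m + 3)]; norm_num
    _ ≤ 2 ^ (n - 2) := zpow_le_zpow_right₀ (by norm_num) (by omega)

/-- Three frequencies in annuli of sizes `2^k`, `2^j`, `2^l` cannot add up if one of the annuli
is much larger than the two others. -/
theorem freq_ne {k j l : ℤ} (h : k + 7 ≤ max j l ∧ (j + 7 ≤ l ∨ l + 7 ≤ j) ∨ (j + 7 ≤ k ∧ l + 7 ≤ k))
    {a b c : Sp N} (habc : a = b + c)
    (ha : (2 : ℝ) ^ (k - 2) ≤ 2 * π * ‖a‖ ∧ 2 * π * ‖a‖ ≤ 2 ^ (k + 3))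
    (hb : (2 : ℝ) ^ (j - 2) ≤ 2 * π * ‖b‖ ∧ 2 * π * ‖b‖ ≤ 2 ^ (j + 3))
    (hc : (2 : ℝ) ^ (l - 2) ≤ 2 * π * ‖c‖ ∧ 2 * π * ‖c‖ ≤ 2 ^ (l + 3)) : False := by
  have p1 : (0 : ℝ) < 2 ^ (k + 3) := by positivity
  have p2 : (0 : ℝ) < 2 ^ (j + 3) := by positivity
  have p3 : (0 : ℝ) < 2 ^ (l + 3) := by positivity
  have hpi := Real.pi_pos
  have n1 : 2 * π * ‖a‖ ≤ 2 * π * ‖b‖ + 2 * π * ‖c‖ := by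
    rw [← mul_add]; gcongr; rw [habc]; exact norm_add_le _ _
  have n2 : 2 * π * ‖b‖ ≤ 2 * π * ‖a‖ + 2 * π * ‖c‖ := by
    rw [← mul_add]; gcongr; rw [show b = a - c by rw [habc]; abel]; exact norm_sub_le _ _
  have n3 : 2 * π * ‖c‖ ≤ 2 * π * ‖a‖ + 2 * π * ‖b‖ := by
    rw [← mul_add]; gcongr; rw [show c = a - b by rw [habc]; abel]; exact norm_sub_le _ _
  rcases h with ⟨h1, h2 | h2⟩ | ⟨h1, h2⟩
  · have e1 := annulus_gap h2
    have e2 := annulus_gap (m := k) (n := l) (by omega)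
    linarith [ha.2, hb.2, hc.1]
  · have e1 := annulus_gap h2
    have e2 := annulus_gap (m := k) (n := j) (by omega)
    linarith [ha.2, hc.2, hb.1]
  · have e1 := annulus_gap h1
    have e2 := annulus_gap h2
    linarith [hb.2, hc.2, ha.1]

/-- The trilinear form `∫ α(x-y) F(y) (w * κ)(y) dy` vanishes if one of the spectra of `α`, `F`, `κ`
lies far out of the two others. -/
theorem trilinear_eq_zero {k j l : ℤ}
    (h : k + 7 ≤ max j l ∧ (j + 7 ≤ l ∨ l + 7 ≤ j) ∨ (j + 7 ≤ k ∧ l + 7 ≤ k))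
    {α η κ : 𝓢(Sp N, ℂ)} (hα : SpecIn k α) (hη : SpecIn j η) (hκ : SpecIn l κ)
    {F : Sp N → ℂ} (hF : Continuous F) {B : ℝ} (hB : ∀ y, ‖F y‖ ≤ B)
    (hF' : ∀ y, F y = ∫ a, η (y - a) * F a) (w : 𝓢'(Sp N, ℂ)) (x : Sp N) :
    ∫ y, α (x - y) * (F y * cv w κ y) = 0 := by
  have hz : ∀ a, ∫ y, α (x - y) * η (y - a) * cv w κ y = 0 := fun a => by
    have hχ : ∀ y, schwartzMul (LinMom.rt α x) (LinMom.rt (reflect η) a) y = α (x - y) * η (y - a) := fun y => by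
      rw [schwartzMul_apply, rt_apply, rt_apply, reflect_apply, neg_sub]
    have h1 := (integral_mul_cv w (schwartzMul (LinMom.rt α x) (LinMom.rt (reflect η) a)) κ).2
    simp only [hχ] at h1
    rw [h1]
    have : smear (schwartzMul (LinMom.rt α x) (LinMom.rt (reflect η) a)) κ = 0 := by
      refine fourier_ext fun ξ => ?_
      rw [smear, fourier_mconv, fourier_reflect, FourierTransform.fourier_zero, zero_apply]
      by_contra hne
      have hk := hκ (-ξ) (right_ne_zero_of_mul hne)
      have hne' := left_ne_zero_of_mul hne
      rw [schwartzMul, fourier_fourierInv_eq, mconv_apply] at hne'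
      obtain ⟨t, ht⟩ : ∃ t, 𝓕 (LinMom.rt α x) t * 𝓕 (LinMom.rt (reflect η) a) (ξ - t) ≠ 0 := by
        by_contra hall
        push Not at hall
        exact hne' (by simp only [hall, integral_zero])
      have ha := hα.rt x t (left_ne_zero_of_mul ht)
      obtain ⟨c, hc⟩ := fourier_rt (reflect η) a (ξ - t)
      have hb := right_ne_zero_of_mul ht
      rw [hc, fourier_reflect, neg_neg] at hb
      have hb := hη _ (right_ne_zero_of_mul hb)
      refine freq_ne h (a := -t) (b := ξ - t) (c := -ξ) (by abel) (by simpa using ha) hb hk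
    rw [this, map_zero]
  have h2 : ∀ y, α (x - y) * (F y * cv w κ y) = ∫ a, F a * (α (x - y) * η (y - a) * cv w κ y) := fun y => by
    rw [hF' y, mul_comm (∫ a, _), ← mul_assoc, ← integral_const_mul]
    congr 1; ext a; ring
  simp_rw [h2]
  rw [integral_integral_swap]
  · simp_rw [integral_const_mul, hz, mul_zero, integral_zero]
  · have hint := (integral_mul_cv w (LinMom.rt α x) κ).1
    have hη' : Integrable fun a => η a := η.integrable
    have h3 : Integrable (fun z : Sp N × Sp N => (α (x - z.1) * cv w κ z.1) * η z.2) (volume.prod volume) := by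
      simpa only [rt_apply] using hint.mul_prod hη'
    have h4 : MeasurePreserving (fun z : Sp N × Sp N => (z.1, z.1 - z.2)) (volume.prod volume) (volume.prod volume) :=
      (MeasurePreserving.id volume).skew_product (g := fun y a => y - a) (by fun_prop)
        (.of_forall fun y => (Measure.measurePreserving_sub_left volume y).map_eq)
    have h5 := h4.integrable_comp_of_integrable h3
    refine (h5.bdd_mul (c := B) (f := fun z : Sp N × Sp N => F z.2)
      (hF.comp continuous_snd).aestronglyMeasurable (.of_forall fun z => hB z.2)).congr
        (.of_forall fun z => ?_)
    simp only [uncurry, Function.comp]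
    ring

/-- `w * κ` and a kernel with a distant spectrum have vanishing convolution. -/
theorem mconv_eq_zero_of_far {k l : ℤ} (h : k + 7 ≤ l ∨ l + 7 ≤ k) {α κ : 𝓢(Sp N, ℂ)}
    (hα : SpecIn k α) (hκ : SpecIn l κ) : mconv α κ = 0 := by
  refine fourier_ext fun ξ => ?_
  rw [fourier_mconv, FourierTransform.fourier_zero, zero_apply]
  by_contra hne
  have h1 := hα ξ (left_ne_zero_of_mul hne)
  have h2 := hκ ξ (right_ne_zero_of_mul hne)
  have p1 : (0 : ℝ) < 2 ^ (k + 3) := by positivity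
  have p3 : (0 : ℝ) < 2 ^ (l + 3) := by positivity
  rcases h with h | h
  · have := annulus_gap h; linarith [h1.2, h2.1]
  · have := annulus_gap h; linarith [h1.1, h2.2]

/-! ### Heat kernels localized to an annulus -/

/-- A smooth symbol supported in the annulus `2^{-2} ≤ |2πξ| ≤ 2^3`. -/
structure AnnSymb (N : ℕ) where
  toS : 𝓢(Sp N, ℂ)
  ann : ∀ ξ, toS ξ ≠ 0 → 1 / 4 ≤ 2 * π * ‖ξ‖ ∧ 2 * π * ‖ξ‖ ≤ 8

theorem AnnSymb.ann_of_mem_tsupport (ψ : AnnSymb N) {ξ : Sp N} (h : ξ ∈ tsupport ψ.toS) :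
    1 / 4 ≤ 2 * π * ‖ξ‖ ∧ 2 * π * ‖ξ‖ ≤ 8 := by
  have hc : IsClosed {ξ : Sp N | 1 / 4 ≤ 2 * π * ‖ξ‖ ∧ 2 * π * ‖ξ‖ ≤ 8} :=
    (isClosed_le continuous_const (continuous_const.mul continuous_norm)).inter
      (isClosed_le (continuous_const.mul continuous_norm) continuous_const)
  exact closure_minimal (fun ξ hξ => ψ.ann ξ hξ) hc h

theorem AnnSymb.hasCompactSupport (ψ : AnnSymb N) : HasCompactSupport ψ.toS := by
  refine HasCompactSupport.of_support_subset_isCompact (isCompact_closedBall (0 : Sp N) 8) fun ξ hξ => ?_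
  have h1 := (ψ.ann ξ hξ).2
  have := Real.pi_gt_three
  rw [mem_closedBall_zero_iff]
  nlinarith [norm_nonneg ξ]

/-- The product with a function that is smooth away from `0`. -/
def AnnSymb.mul (ψ : AnnSymb N) (g : Sp N → ℂ) (hg : ∀ ξ ≠ 0, ContDiffAt ℝ ∞ g ξ) : AnnSymb N where
  toS := HasCompactSupport.toSchwartzMap (f := fun ξ => g ξ * ψ.toS ξ)
    (ψ.hasCompactSupport.mul_left (f := g)) (contDiff_iff_contDiffAt.2 fun ξ => by
      rcases eq_or_ne ξ 0 with rfl | h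
      · have h0 : (0 : Sp N) ∉ tsupport ψ.toS := fun h => by
          have := (ψ.ann_of_mem_tsupport h).1
          rw [norm_zero] at this; linarith
        have : (fun ξ => g ξ * ψ.toS ξ) =ᶠ[nhds 0] fun _ => 0 := by
          filter_upwards [(isClosed_tsupport ψ.toS).isOpen_compl.mem_nhds h0] with η hη
          rw [image_eq_zero_of_notMem_tsupport hη, mul_zero]
        exact contDiffAt_const.congr_of_eventuallyEq this
      · exact (hg ξ h).mul ψ.toS.smooth'.contDiffAt)
  ann ξ h := ψ.ann ξ (right_ne_zero_of_mul (show g ξ * ψ.toS ξ ≠ 0 from h))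

@[simp] theorem AnnSymb.mul_apply (ψ : AnnSymb N) (g : Sp N → ℂ) (hg : ∀ ξ ≠ 0, ContDiffAt ℝ ∞ g ξ)
    (ξ : Sp N) : (ψ.mul g hg).toS ξ = g ξ * ψ.toS ξ := rfl

/-- A directional derivative of a symbol. -/
def AnnSymb.deriv (ψ : AnnSymb N) (v : Sp N) : AnnSymb N where
  toS := ∂_{v} ψ.toS
  ann ξ h := ψ.ann_of_mem_tsupport (by
    by_contra hξ
    refine h ?_
    rw [lineDerivOp_apply_eq_fderiv]
    have : (ψ.toS : Sp N → ℂ) =ᶠ[nhds ξ] fun _ => 0 := by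
      filter_upwards [(isClosed_tsupport ψ.toS).isOpen_compl.mem_nhds hξ] with η hη
      exact image_eq_zero_of_notMem_tsupport hη
    rw [this.fderiv_eq]; simp)

theorem contDiff_heat (m : ℝ) :
    ContDiff ℝ ∞ fun ξ : Sp N => Complex.exp (-(m * (2 * π * ‖ξ‖) ^ 2 : ℝ)) := by
  have h : ContDiff ℝ ∞ fun ξ : Sp N => (-(m * (2 * π) ^ 2 * ‖ξ‖ ^ 2) : ℝ) :=
    (contDiff_const.mul (contDiff_norm_sq ℝ)).neg
  have h' : ContDiff ℝ ∞ fun ξ : Sp N => ((-(m * (2 * π) ^ 2 * ‖ξ‖ ^ 2) : ℝ) : ℂ) :=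
    Complex.ofRealCLM.contDiff.comp h
  convert! h'.cexp using 2
  congr 1; push_cast; ring

/-- The symbol `e^{-m|2πξ|²} ψ`. -/
def AnnSymb.heat (ψ : AnnSymb N) (m : ℝ) : AnnSymb N :=
  ψ.mul (fun ξ => Complex.exp (-(m * (2 * π * ‖ξ‖) ^ 2 : ℝ))) fun _ _ => (contDiff_heat m).contDiffAt

/-- The symbol `-8π² ⟨ξ, v⟩ ψ`, which comes from the derivative of the Gaussian factor. -/
def AnnSymb.grad (ψ : AnnSymb N) (v : Sp N) : AnnSymb N :=
  ψ.mul (fun ξ => ((-(8 * π ^ 2) * inner ℝ ξ v : ℝ) : ℂ)) fun _ _ =>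
    (Complex.ofRealCLM.contDiff.comp (contDiff_const.mul (contDiff_id.inner ℝ contDiff_const))).contDiffAt

/-- The symbol `-|2πξ|² ψ`. -/
def AnnSymb.lap (ψ : AnnSymb N) : AnnSymb N :=
  ψ.mul (fun ξ => (-((2 * π) ^ 2 * ‖ξ‖ ^ 2) : ℝ)) fun _ _ =>
    (Complex.ofRealCLM.contDiff.comp ((contDiff_const.mul (contDiff_norm_sq ℝ)).neg)).contDiffAt

/-- The kernel `e^{mΔ} 𝓕⁻ψ`. -/
def AnnSymb.kernel (ψ : AnnSymb N) (m : ℝ) : 𝓢(Sp N, ℂ) := 𝓕⁻ (ψ.heat m).toS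

theorem AnnSymb.heat_apply (ψ : AnnSymb N) (m : ℝ) (ξ : Sp N) :
    (ψ.heat m).toS ξ = Complex.exp (-(m * (2 * π * ‖ξ‖) ^ 2 : ℝ)) * ψ.toS ξ := rfl

theorem AnnSymb.grad_apply (ψ : AnnSymb N) (v ξ : Sp N) :
    (ψ.grad v).toS ξ = ((-(8 * π ^ 2) * inner ℝ ξ v : ℝ) : ℂ) * ψ.toS ξ := rfl

theorem AnnSymb.lap_apply (ψ : AnnSymb N) (ξ : Sp N) :
    ψ.lap.toS ξ = (-((2 * π) ^ 2 * ‖ξ‖ ^ 2) : ℝ) * ψ.toS ξ := rfl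

theorem AnnSymb.kernel_apply (ψ : AnnSymb N) (m : ℝ) (z : Sp N) :
    ψ.kernel m z = ∫ ξ, Complex.exp (↑(2 * π * inner ℝ ξ z) * Complex.I) * (ψ.heat m).toS ξ := by
  rw [AnnSymb.kernel, fourierInv_coe, Real.fourierInv_eq']
  rfl

theorem AnnSymb.kernel_apply_ball (ψ : AnnSymb N) (m : ℝ) (z : Sp N) :
    ψ.kernel m z = ∫ ξ in Metric.closedBall 0 8,
      Complex.exp (↑(2 * π * inner ℝ ξ z) * Complex.I) * (ψ.heat m).toS ξ := by
  rw [AnnSymb.kernel_apply, setIntegral_eq_integral_of_forall_compl_eq_zero]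
  intro ξ hξ
  by_contra hne
  have h1 := ((ψ.heat m).ann ξ (right_ne_zero_of_mul hne)).2
  have := Real.pi_gt_three
  rw [mem_closedBall_zero_iff] at hξ
  nlinarith [norm_nonneg ξ]

theorem AnnSymb.continuous_kernel (ψ : AnnSymb N) :
    Continuous fun q : ℝ × Sp N => ψ.kernel q.1 q.2 := by
  simp only [AnnSymb.kernel_apply_ball, AnnSymb.heat_apply]
  refine continuous_parametric_integral_of_continuous (X := ℝ × Sp N)
    (f := fun q ξ => Complex.exp (↑(2 * π * inner ℝ ξ q.2) * Complex.I) *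
      (Complex.exp (-(q.1 * (2 * π * ‖ξ‖) ^ 2 : ℝ)) * ψ.toS ξ)) ?_ (isCompact_closedBall _ _)
  have := ψ.toS.continuous
  simp only [Function.uncurry_def]
  fun_prop

theorem AnnSymb.hasDerivAt_kernel (ψ : AnnSymb N) (m : ℝ) (z : Sp N) :
    HasDerivAt (fun m => ψ.kernel m z) (ψ.lap.kernel m z) m := by
  have hcont : ∀ (χ : AnnSymb N) (m : ℝ), Continuous fun ξ : Sp N =>
      Complex.exp (↑(2 * π * inner ℝ ξ z) * Complex.I) * (χ.heat m).toS ξ := fun χ m => by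
    have := (χ.heat m).toS.continuous
    fun_prop
  have hK := isCompact_closedBall (0 : Sp N) 8
  have hb : Continuous fun q : ℝ × Sp N => Complex.exp (↑(2 * π * inner ℝ q.2 z) * Complex.I) * (ψ.lap.heat q.1).toS q.2 := by
    simp only [AnnSymb.heat_apply]
    have := ψ.lap.toS.continuous
    fun_prop
  obtain ⟨B, hB⟩ := ((isCompact_Icc (a := m - 1) (b := m + 1)).prod hK).exists_bound_of_continuousOn hb.continuousOn
  simp only [AnnSymb.kernel_apply_ball]
  refine (hasDerivAt_integral_of_dominated_loc_of_deriv_le (μ := volume.restrict (Metric.closedBall (0 : Sp N) 8))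
    (bound := fun _ => B) (s := Icc (m - 1) (m + 1)) (Icc_mem_nhds (by linarith) (by linarith))
    (F' := fun m ξ => Complex.exp (↑(2 * π * inner ℝ ξ z) * Complex.I) * (ψ.lap.heat m).toS ξ)
    (.of_forall fun m' => (hcont ψ m').aestronglyMeasurable)
    ((hcont ψ m).continuousOn.integrableOn_compact hK)
    (hcont ψ.lap m).aestronglyMeasurable
    ?_ (integrableOn_const (isCompact_closedBall (0 : Sp N) 8).measure_lt_top.ne) ?_).2
  · filter_upwards [ae_restrict_mem measurableSet_closedBall] with ξ hξ x hx
    exact hB (x, ξ) ⟨hx, hξ⟩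
  · refine .of_forall fun ξ x _ => ?_
    simp only [AnnSymb.heat_apply, AnnSymb.lap_apply]
    have h1 : HasDerivAt (fun x : ℝ => (-(x * (2 * π * ‖ξ‖) ^ 2 : ℝ) : ℂ)) (-((2 * π * ‖ξ‖) ^ 2 : ℝ)) x := by
      have := (((hasDerivAt_id x).mul_const ((2 * π * ‖ξ‖) ^ 2)).neg).ofReal_comp
      simpa using this
    have h2 := ((h1.cexp).mul_const (ψ.toS ξ)).const_mul (Complex.exp (↑(2 * π * inner ℝ ξ z) * Complex.I))
    convert! h2 using 1
    push_cast; ring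

theorem AnnSymb.kernel_zero_bound (ψ : AnnSymb N) {m : ℝ} (hm : 0 ≤ m) (z : Sp N) :
    ‖ψ.kernel m z‖ ≤ (∫ ξ, ‖ψ.toS ξ‖) * Real.exp (-(m / 16)) := by
  rw [AnnSymb.kernel_apply, ← integral_mul_const]
  refine norm_integral_le_of_norm_le (ψ.toS.integrable.norm.mul_const _) (.of_forall fun ξ => ?_)
  rw [norm_mul, Complex.norm_exp_ofReal_mul_I, one_mul, AnnSymb.heat_apply, norm_mul, mul_comm,
    ← Complex.ofReal_neg, Complex.norm_exp, Complex.ofReal_re]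
  by_cases h : ψ.toS ξ = 0
  · simp [h]
  · have := (ψ.ann ξ h).1
    gcongr
    have h3 : (1 / 4 : ℝ) ^ 2 ≤ (2 * π * ‖ξ‖) ^ 2 := by gcongr
    have := mul_le_mul_of_nonneg_left h3 hm
    linarith

theorem fourierInv_lineDeriv (v : Sp N) (g : 𝓢(Sp N, ℂ)) (z : Sp N) :
    𝓕⁻ (∂_{v} g) z = -(2 * π * Complex.I * (inner ℝ z v : ℝ) * 𝓕⁻ g z) := by
  rw [fourierInv_eq_neg, fourier_lineDeriv, ← fourierInv_eq_neg, inner_neg_left]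
  push_cast; ring

theorem AnnSymb.deriv_heat (ψ : AnnSymb N) (m : ℝ) (v : Sp N) :
    ∂_{v} (ψ.heat m).toS = ((ψ.deriv v).heat m).toS + (m : ℂ) • ((ψ.grad v).heat m).toS := by
  ext ξ
  rw [lineDerivOp_apply_eq_fderiv]
  have h0 : HasFDerivAt (fun ξ : Sp N => ‖ξ‖ ^ 2) (2 • (innerSL ℝ ξ)) ξ := (hasStrictFDerivAt_norm_sq ξ).hasFDerivAt
  have h1 := Complex.ofRealCLM.hasFDerivAt.comp ξ (h0.const_mul (-(m * (2 * π) ^ 2)))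
  have h2 := (h1.cexp).mul (ψ.toS.hasFDerivAt ξ)
  have h3 : ((ψ.heat m).toS : Sp N → ℂ) = (fun ξ => Complex.exp ((Complex.ofRealCLM ∘ fun y : Sp N => -(m * (2 * π) ^ 2) * ‖y‖ ^ 2) ξ)) * ψ.toS := by
    ext ξ
    rw [Pi.mul_apply, AnnSymb.heat_apply]
    simp only [Function.comp, Complex.ofRealCLM_apply]
    congr 2; push_cast; ring
  rw [h3, h2.fderiv]
  have e1 : (∂_{v} ψ.toS) ξ = fderiv ℝ ψ.toS ξ v := lineDerivOp_apply_eq_fderiv _ _ _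
  have e2 : Complex.exp ((Complex.ofRealCLM ∘ fun y : Sp N => -(m * (2 * π) ^ 2) * ‖y‖ ^ 2) ξ) =
      Complex.exp (-(m * (2 * π * ‖ξ‖) ^ 2 : ℝ)) := by
    simp only [Function.comp, Complex.ofRealCLM_apply]
    congr 1; push_cast; ring
  have e3 : (((ψ.deriv v).heat m).toS + (m : ℂ) • ((ψ.grad v).heat m).toS) ξ =
      ((ψ.deriv v).heat m).toS ξ + (m : ℂ) * ((ψ.grad v).heat m).toS ξ := rfl
  rw [e3, AnnSymb.heat_apply, AnnSymb.heat_apply, AnnSymb.grad_apply]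
  simp only [e2]
  change _ = _ * (∂_{v} ψ.toS) ξ + _
  rw [e1]
  simp [real_inner_comm]
  ring

/-- Decay of any order, by induction: a factor `⟨z, v⟩` differentiates the symbol. The rate `1 / 16` is the
least value of `|2πξ|²` on the annulus. -/
theorem AnnSymb.kernel_pow_bound (n : ℕ) : ∀ (ψ : AnnSymb N) (v : Sp N), ∃ C : ℝ, 0 ≤ C ∧ ∀ m : ℝ, 0 ≤ m →
    ∀ z, |inner ℝ z v| ^ n * ‖ψ.kernel m z‖ ≤ C * (1 + m) ^ n * Real.exp (-(m / 16)) := by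
  induction n with
  | zero => exact fun ψ v => ⟨_, integral_nonneg fun _ => norm_nonneg _, fun m hm z => by
      simpa using ψ.kernel_zero_bound hm z⟩
  | succ n ih =>
    intro ψ v
    obtain ⟨C₁, h₁, hC₁⟩ := ih (ψ.deriv v) v
    obtain ⟨C₂, h₂, hC₂⟩ := ih (ψ.grad v) v
    refine ⟨C₁ + C₂, by positivity, fun m hm z => ?_⟩
    have key := fourierInv_lineDeriv v (ψ.heat m).toS z
    rw [AnnSymb.deriv_heat, FourierTransform.fourierInv_add, FourierTransform.fourierInv_smul] at key
    have key2 := congrArg norm key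
    have hpi := Real.pi_gt_three
    rw [norm_neg, norm_mul, norm_mul, norm_mul, norm_mul, Complex.norm_I, Complex.norm_real,
      Complex.norm_real, RCLike.norm_ofNat, Real.norm_of_nonneg Real.pi_pos.le, mul_one] at key2
    have h4 : |inner ℝ z v| * ‖ψ.kernel m z‖ ≤ ‖(ψ.deriv v).kernel m z‖ + m * ‖(ψ.grad v).kernel m z‖ := by
      have h5 := norm_add_le ((ψ.deriv v).kernel m z) ((m : ℂ) * (ψ.grad v).kernel m z)
      rw [norm_mul, Complex.norm_real, Real.norm_of_nonneg hm] at h5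
      refine le_trans ?_ h5
      refine le_trans ?_ key2.symm.le
      have : 0 ≤ |inner ℝ z v| * ‖ψ.kernel m z‖ := by positivity
      change _ ≤ 2 * π * |inner ℝ z v| * ‖ψ.kernel m z‖
      rw [mul_assoc (2 * π)]
      nlinarith
    have hm1 : 1 ≤ 1 + m := by linarith
    calc |inner ℝ z v| ^ (n + 1) * ‖ψ.kernel m z‖ = |inner ℝ z v| ^ n * (|inner ℝ z v| * ‖ψ.kernel m z‖) := by ring
      _ ≤ |inner ℝ z v| ^ n * (‖(ψ.deriv v).kernel m z‖ + m * ‖(ψ.grad v).kernel m z‖) := by gcongr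
      _ ≤ C₁ * (1 + m) ^ n * Real.exp (-(m / 16)) + m * (C₂ * (1 + m) ^ n * Real.exp (-(m / 16))) := by
        rw [mul_add, mul_left_comm]
        exact add_le_add (hC₁ m hm z) (mul_le_mul_of_nonneg_left (hC₂ m hm z) hm)
      _ ≤ C₁ * (1 + m) ^ n * Real.exp (-(m / 16)) * (1 + m) + (1 + m) * (C₂ * (1 + m) ^ n * Real.exp (-(m / 16))) := by
        refine add_le_add (le_mul_of_one_le_right (by positivity) hm1)
          (mul_le_mul_of_nonneg_right (by linarith) (by positivity))
      _ = _ := by ring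

theorem one_add_norm_pow_le (n : ℕ) (z : Sp N) :
    (1 + ‖z‖) ^ (n + 1) ≤ (N + 1) ^ n * (1 + ∑ i, |inner ℝ z (basisVec i)| ^ (n + 1)) := by
  have h1 : ‖z‖ ≤ ∑ i, |inner ℝ z (basisVec i)| := by
    have : z = ∑ i, (inner ℝ z (basisVec i)) • basisVec i := by
      ext j
      simp [basisVec, EuclideanSpace.inner_single_right, Pi.single_apply]
    calc ‖z‖ = ‖∑ i, (inner ℝ z (basisVec i)) • basisVec i‖ := by rw [← this]
      _ ≤ ∑ i, ‖(inner ℝ z (basisVec i)) • basisVec i‖ := norm_sum_le _ _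
      _ = _ := by refine Finset.sum_congr rfl fun i _ => ?_; rw [norm_smul]; simp [basisVec]
  have h2 := pow_sum_le_card_mul_sum_pow (s := (Finset.univ : Finset (Option (Fin N))))
    (f := fun i => i.elim 1 fun i => |inner ℝ z (basisVec i)|)
    (fun i _ => by cases i <;> simp) n
  simp only [Fintype.sum_option, Option.elim, one_pow, Finset.card_univ, Fintype.card_option,
    Fintype.card_fin, Nat.cast_add, Nat.cast_one] at h2
  exact (pow_le_pow_left₀ (by positivity) (by linarith) _).trans h2

/-- Half of the exponential decay absorbs the powers of `m` that the Gaussian factor produces. -/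
theorem AnnSymb.kernel_bound (ψ : AnnSymb N) : ∃ C : ℝ, 0 ≤ C ∧ ∀ m : ℝ, 0 ≤ m → ∀ z,
    ‖ψ.kernel m z‖ ≤ C * Real.exp (-(m / 32)) * ((1 + ‖z‖) ^ (N + 2))⁻¹ := by
  choose C hC0 hC using fun i : Fin N => AnnSymb.kernel_pow_bound (N + 2) ψ (basisVec i)
  set I := ∫ ξ, ‖ψ.toS ξ‖
  have hI : 0 ≤ I := integral_nonneg fun _ => norm_nonneg _
  have hS : 0 ≤ ∑ i, C i := Finset.sum_nonneg fun i _ => hC0 i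
  refine ⟨(N + 1) ^ (N + 1) * (I + ∑ i, C i) * ((N + 2).factorial * 32 ^ (N + 2) * Real.exp (1 / 32)), by positivity, fun m hm z => ?_⟩
  have hexp : (1 + m) ^ (N + 2) * Real.exp (-(m / 16)) ≤
      ((N + 2).factorial * 32 ^ (N + 2) * Real.exp (1 / 32)) * Real.exp (-(m / 32)) := by
    have := Real.pow_div_factorial_le_exp ((1 + m) / 32) (by positivity) (N + 2)
    rw [div_pow, div_div, div_le_iff₀ (by positivity)] at this
    calc (1 + m) ^ (N + 2) * Real.exp (-(m / 16))
        ≤ (Real.exp ((1 + m) / 32) * (32 ^ (N + 2) * (N + 2).factorial)) * Real.exp (-(m / 16)) := by gcongr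
      _ = (N + 2).factorial * 32 ^ (N + 2) * (Real.exp ((1 + m) / 32) * Real.exp (-(m / 16))) := by ring
      _ = _ := by
        rw [← Real.exp_add, mul_assoc _ (Real.exp (1 / 32)), ← Real.exp_add]; congr 2; ring
  rw [← div_eq_mul_inv, le_div_iff₀ (by positivity), mul_comm]
  calc (1 + ‖z‖) ^ (N + 2) * ‖ψ.kernel m z‖
      ≤ ((N + 1) ^ (N + 1) * (1 + ∑ i, |inner ℝ z (basisVec i)| ^ (N + 2))) * ‖ψ.kernel m z‖ := by
        gcongr; exact one_add_norm_pow_le (N + 1) z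
    _ = (N + 1) ^ (N + 1) * (‖ψ.kernel m z‖ + ∑ i, |inner ℝ z (basisVec i)| ^ (N + 2) * ‖ψ.kernel m z‖) := by
        rw [mul_assoc, add_mul, one_mul, Finset.sum_mul]
    _ ≤ (N + 1) ^ (N + 1) * (I * ((1 + m) ^ (N + 2) * Real.exp (-(m / 16))) + ∑ i, C i * ((1 + m) ^ (N + 2) * Real.exp (-(m / 16)))) := by
        refine mul_le_mul_of_nonneg_left (add_le_add ?_ (Finset.sum_le_sum fun i _ => ?_)) (by positivity)
        · refine (ψ.kernel_zero_bound hm z).trans (mul_le_mul_of_nonneg_left ?_ hI)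
          exact le_mul_of_one_le_left (Real.exp_pos _).le (one_le_pow₀ (by linarith))
        · rw [← mul_assoc]; exact hC i m hm z
    _ = (N + 1) ^ (N + 1) * (I + ∑ i, C i) * ((1 + m) ^ (N + 2) * Real.exp (-(m / 16))) := by
        rw [← Finset.sum_mul]; ring
    _ ≤ _ := by
        rw [mul_assoc _ _ (Real.exp (-(m / 32)))]
        exact mul_le_mul_of_nonneg_left hexp (by positivity)

/-! ### Convolution of Schwartz functions with bounded continuous functions -/

/-- Bounded continuous complex functions, as a property. -/
def BddCts (g : Sp N → ℂ) : Prop := Continuous g ∧ ∃ B, ∀ y, ‖g y‖ ≤ B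

/-- The convolution `α * g`, for vector-valued Schwartz functions `α`. -/
def conv {E : Type*} [NormedAddCommGroup E] [NormedSpace ℝ E] [NormedSpace ℂ E]
    (α : 𝓢(Sp N, E)) (g : Sp N → ℂ) (x : Sp N) : E := ∫ y, g y • α (x - y)

section
variable {E : Type*} [NormedAddCommGroup E] [NormedSpace ℝ E] [NormedSpace ℂ E]

theorem integrable_decay_sub (x : Sp N) : Integrable fun y : Sp N => ((1 + ‖x - y‖) ^ (N + 1))⁻¹ :=
  integrable_decay.comp_sub_left x

theorem BddCts.integrable_smul {g : Sp N → ℂ} (hg : BddCts g) (α : 𝓢(Sp N, E)) (x : Sp N) :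
    Integrable fun y => g y • α (x - y) := by
  obtain ⟨hc, B, hB⟩ := hg
  have h : Integrable fun y => α (x - y) := α.integrable.comp_sub_left x
  exact h.bdd_smul B hc.aestronglyMeasurable (.of_forall hB)

theorem hasFDerivAt_conv [SMulCommClass ℝ ℂ E] {g : Sp N → ℂ} (hg : BddCts g) (α : 𝓢(Sp N, E)) (x : Sp N) :
    HasFDerivAt (conv α g) (conv (fderivCLM ℝ (Sp N) E α) g x) x := by
  have hg' := hg
  obtain ⟨hc, B, hB⟩ := hg
  have hB0 : 0 ≤ B := (norm_nonneg _).trans (hB 0)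
  set β := fderivCLM ℝ (Sp N) E α
  obtain ⟨C, hC0, hC⟩ := exists_decay β (N + 1)
  refine hasFDerivAt_integral_of_dominated_of_fderiv_le (F := fun x y => g y • α (x - y))
    (F' := fun x y => g y • β (x - y)) (s := Metric.ball x 1)
    (bound := fun y => B * (C * 2 ^ (N + 1)) * ((1 + ‖x - y‖) ^ (N + 1))⁻¹) (Metric.ball_mem_nhds x one_pos)
    (.of_forall fun x' => (hg'.integrable_smul α x').aestronglyMeasurable)
    (hg'.integrable_smul α x) (hg'.integrable_smul β x).aestronglyMeasurable
    (.of_forall fun y x' hx' => ?_) ((integrable_decay_sub x).const_mul _)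
    (.of_forall fun y x' _ => ?_)
  · rw [norm_smul, mul_assoc]
    refine mul_le_mul (hB y) ((hC _).trans ?_) (norm_nonneg _) hB0
    rw [mul_assoc]
    refine mul_le_mul_of_nonneg_left ?_ hC0
    rw [mem_ball_iff_norm] at hx'
    have h1 : ‖x - y‖ ≤ ‖x' - y‖ + ‖x' - x‖ := by
      calc ‖x - y‖ = ‖(x' - y) - (x' - x)‖ := by congr 1; abel
        _ ≤ _ := norm_sub_le _ _
    have h2 : 1 + ‖x - y‖ ≤ 2 * (1 + ‖x' - y‖) := by linarith [norm_nonneg (x' - y)]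
    rw [← div_eq_mul_inv, inv_le_comm₀ (by positivity) (by positivity), inv_div, div_le_iff₀ (by positivity), mul_comm, ← mul_pow]
    gcongr
  · have h1 : HasFDerivAt (fun x' => α (x' - y)) (β (x' - y)) x' := by
      simpa using! (α.hasFDerivAt (x' - y)).comp x' ((hasFDerivAt_id x').sub_const y)
    exact h1.const_smul (g y)

/-- By induction on `n`: the derivative of `α * g` is the convolution of `g` with the derivative of `α`,
which takes values in another space. -/
theorem contDiff_conv_nat {g : Sp N → ℂ} (hg : BddCts g) (n : ℕ) : ∀ {E : Type} [NormedAddCommGroup E] [NormedSpace ℝ E] [NormedSpace ℂ E]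
    [SMulCommClass ℝ ℂ E] (α : 𝓢(Sp N, E)), ContDiff ℝ n (conv α g) ∧
      ∀ x, ‖iteratedFDeriv ℝ n (conv α g) x‖ ≤ ∫ y, ‖g y‖ * ‖iteratedFDeriv ℝ n α (x - y)‖ := by
  induction n with
  | zero =>
    intro E _ _ _ _ α
    refine ⟨contDiff_zero.2 (continuous_iff_continuousAt.2 fun x => (hasFDerivAt_conv hg α x).continuousAt), fun x => ?_⟩
    rw [norm_iteratedFDeriv_zero]
    refine (norm_integral_le_integral_norm _).trans_eq ?_
    congr 1; ext y; rw [norm_smul, norm_iteratedFDeriv_zero]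
  | succ n ih =>
    intro E _ _ _ _ α
    obtain ⟨h1, h2⟩ := ih (fderivCLM ℝ (Sp N) E α)
    have hf : fderiv ℝ (conv α g) = conv (fderivCLM ℝ (Sp N) E α) g :=
      funext fun x => (hasFDerivAt_conv hg α x).fderiv
    refine ⟨?_, fun x => ?_⟩
    · rw [Nat.cast_add, Nat.cast_one, contDiff_succ_iff_hasFDerivAt]
      exact ⟨_, h1, fun x => hasFDerivAt_conv hg α x⟩
    · rw [← norm_iteratedFDeriv_fderiv, hf]
      refine (h2 x).trans_eq ?_
      congr 1; ext y
      rw [← norm_iteratedFDeriv_fderiv (f := α)]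
      rfl
end

theorem contDiff_conv {g : Sp N → ℂ} (hg : BddCts g) (α : 𝓢(Sp N, ℂ)) : ContDiff ℝ ∞ (conv α g) :=
  contDiff_infty.2 fun n => (contDiff_conv_nat hg n α).1

theorem conv_eq (α : 𝓢(Sp N, ℂ)) (g : Sp N → ℂ) (x : Sp N) : conv α g x = ∫ y, α (x - y) * g y := by
  simp only [conv, smul_eq_mul, mul_comm]

theorem BddCts.integrable_mul {g : Sp N → ℂ} (hg : BddCts g) (α : 𝓢(Sp N, ℂ)) (x : Sp N) :
    Integrable fun y => α (x - y) * g y := by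
  simpa only [smul_eq_mul, mul_comm] using hg.integrable_smul α x

theorem enorm_conv_le {k : ℤ} {C : ℝ≥0∞} {α : 𝓢(Sp N, ℂ)} (h : KerBd k C α) {g : Sp N → ℂ}
    (hg : Continuous g) (x : Sp N) : ‖conv α g x‖ₑ ≤ C * avg k (fun y => ‖g y‖ₑ) x := by
  rw [conv_eq]; exact enorm_integral_mul_le h hg.enorm.measurable x

theorem norm_conv_le {g : Sp N → ℂ} {B : ℝ} (hB : ∀ y, ‖g y‖ ≤ B) (α : 𝓢(Sp N, ℂ)) (x : Sp N) :
    ‖conv α g x‖ ≤ B * ∫ z, ‖α z‖ := by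
  rw [← integral_sub_left_eq_self (fun z => ‖α z‖) volume x, ← integral_const_mul]
  refine norm_integral_le_of_norm_le ((α.integrable.norm.comp_sub_left x).const_mul B)
    (.of_forall fun y => ?_)
  rw [norm_smul]
  exact mul_le_mul_of_nonneg_right (hB y) (norm_nonneg _)

theorem BddCts.conv {g : Sp N → ℂ} (hg : BddCts g) (α : 𝓢(Sp N, ℂ)) : BddCts (conv α g) :=
  ⟨(contDiff_conv hg α).continuous, _, norm_conv_le hg.2.choose_spec α⟩

/-- Derivatives of a convolution at the scale `2^{-k}` cost a factor `2^k` each. -/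
theorem exists_iteratedFDeriv_conv_le (α : 𝓢(Sp N, ℂ)) (n : ℕ) : ∃ C : ℝ≥0, ∀ (k : ℤ) (g : Sp N → ℂ),
    BddCts g → ∀ x, ‖iteratedFDeriv ℝ n (LinMom.conv (dil k α) g) x‖ₑ ≤
      C * (2 ^ ((k : ℝ) * n) * avg k (fun y => ‖g y‖ₑ) x) := by
  obtain ⟨S, hS0, hS⟩ := exists_iteratedFDeriv_decay α (N + 1) n
  refine ⟨S.toNNReal, fun k g hg x => ?_⟩
  have h2 : (0 : ℝ) < 2 ^ k := by positivity
  have hpow : (2 : ℝ≥0∞) ^ ((k : ℝ) * n) = ofReal (((2 : ℝ) ^ k) ^ n) := by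
    rw [rpow_mul, ENNReal.rpow_natCast, ENNReal.ofReal_pow (by positivity), ← Real.rpow_intCast,
      ← ofReal_rpow_of_pos (by norm_num)]
    norm_num
  have hd : ∀ z, ‖iteratedFDeriv ℝ n (dil k α) z‖ₑ ≤ ofReal S * 2 ^ ((k : ℝ) * n) * maj k z := fun z => by
    have e1 : (dil k α : Sp N → ℂ) = ((((2 : ℝ) ^ k) ^ N : ℝ) : ℂ) • fun z => α ((2 : ℝ) ^ k • z) := rfl
    have e2 : iteratedFDeriv ℝ n (dil k α) z = ((((2 : ℝ) ^ k) ^ N : ℝ) : ℂ) • ((2 : ℝ) ^ k) ^ n • iteratedFDeriv ℝ n α ((2 : ℝ) ^ k • z) := by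
      rw [e1, iteratedFDeriv_const_smul_apply (by
        exact ((α.smooth n).comp (contDiff_const_smul _)).contDiffAt)]
      congr 1
      rw [iteratedFDeriv_comp_const_smul]
      exact α.smooth n
    rw [e2, maj, hpow, ← ofReal_mul hS0, ← ofReal_mul (by positivity), ← ofReal_norm]
    refine ofReal_le_ofReal ?_
    rw [norm_smul, norm_smul, Complex.norm_of_nonneg (by positivity), Real.norm_of_nonneg (by positivity)]
    have := hS ((2 : ℝ) ^ k • z)
    rw [norm_smul, Real.norm_of_nonneg h2.le] at this
    have h3 : ‖iteratedFDeriv ℝ n α ((2 : ℝ) ^ k • z)‖ ≤ S * ((1 + 2 ^ k * ‖z‖) ^ (N + 1))⁻¹ := by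
      rw [← div_eq_mul_inv, le_div_iff₀ (by positivity), mul_comm]; exact this
    calc ((2 : ℝ) ^ k) ^ N * (((2 : ℝ) ^ k) ^ n * ‖iteratedFDeriv ℝ n α ((2 : ℝ) ^ k • z)‖)
        ≤ ((2 : ℝ) ^ k) ^ N * (((2 : ℝ) ^ k) ^ n * (S * ((1 + 2 ^ k * ‖z‖) ^ (N + 1))⁻¹)) := by gcongr
      _ = _ := by ring
  rw [avg_eq k hg.1.enorm.measurable, ← lintegral_const_mul _ (by have := hg.1.enorm.measurable; fun_prop),
    ← lintegral_const_mul _ (by have := hg.1.enorm.measurable; fun_prop)]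
  calc ‖iteratedFDeriv ℝ n (LinMom.conv (dil k α) g) x‖ₑ
      ≤ ofReal (∫ y, ‖g y‖ * ‖iteratedFDeriv ℝ n (dil k α) (x - y)‖) := by
        rw [← ofReal_norm]
        exact ofReal_le_ofReal ((contDiff_conv_nat hg n _).2 x)
    _ ≤ ∫⁻ y, ofReal (‖g y‖ * ‖iteratedFDeriv ℝ n (dil k α) (x - y)‖) :=
        by
          refine (ofReal_le_ofReal (le_abs_self _)).trans ?_
          rw [← Real.norm_eq_abs, ofReal_norm]
          refine (enorm_integral_le_lintegral_enorm _).trans_eq (lintegral_congr fun y => ?_)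
          rw [← ofReal_norm, Real.norm_of_nonneg (by positivity)]
    _ ≤ _ := by
        refine lintegral_mono fun y => ?_
        rw [ofReal_mul (norm_nonneg _), ofReal_norm, ofReal_norm]
        calc ‖g y‖ₑ * ‖iteratedFDeriv ℝ n (dil k α) (x - y)‖ₑ ≤ ‖g y‖ₑ * (ofReal S * 2 ^ ((k : ℝ) * n) * maj k (x - y)) := by
              gcongr; exact hd _
          _ = ofReal S * (2 ^ ((k : ℝ) * n) * (maj k (x - y) * ‖g y‖ₑ)) := by ring

theorem conv_add_left (α β : 𝓢(Sp N, ℂ)) {g : Sp N → ℂ} (hg : BddCts g) (x : Sp N) :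
    conv (α + β) g x = conv α g x + conv β g x := by
  rw [conv, conv, conv, ← integral_add (hg.integrable_smul α x) (hg.integrable_smul β x)]
  congr 1; ext y; rw [add_apply, smul_add]

theorem conv_smul_left (c : ℂ) (α : 𝓢(Sp N, ℂ)) (g : Sp N → ℂ) (x : Sp N) :
    conv (c • α) g x = c * conv α g x := by
  rw [conv, conv, ← integral_const_mul]
  congr 1; ext y; simp only [smul_apply, smul_eq_mul]; ring

theorem conv_zero_left (g : Sp N → ℂ) (x : Sp N) : conv (0 : 𝓢(Sp N, ℂ)) g x = 0 := by
  simp [conv]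

theorem conv_sum_left {ι : Type*} (s : Finset ι) (α : ι → 𝓢(Sp N, ℂ)) {g : Sp N → ℂ} (hg : BddCts g)
    (x : Sp N) : conv (∑ i ∈ s, α i) g x = ∑ i ∈ s, conv (α i) g x := by
  classical
  induction s using Finset.induction_on with
  | empty => simp [conv_zero_left]
  | insert a s ha ih => rw [Finset.sum_insert ha, conv_add_left _ _ hg, ih, Finset.sum_insert ha]

theorem conv_mconv (α β : 𝓢(Sp N, ℂ)) {g : Sp N → ℂ} (hg : BddCts g) (x : Sp N) :
    conv (mconv α β) g x = conv α (conv β g) x := by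
  have e1 : ∀ y, g y • mconv α β (x - y) = ∫ t, g y * (α (x - t) * β (t - y)) := fun y => by
    rw [mconv_apply, ← integral_sub_left_eq_self (fun t => α t * β (x - y - t)) _ x, smul_eq_mul, ← integral_const_mul]
    congr 1; ext t; congr 3; abel
  have e2 : ∀ t, conv β g t • α (x - t) = ∫ y, g y * (α (x - t) * β (t - y)) := fun t => by
    rw [conv, smul_eq_mul, ← integral_mul_const]
    congr 1; ext y; simp only [smul_eq_mul]; ring
  rw [conv, conv]
  simp_rw [e1, e2]
  refine integral_integral_swap ?_
  obtain ⟨hc, B, hB⟩ := hg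
  have h3 : Integrable (fun z : Sp N × Sp N => α z.1 * β z.2) (volume.prod volume) :=
    α.integrable.mul_prod β.integrable
  have h4 : MeasurePreserving (fun z : Sp N × Sp N => (x - z.1, z.1 - z.2)) (volume.prod volume) (volume.prod volume) :=
    (Measure.measurePreserving_sub_left volume x).skew_product (g := fun y a => y - a) (by fun_prop)
      (.of_forall fun y => (Measure.measurePreserving_sub_left volume y).map_eq)
  have h5 := (h4.integrable_comp_of_integrable h3).swap
  exact h5.bdd_mul (c := B) (f := fun z : Sp N × Sp N => g z.1)
    (hc.comp continuous_fst).aestronglyMeasurable (.of_forall fun z => hB z.1)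

/-- Integration by parts in a convolution. -/
theorem conv_lineDeriv (α : 𝓢(Sp N, ℂ)) (v : Sp N) {f : Sp N → ℂ} (hf : BddCts f)
    (hd : Differentiable ℝ f) (hf' : BddCts fun y => fderiv ℝ f y v) (x : Sp N) :
    conv (∂_{v} α) f x = conv α (fun y => fderiv ℝ f y v) x := by
  have h1 : ∀ y, fderiv ℝ (rt α x) y v = -(∂_{v} α) (x - y) := fun y => by
    rw [← lineDerivOp_apply_eq_fderiv, lineDeriv_rt]
    simp
  have := integral_mul_fderiv_eq_neg_fderiv_mul_of_integrable (μ := volume) (f := rt α x) (g := f) (v := v)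
    (by simp only [h1, neg_mul]; exact (hf.integrable_mul _ x).neg)
    (by simp only [rt_apply]; exact hf'.integrable_mul _ x)
    (by simp only [rt_apply]; exact hf.integrable_mul _ x)
    (fun _ _ => (rt α x).differentiableAt) (fun _ _ => hd _)
  simp only [h1, rt_apply, neg_mul, integral_neg, neg_neg] at this
  rw [conv_eq, conv_eq, this]

/-! ### Gain of powers by smoothness -/

theorem contDiffAt_coord_div_norm_sq (v ξ : Sp N) (hξ : ξ ≠ 0) :
    ContDiffAt ℝ ∞ (fun ξ : Sp N => (((2 * π) ⁻¹ * inner ℝ ξ v * (‖ξ‖ ^ 2)⁻¹ : ℝ) : ℂ) * (-Complex.I)) ξ := by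
  have h1 : ContDiffAt ℝ ∞ (fun ξ : Sp N => (2 * π) ⁻¹ * inner ℝ ξ v * (‖ξ‖ ^ 2)⁻¹) ξ :=
    (contDiffAt_const.mul (contDiffAt_id.inner ℝ contDiffAt_const)).mul
      ((contDiff_norm_sq ℝ).contDiffAt.inv (by simpa using hξ))
  exact (Complex.ofRealCLM.contDiff.contDiffAt.comp ξ h1).mul contDiffAt_const

/-- The antiderivatives `ψ_i` of a symbol, with `∑ i, 2πi ξ_i ψ_i = ψ`. -/
def AnnSymb.anti (ψ : AnnSymb N) (i : Fin N) : AnnSymb N :=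
  ψ.mul _ fun ξ hξ => contDiffAt_coord_div_norm_sq (basisVec i) ξ hξ

theorem AnnSymb.anti_apply (ψ : AnnSymb N) (i : Fin N) (ξ : Sp N) : (ψ.anti i).toS ξ =
    (((2 * π) ⁻¹ * inner ℝ ξ (basisVec i) * (‖ξ‖ ^ 2)⁻¹ : ℝ) : ℂ) * (-Complex.I) * ψ.toS ξ := rfl

theorem sum_inner_basisVec_sq (ξ : Sp N) : ∑ i, inner ℝ ξ (basisVec i) ^ 2 = ‖ξ‖ ^ 2 := by
  rw [EuclideanSpace.norm_sq_eq]
  simp [basisVec, EuclideanSpace.inner_single_right]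

/-- A kernel whose spectrum avoids `0` is a sum of derivatives of such kernels. -/
theorem AnnSymb.sum_anti (ψ : AnnSymb N) :
    𝓕⁻ ψ.toS = ∑ i, ∂_{basisVec i} (𝓕⁻ (ψ.anti i).toS : 𝓢(Sp N, ℂ)) := by
  refine fourier_ext fun ξ => ?_
  rw [fourier_sum_apply]
  simp only [fourier_lineDeriv, fourier_fourierInv_eq, AnnSymb.anti_apply]
  by_cases h : ψ.toS ξ = 0
  · simp [h]
  have hξ : ‖ξ‖ ≠ 0 := by
    intro h0
    have := (ψ.ann ξ h).1
    rw [h0] at this; norm_num at this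
  have e : ∀ i : Fin N, 2 * π * Complex.I * (inner ℝ ξ (basisVec i) : ℝ) *
      ((((2 * π) ⁻¹ * inner ℝ ξ (basisVec i) * (‖ξ‖ ^ 2)⁻¹ : ℝ) : ℂ) * (-Complex.I) * ψ.toS ξ) =
      (((inner ℝ ξ (basisVec i)) ^ 2 : ℝ) : ℂ) * (((‖ξ‖ ^ 2 : ℝ) : ℂ)⁻¹ * ψ.toS ξ) := fun i => by
    have hpi : (π : ℂ) ≠ 0 := by exact_mod_cast Real.pi_ne_zero
    have hn : (‖ξ‖ : ℂ) ≠ 0 := by exact_mod_cast hξ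
    push_cast
    field_simp
    rw [Complex.I_sq]; ring
  simp_rw [e]
  rw [← Finset.sum_mul, ← Complex.ofReal_sum, sum_inner_basisVec_sq, ← mul_assoc, mul_inv_cancel₀, one_mul]
  exact_mod_cast pow_ne_zero 2 hξ

/-- Functions of class `C^n`, bounded together with their derivatives. -/
def BddDiff (n : ℕ) (f : Sp N → ℂ) : Prop :=
  ContDiff ℝ n f ∧ ∀ m ≤ n, ∃ B, ∀ y, ‖iteratedFDeriv ℝ m f y‖ ≤ B

theorem BddDiff.bddCts {n : ℕ} {f : Sp N → ℂ} (h : BddDiff n f) : BddCts f :=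
  ⟨h.1.continuous, by simpa only [norm_iteratedFDeriv_zero] using h.2 0 (Nat.zero_le _)⟩

theorem norm_iteratedFDeriv_fderiv_apply {n m : ℕ} {f : Sp N → ℂ} (h : ContDiff ℝ (n + 1 : ℕ) f) (hm : m ≤ n)
    (v : Sp N) (y : Sp N) :
    ‖iteratedFDeriv ℝ m (fun y => fderiv ℝ f y v) y‖ ≤ ‖v‖ * ‖iteratedFDeriv ℝ (m + 1) f y‖ := by
  have h1 : ContDiff ℝ n (fderiv ℝ f) := h.fderiv_right (by norm_cast)
  have := norm_iteratedFDeriv_clm_apply_const (f := fderiv ℝ f) (c := v) (x := y) (N := n) h1.contDiffAt (n := m) (by exact_mod_cast hm)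
  rwa [norm_iteratedFDeriv_fderiv] at this

theorem BddDiff.fderiv {n : ℕ} {f : Sp N → ℂ} (h : BddDiff (n + 1) f) (v : Sp N) :
    BddDiff n fun y => fderiv ℝ f y v := by
  refine ⟨(h.1.fderiv_right (by norm_cast)).clm_apply contDiff_const, fun m hm => ?_⟩
  obtain ⟨B, hB⟩ := h.2 (m + 1) (by omega)
  exact ⟨‖v‖ * B, fun y => (norm_iteratedFDeriv_fderiv_apply h.1 hm v y).trans
    (mul_le_mul_of_nonneg_left (hB y) (norm_nonneg _))⟩

theorem norm_basisVec (i : Fin N) : ‖basisVec i‖ = 1 := by simp [basisVec]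

/-- Convolution with a kernel of zero mean at the scale `2^{-k}` gains `2^{-k}` per derivative. -/
theorem exists_gain (n : ℕ) : ∀ ψ : AnnSymb N, ∃ C : ℝ≥0, ∀ (k : ℤ) (f : Sp N → ℂ), BddDiff n f → ∀ x,
    ‖conv (dil k (𝓕⁻ ψ.toS)) f x‖ₑ ≤
      C * (2 ^ (-(k : ℝ) * n) * avg k (fun y => ‖iteratedFDeriv ℝ n f y‖ₑ) x) := by
  induction n with
  | zero =>
    intro ψ
    obtain ⟨C, hC⟩ := exists_kerBd (𝓕⁻ ψ.toS : 𝓢(Sp N, ℂ))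
    refine ⟨C, fun k f hf x => (enorm_conv_le (hC k) hf.1.continuous x).trans ?_⟩
    have : ∀ y, ‖iteratedFDeriv ℝ 0 f y‖ₑ = ‖f y‖ₑ := fun y => by
      rw [← ofReal_norm, norm_iteratedFDeriv_zero, ofReal_norm]
    simp [this]
  | succ n ih =>
    intro ψ
    choose C hC using fun i => ih (ψ.anti i)
    refine ⟨∑ i, C i, fun k f hf x => ?_⟩
    have hcont : Continuous (iteratedFDeriv ℝ (n + 1) f) := hf.1.continuous_iteratedFDeriv le_rfl
    have h2 : (0 : ℝ) < 2 ^ k := by positivity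
    have e1 : dil k (𝓕⁻ ψ.toS) = ∑ i, ((((2 : ℝ) ^ k)⁻¹ : ℝ) : ℂ) • ∂_{basisVec i} (dil k (𝓕⁻ (ψ.anti i).toS)) := by
      rw [ψ.sum_anti, dil_sum]
      refine Finset.sum_congr rfl fun i _ => ?_
      rw [lineDeriv_dil, smul_smul, ← Complex.ofReal_mul, inv_mul_cancel₀ h2.ne', Complex.ofReal_one, one_smul]
    have hB := hf.bddCts
    rw [e1, conv_sum_left _ _ hB, ENNReal.ofNNReal_finsetSum, Finset.sum_mul]
    refine (enorm_sum_le _ _).trans (Finset.sum_le_sum fun i _ => ?_)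
    rw [conv_smul_left, conv_lineDeriv _ _ hB (hf.1.differentiable (by norm_cast)) (hf.fderiv _).bddCts, enorm_mul]
    have e2 : ‖((((2 : ℝ) ^ k)⁻¹ : ℝ) : ℂ)‖ₑ = (2 : ℝ≥0∞) ^ (-(k : ℝ)) := by
      rw [← ofReal_norm, Complex.norm_of_nonneg (by positivity), ← zpow_neg, ← Real.rpow_intCast,
        ← ofReal_rpow_of_pos (by norm_num)]
      norm_num
    have e3 : (2 : ℝ≥0∞) ^ (-(k : ℝ) * ((n + 1 : ℕ) : ℝ)) = 2 ^ (-(k : ℝ)) * (2 : ℝ≥0∞) ^ (-(k : ℝ) * n) := by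
      rw [← rpow_add _ _ (by norm_num) (by norm_num)]
      congr 1; push_cast; ring
    rw [e2, e3, mul_assoc ((2 : ℝ≥0∞) ^ (-(k : ℝ))), mul_left_comm (C i : ℝ≥0∞)]
    refine mul_le_mul_right ((hC i k _ (hf.fderiv _) x).trans ?_) _
    refine mul_le_mul_right (mul_le_mul_right (avg_mono k (fun y => ?_) x) _) _
    rw [← ofReal_norm, ← ofReal_norm]
    refine ofReal_le_ofReal ?_
    simpa [norm_basisVec] using norm_iteratedFDeriv_fderiv_apply hf.1 le_rfl (basisVec i) y

/-- The symbol of a block as an annular symbol. -/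
def kapSymb : AnnSymb N where
  toS := symb Φ
  ann ξ h := by
    have := specIn_kap_self Φ 0 ξ (by
      rw [kap, fourier_dil]
      simpa [fourier_fourierInv_eq] using h)
    norm_num at this
    exact this

/-! ### Reconstruction of a bounded function from its blocks -/

/-- A cut-off that is `1` on `|2πξ| ≤ 8/3` and vanishes outside `|2πξ| ≤ 5`. -/
def lowBump (N : ℕ) : ContDiffBump (0 : Sp N) :=
  ⟨8 / 3 / (2 * π), 5 / (2 * π), by positivity, by gcongr; norm_num⟩

/-- The symbol `∑_{j ≤ 0} φ(2^{-j} ·)`, equal to `1` near `0`. -/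
def lowSymb : 𝓢(Sp N, ℂ) :=
  HasCompactSupport.toSchwartzMap (f := fun ξ : Sp N => ((lowBump N ξ * (1 - Φ.φ ((2 : ℝ) ^ (-1 : ℤ) • (2 * π) • ξ)
      - Φ.φ ((2 : ℝ) ^ (-2 : ℤ) • (2 * π) • ξ)) : ℝ) : ℂ))
    ((HasCompactSupport.mul_right (lowBump N).hasCompactSupport).comp_left (g := Complex.ofReal) rfl)
    (Complex.ofRealCLM.contDiff.comp ((lowBump N).contDiff.mul ((contDiff_const.sub
      ((Φ.φ.smooth ⊤).comp (contDiff_const_smul _ |>.comp (contDiff_const_smul _)))).sub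
      ((Φ.φ.smooth ⊤).comp (contDiff_const_smul _ |>.comp (contDiff_const_smul _))))))

theorem lowSymb_apply (ξ : Sp N) : lowSymb Φ ξ =
    ((lowBump N ξ * (1 - Φ.φ ((2 : ℝ) ^ (-1 : ℤ) • (2 * π) • ξ)
      - Φ.φ ((2 : ℝ) ^ (-2 : ℤ) • (2 * π) • ξ)) : ℝ) : ℂ) := rfl

/-- On the support of the cut-off only two of the blocks with positive index are present. -/
theorem hasSum_lowSymb {ξ : Sp N} (hξ : ξ ≠ 0) :
    HasSum (fun n : ℕ => Φ.φ ((2 : ℝ) ^ (n : ℤ) • (2 * π) • ξ))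
      (lowBump N ξ * (1 - Φ.φ ((2 : ℝ) ^ (-1 : ℤ) • (2 * π) • ξ)
      - Φ.φ ((2 : ℝ) ^ (-2 : ℤ) • (2 * π) • ξ))) := by
  have hpi := Real.pi_pos
  have hη : (2 * π) • ξ ≠ 0 := smul_ne_zero (by positivity) hξ
  have hnorm : ‖(2 * π) • ξ‖ = 2 * π * ‖ξ‖ := by
    rw [norm_smul, Real.norm_of_nonneg (by positivity)]
  have h1 := Φ.sum_eq_one _ hη
  have hneg : ∀ n : ℕ, Φ.φ ((2 : ℝ) ^ (n : ℤ) • (2 * π) • ξ) ≠ 0 → 2 * π * ‖ξ‖ ≤ 8 / 3 := fun n hn => by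
    have := (Φ.annulus_scaled (k := -(n : ℤ)) (ξ := (2 * π) • ξ) (by simpa using hn)).2
    rw [hnorm] at this
    have h2 : (2 : ℝ) ^ (-(n : ℤ)) ≤ 1 := zpow_le_one_of_nonpos₀ (by norm_num) (by simp)
    linarith
  by_cases h5 : 2 * π * ‖ξ‖ ≤ 5
  · have h2 : HasSum (fun n : ℕ => Φ.φ ((2 : ℝ) ^ (n : ℤ) • (2 * π) • ξ))
        (1 - Φ.φ ((2 : ℝ) ^ (-1 : ℤ) • (2 * π) • ξ) - Φ.φ ((2 : ℝ) ^ (-2 : ℤ) • (2 * π) • ξ)) := by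
      have h3 : HasSum (fun j : ℤ => if j = 1 ∨ j = 2 then Φ.φ ((2 : ℝ) ^ (-j) • (2 * π) • ξ) else 0)
          (Φ.φ ((2 : ℝ) ^ (-1 : ℤ) • (2 * π) • ξ) + Φ.φ ((2 : ℝ) ^ (-2 : ℤ) • (2 * π) • ξ)) := by
        have := hasSum_sum_of_ne_finset_zero (s := ({1, 2} : Finset ℤ))
          (f := fun j : ℤ => if j = 1 ∨ j = 2 then Φ.φ ((2 : ℝ) ^ (-j) • (2 * π) • ξ) else 0)
          (fun j hj => if_neg (by simpa using hj))
          (L := SummationFilter.unconditional ℤ)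
        rw [Finset.sum_pair (by norm_num)] at this
        simpa using this
      have h4 := h1.sub h3
      rw [← sub_sub]  at h4
      rw [← Function.Injective.hasSum_iff (g := fun n : ℕ => -(n : ℤ)) (fun a b h => by simpa using h)] at h4
      · convert! h4 using 2 with n
        simp only [Function.comp, neg_neg]
        rw [if_neg (by omega), sub_zero]
      · intro j hj
        have hj' : 1 ≤ j := by
          by_contra hcon
          exact hj ⟨j.natAbs, show -(j.natAbs : ℤ) = j by omega⟩
        split_ifs with h12
        · simp
        · rw [sub_zero]
          by_contra hne
          have := (Φ.annulus_scaled hne).1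
          rw [hnorm] at this
          have h8 : (2 : ℝ) ^ (3 : ℤ) ≤ 2 ^ j := zpow_le_zpow_right₀ (by norm_num) (by omega)
          norm_num at h8
          linarith
    by_cases h83 : 2 * π * ‖ξ‖ ≤ 8 / 3
    · rw [(lowBump N).one_of_mem_closedBall, one_mul]
      · exact h2
      · rw [mem_closedBall_zero_iff]
        change ‖ξ‖ ≤ 8 / 3 / (2 * π)
        rw [le_div_iff₀ (by positivity)]; linarith
    · have h0 : ∀ n : ℕ, Φ.φ ((2 : ℝ) ^ (n : ℤ) • (2 * π) • ξ) = 0 := fun n => by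
        by_contra hne; exact h83 (hneg n hne)
      simp only [h0] at h2 ⊢
      rw [h2.unique hasSum_zero, mul_zero]
      exact hasSum_zero
  · have h0 : ∀ n : ℕ, Φ.φ ((2 : ℝ) ^ (n : ℤ) • (2 * π) • ξ) = 0 := fun n => by
      by_contra hne
      have := hneg n hne
      linarith
    simp only [h0]
    rw [(lowBump N).zero_of_le_dist, zero_mul]
    · exact hasSum_zero
    · change 5 / (2 * π) ≤ _
      rw [dist_zero_right, div_le_iff₀ (by positivity)]; linarith

/-- Halving the argument adds one block to the low frequencies. -/
theorem lowSymb_step (ξ : Sp N) :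
    lowSymb Φ ((2 : ℝ)⁻¹ • ξ) = lowSymb Φ ξ + (Φ.φ ((2 : ℝ)⁻¹ • (2 * π) • ξ) : ℂ) := by
  rcases eq_or_ne ξ 0 with rfl | hξ
  · have : Φ.φ 0 = 0 := by
      by_contra h
      have := (Φ.annulus 0 h).1
      rw [norm_zero] at this; norm_num at this
    simp [this]
  have h1 := hasSum_lowSymb Φ (ξ := (2 : ℝ)⁻¹ • ξ) (smul_ne_zero (by norm_num) hξ)
  have h2 := (hasSum_lowSymb Φ hξ)
  rw [← hasSum_nat_add_iff' 1] at h1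
  have h3 : ∀ n : ℕ, (2 : ℝ) ^ ((n + 1 : ℕ) : ℤ) • (2 * π) • (2 : ℝ)⁻¹ • ξ = (2 : ℝ) ^ (n : ℤ) • (2 * π) • ξ := fun n => by
    rw [smul_comm (2 * π), smul_smul]
    congr 1; push_cast; rw [zpow_add₀ (by norm_num)]; norm_num; ring
  simp only [h3] at h1
  have h4 := h1.unique h2
  rw [lowSymb_apply, lowSymb_apply, ← Complex.ofReal_add]
  congr 1
  rw [← h4]
  simp [smul_comm (2 * π) (2 : ℝ)⁻¹ ξ]

theorem lowSymb_zero : lowSymb Φ 0 = 1 := by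
  have : Φ.φ 0 = 0 := by
    by_contra h
    have := (Φ.annulus 0 h).1
    rw [norm_zero] at this; norm_num at this
  rw [lowSymb_apply, (lowBump N).one_of_mem_closedBall (Metric.mem_closedBall_self (lowBump N).rIn_pos.le)]
  simp [this]

/-- The kernel of `∑_{j ≤ 0} Δ_j`. -/
def lowKap : 𝓢(Sp N, ℂ) := 𝓕⁻ (lowSymb Φ)

theorem dil_lowKap_succ (k : ℤ) :
    dil (k + 1) (lowKap Φ) = dil k (lowKap Φ) + kap Φ (k + 1) := by
  refine fourier_ext fun ξ => ?_
  rw [fourier_add_apply, fourier_kap, fourier_dil, fourier_dil, lowKap, fourier_fourierInv_eq]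
  have h := lowSymb_step Φ (((2 : ℝ) ^ k)⁻¹ • ξ)
  have e : ((2 : ℝ) ^ (k + 1))⁻¹ = 2⁻¹ * ((2 : ℝ) ^ k)⁻¹ := by
    rw [zpow_add₀ (by norm_num), mul_inv, zpow_one, mul_comm]
  rw [zpow_neg, e, mul_smul 2⁻¹ ((2 : ℝ) ^ k)⁻¹ ξ, h, smul_comm (2 * π), smul_smul 2⁻¹]

theorem sum_conv_kap {b : Sp N → ℂ} (hb : BddCts b) (n : ℕ) (x : Sp N) :
    ∑ j ∈ Finset.Ioc (-(n : ℤ)) n, conv (kap Φ j) b x =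
      conv (dil n (lowKap Φ)) b x - conv (dil (-n) (lowKap Φ)) b x := by
  have key : ∀ (m : ℤ) (r : ℕ), ∑ j ∈ Finset.Ioc m (m + r), conv (kap Φ j) b x =
      conv (dil (m + r) (lowKap Φ)) b x - conv (dil m (lowKap Φ)) b x := fun m r => by
    induction r with
    | zero => simp
    | succ r ih =>
      have : Finset.Ioc m (m + (r + 1 : ℕ)) = insert (m + r + 1) (Finset.Ioc m (m + r)) := by
        ext j; simp only [Finset.mem_Ioc, Finset.mem_insert]; omega
      rw [this, Finset.sum_insert (by simp), ih, Nat.cast_add, Nat.cast_one, ← add_assoc, dil_lowKap_succ,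
        conv_add_left _ _ hb]
      ring
  have := key (-n) (2 * n)
  rw [show (-(n : ℤ) + ((2 * n : ℕ) : ℤ)) = n by push_cast; ring] at this
  exact this

theorem conv_dil_eq (k : ℤ) (α : 𝓢(Sp N, ℂ)) (b : Sp N → ℂ) (x : Sp N) :
    conv (dil k α) b x = ∫ z, b (x - ((2 : ℝ) ^ k)⁻¹ • z) * α z := by
  have h2 : (0 : ℝ) < 2 ^ k := by positivity
  rw [conv, ← integral_sub_left_eq_self (fun y => b y • dil k α (x - y)) volume x]
  have := Measure.integral_comp_smul (volume : Measure (Sp N))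
    (fun z => b (x - ((2 : ℝ) ^ k)⁻¹ • z) * α z) ((2 : ℝ) ^ k)
  rw [finrank_euclideanSpace, Fintype.card_fin, abs_of_pos (by positivity), eq_inv_smul_iff₀ (by positivity)] at this
  rw [← this, ← integral_smul]
  congr 1; ext v
  simp only [sub_sub_cancel, dil_apply, smul_smul, inv_mul_cancel₀ h2.ne', one_smul, Complex.real_smul, smul_eq_mul]
  ring

theorem tendsto_conv_dil_lowKap {b : Sp N → ℂ} (hb : BddCts b) (x : Sp N) :
    Filter.Tendsto (fun n : ℕ => conv (dil n (lowKap Φ)) b x) Filter.atTop (nhds (b x)) := by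
  obtain ⟨hc, B, hB⟩ := hb
  have hint : ∫ z, lowKap Φ z = 1 := by
    have h1 : 𝓕 (lowKap Φ) 0 = 1 := by
      rw [lowKap, fourier_fourierInv_eq, lowSymb_zero]
    rw [fourier_coe, Real.fourier_eq] at h1
    simpa using h1
  have h2 : b x = ∫ z, b x * lowKap Φ z := by rw [integral_const_mul, hint, mul_one]
  rw [h2]
  simp only [conv_dil_eq]
  refine tendsto_integral_of_dominated_convergence (fun z => B * ‖lowKap Φ z‖)
    (fun n => ?_) ((lowKap Φ).integrable.norm.const_mul B)
    (fun n => .of_forall fun z => ?_) (.of_forall fun z => ?_)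
  · exact ((hc.comp (by fun_prop)).mul (lowKap Φ).continuous).aestronglyMeasurable
  · rw [norm_mul]; exact mul_le_mul_of_nonneg_right (hB _) (norm_nonneg _)
  · refine Filter.Tendsto.mul_const _ ?_
    have h3 : Filter.Tendsto (fun n : ℕ => ((2 : ℝ) ^ (n : ℤ))⁻¹) Filter.atTop (nhds 0) := by
      simp only [zpow_natCast, ← inv_pow]
      exact tendsto_pow_atTop_nhds_zero_of_lt_one (by norm_num) (by norm_num)
    have h4 := (h3.smul_const z).const_sub x
    rw [zero_smul, sub_zero] at h4
    exact (hc.tendsto x).comp h4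

/-- The low frequency parts of a bounded function become constant. -/
theorem tendsto_conv_dil_sub (α : 𝓢(Sp N, ℂ)) {b : Sp N → ℂ} (hb : BddCts b) (x y : Sp N) :
    Filter.Tendsto (fun n : ℕ => conv (dil (-n) α) b y - conv (dil (-n) α) b x) Filter.atTop (nhds 0) := by
  choose C hC using fun i : Fin N => exists_iteratedFDeriv_conv_le α 1
  obtain ⟨C, hC⟩ := exists_iteratedFDeriv_conv_le α 1
  have hb' := hb
  obtain ⟨hc, B, hB⟩ := hb
  have hB0 : 0 ≤ B := (norm_nonneg _).trans (hB 0)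
  have h1 : ∀ (n : ℕ) (z : Sp N), ‖fderiv ℝ (conv (dil (-n) α) b) z‖ ≤ (C * ((2 : ℝ≥0∞) ^ (-1 : ℝ)) ^ n * (cMaj N * ofReal B)).toReal := fun n z => by
    rw [← norm_iteratedFDeriv_one]
    have := hC (-n) b hb' z
    have h2 := avg_le_sup (-n) (f := fun y => ‖b y‖ₑ) (c := ofReal B) (fun y => by
      rw [← ofReal_norm]; exact ofReal_le_ofReal (hB y)) z
    have h3 := this.trans (mul_le_mul_right (mul_le_mul_right h2 _) _)
    rw [← toReal_enorm]
    refine toReal_mono ?_ (h3.trans_eq ?_)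
    · have := cMaj_ne_top (N := N)
      finiteness
    · rw [← mul_assoc]; congr 2
      rw [← ENNReal.rpow_natCast, ← rpow_mul]; congr 1; push_cast; ring
  have h2 : ∀ n : ℕ, ‖conv (dil (-n) α) b y - conv (dil (-n) α) b x‖ ≤ (C * ((2 : ℝ≥0∞) ^ (-1 : ℝ)) ^ n * (cMaj N * ofReal B)).toReal * ‖y - x‖ := fun n =>
    convex_univ.norm_image_sub_le_of_norm_fderiv_le (𝕜 := ℝ)
      (fun z _ => (hasFDerivAt_conv hb' _ z).differentiableAt) (fun z _ => h1 n z) (mem_univ _) (mem_univ _)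
  refine squeeze_zero_norm h2 ?_
  rw [← zero_mul ‖y - x‖]
  refine Filter.Tendsto.mul_const _ ?_
  have e : ∀ n : ℕ, (C * ((2 : ℝ≥0∞) ^ (-1 : ℝ)) ^ n * (cMaj N * ofReal B)).toReal = (C * (cMaj N * ofReal B)).toReal * (2⁻¹ : ℝ) ^ n := fun n => by
    simp only [ENNReal.toReal_mul, ENNReal.toReal_pow, ENNReal.rpow_neg_one, ENNReal.toReal_inv, ENNReal.toReal_ofNat]
    ring
  simp_rw [e]
  rw [← mul_zero (C * (cMaj N * ofReal B)).toReal]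
  exact (tendsto_pow_atTop_nhds_zero_of_lt_one (by norm_num) (by norm_num)).const_mul _

/-- A bounded continuous function is, up to a constant, the sum of its blocks. -/
theorem hasSum_conv_kap_sub {b : Sp N → ℂ} (hb : BddCts b) (x y : Sp N)
    (hs : Summable fun j => conv (kap Φ j) b y - conv (kap Φ j) b x) :
    HasSum (fun j => conv (kap Φ j) b y - conv (kap Φ j) b x) (b y - b x) := by
  have h1 := (tendsto_conv_dil_lowKap Φ hb y).sub (tendsto_conv_dil_lowKap Φ hb x)
  have h2 := h1.sub (tendsto_conv_dil_sub (lowKap Φ) hb x y)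
  rw [sub_zero] at h2
  have h3 : Filter.Tendsto (fun n : ℕ => ∑ j ∈ Finset.Ioc (-(n : ℤ)) n, (conv (kap Φ j) b y - conv (kap Φ j) b x))
      Filter.atTop (nhds (b y - b x)) := by
    refine h2.congr fun n => ?_
    rw [Finset.sum_sub_distrib, sum_conv_kap Φ hb, sum_conv_kap Φ hb]; ring
  have h4 := hs.hasSum.comp (Finset.tendsto_Ioc_neg (R := ℤ))
  rw [← tendsto_nhds_unique h4 h3]
  exact hs.hasSum

/-! ### Extension of functions with bounded derivatives from an interval -/

/-- Extension of a smooth function from an interval `J`, with control of the growth of its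
derivatives away from a point `x₀ ∈ J`: the highest derivative is extended as a bounded Lipschitz
function and integrated repeatedly from `x₀`. -/
theorem exists_extension_zero {J : Set ℝ} (hJ : IsOpen J) (hJc : J.OrdConnected) {x₀ : ℝ} (hx₀ : x₀ ∈ J)
    {K : ℝ} (n : ℕ) : ∀ f : ℝ → ℝ, ContDiffOn ℝ ∞ f J →
      (∀ k ≤ n + 1, ∀ x ∈ J, |iteratedDeriv k f x| ≤ K) →
      ∃ g : ℝ → ℝ, ContDiff ℝ n g ∧ EqOn g f J ∧
        ∀ k ≤ n, ∀ x, |iteratedDeriv k g x| ≤ K * (1 + |x - x₀|) ^ (n - k) := by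
  have hderiv : ∀ f : ℝ → ℝ, ContDiffOn ℝ ∞ f J → ∀ x ∈ J, HasDerivAt f (deriv f x) x := fun f hf x hx =>
    ((hf.differentiableOn (by simp)).differentiableAt (hJ.mem_nhds hx)).hasDerivAt
  induction n with
  | zero =>
    intro f hf hK
    have hK0 : 0 ≤ K := (abs_nonneg _).trans (hK 0 (by norm_num) x₀ hx₀)
    have hlip : LipschitzOnWith K.toNNReal f J := by
      refine hJc.convex.lipschitzOnWith_of_nnnorm_hasDerivWithin_le
        (fun x hx => (hderiv f hf x hx).hasDerivWithinAt) fun x hx => ?_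
      have := hK 1 le_rfl x hx
      rw [iteratedDeriv_one] at this
      rw [← NNReal.coe_le_coe, coe_nnnorm, Real.norm_eq_abs, Real.coe_toNNReal _ hK0]
      exact this
    obtain ⟨g, hg, hgf⟩ := hlip.extend_real
    refine ⟨fun x => max (-K) (min K (g x)), ?_, fun x hx => ?_, fun k hk x => ?_⟩
    · have hc : Continuous fun x => max (-K) (min K (g x)) :=
        continuous_const.max (continuous_const.min hg.continuous)
      exact contDiff_zero.2 hc
    · have := abs_le.1 (hK 0 (by norm_num) x hx)
      rw [iteratedDeriv_zero] at this
      simp only [← hgf hx]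
      rw [min_eq_right this.2, max_eq_right this.1]
    · obtain rfl : k = 0 := by omega
      rw [iteratedDeriv_zero, pow_zero, mul_one, abs_le]
      exact ⟨le_max_left _ _, max_le (by linarith) (min_le_left _ _)⟩
  | succ n ih =>
    intro f hf hK
    have hK0 : 0 ≤ K := (abs_nonneg _).trans (hK 0 (by norm_num) x₀ hx₀)
    obtain ⟨g, hg, hgf, hgK⟩ := ih (deriv f) (hf.deriv_of_isOpen hJ (by simp)) fun k hk x hx => by
      rw [← iteratedDeriv_succ']; exact hK (k + 1) (by omega) x hx
    have hd : ∀ x, HasDerivAt (fun x => f x₀ + ∫ y in x₀..x, g y) (g x) x := fun x =>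
      ((intervalIntegral.integral_hasDerivAt_right (hg.continuous.intervalIntegrable _ _)
        (hg.continuous.stronglyMeasurableAtFilter _ _) hg.continuous.continuousAt)).const_add _
    have hde : deriv (fun x => f x₀ + ∫ y in x₀..x, g y) = g := funext fun x => (hd x).deriv
    refine ⟨fun x => f x₀ + ∫ y in x₀..x, g y, ?_, fun x hx => ?_, fun k hk x => ?_⟩
    · rw [Nat.cast_add, Nat.cast_one, contDiff_succ_iff_deriv]
      exact ⟨fun x => (hd x).differentiableAt, by simp, by rw [hde]; exact hg⟩
    · have hsub : uIcc x₀ x ⊆ J := hJc.uIcc_subset hx₀ hx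
      have h1 : ∫ y in x₀..x, g y = ∫ y in x₀..x, deriv f y :=
        intervalIntegral.integral_congr fun y hy => hgf (hsub hy)
      have h2 := intervalIntegral.integral_eq_sub_of_hasDerivAt (f := f) (f' := deriv f) (a := x₀) (b := x)
        (fun y hy => hderiv f hf y (hsub hy))
        (((hf.deriv_of_isOpen hJ (m := 0) (by simp)).continuousOn.mono hsub).intervalIntegrable)
      simp only
      rw [h1, h2]; ring
    · rcases k with _ | k
      · rw [iteratedDeriv_zero]
        have h0 : |f x₀| ≤ K := by simpa using hK 0 (by omega) x₀ hx₀
        have h1 : ‖∫ y in x₀..x, g y‖ ≤ K * (1 + |x - x₀|) ^ n * |x - x₀| := by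
          refine intervalIntegral.norm_integral_le_of_norm_le_const fun y hy => ?_
          have := hgK 0 (Nat.zero_le _) y
          rw [iteratedDeriv_zero] at this
          refine this.trans (mul_le_mul_of_nonneg_left ?_ hK0)
          rw [Nat.sub_zero]
          refine pow_le_pow_left₀ (by positivity) ?_ _
          have := abs_sub_left_of_mem_uIcc (uIoc_subset_uIcc hy)
          linarith
        have h2 : (1 : ℝ) ≤ (1 + |x - x₀|) ^ n := one_le_pow₀ (by linarith [abs_nonneg (x - x₀)])
        calc |f x₀ + ∫ y in x₀..x, g y| ≤ |f x₀| + |∫ y in x₀..x, g y| := abs_add_le _ _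
          _ ≤ K * (1 + |x - x₀|) ^ n + K * (1 + |x - x₀|) ^ n * |x - x₀| :=
            add_le_add (h0.trans (le_mul_of_one_le_right hK0 h2)) h1
          _ = _ := by rw [Nat.sub_zero, pow_succ]; ring
      · rw [iteratedDeriv_succ', hde, Nat.add_sub_add_right]
        exact hgK k (by omega) x

/-- `exists_extension_zero` applied to the derivative: a primitive `F` of the extension `g` of `f'` extends `f`. -/
theorem exists_extension {J : Set ℝ} (hJ : IsOpen J) (hJc : J.OrdConnected) {x₀ : ℝ} (hx₀ : x₀ ∈ J)
    {K : ℝ} {M : ℕ} {f : ℝ → ℝ} (hf : SmoothBoundedOn f J (M + 2) K) :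
    ∃ F g : ℝ → ℝ, ContDiff ℝ M g ∧ (∀ x, HasDerivAt F (g x) x) ∧ EqOn F f J ∧
      ∀ k ≤ M, ∀ x, |iteratedDeriv k g x| ≤ K * (1 + |x - x₀|) ^ (M - k) := by
  obtain ⟨hs, hK⟩ := hf
  obtain ⟨g, hg, hgf, hgK⟩ := exists_extension_zero hJ hJc hx₀ M (deriv f) (hs.deriv_of_isOpen hJ (by simp))
    fun k hk x hx => by rw [← iteratedDeriv_succ']; exact hK (k + 1) (by omega) (by omega) x hx
  refine ⟨fun x => f x₀ + ∫ y in x₀..x, g y, g, hg, fun x =>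
      ((intervalIntegral.integral_hasDerivAt_right (hg.continuous.intervalIntegrable _ _)
        (hg.continuous.stronglyMeasurableAtFilter _ _) hg.continuous.continuousAt)).const_add _, fun x hx => ?_, hgK⟩
  have hsub : uIcc x₀ x ⊆ J := hJc.uIcc_subset hx₀ hx
  have h1 : ∫ y in x₀..x, g y = ∫ y in x₀..x, deriv f y :=
    intervalIntegral.integral_congr fun y hy => hgf (hsub hy)
  have h2 := intervalIntegral.integral_eq_sub_of_hasDerivAt (f := f) (f' := deriv f) (a := x₀) (b := x)
    (fun y hy => ((hs.differentiableOn (by simp)).differentiableAt (hJ.mem_nhds (hsub hy))).hasDerivAt)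
    (((hs.deriv_of_isOpen hJ (m := 0) (by simp)).continuousOn.mono hsub).intervalIntegrable)
  simp only
  rw [h1, h2]; ring

/-! ### Blocks of a composition -/

/-- Leibniz and Faà di Bruno at a point, for an outer function whose derivatives grow
polynomially: in `D^m (g ∘ h · c)` the powers of the size `R` of `h` add up to `R^M`. -/
theorem norm_iteratedFDeriv_comp_mul_le {M : ℕ} {K R C l v x₀ : ℝ} (hR : 1 ≤ R) (hC : 1 ≤ C) (hK : 0 ≤ K) (hl : 0 ≤ l) (hv : 0 ≤ v)
    (hx₀ : 1 + |x₀| ≤ R) {g : ℝ → ℝ} (hg : ContDiff ℝ M g)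
    (hgK : ∀ k ≤ M, ∀ t, |iteratedDeriv k g t| ≤ K * (1 + |t - x₀|) ^ (M - k))
    {h c : Sp N → ℝ} (hh : ContDiff ℝ M h) (hc : ContDiff ℝ M c) (y : Sp N) (hy : |h y| ≤ C * R)
    (hhD : ∀ m ≤ M, ‖iteratedFDeriv ℝ m h y‖ ≤ C * l ^ m * R)
    (hcD : ∀ m ≤ M, ‖iteratedFDeriv ℝ m c y‖ ≤ C * l ^ m * v) {m : ℕ} (hm : m ≤ M) :
    ‖iteratedFDeriv ℝ m (fun y => g (h y) * c y) y‖ ≤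
      2 ^ M * (M.factorial * (C + 1) ^ M * C ^ M * C) * (K * R ^ M) * (l ^ m * v) := by
  have hR0 : 0 < R := by linarith
  have hcomp : ∀ n ≤ M, ‖iteratedFDeriv ℝ n (fun y => g (h y)) y‖ ≤ (M.factorial * (C + 1) ^ M * C ^ M) * (K * R ^ M) * l ^ n := by
    intro n hn
    have e1 : (fun y => g (h y)) = (fun t => g (R * t)) ∘ fun y => R⁻¹ • h y := by
      ext y; simp only [Function.comp, smul_eq_mul, mul_inv_cancel_left₀ hR0.ne']
    have hG : ContDiff ℝ M fun t => g (R * t) := hg.comp (contDiff_const.mul contDiff_id)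
    have hH : ContDiff ℝ M fun y => R⁻¹ • h y := hh.const_smul R⁻¹
    rw [e1]
    have := norm_iteratedFDeriv_comp_le (n := n) hG hH (by exact_mod_cast hn) y (C := (C + 1) ^ M * (K * R ^ M)) (D := C * l)
      (fun i hi => by
        rw [norm_iteratedFDeriv_eq_norm_iteratedDeriv, iteratedDeriv_comp_const_mul (hg.of_le (by exact_mod_cast (hi.trans hn)))]
        simp only [smul_eq_mul, mul_inv_cancel_left₀ hR0.ne', Real.norm_eq_abs, abs_mul, abs_pow, abs_of_pos hR0]
        have h1 := hgK i (hi.trans hn) (h y)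
        have h2 : 1 + |h y - x₀| ≤ (C + 1) * R := by
          have := abs_sub (h y) x₀
          linarith
        calc R ^ i * |iteratedDeriv i g (h y)| ≤ R ^ i * (K * ((C + 1) * R) ^ (M - i)) := by
              refine mul_le_mul_of_nonneg_left (h1.trans (mul_le_mul_of_nonneg_left ?_ hK)) (by positivity)
              exact pow_le_pow_left₀ (by positivity) h2 _
          _ = (C + 1) ^ (M - i) * (K * (R ^ i * R ^ (M - i))) := by rw [mul_pow]; ring
          _ ≤ (C + 1) ^ M * (K * R ^ M) := by
              rw [← pow_add, Nat.add_sub_cancel' (hi.trans hn)]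
              refine mul_le_mul_of_nonneg_right (pow_le_pow_right₀ (by linarith) (Nat.sub_le _ _)) (by positivity))
      (fun i hi1 hi => by
        have : (fun y => R⁻¹ • h y) = R⁻¹ • h := rfl
        rw [this, iteratedFDeriv_const_smul_apply (hh.of_le (by exact_mod_cast (hi.trans hn))).contDiffAt, norm_smul, norm_inv, Real.norm_of_nonneg hR0.le,
          inv_mul_le_iff₀ hR0, mul_pow]
        refine (hhD i (hi.trans hn)).trans ?_
        rw [mul_comm R]
        refine mul_le_mul_of_nonneg_right (mul_le_mul_of_nonneg_right ?_ (by positivity)) hR0.le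
        exact le_self_pow₀ hC (by omega))
    refine this.trans ?_
    have h3 : (n.factorial : ℝ) ≤ M.factorial := by exact_mod_cast Nat.factorial_le hn
    have h4 : C ^ n ≤ C ^ M := pow_le_pow_right₀ hC hn
    calc n.factorial * ((C + 1) ^ M * (K * R ^ M)) * (C * l) ^ n
        = (n.factorial * C ^ n) * ((C + 1) ^ M * (K * R ^ M) * l ^ n) := by rw [mul_pow]; ring
      _ ≤ (M.factorial * C ^ M) * ((C + 1) ^ M * (K * R ^ M) * l ^ n) := by
        refine mul_le_mul_of_nonneg_right (mul_le_mul h3 h4 (by positivity) (by positivity)) (by positivity)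
      _ = _ := by ring
  have hgh : ContDiff ℝ M fun y => g (h y) := hg.comp hh
  refine (norm_iteratedFDeriv_mul_le hgh hc y (by exact_mod_cast hm)).trans ?_
  have hterm : ∀ i ∈ Finset.range (m + 1), (m.choose i : ℝ) * ‖iteratedFDeriv ℝ i (fun y => g (h y)) y‖ * ‖iteratedFDeriv ℝ (m - i) c y‖ ≤
      (m.choose i : ℝ) * ((M.factorial * (C + 1) ^ M * C ^ M * C) * (K * R ^ M) * (l ^ m * v)) := fun i hi => by
    have hi' : i ≤ m := Nat.lt_succ_iff.1 (Finset.mem_range.1 hi)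
    rw [mul_assoc]
    refine mul_le_mul_of_nonneg_left ?_ (by positivity)
    refine (mul_le_mul (hcomp i (hi'.trans hm)) (hcD (m - i) (by omega)) (norm_nonneg _) (by positivity)).trans_eq ?_
    rw [show l ^ m = l ^ i * l ^ (m - i) by rw [← pow_add, Nat.add_sub_cancel' hi']]
    ring
  refine (Finset.sum_le_sum hterm).trans ?_
  rw [← Finset.sum_mul]
  have h5 : (∑ i ∈ Finset.range (m + 1), (m.choose i : ℝ)) = 2 ^ m := by exact_mod_cast Nat.sum_range_choose m
  rw [h5]
  have h6 : (2 : ℝ) ^ m ≤ 2 ^ M := pow_le_pow_right₀ (by norm_num) hm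
  rw [mul_assoc (2 ^ M : ℝ), mul_assoc (2 ^ M : ℝ)]
  refine mul_le_mul_of_nonneg_right h6 (by positivity)

theorem avg_lt_top {g : Sp N → ℂ} (hg : BddCts g) (k : ℤ) (y : Sp N) :
    avg k (fun y => ‖g y‖ₑ) y ≠ ⊤ := by
  obtain ⟨hc, B, hB⟩ := hg
  refine ne_top_of_le_ne_top (b := cMaj N * ofReal B) ?_ (avg_le_sup k (fun y => by
      rw [← ofReal_norm]; exact ofReal_le_ofReal (hB y)) y)
  exact mul_ne_top cMaj_ne_top ofReal_ne_top

theorem exists_iteratedFDeriv_conv_real (α : 𝓢(Sp N, ℂ)) (M : ℕ) : ∃ C : ℝ, 0 ≤ C ∧ ∀ (k : ℤ) (g : Sp N → ℂ),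
    BddCts g → ∀ m ≤ M, ∀ x, ‖iteratedFDeriv ℝ m (conv (dil k α) g) x‖ ≤
      C * ((2 : ℝ) ^ k) ^ m * (avg k (fun y => ‖g y‖ₑ) x).toReal := by
  choose C hC using exists_iteratedFDeriv_conv_le α
  refine ⟨∑ m ∈ Finset.range (M + 1), (C m : ℝ), Finset.sum_nonneg fun _ _ => NNReal.coe_nonneg _, fun k g hg m hm x => ?_⟩
  have h1 := hC m k g hg x
  have hfin := avg_lt_top hg k x
  have h2 := toReal_mono (by
    refine mul_ne_top coe_ne_top (mul_ne_top ?_ hfin)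
    exact ENNReal.rpow_ne_top_of_ne_zero (by norm_num) (by norm_num)) h1
  rw [toReal_enorm, ENNReal.toReal_mul, ENNReal.toReal_mul, ENNReal.coe_toReal, ← ENNReal.toReal_rpow,
    ENNReal.toReal_ofNat, Real.rpow_mul (by norm_num), Real.rpow_intCast, Real.rpow_natCast, ← mul_assoc] at h2
  refine h2.trans ?_
  refine mul_le_mul_of_nonneg_right (mul_le_mul_of_nonneg_right ?_ (by positivity)) toReal_nonneg
  exact Finset.single_le_sum (f := fun m => (C m : ℝ)) (fun _ _ => NNReal.coe_nonneg _) (Finset.mem_range.2 (by omega))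

theorem iteratedFDeriv_re_le {M m : ℕ} {f : Sp N → ℂ} (hf : ContDiff ℝ M f) (hm : m ≤ M) (y : Sp N) :
    ‖iteratedFDeriv ℝ m (fun y => (f y).re) y‖ ≤ ‖iteratedFDeriv ℝ m f y‖ := by
  have := Complex.reCLM.norm_iteratedFDeriv_comp_left (x := y) (hf.contDiffAt) (by exact_mod_cast hm : (m : ℕ∞ω) ≤ M)
  rw [Complex.reCLM_norm, one_mul] at this
  exact this

theorem iteratedFDeriv_ofReal_eq {M m : ℕ} {f : Sp N → ℝ} (hf : ContDiff ℝ M f) (hm : m ≤ M) (y : Sp N) :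
    ‖iteratedFDeriv ℝ m (fun y => (f y : ℂ)) y‖ ≤ ‖iteratedFDeriv ℝ m f y‖ := by
  have := Complex.ofRealCLM.norm_iteratedFDeriv_comp_left (x := y) (hf.contDiffAt) (by exact_mod_cast hm : (m : ℕ∞ω) ≤ M)
  rw [Complex.ofRealCLM_norm, one_mul] at this
  exact this

/-- The coefficient `min(1, 2^{(i-j)M})`. -/
def gainCoef (M : ℕ) (j i : ℤ) : ℝ≥0∞ := (2 : ℝ≥0∞) ^ ((min 0 (i - j) : ℤ) * (M : ℝ))

/-- The part of `r` with frequencies up to `2^i`. -/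
def lowPart (i : ℤ) (r : Sp N → ℂ) : Sp N → ℂ := conv (dil i (lowKap Φ)) r

theorem lowPart_succ (i : ℤ) {r : Sp N → ℂ} (hr : BddCts r) (y : Sp N) :
    lowPart Φ i r y = lowPart Φ (i - 1) r y + conv (kap Φ i) r y := by
  have := dil_lowKap_succ Φ (i - 1)
  rw [sub_add_cancel] at this
  rw [lowPart, this, conv_add_left _ _ hr, lowPart]

/-- What a composition with `F` needs to know about `F' = g`. -/
structure GrowthBound (M : ℕ) (K R : ℝ) (F g : ℝ → ℝ) : Prop where
  smooth : ContDiff ℝ M g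
  hasDerivAt : ∀ x, HasDerivAt F (g x) x
  bound : ∃ x₀, 1 + |x₀| ≤ R ∧ ∀ k ≤ M, ∀ x, |iteratedDeriv k g x| ≤ K * (1 + |x - x₀|) ^ (M - k)

/-- Each derivative of `F'(S_{i-1} r + θ Δ_i r) Δ_i r` costs a factor `2^i`. -/
theorem exists_deriv_increment_le (M : ℕ) : ∃ C : ℝ, 0 ≤ C ∧ ∀ (K R : ℝ) (F g : ℝ → ℝ) (r : Sp N → ℂ),
    0 ≤ K → 1 ≤ R → GrowthBound M K R F g → BddCts r → (∀ y, ‖r y‖ ≤ R) →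
    ∀ (i : ℤ) (θ : ℝ), 0 ≤ θ → θ ≤ 1 →
      ContDiff ℝ M (fun y => g ((lowPart Φ (i - 1) r y).re + θ * (conv (kap Φ i) r y).re) * (conv (kap Φ i) r y).re) ∧
      ∀ m ≤ M, ∀ y, ‖iteratedFDeriv ℝ m (fun y => g ((lowPart Φ (i - 1) r y).re + θ * (conv (kap Φ i) r y).re) * (conv (kap Φ i) r y).re) y‖ ≤
        C * (K * R ^ M) * (((2 : ℝ) ^ i) ^ m * (avg i (fun y => ‖conv (kap Φ i) r y‖ₑ) y).toReal) := by
  obtain ⟨C₁, hC₁, h₁⟩ := exists_iteratedFDeriv_conv_real (lowKap Φ) M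
  obtain ⟨C₂, hC₂, h₂⟩ := exists_iteratedFDeriv_conv_real (𝓕⁻ (symb Φ)) M
  obtain ⟨C₃, hC₃, h₃⟩ := exists_iteratedFDeriv_conv_real (∑ i ∈ ({-1, 0, 1} : Finset ℤ), kap Φ i) M
  set A := (cMaj N).toReal with hA
  have hA0 : 0 ≤ A := toReal_nonneg
  set C := 1 + C₁ * A + C₂ * A + C₃ with hCdef
  have hC : 1 ≤ C := by have := mul_nonneg hC₁ hA0; have := mul_nonneg hC₂ hA0; linarith
  refine ⟨2 ^ M * (M.factorial * (C + 1) ^ M * C ^ M * C), by positivity, fun K R F g r hK hR hF hr hrR i θ hθ0 hθ1 => ?_⟩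
  obtain ⟨x₀, hx₀, hgK⟩ := hF.bound
  have h2i : (0 : ℝ) < 2 ^ i := by positivity
  have hR0 : 0 ≤ R := by linarith
  have havg : ∀ k y, (avg k (fun y => ‖r y‖ₑ) y).toReal ≤ A * R := fun k y => by
    have := avg_le_sup k (f := fun y => ‖r y‖ₑ) (c := ofReal R) (fun y => by
      rw [← ofReal_norm]; exact ofReal_le_ofReal (hrR y)) y
    have h5 := toReal_mono (mul_ne_top cMaj_ne_top ofReal_ne_top) this
    rwa [ENNReal.toReal_mul, ENNReal.toReal_ofReal hR0] at h5
  have sS : ContDiff ℝ M (lowPart Φ (i - 1) r) := (contDiff_conv hr _).of_le (by exact_mod_cast le_top)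
  have sc : ContDiff ℝ M (conv (kap Φ i) r) := (contDiff_conv hr _).of_le (by exact_mod_cast le_top)
  have hS : ∀ m ≤ M, ∀ y, ‖iteratedFDeriv ℝ m (lowPart Φ (i - 1) r) y‖ ≤ C₁ * A * ((2 : ℝ) ^ i) ^ m * R := fun m hm y => by
    refine (h₁ (i - 1) r hr m hm y).trans ?_
    calc C₁ * ((2 : ℝ) ^ (i - 1)) ^ m * (avg (i - 1) (fun y => ‖r y‖ₑ) y).toReal
        ≤ C₁ * ((2 : ℝ) ^ i) ^ m * (A * R) := by
          refine mul_le_mul (mul_le_mul_of_nonneg_left (pow_le_pow_left₀ (by positivity) ?_ _) hC₁) (havg _ _) toReal_nonneg (by positivity)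
          exact zpow_le_zpow_right₀ (by norm_num) (by omega)
      _ = _ := by ring
  have hc : ∀ m ≤ M, ∀ y, ‖iteratedFDeriv ℝ m (conv (kap Φ i) r) y‖ ≤ C₂ * A * ((2 : ℝ) ^ i) ^ m * R := fun m hm y => by
    refine (h₂ i r hr m hm y).trans ?_
    calc C₂ * ((2 : ℝ) ^ i) ^ m * (avg i (fun y => ‖r y‖ₑ) y).toReal
        ≤ C₂ * ((2 : ℝ) ^ i) ^ m * (A * R) := by
          refine mul_le_mul_of_nonneg_left (havg _ _) (by positivity)
      _ = _ := by ring
  have hcv : ∀ m ≤ M, ∀ y, ‖iteratedFDeriv ℝ m (conv (kap Φ i) r) y‖ ≤ C₃ * ((2 : ℝ) ^ i) ^ m * (avg i (fun y => ‖conv (kap Φ i) r y‖ₑ) y).toReal := fun m hm y => by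
    have e : conv (kap Φ i) r = conv (fatKap Φ i) (conv (kap Φ i) r) := by
      ext y; rw [← conv_mconv _ _ hr, mconv_fatKap_kap]
    conv_lhs => rw [e]
    exact h₃ i _ (hr.conv _) m hm y
  set s := fun y => (lowPart Φ (i - 1) r y).re
  set c := fun y => (conv (kap Φ i) r y).re
  have ss : ContDiff ℝ M s := Complex.reCLM.contDiff.comp sS
  have scr : ContDiff ℝ M c := Complex.reCLM.contDiff.comp sc
  have sh : ContDiff ℝ M fun y => s y + θ * c y := ss.add (contDiff_const.mul scr)
  refine ⟨(hF.smooth.comp sh).mul scr, fun m hm y => ?_⟩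
  have hhD : ∀ m ≤ M, ‖iteratedFDeriv ℝ m (fun y => s y + θ * c y) y‖ ≤ C * ((2 : ℝ) ^ i) ^ m * R := fun m hm => by
    have e1 : (fun y => s y + θ * c y) = s + θ • c := rfl
    have hm' : (m : ℕ∞ω) ≤ M := by exact_mod_cast hm
    have hθc : ContDiffAt ℝ m (θ • c) y := ((scr.of_le hm').const_smul θ).contDiffAt
    rw [e1, iteratedFDeriv_add_apply (ss.of_le hm').contDiffAt hθc,
      iteratedFDeriv_const_smul_apply (scr.of_le hm').contDiffAt]
    refine (norm_add_le _ _).trans ?_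
    rw [norm_smul, Real.norm_of_nonneg hθ0]
    have a1 := (iteratedFDeriv_re_le sS hm y).trans (hS m hm y)
    have a2 := (iteratedFDeriv_re_le sc hm y).trans (hc m hm y)
    have a3 : θ * ‖iteratedFDeriv ℝ m c y‖ ≤ C₂ * A * ((2 : ℝ) ^ i) ^ m * R :=
      (mul_le_of_le_one_left (norm_nonneg _) hθ1).trans a2
    have a4 : 0 ≤ (1 + C₃) * (((2 : ℝ) ^ i) ^ m * R) := by positivity
    calc _ ≤ C₁ * A * ((2 : ℝ) ^ i) ^ m * R + C₂ * A * ((2 : ℝ) ^ i) ^ m * R := add_le_add a1 a3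
      _ ≤ _ := by rw [hCdef]; linarith
  refine norm_iteratedFDeriv_comp_mul_le hR hC hK h2i.le toReal_nonneg hx₀ hF.smooth hgK sh scr y ?_ hhD (fun m hm => ?_) hm
  · have := hhD 0 (Nat.zero_le _)
    rw [norm_iteratedFDeriv_zero, pow_zero, mul_one] at this
    exact this
  · refine ((iteratedFDeriv_re_le sc hm y).trans (hcv m hm y)).trans ?_
    refine mul_le_mul_of_nonneg_right (mul_le_mul_of_nonneg_right ?_ (by positivity)) toReal_nonneg
    have := mul_nonneg hC₁ hA0; have := mul_nonneg hC₂ hA0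
    linarith

/-- The increment `F(S_i r) - F(S_{i-1} r)` in the telescoping series for `F(r)`. -/
def increment (F : ℝ → ℝ) (r : Sp N → ℂ) (i : ℤ) (y : Sp N) : ℂ :=
  (F (lowPart Φ i r y).re : ℂ) - (F (lowPart Φ (i - 1) r y).re : ℂ)

/-- The derivative in `θ` of `F(S_{i-1} r + θ Δ_i r)`. -/
def incrementDeriv (g : ℝ → ℝ) (r : Sp N → ℂ) (i : ℤ) (θ : ℝ) (y : Sp N) : ℂ :=
  ((g ((lowPart Φ (i - 1) r y).re + θ * (conv (kap Φ i) r y).re) * (conv (kap Φ i) r y).re : ℝ) : ℂ)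

theorem avg_toReal_le {f : Sp N → ℂ} (hf : BddCts f) (i : ℤ) :
    ∃ B : ℝ, ∀ y, (avg i (fun y => ‖f y‖ₑ) y).toReal ≤ B := by
  obtain ⟨B, hB⟩ := hf.2
  refine ⟨(cMaj N * ofReal B).toReal, fun y => toReal_mono (mul_ne_top cMaj_ne_top ofReal_ne_top) ?_⟩
  exact avg_le_sup i (fun y => by rw [← ofReal_norm]; exact ofReal_le_ofReal (hB y)) y

theorem ofReal_zpow_pow (i : ℤ) (m : ℕ) : ofReal (((2 : ℝ) ^ i) ^ m) = (2 : ℝ≥0∞) ^ ((i : ℝ) * m) := by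
  rw [rpow_mul, ENNReal.rpow_natCast, ENNReal.ofReal_pow (by positivity), ← Real.rpow_intCast,
    ← ofReal_rpow_of_pos (by norm_num)]
  norm_num

theorem exists_incrementDeriv_le (M : ℕ) : ∃ C : ℝ≥0, ∀ (K R : ℝ) (F g : ℝ → ℝ) (r : Sp N → ℂ),
    0 ≤ K → 1 ≤ R → GrowthBound M K R F g → BddCts r → (∀ y, ‖r y‖ ≤ R) → ∀ (i : ℤ) (θ : ℝ), 0 ≤ θ → θ ≤ 1 →
      BddDiff M (incrementDeriv Φ g r i θ) ∧ ∀ m ≤ M, ∀ y, ‖iteratedFDeriv ℝ m (incrementDeriv Φ g r i θ) y‖ₑ ≤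
        (C * ofReal (K * R ^ M) * (2 : ℝ≥0∞) ^ ((i : ℝ) * m)) * avg i (fun y => ‖conv (kap Φ i) r y‖ₑ) y := by
  obtain ⟨C₀, hC₀, h₀⟩ := exists_deriv_increment_le Φ M
  refine ⟨C₀.toNNReal, fun K R F g r hK hR hF hr hrR i θ h0 h1 => ?_⟩
  obtain ⟨B, hB⟩ := avg_toReal_le (hr.conv (kap Φ i)) i
  obtain ⟨hs, hb⟩ := h₀ K R F g r hK hR hF hr hrR i θ h0 h1
  have hKR : 0 ≤ K * R ^ M := by positivity
  generalize K * R ^ M = KR at hb hKR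
  have hfd : ∀ m ≤ M, ∀ y, ‖iteratedFDeriv ℝ m (incrementDeriv Φ g r i θ) y‖ ≤
      C₀ * KR * (((2 : ℝ) ^ i) ^ m * (avg i (fun y => ‖conv (kap Φ i) r y‖ₑ) y).toReal) := fun m hm y =>
    (iteratedFDeriv_ofReal_eq hs hm y).trans (hb m hm y)
  refine ⟨⟨Complex.ofRealCLM.contDiff.comp hs, fun m hm => ⟨C₀ * KR * (((2 : ℝ) ^ i) ^ m * B), fun y => ?_⟩⟩, fun m hm y => ?_⟩
  · refine (hfd m hm y).trans ?_
    exact mul_le_mul_of_nonneg_left (mul_le_mul_of_nonneg_left (hB y) (by positivity)) (mul_nonneg hC₀ hKR)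
  · rw [← ofReal_norm]
    refine (ofReal_le_ofReal (hfd m hm y)).trans_eq ?_
    rw [ofReal_mul (mul_nonneg hC₀ hKR), ofReal_mul hC₀, ofReal_mul (by positivity : (0:ℝ) ≤ ((2 : ℝ) ^ i) ^ m),
      ofReal_zpow_pow, ENNReal.ofReal_toReal (avg_lt_top (hr.conv (kap Φ i)) i y), mul_assoc _ ((2 : ℝ≥0∞) ^ ((i : ℝ) * m))]
    rfl

/-- For `i ≥ j` this is the bound for the increment itself, for `i < j` the increment is smoother than the
scale `2^{-j}` of the kernel, and `exists_gain` applies. -/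
theorem exists_conv_incrementDeriv_le (M : ℕ) : ∃ C : ℝ≥0, ∀ (K R : ℝ) (F g : ℝ → ℝ) (r : Sp N → ℂ),
    0 ≤ K → 1 ≤ R → GrowthBound M K R F g → BddCts r → (∀ y, ‖r y‖ ≤ R) → ∀ (i j : ℤ) (x : Sp N) (θ : ℝ), 0 ≤ θ → θ ≤ 1 →
      ‖conv (kap Φ j) (incrementDeriv Φ g r i θ) x‖ₑ ≤ C * (ofReal (K * R ^ M) * (gainCoef M j i *
        avg j (avg i (fun y => ‖conv (kap Φ i) r y‖ₑ)) x)) := by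
  obtain ⟨C₀, h₀⟩ := exists_incrementDeriv_le Φ M
  obtain ⟨C₁, h₁⟩ := exists_gain M (kapSymb Φ)
  obtain ⟨C₂, h₂⟩ := exists_gain 0 (kapSymb Φ)
  refine ⟨(C₁ + C₂) * C₀, fun K R F g r hK hR hF hr hrR i j x θ h0 h1 => ?_⟩
  obtain ⟨hbd, hen⟩ := h₀ K R F g r hK hR hF hr hrR i θ h0 h1
  have hbd0 : BddDiff 0 (incrementDeriv Φ g r i θ) :=
    ⟨hbd.1.of_le (by simp), fun m hm => hbd.2 m (by omega)⟩
  have hvm : Measurable (avg i (fun y => ‖conv (kap Φ i) r y‖ₑ)) := measurable_avg i (hr.conv (kap Φ i)).1.enorm.measurable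
  generalize avg i (fun y => ‖conv (kap Φ i) r y‖ₑ) = v at hen hvm ⊢
  generalize incrementDeriv Φ g r i θ = f at *
  generalize ofReal (K * R ^ M) = KR at *
  have hgen : ∀ (n : ℕ) (C : ℝ≥0), n ≤ M → C ≤ C₁ + C₂ → 2 ^ (-(j : ℝ) * n) * (2 : ℝ≥0∞) ^ ((i : ℝ) * n) = gainCoef M j i →
      ‖conv (kap Φ j) f x‖ₑ ≤ C * (2 ^ (-(j : ℝ) * n) * avg j (fun y => ‖iteratedFDeriv ℝ n f y‖ₑ) x) →
      ‖conv (kap Φ j) f x‖ₑ ≤ ((C₁ + C₂) * C₀ : ℝ≥0) * (KR * (gainCoef M j i * avg j v x)) := by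
    intro n C hn hC hg h
    refine h.trans ?_
    have h3 := avg_mono j (hen n hn) x
    rw [avg_const_mul _ _ hvm] at h3
    have hC' : (C : ℝ≥0∞) ≤ (C₁ + C₂ : ℝ≥0) := by exact_mod_cast hC
    calc (C : ℝ≥0∞) * (2 ^ (-(j : ℝ) * n) * avg j (fun y => ‖iteratedFDeriv ℝ n f y‖ₑ) x)
        ≤ (C₁ + C₂ : ℝ≥0) * (2 ^ (-(j : ℝ) * n) * ((C₀ * KR * (2 : ℝ≥0∞) ^ ((i : ℝ) * n)) * avg j v x)) :=
          mul_le_mul' hC' (mul_le_mul_right h3 _)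
      _ = (C₁ + C₂ : ℝ≥0) * C₀ * (KR * ((2 ^ (-(j : ℝ) * n) * (2 : ℝ≥0∞) ^ ((i : ℝ) * n)) * avg j v x)) := by ring
      _ = _ := by rw [hg, ENNReal.coe_mul]
  by_cases hij : i ≤ j
  · refine hgen M C₁ le_rfl le_self_add ?_ (h₁ j _ hbd x)
    rw [← rpow_add _ _ (by norm_num) (by norm_num), gainCoef, min_eq_right (by omega)]
    congr 1; push_cast; ring
  · refine hgen 0 C₂ (Nat.zero_le _) le_add_self ?_ (h₂ j _ hbd0 x)
    rw [← rpow_add _ _ (by norm_num) (by norm_num), gainCoef, min_eq_left (by omega)]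
    congr 1; push_cast; ring

theorem continuous_incrementDeriv {g : ℝ → ℝ} (hg : Continuous g) {r : Sp N → ℂ} (hr : BddCts r) (i : ℤ) :
    Continuous fun q : ℝ × Sp N => incrementDeriv Φ g r i q.1 q.2 := by
  have hcS : Continuous (lowPart Φ (i - 1) r) := (hr.conv _).1
  have hcr : Continuous (conv (kap Φ i) r) := (hr.conv _).1
  have h1 : Continuous fun q : ℝ × Sp N => (conv (kap Φ i) r q.2).re := Complex.continuous_re.comp (hcr.comp continuous_snd)
  have h2 : Continuous fun q : ℝ × Sp N => (lowPart Φ (i - 1) r q.2).re := Complex.continuous_re.comp (hcS.comp continuous_snd)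
  exact Complex.continuous_ofReal.comp ((hg.comp (h2.add (continuous_fst.mul h1))).mul h1)

theorem integral_deriv_affine {F g : ℝ → ℝ} (hg : Continuous g) (hF : ∀ x, HasDerivAt F (g x) x) (a b : ℝ) :
    ∫ θ in Ioc (0 : ℝ) 1, ((g (a + θ * b) * b : ℝ) : ℂ) = (F (a + b) : ℂ) - (F a : ℂ) := by
  have hd : ∀ θ ∈ uIcc (0 : ℝ) 1, HasDerivAt (fun θ : ℝ => F (a + θ * b)) (g (a + θ * b) * b) θ := fun θ _ => by
    have h1 : HasDerivAt (fun θ : ℝ => a + θ * b) b θ := by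
      simpa using ((hasDerivAt_id θ).mul_const b).const_add a
    exact (hF _).comp θ h1
  have hcy : Continuous fun θ => g (a + θ * b) * b := by fun_prop
  have := intervalIntegral.integral_eq_sub_of_hasDerivAt hd (hcy.intervalIntegrable _ _)
  rw [intervalIntegral.integral_of_le zero_le_one] at this
  have h2 := integral_ofReal (𝕜 := ℂ) (μ := volume.restrict (Ioc (0:ℝ) 1)) (f := fun θ => g (a + θ * b) * b)
  refine h2.trans ?_
  rw [this]
  simp

/-- The increment is the average over `θ` of its derivative. -/
theorem increment_eq {M : ℕ} {K R : ℝ} {F g : ℝ → ℝ} {r : Sp N → ℂ} (hF : GrowthBound M K R F g)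
    (hr : BddCts r) (i : ℤ) (y : Sp N) :
    increment Φ F r i y = ∫ θ in Ioc (0 : ℝ) 1, incrementDeriv Φ g r i θ y := by
  simp only [incrementDeriv]
  rw [integral_deriv_affine hF.smooth.continuous hF.hasDerivAt, increment, lowPart_succ Φ i hr, Complex.add_re]

theorem conv_increment_eq {M : ℕ} {K R : ℝ} {F g : ℝ → ℝ} {r : Sp N → ℂ} (hF : GrowthBound M K R F g)
    (hr : BddCts r) {B : ℝ} {i : ℤ} (hB : ∀ θ, 0 ≤ θ → θ ≤ 1 → ∀ y, ‖incrementDeriv Φ g r i θ y‖ ≤ B)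
    (α : 𝓢(Sp N, ℂ)) (x : Sp N) :
    conv α (increment Φ F r i) x = ∫ θ in Ioc (0 : ℝ) 1, conv α (incrementDeriv Φ g r i θ) x := by
  have hfc := continuous_incrementDeriv Φ hF.smooth.continuous hr i
  have hinc := increment_eq Φ hF hr i
  simp only [conv, hinc]
  have e : ∀ y, (∫ θ in Ioc (0 : ℝ) 1, incrementDeriv Φ g r i θ y) • α (x - y) = ∫ θ in Ioc (0 : ℝ) 1, incrementDeriv Φ g r i θ y • α (x - y) := fun y =>
    (integral_smul_const _ _).symm
  simp_rw [e]
  refine integral_integral_swap ?_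
  have hI : Integrable (fun q : Sp N × ℝ => α (x - q.1)) (volume.prod (volume.restrict (Ioc (0 : ℝ) 1))) := by
    have := ((α.integrable (μ := volume)).comp_sub_left x).mul_prod (integrable_const (1 : ℂ) (μ := volume.restrict (Ioc (0 : ℝ) 1)))
    simpa using this
  refine hI.bdd_smul B (φ := fun q : Sp N × ℝ => incrementDeriv Φ g r i q.2 q.1)
    (hfc.comp continuous_swap).aestronglyMeasurable ?_
  filter_upwards [Measure.quasiMeasurePreserving_snd.ae (ae_restrict_mem (μ := volume) (measurableSet_Ioc (a := (0 : ℝ)) (b := 1)))] with q hq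
  exact hB q.2 hq.1.le hq.2 q.1

theorem exists_conv_increment_le (M : ℕ) : ∃ C : ℝ≥0, ∀ (K R : ℝ) (F g : ℝ → ℝ) (r : Sp N → ℂ),
    0 ≤ K → 1 ≤ R → GrowthBound M K R F g → BddCts r → (∀ y, ‖r y‖ ≤ R) → ∀ (i j : ℤ) (x : Sp N),
      ‖conv (kap Φ j) (increment Φ F r i) x‖ₑ ≤ C * (ofReal (K * R ^ M) * (gainCoef M j i *
        avg j (avg i (fun y => ‖conv (kap Φ i) r y‖ₑ)) x)) := by
  obtain ⟨C, hC⟩ := exists_conv_incrementDeriv_le Φ M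
  obtain ⟨C₀, h₀⟩ := exists_incrementDeriv_le Φ M
  refine ⟨C, fun K R F g r hK hR hF hr hrR i j x => ?_⟩
  obtain ⟨B, hB⟩ := avg_toReal_le (hr.conv (kap Φ i)) i
  have hbd : ∀ θ, 0 ≤ θ → θ ≤ 1 → ∀ y, ‖incrementDeriv Φ g r i θ y‖ ≤ C₀ * (ofReal (K * R ^ M)).toReal * B := fun θ h0 h1 y => by
    have h := (h₀ K R F g r hK hR hF hr hrR i θ h0 h1).2 0 (Nat.zero_le _) y
    rw [← ofReal_norm, norm_iteratedFDeriv_zero] at h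
    simp only [Nat.cast_zero, mul_zero, rpow_zero, mul_one] at h
    have h2 := toReal_mono (mul_ne_top (mul_ne_top coe_ne_top ofReal_ne_top)
      (avg_lt_top (hr.conv (kap Φ i)) i y)) h
    rw [ENNReal.toReal_ofReal (norm_nonneg _), ENNReal.toReal_mul, ENNReal.toReal_mul, ENNReal.coe_toReal] at h2
    exact h2.trans (mul_le_mul_of_nonneg_left (hB y) (by positivity))
  rw [conv_increment_eq Φ hF hr hbd]
  refine (enorm_integral_le_lintegral_enorm _).trans ?_
  refine (setLIntegral_mono measurable_const fun θ hθ => hC K R F g r hK hR hF hr hrR i j x θ hθ.1.le hθ.2).trans ?_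
  simp

theorem integral_kap (j : ℤ) : ∫ z, kap Φ j z = 0 := by
  have h1 : 𝓕 (kap Φ j) 0 = 0 := by
    rw [fourier_kap]
    have : Φ.φ 0 = 0 := by
      by_contra h
      have := (Φ.annulus 0 h).1
      rw [norm_zero] at this; norm_num at this
    simp [this]
  rw [fourier_coe, Real.fourier_eq] at h1
  simpa using h1

/-- Dominated convergence in a convolution. -/
theorem tendsto_conv {b : ℕ → Sp N → ℂ} {b' : Sp N → ℂ} (hc : ∀ n, Continuous (b n)) {B : ℝ}
    (hB : ∀ n y, ‖b n y‖ ≤ B) (h : ∀ y, Filter.Tendsto (fun n => b n y) Filter.atTop (nhds (b' y)))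
    (α : 𝓢(Sp N, ℂ)) (x : Sp N) :
    Filter.Tendsto (fun n => conv α (b n) x) Filter.atTop (nhds (conv α b' x)) := by
  refine tendsto_integral_of_dominated_convergence (fun y => B * ‖α (x - y)‖)
    (fun n => ((hc n).smul (α.continuous.comp (by fun_prop))).aestronglyMeasurable)
    ((α.integrable.norm.comp_sub_left x).const_mul B)
    (fun n => .of_forall fun y => ?_) (.of_forall fun y => (h y).smul_const _)
  rw [norm_smul]; exact mul_le_mul_of_nonneg_right (hB n y) (norm_nonneg _)

/-- `F(r)` is, up to constants that the block `Δ_j` does not see, the sum of its increments. -/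
theorem enorm_conv_comp_le_tsum {M : ℕ} {K R : ℝ} {F g : ℝ → ℝ} {r : Sp N → ℂ} (hF : GrowthBound M K R F g)
    (hr : BddCts r) (j : ℤ) (x : Sp N) :
    BddCts (fun y => (F (r y).re : ℂ)) ∧
    ‖conv (kap Φ j) (fun y => (F (r y).re : ℂ)) x‖ₑ ≤ ∑' i, ‖conv (kap Φ j) (increment Φ F r i) x‖ₑ := by
  have hFc : Continuous F := continuous_iff_continuousAt.2 fun x => (hF.hasDerivAt x).continuousAt
  obtain ⟨hrc, B, hB⟩ := id hr
  have hB0 : 0 ≤ B := (norm_nonneg _).trans (hB 0)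
  set B' := B + B * ∫ z, ‖lowKap Φ z‖
  have hlow : ∀ i y, ‖lowPart Φ i r y‖ ≤ B' := fun i y => by
    refine (norm_conv_le hB _ _).trans ?_
    have e : ∫ z, ‖dil i (lowKap Φ) z‖ = ∫ z, ‖lowKap Φ z‖ := by
      have h2 : (0 : ℝ) < 2 ^ i := by positivity
      have := Measure.integral_comp_smul (volume : Measure (Sp N)) (fun z => ‖lowKap Φ z‖) ((2 : ℝ) ^ i)
      rw [finrank_euclideanSpace, Fintype.card_fin, abs_of_pos (by positivity), eq_inv_smul_iff₀ (by positivity)] at this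
      rw [← this, ← integral_smul]
      congr 1; ext z
      rw [dil_apply, norm_mul, Complex.norm_of_nonneg (by positivity), smul_eq_mul]
    rw [e]; linarith
  have hrB : ∀ y, ‖r y‖ ≤ B' := fun y => (hB y).trans (le_add_of_nonneg_right (mul_nonneg hB0 (integral_nonneg fun _ => norm_nonneg _)))
  obtain ⟨D, hD⟩ := (isCompact_Icc (a := -B') (b := B')).exists_bound_of_continuousOn hFc.continuousOn
  have hre : ∀ z : ℂ, ‖z‖ ≤ B' → ‖(F z.re : ℂ)‖ ≤ D := fun z hz => by
    rw [Complex.norm_real]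
    exact hD _ (abs_le.1 ((Complex.abs_re_le_norm z).trans hz))
  have hcomp : ∀ {s : Sp N → ℂ}, Continuous s → Continuous fun y => (F (s y).re : ℂ) := fun hs =>
    Complex.continuous_ofReal.comp (hFc.comp (Complex.continuous_re.comp hs))
  have hb : BddCts (fun y => (F (r y).re : ℂ)) := ⟨hcomp hrc, D, fun y => hre _ (hrB y)⟩
  refine ⟨hb, ?_⟩
  have hlc : ∀ i, BddCts (fun y => (F (lowPart Φ i r y).re : ℂ)) := fun i => ⟨hcomp (hr.conv _).1, D, fun y => hre _ (hlow i y)⟩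
  have hsub : ∀ {s t : Sp N → ℂ}, BddCts s → BddCts t → conv (kap Φ j) (fun y => s y - t y) x = conv (kap Φ j) s x - conv (kap Φ j) t x := fun hs ht => by
    rw [conv, conv, conv, ← integral_sub (hs.integrable_smul _ x) (ht.integrable_smul _ x)]
    congr 1; ext y; rw [sub_smul]
  have key : ∀ n : ℕ, ∑ i ∈ Finset.Ioc (-(n : ℤ)) n, conv (kap Φ j) (increment Φ F r i) x =
      conv (kap Φ j) (fun y => (F (lowPart Φ n r y).re : ℂ)) x - conv (kap Φ j) (fun y => (F (lowPart Φ (-n) r y).re : ℂ)) x := fun n => by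
    have key' : ∀ (m : ℤ) (q : ℕ), ∑ i ∈ Finset.Ioc m (m + q), conv (kap Φ j) (increment Φ F r i) x =
      conv (kap Φ j) (fun y => (F (lowPart Φ (m + q) r y).re : ℂ)) x - conv (kap Φ j) (fun y => (F (lowPart Φ m r y).re : ℂ)) x := fun m q => by
      induction q with
      | zero => simp
      | succ q ih =>
        have : Finset.Ioc m (m + (q + 1 : ℕ)) = insert (m + q + 1) (Finset.Ioc m (m + q)) := by
          ext j; simp only [Finset.mem_Ioc, Finset.mem_insert]; omega
        rw [this, Finset.sum_insert (by simp), ih, Nat.cast_add, Nat.cast_one, ← add_assoc]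
        have e : conv (kap Φ j) (increment Φ F r (m + q + 1)) x = conv (kap Φ j) (fun y => (F (lowPart Φ (m + q + 1) r y).re : ℂ)) x - conv (kap Φ j) (fun y => (F (lowPart Φ (m + q) r y).re : ℂ)) x := by
          rw [← hsub (hlc _) (hlc _)]
          have e3 : m + q + 1 - 1 = m + q := by ring
          congr 1; funext y; rw [increment, e3]
        rw [e]; ring
    have := key' (-n) (2 * n)
    rw [show (-(n : ℤ) + ((2 * n : ℕ) : ℤ)) = n by push_cast; ring] at this
    exact this
  have t1 : Filter.Tendsto (fun n : ℕ => conv (kap Φ j) (fun y => (F (lowPart Φ n r y).re : ℂ)) x) Filter.atTop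
      (nhds (conv (kap Φ j) (fun y => (F (r y).re : ℂ)) x)) := by
    refine tendsto_conv (fun n => (hlc n).1) (fun n y => hre _ (hlow n y)) (fun y => ?_) _ x
    exact ((Complex.continuous_ofReal.comp (hFc.comp Complex.continuous_re)).tendsto _).comp (tendsto_conv_dil_lowKap Φ hr y)
  have t2 : Filter.Tendsto (fun n : ℕ => conv (kap Φ j) (fun y => (F (lowPart Φ (-n) r y).re : ℂ)) x) Filter.atTop (nhds 0) := by
    -- the kernel has mean zero, so that constants may be subtracted
    have hconst : ∀ c : ℂ, conv (kap Φ j) (fun _ => c) x = 0 := fun c => by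
      rw [conv, integral_smul, integral_sub_left_eq_self (fun z => kap Φ j z) volume x, integral_kap, smul_zero]
    have e : ∀ n : ℕ, conv (kap Φ j) (fun y => (F (lowPart Φ (-n) r y).re : ℂ)) x =
        conv (kap Φ j) (fun y => (F (lowPart Φ (-n) r y).re : ℂ) - (F (lowPart Φ (-n) r x).re : ℂ)) x := fun n => by
      rw [hsub (hlc _) ⟨continuous_const, _, fun _ => le_rfl⟩, hconst, sub_zero]
    simp_rw [e]
    have h0 : conv (kap Φ j) (fun _ => 0) x = 0 := hconst 0
    rw [← h0]
    refine tendsto_conv (B := D + D) (fun n => (hlc _).1.sub continuous_const) (fun n y => (norm_sub_le _ _).trans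
      (add_le_add (hre _ (hlow _ y)) (hre _ (hlow _ x)))) (fun y => ?_) _ x
    have huc := (isCompact_Icc (a := -B') (b := B')).uniformContinuousOn_of_continuous hFc.continuousOn
    have hd := tendsto_conv_dil_sub (lowKap Φ) hr x y
    rw [Metric.tendsto_atTop] at hd ⊢
    intro ε hε
    obtain ⟨δ, hδ, hδ'⟩ := Metric.uniformContinuousOn_iff.1 huc ε hε
    obtain ⟨n₀, hn₀⟩ := hd δ hδ
    refine ⟨n₀, fun n hn => ?_⟩
    have h1 := hn₀ n hn
    rw [dist_zero_right] at h1 ⊢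
    change ‖((F _ : ℝ) : ℂ) - ((F _ : ℝ) : ℂ)‖ < ε
    rw [← Complex.ofReal_sub, Complex.norm_real, ← dist_eq_norm]
    refine hδ' _ (abs_le.1 ((Complex.abs_re_le_norm _).trans (hlow _ y))) _ (abs_le.1 ((Complex.abs_re_le_norm _).trans (hlow _ x))) ?_
    rw [Real.dist_eq, ← Complex.sub_re]
    exact (Complex.abs_re_le_norm _).trans_lt h1
  have t3 := t1.sub t2
  rw [sub_zero] at t3
  have t4 := (t3.congr fun n => (key n).symm).enorm
  refine le_of_tendsto t4 (.of_forall fun n => ?_)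
  exact (enorm_sum_le _ _).trans (ENNReal.sum_le_tsum _)

/-- The blocks of `F(r)` in terms of the blocks of `r`. -/
theorem exists_nrm_conv_comp_le (M : ℕ) : ∃ C : ℝ≥0, ∀ (p : ℝ) (_ : 1 ≤ p) (K R : ℝ) (F g : ℝ → ℝ) (r : Sp N → ℂ),
    0 ≤ K → 1 ≤ R → GrowthBound M K R F g → BddCts r → (∀ y, ‖r y‖ ≤ R) → ∀ j : ℤ,
      nrm p (fun x => ‖conv (kap Φ j) (fun y => (F (r y).re : ℂ)) x‖ₑ) ≤
        C * (ofReal (K * R ^ M) * ∑' i, gainCoef M j i * nrm p (fun x => ‖conv (kap Φ i) r x‖ₑ)) := by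
  obtain ⟨C, hC⟩ := exists_conv_increment_le Φ M
  refine ⟨C * (cMaj N ^ 4).toNNReal, fun p hp K R F g r hK hR hF hr hrR j => ?_⟩
  have hp0 : 0 ≤ p := by linarith
  have hm : ∀ i, Measurable fun x => ‖conv (kap Φ i) r x‖ₑ := fun i => (hr.conv _).1.enorm.measurable
  have hm1 : ∀ i, Measurable (avg i fun x => ‖conv (kap Φ i) r x‖ₑ) := fun i => measurable_avg i (hm i)
  have hm2 : ∀ i, Measurable (avg j (avg i fun x => ‖conv (kap Φ i) r x‖ₑ)) := fun i => measurable_avg j (hm1 i)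
  have h1 : ∀ x, ‖conv (kap Φ j) (fun y => (F (r y).re : ℂ)) x‖ₑ ≤ ∑' i, (C * (ofReal (K * R ^ M) * gainCoef M j i)) *
        avg j (avg i (fun y => ‖conv (kap Φ i) r y‖ₑ)) x := fun x =>
    (enorm_conv_comp_le_tsum Φ hF hr j x).2.trans (tsum_le_tsum fun i => (hC K R F g r hK hR hF hr hrR i j x).trans_eq (by ring))
  refine (nrm_mono hp0 h1).trans ((nrm_tsum_le hp fun i => (hm2 i).const_mul _).trans ?_)
  have hfin : cMaj N ^ 4 ≠ ⊤ := ENNReal.pow_ne_top cMaj_ne_top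
  rw [← ENNReal.tsum_mul_left, ← ENNReal.tsum_mul_left]
  refine tsum_le_tsum fun i => ?_
  rw [nrm_const_mul (by linarith) _ (hm2 i), ENNReal.coe_mul, coe_toNNReal hfin]
  calc _ ≤ (C * (ofReal (K * R ^ M) * gainCoef M j i)) * (cMaj N ^ 2 * (cMaj N ^ 2 * nrm p (fun x => ‖conv (kap Φ i) r x‖ₑ))) := by
        refine mul_le_mul_right ((nrm_avg_le j hp (hm1 i)).trans (mul_le_mul_right (nrm_avg_le i hp (hm i)) _)) _
    _ = _ := by ring

/-! ### Coefficients at a fixed time -/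

/-- Bernstein's inequality for the blocks of a distribution. -/
theorem exists_enorm_cv_kap_le : ∃ C : ℝ≥0, ∀ (p : ℝ) (_ : 1 ≤ p) (f : 𝓢'(Sp N, ℂ)) (k : ℤ) (x : Sp N),
    ‖cv f (kap Φ k) x‖ₑ ≤ C * (2 ^ ((k : ℝ) * (N / p)) * nrm p fun y => ‖cv f (kap Φ k) y‖ₑ) := by
  obtain ⟨C, -, hC⟩ := exists_enorm_cv_le Φ
  refine ⟨C * (cMaj N).toNNReal, fun p hp f k x => (hC f k x).trans ?_⟩
  rw [ENNReal.coe_mul, coe_toNNReal cMaj_ne_top, mul_assoc]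
  exact mul_le_mul_right (avg_le_nrm k hp (measurable_enorm_cv f _) x) _

theorem conv_fatKap_conv_kap (j : ℤ) {b : Sp N → ℂ} (hb : BddCts b) (x : Sp N) :
    conv (fatKap Φ j) (conv (kap Φ j) b) x = conv (kap Φ j) b x := by
  rw [← conv_mconv _ _ hb, mconv_fatKap_kap]

/-- Bernstein's inequality for the blocks of a bounded function. -/
theorem exists_enorm_conv_kap_le : ∃ C : ℝ≥0, ∀ (p : ℝ) (_ : 1 ≤ p) (b : Sp N → ℂ), BddCts b → ∀ (k : ℤ) (x : Sp N),
    ‖conv (kap Φ k) b x‖ₑ ≤ C * (2 ^ ((k : ℝ) * (N / p)) * nrm p fun y => ‖conv (kap Φ k) b y‖ₑ) := by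
  obtain ⟨C, hC⟩ := exists_kerBd (∑ i ∈ ({-1, 0, 1} : Finset ℤ), kap Φ i)
  refine ⟨C * (cMaj N).toNNReal, fun p hp b hb k x => ?_⟩
  rw [← conv_fatKap_conv_kap Φ k hb x]
  refine (enorm_conv_le (hC k) (hb.conv _).1 x).trans ?_
  rw [ENNReal.coe_mul, coe_toNNReal cMaj_ne_top, mul_assoc]
  exact mul_le_mul_right (avg_le_nrm k hp (hb.conv _).1.enorm.measurable x) _

theorem Represents.cv_eq {g : Sp N → ℂ} {f : 𝓢'(Sp N, ℂ)} (h : Represents g f) (α : 𝓢(Sp N, ℂ)) (x : Sp N) :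
    cv f α x = conv α g x := by
  rw [conv_eq, cv, (h (rt α x)).2]; simp only [rt_apply]

theorem HasSum.apply_test {ι : Type*} {F : ι → 𝓢'(Sp N, ℂ)} {f : 𝓢'(Sp N, ℂ)} (h : HasSum F f) (χ : 𝓢(Sp N, ℂ)) :
    HasSum (fun i => F i χ) (f χ) :=
  (PointwiseConvergenceCLM.evalCLM (RingHom.id ℂ) ℂ χ).hasSum h

/-- A distribution that is the uniformly convergent sum of its blocks is a bounded continuous function. -/
theorem exists_bddCts_represents {p : ℝ} (hp : 1 ≤ p) : ∃ C : ℝ≥0, ∀ f : 𝓢'(Sp N, ℂ),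
    HasSum (fun k : ℤ => block Φ k f) f →
    ∑' k : ℤ, 2 ^ ((k : ℝ) * (N / p)) * nrm p (fun y => ‖cv f (kap Φ k) y‖ₑ) ≠ ⊤ →
    ∃ A, BddCts A ∧ Represents A f ∧
      ∀ x, ‖A x‖ₑ ≤ C * ∑' k : ℤ, 2 ^ ((k : ℝ) * (N / p)) * nrm p fun y => ‖cv f (kap Φ k) y‖ₑ := by
  obtain ⟨C, hC⟩ := exists_enorm_cv_kap_le Φ
  refine ⟨C, fun f h hs => ?_⟩
  set B : ℤ → ℝ≥0∞ := fun k => C * (2 ^ ((k : ℝ) * (N / p)) * nrm p fun y => ‖cv f (kap Φ k) y‖ₑ) with hBdef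
  have hB : ∑' k, B k ≠ ⊤ := by
    rw [ENNReal.tsum_mul_left]; exact mul_ne_top coe_ne_top hs
  have hBk : ∀ k, B k ≠ ⊤ := fun k => ne_top_of_tsum_ne_top hB k
  have hBs : Summable fun k => (B k).toReal := ENNReal.summable_toReal hB
  have hle : ∀ k x, ‖cv f (kap Φ k) x‖ ≤ (B k).toReal := fun k x => by
    have := toReal_mono (hBk k) (hC p hp f k x)
    rwa [toReal_enorm] at this
  have hsx : ∀ x, HasSum (fun k => cv f (kap Φ k) x) (∑' k, cv f (kap Φ k) x) := fun x =>
    (Summable.of_norm_bounded hBs fun k => hle k x).hasSum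
  have hA : BddCts fun x => ∑' k, cv f (kap Φ k) x :=
    ⟨continuous_tsum (fun k => continuous_cv f _) hBs hle, _, fun x => tsum_of_norm_bounded hBs.hasSum fun k => hle k x⟩
  refine ⟨_, hA, fun χ => ⟨?_, ?_⟩, fun x => enorm_tsum_le_tsum_enorm.trans ?_⟩
  · obtain ⟨D, hD⟩ := hA.2
    exact χ.integrable.mul_bdd hA.1.aestronglyMeasurable (.of_forall hD)
  · refine (HasSum.apply_test h χ).unique ?_
    have h1 : ∀ k, block Φ k f χ = ∫ x, χ x * cv f (kap Φ k) x := fun k => (represents_block Φ k f χ).2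
    simp_rw [h1]
    have h2 : ∀ x, χ x * ∑' k, cv f (kap Φ k) x = ∑' k, χ x * cv f (kap Φ k) x := fun x => tsum_mul_left.symm
    simp_rw [h2]
    refine hasSum_integral_of_summable_integral_norm (fun k => (represents_block Φ k f χ).1) ?_
    refine Summable.of_nonneg_of_le (fun k => integral_nonneg fun x => norm_nonneg _) (fun k => ?_) (hBs.mul_left (∫ x, ‖χ x‖))
    rw [← integral_mul_const]
    refine integral_mono (represents_block Φ k f χ).1.norm (χ.integrable.norm.mul_const _) fun x => ?_
    simp only [norm_mul]
    exact mul_le_mul_of_nonneg_left (hle k x) (norm_nonneg _)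
  · rw [← ENNReal.tsum_mul_left]
    exact tsum_le_tsum fun k => hC p hp f k x

theorem two_rpow_ofReal (x : ℝ) : ofReal ((2 : ℝ) ^ x) = (2 : ℝ≥0∞) ^ x := by
  rw [← ofReal_rpow_of_pos (by norm_num)]; norm_num

theorem conv_kap_const (j : ℤ) (c : ℂ) (x : Sp N) : conv (kap Φ j) (fun _ => c) x = 0 := by
  rw [conv, integral_smul, integral_sub_left_eq_self (fun z => kap Φ j z) volume x, integral_kap, smul_zero]

theorem conv_add_right (α : 𝓢(Sp N, ℂ)) {f g : Sp N → ℂ} (hf : BddCts f) (hg : BddCts g) (x : Sp N) :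
    conv α (fun y => f y + g y) x = conv α f x + conv α g x := by
  rw [conv, conv, conv, ← integral_add (hf.integrable_smul _ x) (hg.integrable_smul _ x)]
  congr 1; ext y; rw [add_smul]

/-- A continuous function is bounded by its essential supremum. -/
theorem norm_le_of_ae_le {r : Sp N → ℂ} (hr : Continuous r) {R : ℝ} (h : ∀ᵐ x, ‖r x‖ ≤ R) (x : Sp N) : ‖r x‖ ≤ R := by
  have hd : Dense {x | ‖r x‖ ≤ R} := Measure.dense_of_ae h
  have h1 : x ∈ closure {x | ‖r x‖ ≤ R} := hd x
  rw [(isClosed_le hr.norm continuous_const).closure_eq] at h1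
  exact h1

/-- The coefficient `F(ρ)` agrees almost everywhere with a bounded continuous function, whose blocks
are controlled by those of the fluctuation `a = ρ - ρc`. -/
theorem exists_coefficient {p : ℝ} (hp : 1 ≤ p) : ∃ C : ℝ≥0, ∀ (K : ℝ) (J : Set ℝ) (F : ℝ → ℝ) (ρ : Sp N → ℝ)
    (ρc : ℝ) (a : 𝓢'(Sp N, ℂ)), IsOpen J → J.OrdConnected → SmoothBoundedOn F J (⌊(N : ℝ) / p⌋₊ + 4) K →
    Represents (fun x => ((ρ x - ρc : ℝ) : ℂ)) a → HasSum (fun k : ℤ => block Φ k a) a → (∀ᵐ x, ρ x ∈ J) →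
    besovNorm Φ oneWeight p (N / p) a ≠ ⊤ →
    ∃ b : Sp N → ℂ, BddCts b ∧ (∀ᵐ x, b x = (F (ρ x) : ℂ)) ∧ ∀ j, nrm p (fun x => ‖conv (kap Φ j) b x‖ₑ) ≤
      C * (ofReal K * (1 + eLpNorm ρ ⊤ volume) ^ (⌊(N : ℝ) / p⌋₊ + 2) *
        ∑' i, gainCoef (⌊(N : ℝ) / p⌋₊ + 2) j i * nrm p (fun x => ‖cv a (kap Φ i) x‖ₑ)) := by
  obtain ⟨C, hC⟩ := exists_nrm_conv_comp_le Φ (⌊(N : ℝ) / p⌋₊ + 2)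
  refine ⟨C, fun K J F ρ ρc a hJ hJc hF hrep hsum hρJ hfin => ?_⟩
  have hs : ∑' k : ℤ, 2 ^ ((k : ℝ) * (N / p)) * nrm p (fun y => ‖cv a (kap Φ k) y‖ₑ) ≠ ⊤ := by
    convert hfin using 1
    refine tsum_congr fun k => ?_
    rw [lpNorm_block Φ k hp, oneWeight, mul_one, two_rpow_ofReal]
  obtain ⟨A, hA, hAr, -⟩ := (exists_bddCts_represents Φ hp).choose_spec a hsum hs
  have hae := hAr.ae_eq hrep
  set r : Sp N → ℂ := fun x => A x + (ρc : ℂ) with hr_def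
  have hcst : BddCts fun _ : Sp N => (ρc : ℂ) := ⟨continuous_const, _, fun _ => le_rfl⟩
  have hr : BddCts r := ⟨hA.1.add continuous_const, hA.2.choose + ‖(ρc : ℂ)‖, fun y =>
    (norm_add_le _ _).trans (add_le_add (hA.2.choose_spec y) le_rfl)⟩
  have hrρ : ∀ᵐ x, r x = (ρ x : ℂ) := hae.mono fun x hx => by
    simp only [hr_def, hx]; push_cast; ring
  have hconv : ∀ i x, conv (kap Φ i) r x = cv a (kap Φ i) x := fun i x => by
    rw [conv_add_right _ hA hcst, conv_kap_const, add_zero, hAr.cv_eq]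
  have hρfin : eLpNorm ρ ⊤ volume ≠ ⊤ := by
    obtain ⟨D, hD⟩ := hr.2
    rw [eLpNorm_exponent_top]
    refine ne_top_of_le_ne_top ofReal_ne_top (essSup_le_of_ae_le (ofReal D) (hrρ.mono fun x hx => ?_))
    change ‖ρ x‖ₑ ≤ ofReal D
    rw [← ofReal_norm]
    refine ofReal_le_ofReal ?_
    have := hD x
    rwa [hx, Complex.norm_real] at this
  set R₀ := (eLpNorm ρ ⊤ volume).toReal with hR₀
  have hρR : ∀ᵐ x, |ρ x| ≤ R₀ := by
    filter_upwards [ae_le_eLpNormEssSup (f := ρ) (μ := (volume : Measure (Sp N)))] with x hx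
    rw [← eLpNorm_exponent_top] at hx
    have := toReal_mono hρfin hx
    rwa [toReal_enorm, Real.norm_eq_abs] at this
  have hR₀n : 0 ≤ R₀ := toReal_nonneg
  have hrR : ∀ y, ‖r y‖ ≤ 1 + R₀ := fun y => (norm_le_of_ae_le hr.1 (by
    filter_upwards [hrρ, hρR] with x h1 h2
    rw [h1, Complex.norm_real]; exact h2) y).trans (by linarith)
  obtain ⟨x, hxJ, hxR⟩ := (hρJ.and hρR).exists
  have hK : 0 ≤ K := (abs_nonneg _).trans (hF.2 1 le_rfl (by omega) _ hxJ)
  obtain ⟨E, g, hg, hE, hEF, hgK⟩ := exists_extension hJ hJc hxJ (M := ⌊(N : ℝ) / p⌋₊ + 2) hF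
  have hG : GrowthBound (⌊(N : ℝ) / p⌋₊ + 2) K (1 + R₀) E g := ⟨hg, hE, ρ x, by linarith, hgK⟩
  refine ⟨fun y => (E (r y).re : ℂ), (enorm_conv_comp_le_tsum Φ hG hr 0 0).1, ?_, fun j => ?_⟩
  · filter_upwards [hrρ, hρJ] with y h1 h2
    rw [h1, Complex.ofReal_re, hEF h2]
  · refine (hC p hp K (1 + R₀) E g r hK (by linarith) hG hr hrR j).trans_eq ?_
    simp_rw [hconv]
    rw [ofReal_mul hK, ENNReal.ofReal_pow (by linarith), ENNReal.ofReal_add zero_le_one hR₀n,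
      ENNReal.ofReal_toReal hρfin, ENNReal.ofReal_one]

/-! ### The commutator with a coefficient at a fixed time -/

/-- `2^{jN/p}` times the `L^p` norm of the `j`-th block, which controls its supremum. -/
def blockSup (p : ℝ) (b : Sp N → ℂ) (j : ℤ) : ℝ≥0∞ :=
  2 ^ ((j : ℝ) * (N / p)) * nrm p fun y => ‖conv (kap Φ j) b y‖ₑ

theorem two_zpow_ofReal (k : ℤ) : ofReal ((2 : ℝ) ^ k) = (2 : ℝ≥0∞) ^ (k : ℝ) := by
  rw [← Real.rpow_intCast, two_rpow_ofReal]

theorem exists_block_increment_le : ∃ C : ℝ≥0, ∀ (p : ℝ) (_ : 1 ≤ p) (b : Sp N → ℂ), BddCts b →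
    ∀ (j : ℤ), blockSup Φ p b j ≠ ⊤ → ∀ x y : Sp N, ‖conv (kap Φ j) b y - conv (kap Φ j) b x‖ₑ ≤
      C * (ofReal ((2 : ℝ) ^ j * ‖x - y‖) * blockSup Φ p b j) := by
  obtain ⟨C, hC⟩ := exists_iteratedFDeriv_conv_le (N := N) (∑ i ∈ ({-1, 0, 1} : Finset ℤ), kap Φ i) 1
  refine ⟨C * (cMaj N).toNNReal, fun p hp b hb j hfin x y => ?_⟩
  have hF := hb.conv (kap Φ j)
  have heq : conv (fatKap Φ j) (conv (kap Φ j) b) = conv (kap Φ j) b := funext fun z => conv_fatKap_conv_kap Φ j hb z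
  have hd : ∀ z, ‖fderiv ℝ (conv (kap Φ j) b) z‖ₑ ≤ C * (2 ^ (j : ℝ) * (cMaj N * blockSup Φ p b j)) := fun z => by
    have h := hC j _ hF z
    have h2 : ‖iteratedFDeriv ℝ 1 (conv (fatKap Φ j) (conv (kap Φ j) b)) z‖ₑ = ‖fderiv ℝ (conv (kap Φ j) b) z‖ₑ := by
      rw [heq, ← ofReal_norm, ← ofReal_norm, norm_iteratedFDeriv_one]
    change ‖iteratedFDeriv ℝ 1 (conv (fatKap Φ j) (conv (kap Φ j) b)) z‖ₑ ≤ _ at h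
    rw [h2, Nat.cast_one, mul_one] at h
    refine h.trans (mul_le_mul_right (mul_le_mul_right ?_ _) _)
    exact avg_le_nrm j hp hF.1.enorm.measurable z
  have hD : (C : ℝ≥0∞) * (2 ^ (j : ℝ) * (cMaj N * blockSup Φ p b j)) ≠ ⊤ := by
    refine mul_ne_top coe_ne_top (mul_ne_top ?_ (mul_ne_top cMaj_ne_top hfin))
    exact ENNReal.rpow_ne_top_of_ne_zero (by norm_num) (by norm_num)
  have hdiff : Differentiable ℝ (conv (kap Φ j) b) := (contDiff_conv hb _).differentiable (by simp)
  have hmv := Convex.norm_image_sub_le_of_norm_fderiv_le (𝕜 := ℝ) (f := conv (kap Φ j) b) (s := univ)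
    (fun z _ => hdiff z) (fun z _ => by
      have := toReal_mono hD (hd z)
      rwa [toReal_enorm] at this) convex_univ (mem_univ x) (mem_univ y)
  rw [← ofReal_norm]
  refine (ofReal_le_ofReal hmv).trans_eq ?_
  rw [ofReal_mul toReal_nonneg, ENNReal.ofReal_toReal hD, ofReal_mul (by positivity), two_zpow_ofReal,
    norm_sub_rev, ENNReal.coe_mul, coe_toNNReal cMaj_ne_top]
  ring

/-- The contribution of the blocks `Δ_j b` and `Δ_l w` to the commutator at frequency `2^k`. -/
def commTerm (p : ℝ) (b : Sp N → ℂ) (w : 𝓢'(Sp N, ℂ)) (k j l : ℤ) (x : Sp N) : ℝ≥0∞ :=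
  if |l - k| ≤ 7 then 2 ^ ((min 0 (j - k) : ℤ) : ℝ) * blockSup Φ p b j * avg k (fun y => ‖cv w (kap Φ l) y‖ₑ) x
  else if (k < l ∧ |j - l| ≤ 7) ∨ (l < k ∧ |j - k| ≤ 7) then
    avg k (fun y => ‖cv w (kap Φ l) y‖ₑ * ‖conv (kap Φ j) b y‖ₑ) x
  else 0

theorem enorm_integral_le_avg {k : ℤ} {A D : ℝ≥0∞} {g : Sp N → ℂ} {f : Sp N → ℝ≥0∞} (hf : Measurable f) (x : Sp N)
    (h : ∀ y, ‖g y‖ₑ ≤ A * maj k (x - y) * (D * f y)) : ‖∫ y, g y‖ₑ ≤ A * (D * avg k f x) := by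
  rw [← avg_const_mul k D hf, avg_eq k (hf.const_mul D), ← lintegral_const_mul _ (by fun_prop)]
  exact (enorm_integral_le_lintegral_enorm _).trans (lintegral_mono fun y => (h y).trans_eq (mul_assoc _ _ _))

/-- The increments of a low block of the coefficient gain a factor `2^{j-k}` against a kernel at the scale `2^{-k}`. -/
theorem exists_near_le : ∃ C : ℝ≥0, ∀ (p : ℝ) (_ : 1 ≤ p) (b : Sp N → ℂ), BddCts b →
    ∀ (k j : ℤ), blockSup Φ p b j ≠ ⊤ → ∀ (A : ℝ≥0) (α : 𝓢(Sp N, ℂ)), KerBd k A α → ∀ g : Sp N → ℂ, (Measurable fun y => ‖g y‖ₑ) → ∀ x,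
      ‖∫ y, (conv (kap Φ j) b y - conv (kap Φ j) b x) * (α (x - y) * g y)‖ₑ ≤
        A * (C * (2 ^ ((min 0 (j - k) : ℤ) : ℝ) * blockSup Φ p b j) * avg k (fun y => ‖g y‖ₑ) x) := by
  obtain ⟨C₁, h₁⟩ := exists_block_increment_le Φ
  obtain ⟨C₂, h₂⟩ := exists_enorm_conv_kap_le Φ
  refine ⟨C₁ + 2 * C₂, fun p hp b hb k j hfin A α hα g hg x => ?_⟩
  have hC : ∀ D : ℝ≥0, D ≤ C₁ + 2 * C₂ → ∀ E : ℝ≥0∞, (∀ y, ‖(conv (kap Φ j) b y - conv (kap Φ j) b x) * (α (x - y) * g y)‖ₑ ≤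
      A * maj k (x - y) * ((D * (E * blockSup Φ p b j)) * ‖g y‖ₑ)) → E = (2 : ℝ≥0∞) ^ ((min 0 (j - k) : ℤ) : ℝ) →
      ‖∫ y, (conv (kap Φ j) b y - conv (kap Φ j) b x) * (α (x - y) * g y)‖ₑ ≤ A * ((C₁ + 2 * C₂ : ℝ≥0) * (2 ^ ((min 0 (j - k) : ℤ) : ℝ) * blockSup Φ p b j) * avg k (fun y => ‖g y‖ₑ) x) := by
    intro D hD E h hE
    refine (enorm_integral_le_avg hg x h).trans (mul_le_mul_right (mul_le_mul_left ?_ _) _)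
    rw [hE]
    exact mul_le_mul_left (by exact_mod_cast hD) _
  by_cases hjk : j ≤ k
  · refine hC C₁ le_self_add ((2 : ℝ≥0∞) ^ ((j - k : ℤ) : ℝ)) (fun y => ?_) (by rw [min_eq_right (by omega)])
    rw [enorm_mul, enorm_mul]
    have e : ofReal ((2 : ℝ) ^ j * ‖x - y‖) = 2 ^ ((j - k : ℤ) : ℝ) * ofReal ((2 : ℝ) ^ k * ‖x - y‖) := by
      rw [← two_zpow_ofReal, ← ofReal_mul (by positivity), ← mul_assoc, ← zpow_add₀ (by norm_num)]
      congr 3; ring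
    calc _ ≤ (C₁ * (ofReal ((2 : ℝ) ^ j * ‖x - y‖) * blockSup Φ p b j)) * (‖α (x - y)‖ₑ * ‖g y‖ₑ) :=
          mul_le_mul_left (h₁ p hp b hb j hfin x y) _
      _ = (ofReal ((2 : ℝ) ^ k * ‖x - y‖) * ‖α (x - y)‖ₑ) * (((C₁ * (2 ^ ((j - k : ℤ) : ℝ) * blockSup Φ p b j))) * ‖g y‖ₑ) := by
          rw [e]; ring
      _ ≤ _ := mul_le_mul_left (hα _).2 _
  · refine hC (2 * C₂) le_add_self 1 (fun y => ?_) (by rw [min_eq_left (by omega)]; simp)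
    rw [enorm_mul, enorm_mul]
    calc _ ≤ (2 * C₂ * blockSup Φ p b j) * (‖α (x - y)‖ₑ * ‖g y‖ₑ) := by
          refine mul_le_mul_left ((enorm_sub_le).trans ((add_le_add (h₂ p hp b hb j y) (h₂ p hp b hb j x)).trans_eq ?_)) _
          rw [← two_mul, mul_assoc]; rfl
      _ = ‖α (x - y)‖ₑ * (((2 * C₂ : ℝ≥0) * (1 * blockSup Φ p b j)) * ‖g y‖ₑ) := by push_cast; ring
      _ ≤ _ := mul_le_mul_left (hα _).1 _

/-- When the frequencies `2^k` and `2^l` are comparable, the increments of `Δ_j b` are small on the scale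
of the kernel; otherwise the two parts of the commutator are products with separated spectra,
which vanish unless `2^j` is comparable to the larger of `2^k` and `2^l`. -/
theorem exists_commTerm_le : ∃ C : ℝ≥0, ∀ (p : ℝ) (_ : 1 ≤ p) (b : Sp N → ℂ), BddCts b →
    ∀ (w : 𝓢'(Sp N, ℂ)) (k j l : ℤ), blockSup Φ p b j ≠ ⊤ → ∀ (A : ℝ≥0) (α : 𝓢(Sp N, ℂ)), KerBd k A α → SpecIn k α → ∀ x,
      ‖∫ y, (conv (kap Φ j) b y - conv (kap Φ j) b x) * (α (x - y) * cv w (kap Φ l) y)‖ₑ ≤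
        A * (C * commTerm Φ p b w k j l x) := by
  obtain ⟨C₀, hn⟩ := exists_near_le Φ
  refine ⟨1 + C₀, fun p hp b hb w k j l hfin A α hα hs x => ?_⟩
  have hF := hb.conv (kap Φ j)
  have hw := measurable_enorm_cv w (kap Φ l)
  have hint : Integrable fun y => α (x - y) * cv w (kap Φ l) y := by
    have := (integral_mul_cv w (rt α x) (kap Φ l)).1
    simpa only [rt_apply] using this
  by_cases h1 : |l - k| ≤ 7
  · rw [commTerm, if_pos h1, ← mul_assoc ((1 + C₀ : ℝ≥0) : ℝ≥0∞)]
    refine (hn p hp b hb k j hfin A α hα _ hw x).trans (mul_le_mul_right (mul_le_mul_left (mul_le_mul_left ?_ _) _) _)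
    exact_mod_cast (by rw [add_comm]; exact le_self_add : C₀ ≤ 1 + C₀)
  -- the part with `Δ_j b` at the point `x` vanishes, the spectra of `α` and of the block of `w` being disjoint
  · have hzero : ∫ y, α (x - y) * cv w (kap Φ l) y = 0 := by
      rw [integral_mul_cv', mconv_eq_zero_of_far ?_ hs (specIn_kap_self Φ l), cv_zero]
      by_contra hcon
      exact h1 (abs_le.2 (by constructor <;> omega))
    have e : ∫ y, (conv (kap Φ j) b y - conv (kap Φ j) b x) * (α (x - y) * cv w (kap Φ l) y) =
        ∫ y, conv (kap Φ j) b y * (α (x - y) * cv w (kap Φ l) y) := by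
      obtain ⟨B, hB⟩ := hF.2
      simp_rw [sub_mul]
      rw [integral_sub (hint.bdd_mul hF.1.aestronglyMeasurable (.of_forall hB)) (hint.const_mul _), integral_const_mul, hzero,
        mul_zero, sub_zero]
    rw [e, commTerm, if_neg h1]
    split_ifs with h2
    · refine (enorm_integral_le_avg (k := k) (A := A) (D := 1) (hw.mul hF.1.enorm.measurable) x fun y => ?_).trans
        (mul_le_mul_right (mul_le_mul_left ?_ _) _)
      · rw [enorm_mul, enorm_mul, one_mul]
        calc _ = ‖α (x - y)‖ₑ * (‖cv w (kap Φ l) y‖ₑ * ‖conv (kap Φ j) b y‖ₑ) := by ring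
          _ ≤ _ := mul_le_mul_left (hα _).1 _
      · have : (1 : ℝ≥0) ≤ 1 + C₀ := le_self_add
        exact_mod_cast this
    · obtain ⟨B, hB⟩ := hF.2
      have hfar : k + 7 ≤ max j l ∧ (j + 7 ≤ l ∨ l + 7 ≤ j) ∨ (j + 7 ≤ k ∧ l + 7 ≤ k) := by
        rw [not_or] at h2
        have a1 := h2.1; have a2 := h2.2
        rw [abs_le] at h1 a1 a2
        omega
      have := trilinear_eq_zero hfar hs (specIn_fatKap Φ j) (specIn_kap_self Φ l) hF.1 hB
        (fun y => by rw [← conv_eq, conv_fatKap_conv_kap Φ j hb]) w x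
      have e2 : ∀ y, conv (kap Φ j) b y * (α (x - y) * cv w (kap Φ l) y) = α (x - y) * (conv (kap Φ j) b y * cv w (kap Φ l) y) := fun y => by ring
      simp_rw [e2]
      rw [this]; simp

theorem sum_mconv_kap {k : ℤ} {α : 𝓢(Sp N, ℂ)} (hs : SpecIn k α) :
    ∑ l ∈ Finset.Icc (k - 6) (k + 6), mconv α (kap Φ l) = α := by
  refine fourier_ext fun ξ => ?_
  rw [fourier_sum_apply]
  simp_rw [fourier_mconv]
  rw [← Finset.mul_sum]
  by_cases h : 𝓕 α ξ = 0
  · rw [h, zero_mul]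
  · have hξ : ξ ≠ 0 := by
      rintro rfl
      have := (hs 0 h).1
      rw [norm_zero, mul_zero] at this
      exact absurd this (not_le.2 (by positivity))
    have h1 := Φ.sum_eq_one ((2 * π) • ξ) (smul_ne_zero (by positivity) hξ)
    have h2 : ∀ l ∉ Finset.Icc (k - 6) (k + 6), Φ.φ ((2 : ℝ) ^ (-l) • (2 * π) • ξ) = 0 := fun l hl => by
      have := mconv_eq_zero_of_far (k := k) (l := l) (by rw [Finset.mem_Icc] at hl; omega) hs (specIn_kap_self Φ l)
      have h3 := fourier_mconv α (kap Φ l) ξ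
      have h4 : 𝓕 (0 : 𝓢(Sp N, ℂ)) ξ = 0 := by
        rw [FourierTransform.fourier_zero]; rfl
      rw [this, fourier_kap, h4] at h3
      exact_mod_cast (mul_eq_zero.1 h3.symm).resolve_left h
    have h3 := h1.unique (hasSum_sum_of_ne_finset_zero h2)
    have h4 : ∑ l ∈ Finset.Icc (k - 6) (k + 6), 𝓕 (kap Φ l) ξ = 1 := by
      simp_rw [fourier_kap]
      exact_mod_cast h3.symm
    rw [h4, mul_one]

theorem hasSum_cv_mconv_kap {k : ℤ} {α : 𝓢(Sp N, ℂ)} (hs : SpecIn k α) (w : 𝓢'(Sp N, ℂ)) (x : Sp N) :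
    HasSum (fun l => cv w (mconv α (kap Φ l)) x) (cv w α x) := by
  have h : ∀ l ∉ Finset.Icc (k - 6) (k + 6), cv w (mconv α (kap Φ l)) x = 0 := fun l hl => by
    rw [mconv_eq_zero_of_far (by rw [Finset.mem_Icc] at hl; omega) hs (specIn_kap_self Φ l), cv_zero]
  have : HasSum (fun l => cv w (mconv α (kap Φ l)) x) (∑ l ∈ Finset.Icc (k - 6) (k + 6), cv w (mconv α (kap Φ l)) x) :=
    hasSum_sum_of_ne_finset_zero h
  rwa [← cv_sum, sum_mconv_kap Φ hs] at this

/-- The commutator with one block of `w`, in terms of the blocks of the coefficient. -/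
theorem enorm_integral_sub_mul_le {p : ℝ} (hp : 1 ≤ p) {b : Sp N → ℂ} (hb : BddCts b)
    (hfin : ∑' j, blockSup Φ p b j ≠ ⊤) {g : Sp N → ℂ} (hg : Integrable g) (x : Sp N) :
    ‖∫ y, (b y - b x) * g y‖ₑ ≤ ∑' j, ‖∫ y, (conv (kap Φ j) b y - conv (kap Φ j) b x) * g y‖ₑ := by
  obtain ⟨C, hC⟩ := exists_enorm_conv_kap_le Φ
  have hBk : ∀ j, (C : ℝ≥0∞) * blockSup Φ p b j ≠ ⊤ := fun j =>
    mul_ne_top coe_ne_top (ne_top_of_tsum_ne_top hfin j)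
  have hBs : Summable fun j => ((C : ℝ≥0∞) * blockSup Φ p b j).toReal := by
    refine ENNReal.summable_toReal ?_
    rw [ENNReal.tsum_mul_left]; exact mul_ne_top coe_ne_top hfin
  have hle : ∀ j y, ‖conv (kap Φ j) b y‖ ≤ ((C : ℝ≥0∞) * blockSup Φ p b j).toReal := fun j y => by
    have := toReal_mono (hBk j) (hC p hp b hb j y)
    rwa [toReal_enorm] at this
  have hle2 : ∀ j y, ‖conv (kap Φ j) b y - conv (kap Φ j) b x‖ ≤ 2 * ((C : ℝ≥0∞) * blockSup Φ p b j).toReal := fun j y =>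
    (norm_sub_le _ _).trans (by linarith [hle j y, hle j x])
  have hsum : ∀ y, HasSum (fun j => conv (kap Φ j) b y - conv (kap Φ j) b x) (b y - b x) := fun y =>
    hasSum_conv_kap_sub Φ hb x y (Summable.of_norm_bounded (hBs.mul_left 2) fun j => hle2 j y)
  have hi : ∀ j, Integrable fun y => (conv (kap Φ j) b y - conv (kap Φ j) b x) * g y := fun j =>
    hg.bdd_mul ((hb.conv _).1.sub continuous_const).aestronglyMeasurable (.of_forall (hle2 j))
  have h1 : HasSum (fun j => ∫ y, (conv (kap Φ j) b y - conv (kap Φ j) b x) * g y) (∫ y, (b y - b x) * g y) := by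
    have : ∀ y, (b y - b x) * g y = ∑' j, (conv (kap Φ j) b y - conv (kap Φ j) b x) * g y := fun y =>
      ((hsum y).mul_right _).tsum_eq.symm
    simp_rw [this]
    refine hasSum_integral_of_summable_integral_norm hi ?_
    refine Summable.of_nonneg_of_le (fun j => integral_nonneg fun x => norm_nonneg _) (fun j => ?_) ((hBs.mul_left 2).mul_right (∫ y, ‖g y‖))
    rw [← integral_const_mul]
    refine integral_mono (hi j).norm (hg.norm.const_mul _) fun y => ?_
    simp only [norm_mul]
    exact mul_le_mul_of_nonneg_right (hle2 j y) (norm_nonneg _)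
  rw [← h1.tsum_eq]
  exact enorm_tsum_le_tsum_enorm

/-- The coefficient of the product of the norms of `Δ_j b` and `Δ_l w` in the bound for the commutator
at frequency `2^k`. -/
def commCoef (N : ℕ) (p r : ℝ) (k j l : ℤ) : ℝ≥0∞ :=
  if |l - k| ≤ 7 then (2 : ℝ≥0∞) ^ (((min 0 (j - k) : ℤ) : ℝ) + j * (N / p))
  else if k < l ∧ |j - l| ≤ 7 then (2 : ℝ≥0∞) ^ ((k : ℝ) * (N / r) + j * (N / p - N / r))
  else if l < k ∧ |j - k| ≤ 7 then (2 : ℝ≥0∞) ^ ((l : ℝ) * (N / p))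
  else 0

theorem two_rpow_add (x y : ℝ) : (2 : ℝ≥0∞) ^ (x + y) = (2 : ℝ≥0∞) ^ x * (2 : ℝ≥0∞) ^ y :=
  rpow_add _ _ (by norm_num) (by norm_num)

theorem measurable_commTerm (p : ℝ) {b : Sp N → ℂ} (hb : BddCts b) (w : 𝓢'(Sp N, ℂ)) (k j l : ℤ) :
    Measurable (commTerm Φ p b w k j l) := by
  have hF := (hb.conv (kap Φ j)).1.enorm.measurable
  have hw := measurable_enorm_cv w (kap Φ l)
  unfold commTerm
  split_ifs
  · exact (measurable_avg k hw).const_mul _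
  · exact measurable_avg k (hw.mul hF)
  · exact measurable_const

/-- When `Δ_j b` and `Δ_l w` have comparable frequencies above `2^k`, the first is placed in `L^r`. The
product lies in the Lebesgue space of exponent `1 / (1/p + 1/r)`, which is at least `1` as `r ≥ p'`, and the
average at the scale `2^{-k}` returns to `L^p` at the cost `2^{kN/r}`. -/
theorem exists_nrm_commTerm_le {p r : ℝ} (hp : 1 < p) (hpr : p ≤ r) (hr : p.conjExponent ≤ r) :
    ∃ C : ℝ≥0, ∀ (b : Sp N → ℂ), BddCts b → ∀ (w : 𝓢'(Sp N, ℂ)) (k j l : ℤ),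
      nrm p (commTerm Φ p b w k j l) ≤ C * (commCoef N p r k j l *
        (nrm p (fun y => ‖conv (kap Φ j) b y‖ₑ) * nrm p (fun y => ‖cv w (kap Φ l) y‖ₑ))) := by
  obtain ⟨C₁, h₁⟩ := exists_enorm_cv_kap_le Φ
  obtain ⟨C₂, h₂⟩ := exists_kerBd (∑ i ∈ ({-1, 0, 1} : Finset ℤ), kap Φ i)
  have hc : cMaj N ≠ ⊤ := cMaj_ne_top
  have h1c : 1 ≤ cMaj N := one_le_cMaj
  obtain ⟨c, hcc⟩ : ∃ c : ℝ≥0, (c : ℝ≥0∞) = cMaj N := ⟨_, coe_toNNReal hc⟩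
  have hp0 : 0 < p := by linarith
  refine ⟨c ^ 2 + c ^ 2 * ((1 + C₂) * c) + C₁ * c ^ 2, fun b hb w k j l => ?_⟩
  have hF := (hb.conv (kap Φ j)).1.enorm.measurable
  have hw := measurable_enorm_cv w (kap Φ l)
  have hcoe : ((c ^ 2 + c ^ 2 * ((1 + C₂) * c) + C₁ * c ^ 2 : ℝ≥0) : ℝ≥0∞) =
    cMaj N ^ 2 + cMaj N ^ 2 * ((1 + C₂) * cMaj N) + C₁ * cMaj N ^ 2 := by rw [← hcc]; push_cast; rfl
  rw [hcoe]
  by_cases hl : |l - k| ≤ 7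
  · have e : commTerm Φ p b w k j l = fun x => (2 ^ ((min 0 (j - k) : ℤ) : ℝ) * blockSup Φ p b j) * avg k (fun y => ‖cv w (kap Φ l) y‖ₑ) x := by
      funext x; rw [commTerm, if_pos hl]
    rw [e, nrm_const_mul hp0 _ (measurable_avg k hw), commCoef, if_pos hl, two_rpow_add, blockSup]
    refine (mul_le_mul_right (nrm_avg_le k hp.le hw) _).trans ?_
    calc _ = cMaj N ^ 2 * (2 ^ ((min 0 (j - k) : ℤ) : ℝ) * (2 : ℝ≥0∞) ^ ((j : ℝ) * (N / p)) *
          (nrm p (fun y => ‖conv (kap Φ j) b y‖ₑ) * nrm p (fun y => ‖cv w (kap Φ l) y‖ₑ))) := by ring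
      _ ≤ _ := mul_le_mul_left (by rw [add_assoc]; exact le_self_add) _
  · by_cases h2 : k < l ∧ |j - l| ≤ 7
    · have e : commTerm Φ p b w k j l = avg k (fun y => ‖cv w (kap Φ l) y‖ₑ * ‖conv (kap Φ j) b y‖ₑ) := by
        funext x; rw [commTerm, if_neg hl, if_pos (Or.inl h2)]
      rw [e, commCoef, if_neg hl, if_pos h2, two_rpow_add]
      have hb2 : nrm r (fun y => ‖conv (kap Φ j) b y‖ₑ) ≤ (1 + C₂) * cMaj N * (2 ^ ((j : ℝ) * (N / p - N / r)) * nrm p (fun y => ‖conv (kap Φ j) b y‖ₑ)) := by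
        refine nrm_bernstein j hp.le hpr hF le_self_add fun x => ?_
        have h3 := enorm_conv_le (h₂ j) (hb.conv (kap Φ j)).1 x
        change ‖conv (fatKap Φ j) (conv (kap Φ j) b) x‖ₑ ≤ _ at h3
        rw [conv_fatKap_conv_kap Φ j hb] at h3
        exact h3.trans (mul_le_mul_left le_add_self _)
      refine (nrm_avg_mul_le k hp hr hw hF).trans ?_
      calc _ ≤ cMaj N ^ 2 * (2 ^ ((k : ℝ) * (N / r)) * (nrm p (fun y => ‖cv w (kap Φ l) y‖ₑ) *
            ((1 + C₂) * cMaj N * (2 ^ ((j : ℝ) * (N / p - N / r)) * nrm p (fun y => ‖conv (kap Φ j) b y‖ₑ))))) :=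
            mul_le_mul_right (mul_le_mul_right (mul_le_mul_right hb2 _) _) _
        _ = (cMaj N ^ 2 * ((1 + C₂) * cMaj N)) * (2 ^ ((k : ℝ) * (N / r)) * (2 : ℝ≥0∞) ^ ((j : ℝ) * (N / p - N / r)) *
            (nrm p (fun y => ‖conv (kap Φ j) b y‖ₑ) * nrm p (fun y => ‖cv w (kap Φ l) y‖ₑ))) := by ring
        _ ≤ _ := mul_le_mul_left (le_add_self.trans le_self_add) _
    · by_cases h3 : l < k ∧ |j - k| ≤ 7
      · have e : commTerm Φ p b w k j l = avg k (fun y => ‖cv w (kap Φ l) y‖ₑ * ‖conv (kap Φ j) b y‖ₑ) := by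
          funext x; rw [commTerm, if_neg hl, if_pos (Or.inr h3)]
        rw [e, commCoef, if_neg hl, if_neg h2, if_pos h3]
        set S := (C₁ : ℝ≥0∞) * (2 ^ ((l : ℝ) * (N / p)) * nrm p fun y => ‖cv w (kap Φ l) y‖ₑ) with hS
        have h4 : ∀ x, avg k (fun y => ‖cv w (kap Φ l) y‖ₑ * ‖conv (kap Φ j) b y‖ₑ) x ≤ S * avg k (fun y => ‖conv (kap Φ j) b y‖ₑ) x := fun x => by
          rw [← avg_const_mul k _ hF]
          exact avg_mono k (fun y => mul_le_mul_left (h₁ p hp.le w l y) _) x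
        refine (nrm_mono hp0.le h4).trans ?_
        rw [nrm_const_mul hp0 _ (measurable_avg k hF)]
        refine (mul_le_mul_right (nrm_avg_le k hp.le hF) _).trans ?_
        calc _ = (C₁ * cMaj N ^ 2) * ((2 : ℝ≥0∞) ^ ((l : ℝ) * (N / p)) *
              (nrm p (fun y => ‖conv (kap Φ j) b y‖ₑ) * nrm p (fun y => ‖cv w (kap Φ l) y‖ₑ))) := by rw [hS]; ring
          _ ≤ _ := mul_le_mul_left le_add_self _
      · have e : commTerm Φ p b w k j l = fun _ => 0 := by
          funext x; rw [commTerm, if_neg hl, if_neg (by tauto)]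
        rw [e]
        have : nrm p (fun _ : Sp N => (0 : ℝ≥0∞)) = 0 := by
          rw [nrm, ENNReal.zero_rpow_of_pos hp0, lintegral_zero, ENNReal.zero_rpow_of_pos (by positivity)]
        rw [this]; exact zero_le

/-- The commutator of the multiplication by a coefficient and the convolution with a kernel at
the scale `2^{-k}`. The bound `E` does not depend on the kernel, which may therefore vary with `x`. -/
theorem exists_commutator {p r : ℝ} (hp : 1 < p) (hpr : p ≤ r) (hr : p.conjExponent ≤ r) :
    ∃ C : ℝ≥0, ∀ (b : Sp N → ℂ) (m : Sp N → ℝ), BddCts b → (∀ᵐ x, b x = (m x : ℂ)) → ∑' j, blockSup Φ p b j ≠ ⊤ →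
      ∀ (w : 𝓢'(Sp N, ℂ)) (k : ℤ), ∃ E : Sp N → ℝ≥0∞, Measurable E ∧
        nrm p E ≤ C * ∑' j, ∑' l, commCoef N p r k j l *
          (nrm p (fun y => ‖conv (kap Φ j) b y‖ₑ) * nrm p (fun y => ‖cv w (kap Φ l) y‖ₑ)) ∧
        ∀ (A : ℝ≥0) (α : 𝓢(Sp N, ℂ)), KerBd k A α → SpecIn k α → ∀ x,
          ‖productPairing Φ m w (rt α x) - b x * cv w α x‖ₑ ≤ A * E x := by
  obtain ⟨C₁, h₁⟩ := exists_commTerm_le Φ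
  obtain ⟨C₂, h₂⟩ := exists_nrm_commTerm_le Φ hp hpr hr
  refine ⟨C₁ * C₂, fun b m hb hm hfin w k => ⟨fun x => C₁ * ∑' q : ℤ × ℤ, commTerm Φ p b w k q.1 q.2 x,
    ?_, ?_, fun A α hα hs x => ?_⟩⟩
  · have hmeas : ∀ q : ℤ × ℤ, Measurable (commTerm Φ p b w k q.1 q.2) := fun q => measurable_commTerm Φ p hb w k q.1 q.2
    have hmeas' : Measurable fun x => ∑' q : ℤ × ℤ, commTerm Φ p b w k q.1 q.2 x := Measurable.tsum hmeas
    exact hmeas'.const_mul _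
  · have hmeas : ∀ q : ℤ × ℤ, Measurable (commTerm Φ p b w k q.1 q.2) := fun q => measurable_commTerm Φ p hb w k q.1 q.2
    have hmeas' : Measurable fun x => ∑' q : ℤ × ℤ, commTerm Φ p b w k q.1 q.2 x := Measurable.tsum hmeas
    rw [nrm_const_mul (by linarith) _ hmeas', ENNReal.coe_mul, mul_assoc]
    refine mul_le_mul_right ((nrm_tsum_le hp.le hmeas).trans ?_) _
    rw [← ENNReal.tsum_prod (f := fun j l => commCoef N p r k j l *
          (nrm p (fun y => ‖conv (kap Φ j) b y‖ₑ) * nrm p (fun y => ‖cv w (kap Φ l) y‖ₑ))), ← ENNReal.tsum_mul_left]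
    exact tsum_le_tsum fun q => h₂ b hb w k q.1 q.2
  · have hint : ∀ l, Integrable fun y => α (x - y) * cv w (kap Φ l) y := fun l => by
      have := (integral_mul_cv w (rt α x) (kap Φ l)).1
      simpa only [rt_apply] using this
    set D : ℤ → ℂ := fun l => ∫ y, (b y - b x) * (α (x - y) * cv w (kap Φ l) y) with hD
    have hDle : ∑' l, ‖D l‖ₑ ≤ A * (C₁ * ∑' q : ℤ × ℤ, commTerm Φ p b w k q.1 q.2 x) := by
      rw [ENNReal.tsum_prod (f := fun j l => commTerm Φ p b w k j l x), ENNReal.tsum_comm, ← ENNReal.tsum_mul_left, ← ENNReal.tsum_mul_left]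
      refine tsum_le_tsum fun l => (enorm_integral_sub_mul_le Φ hp.le hb hfin (hint l) x).trans ?_
      rw [← ENNReal.tsum_mul_left, ← ENNReal.tsum_mul_left]
      exact tsum_le_tsum fun j => h₁ p hp.le b hb w k j l (ne_top_of_tsum_ne_top hfin j) A α hα hs x
    by_cases htop : A * (C₁ * ∑' q : ℤ × ℤ, commTerm Φ p b w k q.1 q.2 x) = ⊤
    · rw [htop]; exact le_top
    have hDs : Summable D := by
      have := ENNReal.summable_toReal (ne_top_of_le_ne_top htop hDle)
      simp only [toReal_enorm] at this
      exact this.of_norm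
    have hT : ∀ l, ∫ y, ((m y : ℝ) : ℂ) * (rt α x y * density (block Φ l w) y) = D l + b x * cv w (mconv α (kap Φ l)) x := fun l => by
      obtain ⟨B, hB⟩ := hb.2
      rw [hD, ← integral_mul_cv', ← integral_const_mul, ← integral_add]
      · refine integral_congr_ae ?_
        filter_upwards [hm, density_block Φ l w] with y h1 h2
        rw [h2, ← h1, rt_apply]; ring
      · exact (hint l).bdd_mul (hb.1.sub continuous_const).aestronglyMeasurable (.of_forall fun y =>
          (norm_sub_le _ _).trans (add_le_add (hB y) (hB x)))
      · exact (hint l).const_mul _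
    have h3 := hDs.hasSum.add ((hasSum_cv_mconv_kap Φ hs w x).mul_left (b x))
    have h4 : productPairing Φ m w (rt α x) = ∑' l, D l + b x * cv w α x := by
      rw [← h3.tsum_eq]; exact tsum_congr hT
    rw [h4, add_sub_cancel_right]
    exact enorm_tsum_le_tsum_enorm.trans hDle

/-! ### Weighted sums over frequencies -/

/-- Weights that grow with the frequency, but not faster than the frequency itself. -/
def SlowWeight (W : ℤ → ℝ≥0∞) : Prop :=
  ∀ j k : ℤ, j ≤ k → W j ≤ W k ∧ W k ≤ 2 ^ ((k : ℝ) - j) * W j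

theorem two_rpow_mono {x y : ℝ} (h : x ≤ y) : (2 : ℝ≥0∞) ^ x ≤ (2 : ℝ≥0∞) ^ y :=
  rpow_le_rpow_of_exponent_le (by norm_num) h

theorem two_rpow_ne_top (x : ℝ) : (2 : ℝ≥0∞) ^ x ≠ ⊤ := ENNReal.rpow_ne_top_of_ne_zero (by norm_num) (by norm_num)

theorem tsum_two_rpow_abs_ne_top {δ : ℝ} (hδ : 0 < δ) : ∑' k : ℤ, (2 : ℝ≥0∞) ^ (-(|(k : ℝ)| * δ)) ≠ ⊤ := by
  have hr : (2 : ℝ) ^ (-δ) < 1 := Real.rpow_lt_one_of_one_lt_of_neg (by norm_num) (by linarith)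
  have hg : Summable fun n : ℕ => ((2 : ℝ) ^ (-δ)) ^ n := summable_geometric_of_lt_one (by positivity) hr
  have e : ∀ n : ℕ, (2 : ℝ) ^ (-((n : ℝ) * δ)) = ((2 : ℝ) ^ (-δ)) ^ n := fun n => by
    rw [← Real.rpow_natCast, ← Real.rpow_mul (by norm_num)]; congr 1; ring
  have hs : Summable fun k : ℤ => (2 : ℝ) ^ (-(|(k : ℝ)| * δ)) := by
    refine Summable.of_nat_of_neg ?_ ?_
    · refine hg.congr fun n => ?_
      rw [← e, Int.cast_natCast, abs_of_nonneg (by positivity)]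
    · refine hg.congr fun n => ?_
      rw [← e, Int.cast_neg, Int.cast_natCast, abs_neg, abs_of_nonneg (by positivity)]
  have := hs.tsum_ofReal_ne_top
  simp_rw [two_rpow_ofReal] at this
  exact this

theorem tsum_two_rpow_abs_sub (δ : ℝ) (m : ℤ) :
    ∑' k : ℤ, (2 : ℝ≥0∞) ^ (-(|(k : ℝ) - m| * δ)) = ∑' k : ℤ, (2 : ℝ≥0∞) ^ (-(|(k : ℝ)| * δ)) := by
  conv_rhs => rw [← (Equiv.subRight m).tsum_eq]
  refine tsum_congr fun k => ?_
  simp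

theorem SlowWeight.le_mul {W : ℤ → ℝ≥0∞} (h : SlowWeight W) (j k : ℤ) :
    W k * (2 : ℝ≥0∞) ^ ((min 0 (j - k) : ℤ) : ℝ) ≤ W j := by
  by_cases hjk : k ≤ j
  · rw [min_eq_left (by omega)]; simpa using (h k j hjk).1
  · rw [min_eq_right (by omega)]
    refine (mul_le_mul_left (h j k (by omega)).2 _).trans_eq ?_
    rw [mul_right_comm, ← two_rpow_add]
    push_cast
    rw [show (k : ℝ) - j + (j - k) = 0 by ring, rpow_zero, one_mul]

theorem SlowWeight.le_near {W : ℤ → ℝ≥0∞} (h : SlowWeight W) {j k : ℤ} (hjk : |j - k| ≤ 7) :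
    W k ≤ 2 ^ (7 : ℝ) * W j := by
  rw [abs_le] at hjk
  by_cases hle : k ≤ j
  · refine (h k j hle).1.trans ?_
    have : (1 : ℝ≥0∞) ≤ (2 : ℝ≥0∞) ^ (7 : ℝ) := ENNReal.one_le_rpow (by norm_num) (by norm_num)
    exact le_mul_of_one_le_left' this
  · refine (h j k (by omega)).2.trans (mul_le_mul_left (two_rpow_mono ?_) _)
    have : ((k - j : ℤ) : ℝ) ≤ 7 := by exact_mod_cast (by omega : k - j ≤ 7)
    push_cast at this; exact this

/-- Schur's test in the output frequency. The high-high interactions need `-(N / r) < σ`, the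
low-high ones `σ ≤ N / p`. -/
theorem exists_tsum_commCoef_le (N : ℕ) {p r σ : ℝ} (hp : 0 < p) (hr : 0 < r) (h1 : -(N / r) < σ) (h2 : σ ≤ N / p) :
    ∃ C : ℝ≥0, ∀ W : ℤ → ℝ≥0∞, SlowWeight W → ∀ j l : ℤ,
      ∑' k : ℤ, 2 ^ ((k : ℝ) * σ) * W k * commCoef N p r k j l ≤
        C * (2 ^ ((j : ℝ) * (N / p)) * W j * (2 : ℝ≥0∞) ^ ((l : ℝ) * σ)) := by
  set δ := σ + N / r with hδ
  have hδ0 : 0 < δ := by linarith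
  have hNp : 0 ≤ (N : ℝ) / p := by positivity
  have hNr : 0 ≤ (N : ℝ) / r := by positivity
  -- room for the shifts of the frequencies by at most `7`
  set e₀ : ℝ := 7 * (|σ| + δ + N / r + N / p + 1) with he₀
  set S := ∑' k : ℤ, (2 : ℝ≥0∞) ^ (-(|(k : ℝ)| * δ)) with hS
  have hSt : S ≠ ⊤ := tsum_two_rpow_abs_ne_top hδ0
  have hfin : (2 : ℝ≥0∞) ^ e₀ * (S + S) ≠ ⊤ := mul_ne_top (two_rpow_ne_top _) (ENNReal.add_ne_top.2 ⟨hSt, hSt⟩)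
  refine ⟨((2 : ℝ≥0∞) ^ e₀ * (S + S)).toNNReal, fun W hW j l => ?_⟩
  rw [coe_toNNReal hfin]
  set Q := 2 ^ ((j : ℝ) * (N / p)) * W j * (2 : ℝ≥0∞) ^ ((l : ℝ) * σ) with hQ
  have hσ := le_abs_self σ
  have hσ' := neg_abs_le σ
  have habs0 := abs_nonneg σ
  have near : ∀ {m n : ℤ}, |m - n| ≤ 7 → |(m : ℝ) - n| ≤ 7 := fun h => by exact_mod_cast h
  have hterm : ∀ k : ℤ, 2 ^ ((k : ℝ) * σ) * W k * commCoef N p r k j l ≤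
      (2 : ℝ≥0∞) ^ e₀ * Q * ((2 : ℝ≥0∞) ^ (-(|(k : ℝ) - l| * δ)) + (2 : ℝ≥0∞) ^ (-(|(k : ℝ) - j| * δ))) := fun k => by
    have fin : ∀ (x y : ℝ), x + (j : ℝ) * 0 ≤ e₀ + (j : ℝ) * (N / p) + l * σ + y → 
        (2 : ℝ≥0∞) ^ x * W j ≤ (2 : ℝ≥0∞) ^ e₀ * Q * (2 : ℝ≥0∞) ^ y := fun x y hxy => by
      rw [hQ]
      calc (2 : ℝ≥0∞) ^ x * W j ≤ 2 ^ (e₀ + (j : ℝ) * (N / p) + l * σ + y) * W j :=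
            mul_le_mul_left (two_rpow_mono (by linarith)) _
        _ = _ := by rw [two_rpow_add, two_rpow_add, two_rpow_add]; ring
    unfold commCoef
    split_ifs with c1 c2 c3
    -- the commutator gains `2^{min(0, j-k)}`, and `k` is close to `l`
    · have hn := near c1
      rw [abs_sub_comm] at hn
      calc _ = 2 ^ ((k : ℝ) * σ + j * (N / p)) * (W k * (2 : ℝ≥0∞) ^ ((min 0 (j - k) : ℤ) : ℝ)) := by
            rw [two_rpow_add, two_rpow_add]; ring
        _ ≤ 2 ^ ((k : ℝ) * σ + j * (N / p)) * W j := mul_le_mul_right (hW.le_mul j k) _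
        _ ≤ (2 : ℝ≥0∞) ^ e₀ * Q * (2 : ℝ≥0∞) ^ (-(|(k : ℝ) - l| * δ)) := by
            refine fin _ _ ?_
            have a1 : ((k : ℝ) - l) * σ ≤ 7 * |σ| := (le_abs_self _).trans (by
              rw [abs_mul]; exact mul_le_mul_of_nonneg_right hn habs0)
            have a2 : |(k : ℝ) - l| * δ ≤ 7 * δ := mul_le_mul_of_nonneg_right hn hδ0.le
            rw [he₀]; nlinarith
        _ ≤ _ := mul_le_mul_right le_self_add _
    -- high-high interactions: the sum over `k < l` converges because of `-(N / r) < σ`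
    · have hn := near c2.2
      have hkl : (k : ℝ) ≤ l := by exact_mod_cast c2.1.le
      have hkj : k ≤ j := by have := c2.2; rw [abs_le] at c1 this; omega
      calc _ = 2 ^ ((k : ℝ) * σ + (k * (N / r) + j * (N / p - N / r))) * W k := by
            rw [two_rpow_add ((k : ℝ) * σ)]; ring
        _ ≤ 2 ^ ((k : ℝ) * σ + (k * (N / r) + j * (N / p - N / r))) * W j := mul_le_mul_right (hW k j hkj).1 _
        _ ≤ (2 : ℝ≥0∞) ^ e₀ * Q * (2 : ℝ≥0∞) ^ (-(|(k : ℝ) - l| * δ)) := by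
            refine fin _ _ ?_
            rw [abs_of_nonpos (by linarith)]
            have a1 : ((l : ℝ) - j) * (N / r) ≤ 7 * (N / r) := mul_le_mul_of_nonneg_right (by linarith [(abs_le.1 hn).1]) hNr
            rw [he₀]; rw [hδ] at *; nlinarith
        _ ≤ _ := mul_le_mul_right le_self_add _
    -- a low frequency of the solution: `k` is close to `j`, and `σ ≤ N / p` compares `2^l` with `2^k`
    · have hn := near c3.2
      have hkl : (l : ℝ) ≤ k := by exact_mod_cast c3.1.le
      calc _ = 2 ^ ((k : ℝ) * σ + l * (N / p)) * W k := by rw [two_rpow_add]; ring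
        _ ≤ 2 ^ ((k : ℝ) * σ + l * (N / p)) * (2 ^ (7 : ℝ) * W j) := mul_le_mul_right (hW.le_near c3.2) _
        _ = 2 ^ ((k : ℝ) * σ + l * (N / p) + 7) * W j := by rw [two_rpow_add _ 7]; ring
        _ ≤ (2 : ℝ≥0∞) ^ e₀ * Q * (2 : ℝ≥0∞) ^ (-(|(k : ℝ) - j| * δ)) := by
            refine fin _ _ ?_
            rw [abs_sub_comm]
            have a1 : |(j : ℝ) - k| * δ ≤ 7 * δ := mul_le_mul_of_nonneg_right hn hδ0.le
            have a2 : ((k : ℝ) - j) * (N / p) ≤ 7 * (N / p) := mul_le_mul_of_nonneg_right (by linarith [(abs_le.1 hn).1]) hNp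
            have a3 : 0 ≤ ((k : ℝ) - l) * (N / p - σ) := mul_nonneg (by linarith) (by linarith)
            rw [he₀]; nlinarith
        _ ≤ _ := mul_le_mul_right le_add_self _
    · simp
  refine (tsum_le_tsum hterm).trans_eq ?_
  rw [ENNReal.tsum_mul_left, ENNReal.tsum_add]
  rw [tsum_two_rpow_abs_sub, tsum_two_rpow_abs_sub]; ring

/-- The weight grows at most like `2^{j(N/p+1)}`, less than the decay `2^{-jM}` of the coefficients. -/
theorem exists_tsum_gainCoef_le (N : ℕ) {p : ℝ} {M : ℕ} (hN : 0 < (N : ℝ) / p) (hM : (N : ℝ) / p + 1 < M) :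
    ∃ C : ℝ≥0, ∀ W : ℤ → ℝ≥0∞, SlowWeight W → ∀ i : ℤ,
      ∑' j : ℤ, 2 ^ ((j : ℝ) * (N / p)) * W j * gainCoef M j i ≤ C * (2 ^ ((i : ℝ) * (N / p)) * W i) := by
  set ε := min ((N : ℝ) / p) (M - 1 - N / p) with hε
  have hε0 : 0 < ε := lt_min hN (by linarith)
  have hSt := tsum_two_rpow_abs_ne_top hε0
  refine ⟨(∑' k : ℤ, (2 : ℝ≥0∞) ^ (-(|(k : ℝ)| * ε))).toNNReal, fun W hW i => ?_⟩
  rw [coe_toNNReal hSt, ← tsum_two_rpow_abs_sub ε i, ← ENNReal.tsum_mul_right]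
  refine tsum_le_tsum fun j => ?_
  have e1 : ε ≤ (N : ℝ) / p := min_le_left _ _
  have e2 : ε ≤ M - 1 - N / p := min_le_right _ _
  unfold gainCoef
  by_cases hji : j ≤ i
  · have hji' : (j : ℝ) ≤ i := by exact_mod_cast hji
    rw [min_eq_left (by omega), abs_of_nonpos (by linarith), Int.cast_zero, zero_mul, rpow_zero, mul_one,
      ← mul_assoc, ← two_rpow_add]
    refine mul_le_mul' (two_rpow_mono ?_) (hW j i hji).1
    nlinarith
  · have hji' : (i : ℝ) ≤ j := by exact_mod_cast (by omega : i ≤ j)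
    rw [min_eq_right (by omega), abs_of_nonneg (by linarith)]
    refine (mul_le_mul_left (mul_le_mul_right (hW i j (by omega)).2 _) _).trans ?_
    calc _ = 2 ^ ((j : ℝ) * (N / p) + (j - i) + ((i - j : ℤ) : ℝ) * M) * W i := by
          rw [two_rpow_add, two_rpow_add]; ring
      _ ≤ 2 ^ (-((j - i : ℝ) * ε) + (i : ℝ) * (N / p)) * W i := by
          refine mul_le_mul_left (two_rpow_mono ?_) _
          push_cast
          nlinarith
      _ = _ := by rw [two_rpow_add]; ring

/-- The weighted sum of the commutator bounds is controlled by the product of the norms. -/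
theorem exists_tsum_commutator_le (N : ℕ) {p r σ : ℝ} {M : ℕ} (hp : 0 < p) (hr : 0 < r) (h1 : -(N / r) < σ) (h2 : σ ≤ N / p)
    (hN : 0 < (N : ℝ) / p) (hM : (N : ℝ) / p + 1 < M) :
    ∃ C : ℝ≥0, ∀ W : ℤ → ℝ≥0∞, SlowWeight W → ∀ (D : ℝ≥0∞) (α n : ℤ → ℝ≥0∞),
      ∑' k : ℤ, 2 ^ ((k : ℝ) * σ) * W k *
          ∑' j, ∑' l, commCoef N p r k j l * ((D * ∑' i, gainCoef M j i * α i) * n l) ≤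
        C * (D * (∑' i : ℤ, 2 ^ ((i : ℝ) * (N / p)) * W i * α i) * ∑' l : ℤ, 2 ^ ((l : ℝ) * σ) * n l) := by
  obtain ⟨C₁, hC₁⟩ := exists_tsum_commCoef_le N hp hr h1 h2
  obtain ⟨C₂, hC₂⟩ := exists_tsum_gainCoef_le N hN hM
  refine ⟨C₁ * C₂, fun W hW D α n => ?_⟩
  set f : ℤ → ℝ≥0∞ := fun j => D * ∑' i, gainCoef M j i * α i with hf
  have step1 : ∑' k : ℤ, 2 ^ ((k : ℝ) * σ) * W k * ∑' j, ∑' l, commCoef N p r k j l * (f j * n l) ≤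
      C₁ * ((∑' j : ℤ, 2 ^ ((j : ℝ) * (N / p)) * W j * f j) * ∑' l : ℤ, 2 ^ ((l : ℝ) * σ) * n l) := by
    calc _ = ∑' j : ℤ, ∑' l : ℤ, (∑' k : ℤ, 2 ^ ((k : ℝ) * σ) * W k * commCoef N p r k j l) * (f j * n l) := by
          simp_rw [← ENNReal.tsum_mul_left, ← ENNReal.tsum_mul_right]
          rw [ENNReal.tsum_comm]
          refine tsum_congr fun j => ?_
          rw [ENNReal.tsum_comm]
          refine tsum_congr fun l => tsum_congr fun k => by ring
      _ ≤ ∑' j : ℤ, ∑' l : ℤ, (C₁ * (2 ^ ((j : ℝ) * (N / p)) * W j * (2 : ℝ≥0∞) ^ ((l : ℝ) * σ))) * (f j * n l) :=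
          tsum_le_tsum fun j => tsum_le_tsum fun l => mul_le_mul_left (hC₁ W hW j l) _
      _ = _ := by
          rw [← ENNReal.tsum_mul_right, ← ENNReal.tsum_mul_left]
          refine tsum_congr fun j => ?_
          rw [← ENNReal.tsum_mul_left, ← ENNReal.tsum_mul_left]
          refine tsum_congr fun l => by ring
  have step2 : ∑' j : ℤ, 2 ^ ((j : ℝ) * (N / p)) * W j * f j ≤
      D * (C₂ * ∑' i : ℤ, 2 ^ ((i : ℝ) * (N / p)) * W i * α i) := by
    calc _ = D * ∑' i, (∑' j : ℤ, 2 ^ ((j : ℝ) * (N / p)) * W j * gainCoef M j i) * α i := by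
          simp_rw [hf, ← ENNReal.tsum_mul_right, ← ENNReal.tsum_mul_left]
          rw [ENNReal.tsum_comm]
          refine tsum_congr fun i => tsum_congr fun j => by ring
      _ ≤ _ := by
          refine mul_le_mul_right ?_ _
          rw [← ENNReal.tsum_mul_left]
          exact tsum_le_tsum fun i => (mul_le_mul_left (hC₂ W hW i) _).trans_eq (mul_assoc _ _ _)
  refine step1.trans ((mul_le_mul_right (mul_le_mul_left step2 _) _).trans_eq ?_)
  rw [ENNReal.coe_mul]; ring

/-! ### The viscous term at a fixed time -/

/-- A coefficient `m`, given by a bounded continuous function `b` whose blocks have `L^p` norms at most `f`. -/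
structure Coeff (p : ℝ) (f : ℤ → ℝ≥0∞) (m : Sp N → ℝ) (b : Sp N → ℂ) : Prop where
  bdd : BddCts b
  ae_eq : ∀ᵐ x, b x = (m x : ℂ)
  summable : ∑' j, blockSup Φ p b j ≠ ⊤
  le : ∀ j, nrm p (fun y => ‖conv (kap Φ j) b y‖ₑ) ≤ f j

/-- The `L^p` norm of the `l`-th block of a vector field. -/
def freqNorm (p : ℝ) (u : Fin N → 𝓢'(Sp N, ℂ)) (l : ℤ) : ℝ≥0∞ :=
  ∑ i, nrm p fun y => ‖cv (u i) (kap Φ l) y‖ₑ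

/-- The bound for the commutator at frequency `2^k`, in terms of the norms of the blocks of the
coefficient and of the gradient. -/
def viscBound (N : ℕ) (p r : ℝ) (f n : ℤ → ℝ≥0∞) (k : ℤ) : ℝ≥0∞ :=
  ∑' j, ∑' l, commCoef N p r k j l * (f j * (2 ^ (l : ℝ) * n l))

theorem nrm_sum_le {ι : Type*} [Fintype ι] {p : ℝ} (hp : 1 ≤ p) {f : ι → Sp N → ℝ≥0∞} (hf : ∀ i, Measurable (f i)) :
    nrm p (fun x => ∑ i, f i x) ≤ ∑ i, nrm p (f i) := by
  have := nrm_tsum_le hp hf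
  simpa only [tsum_fintype] using this

theorem productPairing_neg (m : Sp N → ℝ) (f : 𝓢'(Sp N, ℂ)) (χ : 𝓢(Sp N, ℂ)) :
    productPairing Φ m f (-χ) = -productPairing Φ m f χ := by
  unfold productPairing
  rw [← tsum_neg]
  refine tsum_congr fun k => ?_
  rw [← integral_neg]
  refine integral_congr_ae (.of_forall fun x => ?_)
  simp only [neg_apply]; ring

theorem viscousPairing_rt (m l : Sp N → ℝ) (u : Fin N → 𝓢'(Sp N, ℂ)) (i : Fin N)
    (α : 𝓢(Sp N, ℂ)) (x : Sp N) :
    viscousPairing Φ m l u i (rt α x) =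
      ∑ j : Fin N, productPairing Φ m (∂_{basisVec j} (u i)) (rt (∂_{basisVec j} α) x) +
        productPairing Φ l (divergence u) (rt (∂_{basisVec i} α) x) := by
  simp only [viscousPairing, lineDeriv_rt, productPairing_neg, Finset.sum_neg_distrib, neg_neg, sub_neg_eq_add]

theorem KerBd.smul {k : ℤ} {C : ℝ≥0∞} {α : 𝓢(Sp N, ℂ)} (h : KerBd k C α) (c : ℂ) : KerBd k (‖c‖ₑ * C) (c • α : 𝓢(Sp N, ℂ)) := fun z => by
  have e : (c • α : 𝓢(Sp N, ℂ)) z = c * α z := rfl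
  rw [e, enorm_mul]
  refine ⟨?_, ?_⟩
  · rw [mul_assoc]; exact mul_le_mul_right (h z).1 _
  · calc _ = ‖c‖ₑ * (ofReal ((2 : ℝ) ^ k * ‖z‖) * ‖α z‖ₑ) := by ring
      _ ≤ _ := by rw [mul_assoc]; exact mul_le_mul_right (h z).2 _

theorem enorm_two_zpow (k : ℤ) : ‖(((2 : ℝ) ^ k : ℝ) : ℂ)‖ₑ = (2 : ℝ≥0∞) ^ (k : ℝ) := by
  rw [← ofReal_norm, Complex.norm_real, Real.norm_of_nonneg (by positivity), two_zpow_ofReal]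

theorem exists_kerBd_lineDeriv (α : 𝓢(Sp N, ℂ)) : ∃ C : ℝ≥0, ∀ (i : Fin N) (k : ℤ),
    KerBd k (2 ^ (k : ℝ) * C) (∂_{basisVec i} (dil k α) : 𝓢(Sp N, ℂ)) := by
  choose C hC using fun i : Fin N => exists_kerBd (∂_{basisVec i} α : 𝓢(Sp N, ℂ))
  refine ⟨∑ i, C i, fun i k z => ?_⟩
  rw [lineDeriv_dil]
  have h := (hC i k).smul (((2 : ℝ) ^ k : ℝ) : ℂ) z
  rw [enorm_two_zpow] at h
  have hle : (C i : ℝ≥0∞) ≤ (∑ i, C i : ℝ≥0) := by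
    exact_mod_cast Finset.single_le_sum (f := C) (fun _ _ => zero_le) (Finset.mem_univ i)
  have h2 : 2 ^ (k : ℝ) * C i * maj k z ≤ 2 ^ (k : ℝ) * (∑ i, C i : ℝ≥0) * maj k z :=
    mul_le_mul_left (mul_le_mul_right hle _) _
  exact ⟨h.1.trans h2, h.2.trans h2⟩

theorem exists_kerBd_lineDeriv_two (α : 𝓢(Sp N, ℂ)) : ∃ C : ℝ≥0, ∀ (i j : Fin N) (k : ℤ),
    KerBd k (2 ^ (k : ℝ) * (2 ^ (k : ℝ) * C)) (∂_{basisVec i} (∂_{basisVec j} (dil k α)) : 𝓢(Sp N, ℂ)) := by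
  choose C hC using fun j : Fin N => exists_kerBd_lineDeriv (∂_{basisVec j} α : 𝓢(Sp N, ℂ))
  refine ⟨∑ i, C i, fun i j k z => ?_⟩
  have e : (∂_{basisVec i} (∂_{basisVec j} (dil k α)) : 𝓢(Sp N, ℂ)) =
      (((2 : ℝ) ^ k : ℝ) : ℂ) • (∂_{basisVec i} (dil k (∂_{basisVec j} α : 𝓢(Sp N, ℂ))) : 𝓢(Sp N, ℂ)) := by
    rw [lineDeriv_dil k (basisVec j), LineDeriv.lineDerivOp_smul]
  have h := (hC j i k).smul (((2 : ℝ) ^ k : ℝ) : ℂ) z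
  rw [enorm_two_zpow, ← e] at h
  have hle : (C j : ℝ≥0∞) ≤ (∑ i, C i : ℝ≥0) := by
    exact_mod_cast Finset.single_le_sum (f := C) (fun _ _ => zero_le) (Finset.mem_univ j)
  have h2 : 2 ^ (k : ℝ) * (2 ^ (k : ℝ) * C j) * maj k z ≤
      2 ^ (k : ℝ) * (2 ^ (k : ℝ) * (∑ i, C i : ℝ≥0)) * maj k z :=
    mul_le_mul_left (mul_le_mul_right (mul_le_mul_right hle _) _) _
  exact ⟨h.1.trans h2, h.2.trans h2⟩

theorem exists_nrm_cv_lineDeriv_le {p : ℝ} (hp : 1 ≤ p) : ∃ C : ℝ≥0, ∀ (i : Fin N) (f : 𝓢'(Sp N, ℂ)) (k : ℤ),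
    nrm p (fun x => ‖cv (∂_{basisVec i} f) (kap Φ k) x‖ₑ) ≤ C * (2 ^ (k : ℝ) * nrm p fun x => ‖cv f (kap Φ k) x‖ₑ) := by
  obtain ⟨C, hC⟩ := exists_enorm_cv_lineDeriv_le Φ
  refine ⟨C * (cMaj N ^ 2).toNNReal, fun i f k => ?_⟩
  have hm := measurable_enorm_cv f (kap Φ k)
  refine (nrm_mono (by linarith) fun x => (hC i f k x).trans_eq (mul_assoc _ _ _).symm).trans ?_
  rw [nrm_const_mul (by linarith) _ (measurable_avg k hm), ENNReal.coe_mul, coe_toNNReal (ENNReal.pow_ne_top cMaj_ne_top)]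
  exact (mul_le_mul_right (nrm_avg_le k hp hm) _).trans_eq (by ring)

theorem cv_divergence (u : Fin N → 𝓢'(Sp N, ℂ)) (α : 𝓢(Sp N, ℂ)) (x : Sp N) :
    cv (divergence u) α x = ∑ i, cv (∂_{basisVec i} (u i)) α x := by
  simp only [cv, divergence]
  exact map_sum (PointwiseConvergenceCLM.evalCLM (RingHom.id ℂ) ℂ (rt α x)) (fun i => ∂_{basisVec i} (u i)) Finset.univ

theorem nrm_cv_divergence_le {p : ℝ} (hp : 1 ≤ p) {C : ℝ≥0}
    (hC : ∀ (i : Fin N) (f : 𝓢'(Sp N, ℂ)) (k : ℤ),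
      nrm p (fun x => ‖cv (∂_{basisVec i} f) (kap Φ k) x‖ₑ) ≤ C * (2 ^ (k : ℝ) * nrm p fun x => ‖cv f (kap Φ k) x‖ₑ))
    (u : Fin N → 𝓢'(Sp N, ℂ)) (k : ℤ) :
    nrm p (fun x => ‖cv (divergence u) (kap Φ k) x‖ₑ) ≤ C * (2 ^ (k : ℝ) * freqNorm Φ p u k) := by
  have h : ∀ x, ‖cv (divergence u) (kap Φ k) x‖ₑ ≤ ∑ i, ‖cv (∂_{basisVec i} (u i)) (kap Φ k) x‖ₑ := fun x => by
    rw [cv_divergence]; exact enorm_sum_le _ _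
  refine (nrm_mono (by linarith) h).trans ((nrm_sum_le hp fun i => measurable_enorm_cv _ _).trans ?_)
  rw [freqNorm, Finset.mul_sum, Finset.mul_sum]
  exact Finset.sum_le_sum fun i _ => hC i (u i) k

theorem exists_nrm_cv_lineDeriv_two_le {p : ℝ} (hp : 1 ≤ p) : ∃ C : ℝ≥0, ∀ (i j : Fin N) (f : 𝓢'(Sp N, ℂ)) (k : ℤ),
    nrm p (fun x => ‖cv (∂_{basisVec i} f) (∂_{basisVec j} (kap Φ k)) x‖ₑ) ≤
      C * (2 ^ (k : ℝ) * (2 ^ (k : ℝ) * nrm p fun x => ‖cv f (kap Φ k) x‖ₑ)) := by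
  obtain ⟨C, hC⟩ := exists_kerBd_lineDeriv_two (∑ i ∈ ({-1, 0, 1} : Finset ℤ), kap Φ i)
  refine ⟨C * (cMaj N ^ 2).toNNReal, fun i j f k => ?_⟩
  have hm := measurable_enorm_cv f (kap Φ k)
  have e : (∂_{basisVec i} (∂_{basisVec j} (kap Φ k)) : 𝓢(Sp N, ℂ)) = mconv (∂_{basisVec i} (∂_{basisVec j} (fatKap Φ k))) (kap Φ k) := by
    rw [← lineDeriv_mconv_left, ← lineDeriv_mconv_left, mconv_fatKap_kap]
  have h : ∀ x, ‖cv (∂_{basisVec i} f) (∂_{basisVec j} (kap Φ k)) x‖ₑ ≤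
      (2 ^ (k : ℝ) * (2 ^ (k : ℝ) * C)) * avg k (fun y => ‖cv f (kap Φ k) y‖ₑ) x := fun x => by
    rw [cv_lineDeriv, e]; exact enorm_cv_mconv_le (hC i j k) f _ x
  refine (nrm_mono (by linarith) h).trans ?_
  rw [nrm_const_mul (by linarith) _ (measurable_avg k hm), ENNReal.coe_mul, coe_toNNReal (ENNReal.pow_ne_top cMaj_ne_top)]
  exact (mul_le_mul_right (nrm_avg_le k hp hm) _).trans_eq (by ring)

/-- The principal part `b Δu_i + b' ∂_i div u` of the viscous term, localized by the `k`-th block. -/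
def principal (u : Fin N → 𝓢'(Sp N, ℂ)) (k : ℤ) (b b' : ℂ) (i : Fin N) (x : Sp N) : ℂ :=
  b * ∑ j : Fin N, cv (∂_{basisVec j} (u i)) (∂_{basisVec j} (kap Φ k)) x + b' * cv (divergence u) (∂_{basisVec i} (kap Φ k)) x

/-- The viscous term localized at the frequency `2^k` is its principal part with the coefficients outside
of the kernel, up to a commutator. -/
theorem exists_visc_sub_principal_le {p r : ℝ} (hp : 1 < p) (hpr : p ≤ r) (hr : p.conjExponent ≤ r) :
    ∃ C : ℝ≥0, ∀ (f : ℤ → ℝ≥0∞) (m m' : Sp N → ℝ) (b b' : Sp N → ℂ), Coeff Φ p f m b → Coeff Φ p f m' b' →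
      ∀ (u : Fin N → 𝓢'(Sp N, ℂ)) (k : ℤ), ∃ E : Sp N → ℝ≥0∞, Measurable E ∧
        nrm p E ≤ C * (2 ^ (k : ℝ) * viscBound N p r f (freqNorm Φ p u) k) ∧
        ∀ i x, ‖viscousPairing Φ m m' u i (rt (kap Φ k) x) - principal Φ u k (b x) (b' x) i x‖ₑ ≤ E x := by
  obtain ⟨C₁, h₁⟩ := exists_commutator Φ hp hpr hr
  obtain ⟨C₂, h₂⟩ := exists_nrm_cv_lineDeriv_le Φ hp.le
  obtain ⟨C₃, h₃⟩ := exists_kerBd_lineDeriv (𝓕⁻ (symb Φ))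
  refine ⟨C₃ * (N * N + 1) * (C₁ * C₂), fun f m m' b b' hb hb' u k => ?_⟩
  choose E hE hEn hEb using fun q : Fin N × Fin N => h₁ b m hb.bdd hb.ae_eq hb.summable (∂_{basisVec q.2} (u q.1)) k
  obtain ⟨E', hE', hEn', hEb'⟩ := h₁ b' m' hb'.bdd hb'.ae_eq hb'.summable (divergence u) k
  have hbound : ∀ (b : Sp N → ℂ), (∀ j, nrm p (fun y => ‖conv (kap Φ j) b y‖ₑ) ≤ f j) → ∀ w : 𝓢'(Sp N, ℂ),
      (∀ l, nrm p (fun x => ‖cv w (kap Φ l) x‖ₑ) ≤ C₂ * (2 ^ (l : ℝ) * freqNorm Φ p u l)) →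
      C₁ * ∑' j, ∑' l, commCoef N p r k j l * (nrm p (fun y => ‖conv (kap Φ j) b y‖ₑ) * nrm p (fun y => ‖cv w (kap Φ l) y‖ₑ)) ≤
        (C₁ * C₂) * viscBound N p r f (freqNorm Φ p u) k := fun b hb w hw => by
    rw [mul_assoc]
    refine mul_le_mul_right ?_ _
    rw [viscBound, ← ENNReal.tsum_mul_left]
    refine tsum_le_tsum fun j => ?_
    rw [← ENNReal.tsum_mul_left]
    refine tsum_le_tsum fun l => ?_
    refine (mul_le_mul_right (mul_le_mul' (hb j) (hw l)) _).trans_eq (by ring)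
  have hn1 : ∀ q, nrm p (E q) ≤ (C₁ * C₂) * viscBound N p r f (freqNorm Φ p u) k := fun q =>
    (hEn q).trans (hbound b hb.le _ fun l => (h₂ q.2 (u q.1) l).trans (mul_le_mul_right (mul_le_mul_right
      (Finset.single_le_sum (f := fun i => nrm p fun y => ‖cv (u i) (kap Φ l) y‖ₑ) (fun _ _ => zero_le) (Finset.mem_univ q.1)) _) _))
  have hn2 : nrm p E' ≤ (C₁ * C₂) * viscBound N p r f (freqNorm Φ p u) k :=
    hEn'.trans (hbound b' hb'.le _ fun l => nrm_cv_divergence_le Φ hp.le h₂ u l)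
  have hs : Measurable fun x => ∑ q, E q x := Finset.measurable_sum _ fun q _ => hE q
  refine ⟨fun x => (2 ^ (k : ℝ) * C₃) * (∑ q, E q x + E' x), (hs.add hE').const_mul _, ?_, fun i x => ?_⟩
  · have h0 := nrm_const_mul (p := p) (by linarith) (2 ^ (k : ℝ) * C₃) (hs.add hE')
    simp only [Pi.add_apply] at h0
    rw [h0]
    have h4 : nrm p (fun x => ∑ q, E q x + E' x) ≤ (N * N + 1) * ((C₁ * C₂) * viscBound N p r f (freqNorm Φ p u) k) := by
      refine (nrm_add_le hp.le hs hE').trans ?_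
      refine (add_le_add ((nrm_sum_le hp.le hE).trans (Finset.sum_le_sum fun q _ => hn1 q)) hn2).trans_eq ?_
      rw [Finset.sum_const, Finset.card_univ, Fintype.card_prod, Fintype.card_fin, nsmul_eq_mul]
      push_cast; ring
    refine (mul_le_mul_right h4 _).trans_eq ?_
    push_cast; ring
  · have hA : ∀ i, KerBd k ((((2 : ℝ≥0∞) ^ (k : ℝ) * C₃).toNNReal : ℝ≥0) : ℝ≥0∞) (∂_{basisVec i} (kap Φ k) : 𝓢(Sp N, ℂ)) := fun i => by
      rw [coe_toNNReal (mul_ne_top (two_rpow_ne_top _) coe_ne_top)]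
      exact h₃ i k
    have hAe : ((((2 : ℝ≥0∞) ^ (k : ℝ) * C₃).toNNReal : ℝ≥0) : ℝ≥0∞) = (2 : ℝ≥0∞) ^ (k : ℝ) * C₃ :=
      coe_toNNReal (mul_ne_top (two_rpow_ne_top _) coe_ne_top)
    have e : viscousPairing Φ m m' u i (rt (kap Φ k) x) - principal Φ u k (b x) (b' x) i x =
        ∑ j : Fin N, (productPairing Φ m (∂_{basisVec j} (u i)) (rt (∂_{basisVec j} (kap Φ k)) x) - b x * cv (∂_{basisVec j} (u i)) (∂_{basisVec j} (kap Φ k)) x) +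
        (productPairing Φ m' (divergence u) (rt (∂_{basisVec i} (kap Φ k)) x) - b' x * cv (divergence u) (∂_{basisVec i} (kap Φ k)) x) := by
      rw [viscousPairing_rt, principal, Finset.sum_sub_distrib, Finset.mul_sum]; ring
    rw [e]
    refine (enorm_add_le _ _).trans ?_
    beta_reduce
    rw [mul_add]
    refine add_le_add ((enorm_sum_le _ _).trans ?_) ?_
    · rw [Finset.mul_sum]
      calc _ ≤ ∑ j, (2 ^ (k : ℝ) * C₃) * E (i, j) x := Finset.sum_le_sum fun j _ => by
            have := hEb (i, j) _ _ (hA j) ((specIn_kap_self Φ k).lineDeriv _) x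
            rwa [hAe] at this
        _ ≤ ∑ i, ∑ j, (2 ^ (k : ℝ) * C₃) * E (i, j) x :=
            Finset.single_le_sum (f := fun i => ∑ j, (2 ^ (k : ℝ) * C₃) * E (i, j) x) (fun _ _ => zero_le) (Finset.mem_univ i)
        _ = _ := by rw [← Fintype.sum_prod_type' (f := fun i j => (2 ^ (k : ℝ) * C₃) * E (i, j) x)]
    · have := hEb' _ _ (hA i) ((specIn_kap_self Φ k).lineDeriv _) x
      rwa [hAe] at this

/-! ### Freezing the coefficients at a point -/

/-- The commutator of the multiplication by a coefficient and the convolution with `H`, acting on a function localized at the frequency `2^k`. -/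
theorem exists_freeze_le {p : ℝ} (hp : 1 ≤ p) : ∃ C : ℝ≥0, ∀ (b : Sp N → ℂ), BddCts b →
    ∑' j, blockSup Φ p b j ≠ ⊤ → ∀ (k : ℤ) (A : ℝ≥0) (H : 𝓢(Sp N, ℂ)), KerBd k A H → ∀ g : Sp N → ℂ, Continuous g →
      ∀ x, Integrable (fun y => H (x - y) * g y) →
      ‖∫ y, (b y - b x) * (H (x - y) * g y)‖ₑ ≤
        A * ((C * ∑' j, 2 ^ ((min 0 (j - k) : ℤ) : ℝ) * blockSup Φ p b j) * avg k (fun y => ‖g y‖ₑ) x) := by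
  obtain ⟨C, hC⟩ := exists_near_le Φ
  refine ⟨C, fun b hb hs k A H hH g hg x hi => ?_⟩
  refine (enorm_integral_sub_mul_le Φ hp hb hs hi x).trans ?_
  refine (tsum_le_tsum fun j => hC p hp b hb k j (ne_top_of_tsum_ne_top hs j) A H hH g hg.enorm.measurable x).trans_eq ?_
  rw [ENNReal.tsum_mul_left, ENNReal.tsum_mul_right, ENNReal.tsum_mul_left]

/-- The commutator of `exists_freeze_le` is made of the terms of `viscBound` with `l = k`. -/
theorem near_le_viscBound (p r : ℝ) {f : ℤ → ℝ≥0∞} {m : Sp N → ℝ} {b : Sp N → ℂ} (hb : Coeff Φ p f m b)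
    (n : ℤ → ℝ≥0∞) (k : ℤ) :
    (∑' j, 2 ^ ((min 0 (j - k) : ℤ) : ℝ) * blockSup Φ p b j) * (2 ^ (k : ℝ) * n k) ≤ viscBound N p r f n k := by
  rw [← ENNReal.tsum_mul_right, viscBound]
  refine tsum_le_tsum fun j => le_trans ?_ (ENNReal.le_tsum k)
  rw [commCoef, if_pos (by simp), two_rpow_add, blockSup]
  calc _ ≤ 2 ^ ((min 0 (j - k) : ℤ) : ℝ) * (2 ^ ((j : ℝ) * (N / p)) * f j) * (2 ^ (k : ℝ) * n k) :=
        mul_le_mul_left (mul_le_mul_right (mul_le_mul_right (hb.le j) _) _) _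
    _ = _ := by ring

theorem mconv_sum_left {ι : Type*} (s : Finset ι) (α : ι → 𝓢(Sp N, ℂ)) (β : 𝓢(Sp N, ℂ)) :
    mconv (∑ i ∈ s, α i) β = ∑ i ∈ s, mconv (α i) β := by
  refine fourier_ext fun ξ => ?_
  rw [fourier_mconv, fourier_sum_apply, fourier_sum_apply, Finset.sum_mul]
  exact Finset.sum_congr rfl fun i _ => (fourier_mconv _ _ _).symm

/-- The Laplacian of a Schwartz function. -/
def lapl (α : 𝓢(Sp N, ℂ)) : 𝓢(Sp N, ℂ) := ∑ j : Fin N, ∂_{basisVec j} (∂_{basisVec j} α)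

/-- For kernels `H` that are divergence free (`ε = 0`) or gradients (`ε = 1`), the convolution with `H`
turns the Lamé operator with the coefficients `c, c'` into `(c + ε c') Δ`. -/
theorem sum_integral_principal (u : Fin N → 𝓢'(Sp N, ℂ)) (k : ℤ) {ε : ℂ} {H : Fin N → 𝓢(Sp N, ℂ)}
    (hH : ∀ a : Fin N, ∑ i : Fin N, (∂_{basisVec a} (∂_{basisVec i} (H i)) : 𝓢(Sp N, ℂ)) = ε • lapl (H a)) (x : Sp N) :
    (∑ i : Fin N, ∫ z, H i (x - z) * ∑ j : Fin N, cv (∂_{basisVec j} (u i)) (∂_{basisVec j} (kap Φ k)) z =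
      ∑ i : Fin N, ∫ z, lapl (H i) (x - z) * cv (u i) (kap Φ k) z) ∧
    ∑ i : Fin N, ∫ z, H i (x - z) * cv (divergence u) (∂_{basisVec i} (kap Φ k)) z =
      ε * ∑ i : Fin N, ∫ z, lapl (H i) (x - z) * cv (u i) (kap Φ k) z := by
  have hl : ∀ i, ∫ z, lapl (H i) (x - z) * cv (u i) (kap Φ k) z = cv (u i) (mconv (lapl (H i)) (kap Φ k)) x := fun i =>
    integral_mul_cv' _ _ _ _
  have hdiv2 : ∀ v w α β, (mconv α (∂_{w} (∂_{v} β)) : 𝓢(Sp N, ℂ)) = mconv (∂_{w} (∂_{v} α)) β := fun v w α β => by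
    rw [← lineDeriv_mconv_right, ← lineDeriv_mconv_right, lineDeriv_mconv_left, lineDeriv_mconv_left]
  simp_rw [hl]
  constructor
  · refine Finset.sum_congr rfl fun i _ => ?_
    have e : ∀ z, ∑ j : Fin N, cv (∂_{basisVec j} (u i)) (∂_{basisVec j} (kap Φ k)) z = cv (u i) (lapl (kap Φ k)) z := fun z => by
      simp_rw [cv_lineDeriv]; rw [lapl, cv_sum]
    simp_rw [e]
    rw [integral_mul_cv', lapl, lapl, mconv_comm, mconv_sum_left, mconv_sum_left]
    congr 1
    refine Finset.sum_congr rfl fun j _ => ?_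
    rw [mconv_comm, hdiv2]
  · simp_rw [integral_mul_cv', cv_divergence, cv_lineDeriv]
    rw [Finset.sum_comm, Finset.mul_sum]
    refine Finset.sum_congr rfl fun a _ => ?_
    rw [← cv_sum, ← cv_smul]
    congr 1
    have e : ∀ i : Fin N, (∂_{basisVec a} (mconv (H i) (∂_{basisVec i} (kap Φ k))) : 𝓢(Sp N, ℂ)) = mconv (∂_{basisVec a} (∂_{basisVec i} (H i))) (kap Φ k) := fun i => by
      rw [lineDeriv_mconv_right, hdiv2]
    simp_rw [e]
    rw [← mconv_sum_left, hH]
    refine fourier_ext fun ξ => ?_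
    rw [fourier_mconv, fourier_smul_apply, fourier_smul_apply, fourier_mconv]; ring

theorem sum_cv_lineDeriv (u : 𝓢'(Sp N, ℂ)) (β : 𝓢(Sp N, ℂ)) (z : Sp N) :
    ∑ j : Fin N, cv (∂_{basisVec j} u) (∂_{basisVec j} β) z = cv u (lapl β) z := by
  simp_rw [cv_lineDeriv]; rw [lapl, cv_sum]

theorem integrable_mul_cv (H β : 𝓢(Sp N, ℂ)) (f : 𝓢'(Sp N, ℂ)) (x : Sp N) : Integrable fun y => H (x - y) * cv f β y := by
  have := (integral_mul_cv f (rt H x) β).1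
  simpa only [rt_apply] using this

theorem lintegral_enorm_mul_le {k : ℤ} {A : ℝ≥0∞} {H : 𝓢(Sp N, ℂ)} (h : KerBd k A H) {E : Sp N → ℝ≥0∞} (hE : Measurable E)
    {g : Sp N → ℂ} (hg : ∀ z, ‖g z‖ₑ ≤ E z) (x : Sp N) : ∫⁻ z, ‖H (x - z) * g z‖ₑ ≤ A * avg k E x := by
  rw [avg_eq k hE, ← lintegral_const_mul _ (by fun_prop)]
  refine lintegral_mono fun z => ?_
  simp only [enorm_mul]
  rw [← mul_assoc]
  exact mul_le_mul' (h _).1 (hg z)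

theorem exists_nrm_principal_le {p : ℝ} (hp : 1 ≤ p) : ∃ C : ℝ≥0, ∀ (u : Fin N → 𝓢'(Sp N, ℂ)) (k : ℤ) (i : Fin N),
    nrm p (fun z => ‖cv (u i) (lapl (kap Φ k)) z‖ₑ) ≤ C * (2 ^ (k : ℝ) * (2 ^ (k : ℝ) * freqNorm Φ p u k)) ∧
    nrm p (fun z => ‖cv (divergence u) (∂_{basisVec i} (kap Φ k)) z‖ₑ) ≤ C * (2 ^ (k : ℝ) * (2 ^ (k : ℝ) * freqNorm Φ p u k)) := by
  obtain ⟨C, hC⟩ := exists_nrm_cv_lineDeriv_two_le Φ hp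
  refine ⟨N * C + C, fun u k i => ⟨?_, ?_⟩⟩
  · have h : ∀ z, ‖cv (u i) (lapl (kap Φ k)) z‖ₑ ≤ ∑ j : Fin N, ‖cv (∂_{basisVec j} (u i)) (∂_{basisVec j} (kap Φ k)) z‖ₑ := fun z => by
      rw [← sum_cv_lineDeriv]; exact enorm_sum_le _ _
    refine (nrm_mono (by linarith) h).trans ((nrm_sum_le hp fun j => measurable_enorm_cv _ _).trans ?_)
    have h2 : ∀ j : Fin N, nrm p (fun z => ‖cv (∂_{basisVec j} (u i)) (∂_{basisVec j} (kap Φ k)) z‖ₑ) ≤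
        C * (2 ^ (k : ℝ) * (2 ^ (k : ℝ) * freqNorm Φ p u k)) := fun j =>
      (hC j j (u i) k).trans (mul_le_mul_right (mul_le_mul_right (mul_le_mul_right
        (Finset.single_le_sum (f := fun i => nrm p fun y => ‖cv (u i) (kap Φ k) y‖ₑ) (fun _ _ => zero_le) (Finset.mem_univ i)) _) _) _)
    refine (Finset.sum_le_sum fun j _ => h2 j).trans ?_
    rw [Finset.sum_const, Finset.card_univ, Fintype.card_fin, nsmul_eq_mul, ← mul_assoc]
    refine mul_le_mul_left ?_ _
    push_cast; exact le_self_add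
  · have h : ∀ z, ‖cv (divergence u) (∂_{basisVec i} (kap Φ k)) z‖ₑ ≤ ∑ j : Fin N, ‖cv (∂_{basisVec j} (u j)) (∂_{basisVec i} (kap Φ k)) z‖ₑ := fun z => by
      rw [cv_divergence]; exact enorm_sum_le _ _
    refine (nrm_mono (by linarith) h).trans ((nrm_sum_le hp fun j => measurable_enorm_cv _ _).trans ?_)
    refine (Finset.sum_le_sum fun j _ => hC j i (u j) k).trans ?_
    rw [← Finset.mul_sum, ← Finset.mul_sum, ← Finset.mul_sum]
    refine mul_le_mul_left ?_ _
    push_cast; exact le_add_self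

/-- The viscous term, convolved with kernels `H` as in `sum_integral_principal`, is the Laplacian with the
coefficient frozen at the point `x`, up to a commutator whose bound `E` does not depend on `H`. -/
theorem exists_frozen {p r : ℝ} (hp : 1 < p) (hpr : p ≤ r) (hr : p.conjExponent ≤ r) :
    ∃ C : ℝ≥0, ∀ (f : ℤ → ℝ≥0∞) (m m' : Sp N → ℝ) (b b' : Sp N → ℂ), Coeff Φ p f m b → Coeff Φ p f m' b' →
      ∀ (u : Fin N → 𝓢'(Sp N, ℂ)) (k : ℤ), viscBound N p r f (freqNorm Φ p u) k ≠ ⊤ →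
        (∀ i, AEStronglyMeasurable (fun z => viscousPairing Φ m m' u i (rt (kap Φ k) z)) volume) →
        ∃ E : Sp N → ℝ≥0∞, Measurable E ∧ nrm p E ≤ C * (2 ^ (k : ℝ) * viscBound N p r f (freqNorm Φ p u) k) ∧
          ∀ (ε : ℂ) (A : ℝ≥0) (H : Fin N → 𝓢(Sp N, ℂ)), (∀ i, KerBd k A (H i)) →
            (∀ a : Fin N, ∑ i : Fin N, (∂_{basisVec a} (∂_{basisVec i} (H i)) : 𝓢(Sp N, ℂ)) = ε • lapl (H a)) → ∀ x,
            ‖∑ i, (∫ z, H i (x - z) * viscousPairing Φ m m' u i (rt (kap Φ k) z)) -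
              (b x + ε * b' x) * ∑ i, ∫ z, lapl (H i) (x - z) * cv (u i) (kap Φ k) z‖ₑ ≤ A * E x := by
  obtain ⟨C₁, h₁⟩ := exists_visc_sub_principal_le Φ hp hpr hr
  obtain ⟨C₂, h₂⟩ := exists_freeze_le Φ hp.le
  obtain ⟨C₃, h₃⟩ := exists_nrm_principal_le Φ hp.le
  refine ⟨N * ((cMaj N ^ 2).toNNReal * (C₁ + 2 * (C₂ * C₃))), fun f m m' b b' hb hb' u k hfin hmeas => ?_⟩
  obtain ⟨E₀, hE₀, hE₀n, hE₀b⟩ := h₁ f m m' b b' hb hb' u k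
  have hc2 : (((cMaj N ^ 2).toNNReal : ℝ≥0) : ℝ≥0∞) = cMaj N ^ 2 := coe_toNNReal (ENNReal.pow_ne_top cMaj_ne_top)
  set V := viscBound N p r f (freqNorm Φ p u) k with hV
  set g₁ : Fin N → Sp N → ℂ := fun i z => cv (u i) (lapl (kap Φ k)) z with hg₁
  set g₂ : Fin N → Sp N → ℂ := fun i z => cv (divergence u) (∂_{basisVec i} (kap Φ k)) z with hg₂
  have hg₁c : ∀ i, Continuous (g₁ i) := fun i => continuous_cv _ _
  have hg₂c : ∀ i, Continuous (g₂ i) := fun i => continuous_cv _ _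
  set Q := C₂ * ∑' j, 2 ^ ((min 0 (j - k) : ℤ) : ℝ) * blockSup Φ p b j with hQ
  set Q' := C₂ * ∑' j, 2 ^ ((min 0 (j - k) : ℤ) : ℝ) * blockSup Φ p b' j with hQ'
  have ma := measurable_avg k hE₀
  have m1 : ∀ i, Measurable (avg k fun z => ‖g₁ i z‖ₑ) := fun i => measurable_avg k (hg₁c i).enorm.measurable
  have m2 : ∀ i, Measurable (avg k fun z => ‖g₂ i z‖ₑ) := fun i => measurable_avg k (hg₂c i).enorm.measurable
  refine ⟨fun x => ∑ i, (avg k E₀ x + (Q * avg k (fun z => ‖g₁ i z‖ₑ) x + Q' * avg k (fun z => ‖g₂ i z‖ₑ) x)),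
    Finset.measurable_fun_sum _ fun i _ => ma.add (((m1 i).const_mul Q).add ((m2 i).const_mul Q')), ?_, fun ε A H hH hHε x => ?_⟩
  · have hone : ∀ i, nrm p (fun x => avg k E₀ x + (Q * avg k (fun z => ‖g₁ i z‖ₑ) x + Q' * avg k (fun z => ‖g₂ i z‖ₑ) x)) ≤
        cMaj N ^ 2 * (C₁ + 2 * (C₂ * C₃)) * (2 ^ (k : ℝ) * V) := fun i => by
      have q1 : ∀ (b : Sp N → ℂ) (m : Sp N → ℝ), Coeff Φ p f m b → ∀ g : Sp N → ℂ, Continuous g → nrm p (fun z => ‖g z‖ₑ) ≤ C₃ * (2 ^ (k : ℝ) * (2 ^ (k : ℝ) * freqNorm Φ p u k)) →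
          nrm p (fun x => (C₂ * ∑' j, 2 ^ ((min 0 (j - k) : ℤ) : ℝ) * blockSup Φ p b j) * avg k (fun z => ‖g z‖ₑ) x) ≤
            cMaj N ^ 2 * (C₂ * C₃) * (2 ^ (k : ℝ) * V) := fun b m hb g hg hgn => by
        rw [nrm_const_mul (by linarith) _ (measurable_avg k hg.enorm.measurable)]
        refine (mul_le_mul_right ((nrm_avg_le k hp.le hg.enorm.measurable).trans (mul_le_mul_right hgn _)) _).trans ?_
        calc _ = cMaj N ^ 2 * (C₂ * C₃) * (2 ^ (k : ℝ) * ((∑' j, 2 ^ ((min 0 (j - k) : ℤ) : ℝ) * blockSup Φ p b j) *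
              (2 ^ (k : ℝ) * freqNorm Φ p u k))) := by ring
          _ ≤ _ := mul_le_mul_right (mul_le_mul_right (near_le_viscBound Φ p r hb _ k) _) _
      refine (nrm_add_le hp.le ma (((m1 i).const_mul Q).add ((m2 i).const_mul Q'))).trans ?_
      refine (add_le_add ((nrm_avg_le k hp.le hE₀).trans (mul_le_mul_right hE₀n _))
        ((nrm_add_le hp.le ((m1 i).const_mul Q) ((m2 i).const_mul Q')).trans
          (add_le_add (q1 b m hb (g₁ i) (hg₁c i) (h₃ u k i).1) (q1 b' m' hb' (g₂ i) (hg₂c i) (h₃ u k i).2)))).trans_eq ?_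
      ring
    refine (nrm_sum_le hp.le fun i => ma.add (((m1 i).const_mul Q).add ((m2 i).const_mul Q'))).trans ?_
    refine (Finset.sum_le_sum fun i _ => hone i).trans_eq ?_
    rw [Finset.sum_const, Finset.card_univ, Fintype.card_fin, nsmul_eq_mul]
    push_cast
    rw [hc2]; ring
  · obtain ⟨B, hB⟩ := hb.bdd.2
    obtain ⟨B', hB'⟩ := hb'.bdd.2
    set T : Fin N → Sp N → ℂ := fun i z => viscousPairing Φ m m' u i (rt (kap Φ k) z) with hT
    have hprin : ∀ i z c c', principal Φ u k c c' i z = c * g₁ i z + c' * g₂ i z := fun i z c c' => by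
      rw [principal, sum_cv_lineDeriv]
    set R : Fin N → Sp N → ℂ := fun i z => T i z - (b z * g₁ i z + b' z * g₂ i z) with hR
    have hRb : ∀ i z, ‖R i z‖ₑ ≤ E₀ z := fun i z => by
      have := hE₀b i z
      rwa [hprin] at this
    have havg : avg k E₀ x ≠ ⊤ := by
      refine ne_top_of_le_ne_top ?_ (avg_le_nrm k hp.le hE₀ x)
      refine mul_ne_top cMaj_ne_top (mul_ne_top (two_rpow_ne_top _) (ne_top_of_le_ne_top ?_ hE₀n))
      exact mul_ne_top coe_ne_top (mul_ne_top (two_rpow_ne_top _) hfin)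
    have hRm : ∀ i, AEStronglyMeasurable (R i) volume := fun i =>
      (hmeas i).sub ((hb.bdd.1.mul (hg₁c i)).add (hb'.bdd.1.mul (hg₂c i))).aestronglyMeasurable
    have hRi : ∀ i, Integrable fun z => H i (x - z) * R i z := fun i => by
      refine ⟨((H i).continuous.comp (continuous_const.sub continuous_id)).aestronglyMeasurable.mul (hRm i), ?_⟩
      exact (lintegral_enorm_mul_le (hH i) hE₀ (hRb i) x).trans_lt (ENNReal.mul_lt_top ENNReal.coe_lt_top havg.lt_top)
    have hi1 : ∀ i, Integrable fun z => H i (x - z) * g₁ i z := fun i => integrable_mul_cv _ _ _ _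
    have hi2 : ∀ i, Integrable fun z => H i (x - z) * g₂ i z := fun i => integrable_mul_cv _ _ _ _
    have hj1 : ∀ i, Integrable fun z => (b z - b x) * (H i (x - z) * g₁ i z) := fun i =>
      (hi1 i).bdd_mul (hb.bdd.1.sub continuous_const).aestronglyMeasurable (.of_forall fun z =>
        (norm_sub_le _ _).trans (add_le_add (hB z) (hB x)))
    have hj2 : ∀ i, Integrable fun z => (b' z - b' x) * (H i (x - z) * g₂ i z) := fun i =>
      (hi2 i).bdd_mul (hb'.bdd.1.sub continuous_const).aestronglyMeasurable (.of_forall fun z =>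
        (norm_sub_le _ _).trans (add_le_add (hB' z) (hB' x)))
    have hsplit : ∀ i, ∫ z, H i (x - z) * T i z = (∫ z, H i (x - z) * R i z) +
        ((∫ z, (b z - b x) * (H i (x - z) * g₁ i z)) + ∫ z, (b' z - b' x) * (H i (x - z) * g₂ i z)) +
        (b x * (∫ z, H i (x - z) * g₁ i z) + b' x * ∫ z, H i (x - z) * g₂ i z) := fun i => by
      have hj : Integrable fun z => (b z - b x) * (H i (x - z) * g₁ i z) + (b' z - b' x) * (H i (x - z) * g₂ i z) :=
        (hj1 i).add (hj2 i)
      have hk : Integrable fun z => b x * (H i (x - z) * g₁ i z) + b' x * (H i (x - z) * g₂ i z) :=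
        ((hi1 i).const_mul _).add ((hi2 i).const_mul _)
      have hRj : Integrable fun z => H i (x - z) * R i z +
          ((b z - b x) * (H i (x - z) * g₁ i z) + (b' z - b' x) * (H i (x - z) * g₂ i z)) := (hRi i).add hj
      rw [← integral_const_mul, ← integral_const_mul, ← integral_add (hj1 i) (hj2 i),
        ← integral_add ((hi1 i).const_mul _) ((hi2 i).const_mul _), ← integral_add (hRi i) hj, ← integral_add hRj hk]
      refine integral_congr_ae (.of_forall fun z => ?_)
      simp only [hR]; ring
    obtain ⟨hp1, hp2⟩ := sum_integral_principal Φ u k hHε x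
    simp_rw [sum_cv_lineDeriv] at hp1
    have hmain : ∑ i, (∫ z, H i (x - z) * T i z) - (b x + ε * b' x) * ∑ i, ∫ z, lapl (H i) (x - z) * cv (u i) (kap Φ k) z =
        ∑ i, ((∫ z, H i (x - z) * R i z) + ((∫ z, (b z - b x) * (H i (x - z) * g₁ i z)) + ∫ z, (b' z - b' x) * (H i (x - z) * g₂ i z))) := by
      simp_rw [hsplit]
      rw [Finset.sum_add_distrib, Finset.sum_add_distrib (g := fun i => b' x * ∫ z, H i (x - z) * g₂ i z), ← Finset.mul_sum, ← Finset.mul_sum]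
      rw [show ∑ i, ∫ z, H i (x - z) * g₁ i z = ∑ i : Fin N, ∫ z, lapl (H i) (x - z) * cv (u i) (kap Φ k) z from hp1,
        show ∑ i, ∫ z, H i (x - z) * g₂ i z = ε * ∑ i : Fin N, ∫ z, lapl (H i) (x - z) * cv (u i) (kap Φ k) z from hp2]
      ring
    rw [hmain]
    refine (enorm_sum_le _ _).trans ?_
    rw [Finset.mul_sum]
    refine Finset.sum_le_sum fun i _ => ?_
    rw [mul_add, mul_add]
    refine (enorm_add_le _ _).trans (add_le_add ?_ ((enorm_add_le _ _).trans (add_le_add ?_ ?_)))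
    · exact (enorm_integral_le_lintegral_enorm _).trans (lintegral_enorm_mul_le (hH i) hE₀ (hRb i) x)
    · exact h₂ b hb.bdd hb.summable k A (H i) (hH i) (g₁ i) (hg₁c i) x (hi1 i)
    · exact h₂ b' hb'.bdd hb'.summable k A (H i) (hH i) (g₂ i) (hg₂c i) x (hi2 i)

/-- A crude bound, which serves to justify integrability only. -/
theorem exists_nrm_visc_le {p r : ℝ} (hp : 1 < p) (hpr : p ≤ r) (hr : p.conjExponent ≤ r) :
    ∃ C : ℝ≥0, ∀ (f : ℤ → ℝ≥0∞) (m m' : Sp N → ℝ) (b b' : Sp N → ℂ), Coeff Φ p f m b → Coeff Φ p f m' b' →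
      ∀ S : ℝ≥0∞, (∀ x, ‖b x‖ₑ ≤ S) → (∀ x, ‖b' x‖ₑ ≤ S) → ∀ (u : Fin N → 𝓢'(Sp N, ℂ)) (k : ℤ) (i : Fin N),
        nrm p (fun z => ‖viscousPairing Φ m m' u i (rt (kap Φ k) z)‖ₑ) ≤
          C * (2 ^ (k : ℝ) * viscBound N p r f (freqNorm Φ p u) k +
            S * (2 ^ (k : ℝ) * (2 ^ (k : ℝ) * freqNorm Φ p u k))) := by
  obtain ⟨C₁, h₁⟩ := exists_visc_sub_principal_le Φ hp hpr hr
  obtain ⟨C₃, h₃⟩ := exists_nrm_principal_le Φ hp.le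
  refine ⟨C₁ + 2 * C₃, fun f m m' b b' hb hb' S hS hS' u k i => ?_⟩
  obtain ⟨E₀, hE₀, hE₀n, hE₀b⟩ := h₁ f m m' b b' hb hb' u k
  have c1 : Measurable fun z => ‖cv (u i) (lapl (kap Φ k)) z‖ₑ := measurable_enorm_cv _ _
  have c2 : Measurable fun z => ‖cv (divergence u) (∂_{basisVec i} (kap Φ k)) z‖ₑ := measurable_enorm_cv _ _
  have hpt : ∀ z, ‖viscousPairing Φ m m' u i (rt (kap Φ k) z)‖ₑ ≤ E₀ z + (S * ‖cv (u i) (lapl (kap Φ k)) z‖ₑ +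
      S * ‖cv (divergence u) (∂_{basisVec i} (kap Φ k)) z‖ₑ) := fun z => by
    have h := hE₀b i z
    have e : viscousPairing Φ m m' u i (rt (kap Φ k) z) = (viscousPairing Φ m m' u i (rt (kap Φ k) z) - principal Φ u k (b z) (b' z) i z) +
      (b z * cv (u i) (lapl (kap Φ k)) z + b' z * cv (divergence u) (∂_{basisVec i} (kap Φ k)) z) := by
      rw [principal, sum_cv_lineDeriv]; ring
    rw [e]
    refine (enorm_add_le _ _).trans (add_le_add h ((enorm_add_le _ _).trans ?_))
    rw [enorm_mul, enorm_mul]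
    exact add_le_add (mul_le_mul_left (hS z) _) (mul_le_mul_left (hS' z) _)
  refine (nrm_mono (by linarith) hpt).trans ((nrm_add_le hp.le hE₀ ((c1.const_mul S).add (c2.const_mul S))).trans ?_)
  refine (add_le_add hE₀n (nrm_add_le hp.le (c1.const_mul S) (c2.const_mul S))).trans ?_
  rw [nrm_const_mul (by linarith) _ c1, nrm_const_mul (by linarith) _ c2]
  refine (add_le_add le_rfl (add_le_add (mul_le_mul_right (h₃ u k i).1 _) (mul_le_mul_right (h₃ u k i).2 _))).trans ?_
  rw [mul_add]
  refine add_le_add (mul_le_mul_left (by push_cast; exact le_self_add) _) ?_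
  calc _ = (2 * C₃) * (S * (2 ^ (k : ℝ) * (2 ^ (k : ℝ) * freqNorm Φ p u k))) := by ring
    _ ≤ _ := mul_le_mul_left (by push_cast; exact le_add_self) _

/-! ### Duhamel's formula with a frozen space variable -/

theorem absolutelyContinuousOnInterval_integral {g : ℝ → ℂ} {a b : ℝ} (hg : IntervalIntegrable g volume a b) :
    AbsolutelyContinuousOnInterval (fun s => ∫ τ in a..s, g τ) a b := by
  have hre : IntervalIntegrable (fun s => (g s).re) volume a b := ⟨hg.1.re, hg.2.re⟩
  have him : IntervalIntegrable (fun s => (g s).im) volume a b := ⟨hg.1.im, hg.2.im⟩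
  have hc : ∀ w : ℂ, AbsolutelyContinuousOnInterval (fun _ : ℝ => w) a b := fun w =>
    (LipschitzWith.const w).lipschitzOnWith.absolutelyContinuousOnInterval
  have h := ((hre.absolutelyContinuousOnInterval_intervalIntegral left_mem_uIcc).smul (hc 1)).add
    ((him.absolutelyContinuousOnInterval_intervalIntegral left_mem_uIcc).smul (hc Complex.I))
  refine (absolutelyContinuousOnInterval_iff _ _ _).2 fun ε hε => ?_
  obtain ⟨δ, hδ, hδ'⟩ := (absolutelyContinuousOnInterval_iff _ _ _).1 h ε hε
  refine ⟨δ, hδ, fun E hE hlt => ?_⟩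
  refine (Finset.sum_congr rfl fun i hi => ?_).trans_lt (hδ' E hE hlt)
  have key : ∀ s ∈ uIcc a b, ∫ τ in a..s, g τ =
      ((fun s => ∫ τ in a..s, (g τ).re) • (fun _ : ℝ => (1 : ℂ)) + (fun s => ∫ τ in a..s, (g τ).im) • (fun _ : ℝ => Complex.I)) s := fun s hs => by
    have hgs : IntervalIntegrable g volume a s := hg.mono_set (uIcc_subset_uIcc_left hs)
    simp only [Pi.add_apply, Pi.smul_apply', Complex.real_smul, mul_one]
    rw [← intervalIntegral.integral_ofReal, ← intervalIntegral.integral_ofReal, ← intervalIntegral.integral_mul_const,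
      ← intervalIntegral.integral_add]
    · exact intervalIntegral.integral_congr fun τ _ => (Complex.re_add_im _).symm
    · exact ⟨hgs.1.re.ofReal, hgs.2.re.ofReal⟩
    · exact (IntervalIntegrable.mul_const (⟨hgs.1.im.ofReal, hgs.2.im.ofReal⟩) _)
  rw [key _ (hE.1 i hi).1, key _ (hE.1 i hi).2]

theorem intervalIntegrable_of_abs_le {κ : ℝ → ℝ} {D : ℝ} (hκm : Measurable κ) (hκ : ∀ s, |κ s| ≤ D) (a b : ℝ) :
    IntervalIntegrable κ volume a b :=
  (intervalIntegrable_const (c := D)).mono_fun hκm.aestronglyMeasurable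
    (.of_forall fun s => (hκ s).trans (le_abs_self _))

theorem absolutelyContinuousOnInterval_comp_integral {κ : ℝ → ℝ} {D t : ℝ} (hκm : Measurable κ) (hκ : ∀ s, |κ s| ≤ D)
    {h h' : ℝ → ℂ} (hh : ∀ m, HasDerivAt h (h' m) m) (hc : Continuous h') :
    AbsolutelyContinuousOnInterval (fun s => h (∫ σ in s..t, κ σ)) 0 t := by
  have hint := intervalIntegrable_of_abs_le hκm hκ
  have hM : ∀ a b, |(∫ σ in a..t, κ σ) - ∫ σ in b..t, κ σ| ≤ D * |a - b| := fun a b => by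
    rw [intervalIntegral.integral_interval_sub_interval_comm (hint a t) (hint b t) (hint a b), intervalIntegral.integral_same, sub_zero]
    have := intervalIntegral.norm_integral_le_of_norm_le_const (a := a) (b := b) (f := κ) (C := D) fun s _ => hκ s
    rwa [Real.norm_eq_abs, abs_sub_comm b a] at this
  have hD : 0 ≤ D := (abs_nonneg _).trans (hκ 0)
  obtain ⟨L, hL⟩ := (isCompact_Icc (a := -(D * |t|)) (b := D * |t|)).exists_bound_of_continuousOn hc.continuousOn
  have hLip : LipschitzOnWith L.toNNReal h (Icc (-(D * |t|)) (D * |t|)) :=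
    (convex_Icc _ _).lipschitzOnWith_of_nnnorm_hasDerivWithin_le (fun m _ => (hh m).hasDerivWithinAt) fun m hm => by
      rw [← NNReal.coe_le_coe, coe_nnnorm]
      exact (hL m hm).trans (Real.le_coe_toNNReal L)
  have hmem : ∀ s ∈ uIcc 0 t, ∫ σ in s..t, κ σ ∈ Icc (-(D * |t|)) (D * |t|) := fun s hs => by
    have h1 := hM s t
    rw [intervalIntegral.integral_same, sub_zero] at h1
    have h2 : |s - t| ≤ |t| := by
      have := abs_sub_le_of_uIcc_subset_uIcc (uIcc_subset_uIcc_right hs)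
      rw [abs_sub_comm] at this
      simpa using this
    exact abs_le.1 (h1.trans (mul_le_mul_of_nonneg_left h2 hD))
  refine LipschitzOnWith.absolutelyContinuousOnInterval (K := L.toNNReal * D.toNNReal) ?_
  refine LipschitzOnWith.of_dist_le_mul fun a ha b hb => ?_
  refine (hLip.dist_le_mul _ (hmem a ha) _ (hmem b hb)).trans ?_
  push_cast
  rw [mul_assoc, Real.coe_toNNReal D hD, Real.dist_eq, Real.dist_eq]
  exact mul_le_mul_of_nonneg_left (hM a b) (NNReal.coe_nonneg _)

/-- Integration by parts along the flow of `s ↦ ∫_s^t κ`. -/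
theorem duhamel_scalar {κ : ℝ → ℝ} {D t : ℝ} (hκm : Measurable κ) (hκ : ∀ s, |κ s| ≤ D)
    {h h' : ℝ → ℂ} (hh : ∀ m, HasDerivAt h (h' m) m) (hc : Continuous h') {g : ℝ → ℂ}
    (hg : IntervalIntegrable g volume 0 t) (v₀ : ℂ) :
    h 0 * (v₀ + ∫ τ in (0 : ℝ)..t, g τ) = h (∫ σ in (0 : ℝ)..t, κ σ) * v₀ +
      ∫ s in (0 : ℝ)..t, (h (∫ σ in s..t, κ σ) * g s - h' (∫ σ in s..t, κ σ) * κ s * (v₀ + ∫ τ in (0 : ℝ)..s, g τ)) := by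
  have hint := intervalIntegrable_of_abs_le hκm hκ
  have hMc : Continuous fun s => ∫ σ in s..t, κ σ := by
    rw [show (fun s => ∫ σ in s..t, κ σ) = fun s => -∫ σ in t..s, κ σ from funext fun s => intervalIntegral.integral_symm t s]
    exact (intervalIntegral.continuous_primitive hint t).neg
  have hhc : Continuous h := continuous_iff_continuousAt.2 fun m => (hh m).continuousAt
  have hvc : ContinuousOn (fun s => v₀ + ∫ τ in (0 : ℝ)..s, g τ) (uIcc 0 t) :=
    continuousOn_const.add (intervalIntegral.continuousOn_primitive_interval' hg left_mem_uIcc)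
  set q : ℝ → ℂ := fun s => h (∫ σ in s..t, κ σ) * g s - h' (∫ σ in s..t, κ σ) * κ s * (v₀ + ∫ τ in (0 : ℝ)..s, g τ) with hq
  have hκi : IntervalIntegrable (fun s => (κ s : ℂ)) volume 0 t := ⟨(hint 0 t).1.ofReal, (hint 0 t).2.ofReal⟩
  have hqi : IntervalIntegrable q volume 0 t := by
    refine (hg.continuousOn_mul (hhc.comp hMc).continuousOn).sub ?_
    exact ((hκi.continuousOn_mul (hc.comp hMc).continuousOn)).mul_continuousOn hvc
  have hA := ((absolutelyContinuousOnInterval_comp_integral (t := t) hκm hκ hh hc).smul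
    (((LipschitzWith.const v₀).lipschitzOnWith.absolutelyContinuousOnInterval).add (absolutelyContinuousOnInterval_integral hg))).sub
    (absolutelyContinuousOnInterval_integral hqi)
  obtain ⟨C, hC⟩ := hA.const_of_ae_hasDerivAt_zero (by
    filter_upwards [hg.ae_hasDerivAt_integral, hqi.ae_hasDerivAt_integral, (hint 0 t).ae_hasDerivAt_integral] with s h1 h2 h3 hs
    have d1 := h1 hs 0 left_mem_uIcc
    have d2 := h2 hs 0 left_mem_uIcc
    have d3 : HasDerivAt (fun s => ∫ σ in s..t, κ σ) (-κ s) s := by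
      rw [show (fun s => ∫ σ in s..t, κ σ) = fun s => -∫ σ in t..s, κ σ from funext fun s => intervalIntegral.integral_symm t s]
      exact (h3 hs t right_mem_uIcc).neg
    have d4 : HasDerivAt (fun s => h (∫ σ in s..t, κ σ)) ((-κ s : ℝ) • h' (∫ σ in s..t, κ σ)) s :=
      (hh _).scomp s d3
    have := (d4.mul (d1.const_add v₀)).sub d2
    refine this.congr_deriv ?_
    simp only [hq, Complex.real_smul]; push_cast; ring)
  have e0 := hC 0 left_mem_uIcc
  have e1 := hC t right_mem_uIcc
  simp only [Pi.sub_apply, smul_eq_mul, Pi.mul_apply, Pi.add_apply, intervalIntegral.integral_same, add_zero, sub_zero] at e0 e1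
  rw [e0, ← e1]; ring

theorem measurable_intervalIntegral {X E : Type*} [MeasurableSpace X] [NormedAddCommGroup E] [NormedSpace ℝ E] [MeasurableSpace E]
    [BorelSpace E] [SecondCountableTopology E]
    {g : ℝ → X → E} (hg : Measurable (uncurry g)) {α β : X → ℝ} (hα : Measurable α) (hβ : Measurable β) :
    Measurable fun x => ∫ τ in α x..β x, g τ x := by
  have key : ∀ {α β : X → ℝ}, Measurable α → Measurable β → Measurable fun x => ∫ τ in Ioc (α x) (β x), g τ x := fun {α β} hα hβ => by
    simp_rw [← integral_indicator measurableSet_Ioc]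
    have hm : Measurable (uncurry fun (x : X) (τ : ℝ) => (Ioc (α x) (β x)).indicator (fun τ => g τ x) τ) := by
      have hs : MeasurableSet {q : X × ℝ | q.2 ∈ Ioc (α q.1) (β q.1)} :=
        (measurableSet_lt (hα.comp measurable_fst) measurable_snd).inter (measurableSet_le measurable_snd (hβ.comp measurable_fst))
      exact (hg.comp measurable_swap).indicator hs
    exact (hm.stronglyMeasurable.integral_prod_right (ν := volume)).measurable
  exact (key hα hβ).sub (key hβ hα)

/-- Duhamel's formula for one kernel, integrated in space; `w` dominates the kernels. -/
theorem duhamel_integral {κ : ℝ → ℝ} {D : ℝ≥0} {t : ℝ} (ht : 0 ≤ t) (hκm : Measurable κ) (hκ0 : ∀ s, 0 ≤ κ s) (hκ : ∀ s, κ s ≤ D)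
    {h h' : ℝ → Sp N → ℂ} (hh : ∀ m z, HasDerivAt (fun m => h m z) (h' m z) m) (hc : Continuous (uncurry h))
    (hc' : Continuous (uncurry h')) {w : Sp N → ℝ≥0∞} (hw : Measurable w) (hw0 : ∀ z, w z ≠ 0)
    (hhw : ∀ m, 0 ≤ m → ∀ z, ‖h m z‖ₑ ≤ w z) (hhw' : ∀ m, 0 ≤ m → ∀ z, ‖h' m z‖ₑ ≤ w z)
    {g : ℝ → Sp N → ℂ} (hg : Measurable (uncurry g)) {v₀ : Sp N → ℂ} (hv₀ : Measurable v₀)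
    (hv₀f : ∫⁻ z, w z * ‖v₀ z‖ₑ ≠ ⊤) (hgf : ∫⁻ s in Ioc 0 t, ∫⁻ z, w z * ‖g s z‖ₑ ≠ ⊤) :
    IntegrableOn (fun s => ∫ z, (h (∫ σ in s..t, κ σ) z * g s z -
      h' (∫ σ in s..t, κ σ) z * κ s * (v₀ z + ∫ τ in (0 : ℝ)..s, g τ z))) (Ioc 0 t) ∧
    ∫ z, h 0 z * (v₀ z + ∫ τ in (0 : ℝ)..t, g τ z) = (∫ z, h (∫ σ in (0 : ℝ)..t, κ σ) z * v₀ z) +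
      ∫ s in Ioc 0 t, ∫ z, (h (∫ σ in s..t, κ σ) z * g s z - h' (∫ σ in s..t, κ σ) z * κ s * (v₀ z + ∫ τ in (0 : ℝ)..s, g τ z)) := by
  have hgm : Measurable fun q : ℝ × Sp N => w q.2 * ‖g q.1 q.2‖ₑ := (hw.comp measurable_snd).mul hg.enorm
  have hswap : ∫⁻ z, w z * ∫⁻ s in Ioc 0 t, ‖g s z‖ₑ ≠ ⊤ := by
    have e : ∫⁻ z, w z * ∫⁻ s in Ioc 0 t, ‖g s z‖ₑ = ∫⁻ s in Ioc 0 t, ∫⁻ z, w z * ‖g s z‖ₑ := by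
      rw [lintegral_lintegral_swap hgm.aemeasurable]
      refine lintegral_congr fun z => (lintegral_const_mul _ ?_).symm
      exact (hg.comp measurable_prodMk_right).enorm
    rwa [e]
  have hGm : Measurable fun z => ∫⁻ s in Ioc 0 t, ‖g s z‖ₑ := Measurable.lintegral_prod_left' (f := fun q : ℝ × Sp N => ‖g q.1 q.2‖ₑ) hg.enorm
  have hae : ∀ᵐ z, ∫⁻ s in Ioc 0 t, ‖g s z‖ₑ < ⊤ := by
    filter_upwards [ae_lt_top (hw.mul hGm) hswap] with z hz
    exact ENNReal.lt_top_of_mul_ne_top_right hz.ne (hw0 z)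
  have hint : ∀ᵐ z, IntervalIntegrable (fun s => g s z) volume 0 t := hae.mono fun z hz =>
    (intervalIntegrable_iff_integrableOn_Ioc_of_le ht).2 ⟨(hg.comp measurable_prodMk_right).aestronglyMeasurable, hz⟩
  have habs : ∀ s, |κ s| ≤ D := fun s => by rw [abs_of_nonneg (hκ0 s)]; exact hκ s
  have hM : ∀ s, s ≤ t → 0 ≤ ∫ σ in s..t, κ σ := fun s hs => intervalIntegral.integral_nonneg hs fun σ _ => hκ0 σ
  have hMm : Measurable fun s => ∫ σ in s..t, κ σ :=
    measurable_intervalIntegral (g := fun σ _ => κ σ) (hκm.comp measurable_fst) measurable_id measurable_const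
  have hvm : Measurable fun q : Sp N × ℝ => ∫ τ in (0 : ℝ)..q.2, g τ q.1 :=
    measurable_intervalIntegral (X := Sp N × ℝ) (g := fun τ q => g τ q.1) (hg.comp (measurable_fst.prodMk (measurable_fst.comp measurable_snd)))
      measurable_const measurable_snd
  set q : Sp N → ℝ → ℂ := fun z s => h (∫ σ in s..t, κ σ) z * g s z -
    h' (∫ σ in s..t, κ σ) z * κ s * (v₀ z + ∫ τ in (0 : ℝ)..s, g τ z) with hq
  have hqm : Measurable (uncurry q) := by
    refine ((hc.measurable.comp ((hMm.comp measurable_snd).prodMk measurable_fst)).mul (hg.comp measurable_swap)).sub ?_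
    exact ((hc'.measurable.comp ((hMm.comp measurable_snd).prodMk measurable_fst)).mul
      (Complex.measurable_ofReal.comp (hκm.comp measurable_snd))).mul ((hv₀.comp measurable_fst).add hvm)
  have hqb : ∀ z, ∀ s ∈ Ioc 0 t, ‖q z s‖ₑ ≤ w z * ‖g s z‖ₑ + D * (w z * ‖v₀ z‖ₑ + w z * ∫⁻ s in Ioc 0 t, ‖g s z‖ₑ) := fun z s hs => by
    refine enorm_sub_le.trans (add_le_add ?_ ?_)
    · rw [enorm_mul]; exact mul_le_mul_left (hhw _ (hM s hs.2) z) _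
    · rw [enorm_mul, enorm_mul, ← mul_add, ← mul_assoc, mul_comm (D : ℝ≥0∞)]
      refine mul_le_mul' (mul_le_mul' (hhw' _ (hM s hs.2) z) ?_) ((enorm_add_le _ _).trans (add_le_add le_rfl ?_))
      · rw [← ofReal_norm, Complex.norm_real, Real.norm_eq_abs, ← ENNReal.ofReal_coe_nnreal]
        exact ofReal_le_ofReal (habs s)
      · rw [intervalIntegral.integral_of_le hs.1.le]
        exact (enorm_integral_le_lintegral_enorm _).trans (lintegral_mono_set (Ioc_subset_Ioc_right hs.2))
  have hqi : Integrable (uncurry q) ((volume : Measure (Sp N)).prod (volume.restrict (Ioc 0 t))) := by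
    refine ⟨hqm.aestronglyMeasurable, ?_⟩
    rw [HasFiniteIntegral, lintegral_prod _ hqm.enorm.aemeasurable]
    have hle : ∫⁻ z, ∫⁻ s in Ioc 0 t, ‖uncurry q (z, s)‖ₑ ≤
        ∫⁻ z, ((w z * ∫⁻ s in Ioc 0 t, ‖g s z‖ₑ) + D * (w z * ‖v₀ z‖ₑ + w z * ∫⁻ s in Ioc 0 t, ‖g s z‖ₑ) * volume (Ioc 0 t)) := by
      refine lintegral_mono fun z => ?_
      refine (setLIntegral_mono' measurableSet_Ioc fun s hs => hqb z s hs).trans_eq ?_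
      have hgz : Measurable fun s => ‖g s z‖ₑ := (hg.comp measurable_prodMk_right).enorm
      rw [lintegral_add_right _ measurable_const, lintegral_const, Measure.restrict_apply_univ, lintegral_const_mul _ hgz]
    refine hle.trans_lt ?_
    have ha : Measurable fun z => w z * ∫⁻ s in Ioc 0 t, ‖g s z‖ₑ := hw.mul hGm
    have hb : Measurable fun z => w z * ‖v₀ z‖ₑ := hw.mul hv₀.enorm
    have hba : Measurable fun z => w z * ‖v₀ z‖ₑ + w z * ∫⁻ s in Ioc 0 t, ‖g s z‖ₑ := hb.add ha
    rw [lintegral_add_left ha, lintegral_mul_const _ (hba.const_mul _), lintegral_const_mul _ hba, lintegral_add_left hb]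
    refine ENNReal.add_lt_top.2 ⟨hswap.lt_top, ?_⟩
    exact ENNReal.mul_lt_top (ENNReal.mul_lt_top ENNReal.coe_lt_top (ENNReal.add_lt_top.2 ⟨hv₀f.lt_top, hswap.lt_top⟩))
      (by rw [Real.volume_Ioc]; exact ENNReal.ofReal_lt_top)
  have h1 : ∀ᵐ z, h 0 z * (v₀ z + ∫ τ in (0 : ℝ)..t, g τ z) = h (∫ σ in (0 : ℝ)..t, κ σ) z * v₀ z + ∫ s in Ioc 0 t, q z s :=
    hint.mono fun z hz => by
      rw [← intervalIntegral.integral_of_le ht]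
      exact duhamel_scalar hκm habs (fun m => hh m z) (hc'.comp (Continuous.prodMk_left z)) hz (v₀ z)
  refine ⟨hqi.integral_prod_right, ?_⟩
  have hr : Integrable fun z => ∫ s in Ioc 0 t, q z s := hqi.integral_prod_left
  rw [integral_congr_ae h1, integral_add _ hr]
  · rw [integral_integral_swap hqi]
  · refine ⟨((hc.comp (Continuous.prodMk_right _)).measurable.mul hv₀).aestronglyMeasurable, ?_⟩
    refine lt_of_le_of_lt (lintegral_mono fun z => ?_) hv₀f.lt_top
    rw [enorm_mul]; exact mul_le_mul_left (hhw _ (hM 0 ht) z) _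

theorem maj_ne_zero (k : ℤ) (z : Sp N) : maj k z ≠ 0 := by
  rw [maj, Ne, ENNReal.ofReal_eq_zero, not_le]; positivity

theorem nrm_const_mul_le {p : ℝ} (hp : 0 < p) {c : ℝ≥0∞} (hc : c ≠ ⊤) (f : Sp N → ℝ≥0∞) :
    nrm p (fun x => c * f x) ≤ c * nrm p f := by
  simp_rw [nrm, mul_rpow_of_nonneg _ _ hp.le]
  rw [lintegral_const_mul' _ _ (ENNReal.rpow_ne_top_of_nonneg hp.le hc), mul_rpow_of_nonneg _ _ (by positivity),
    ← rpow_mul, mul_one_div_cancel hp.ne', rpow_one]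

theorem measurable_maj_mul (k : ℤ) (x : Sp N) {g : Sp N → ℂ} (hg : Measurable g) : Measurable fun y => maj k (x - y) * ‖g y‖ₑ :=
  ((measurable_maj k).comp (measurable_const.sub measurable_id)).mul hg.enorm

theorem integrable_maj_mul {k : ℤ} {p : ℝ} (hp : 1 ≤ p) {A : ℝ≥0} {h : Sp N → ℂ} (hh : Continuous h) (hA : ∀ z, ‖h z‖ₑ ≤ A * maj k z)
    {g : Sp N → ℂ} (hg : Measurable g) (hgn : nrm p (fun z => ‖g z‖ₑ) ≠ ⊤) (x : Sp N) : Integrable fun z => h (x - z) * g z := by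
  refine ⟨((hh.comp (continuous_const.sub continuous_id)).measurable.mul hg).aestronglyMeasurable, ?_⟩
  have : ∫⁻ z, ‖h (x - z) * g z‖ₑ ≤ A * avg k (fun z => ‖g z‖ₑ) x := by
    rw [avg_eq k hg.enorm, ← lintegral_const_mul _ (measurable_maj_mul k x hg)]
    refine lintegral_mono fun z => ?_
    simp only [enorm_mul]
    rw [← mul_assoc]
    exact mul_le_mul_left (hA _) _
  refine (this.trans (mul_le_mul_right (avg_le_nrm k hp hg.enorm x) _)).trans_lt ?_
  exact ENNReal.mul_lt_top ENNReal.coe_lt_top (ENNReal.mul_lt_top cMaj_ne_top.lt_top (ENNReal.mul_lt_top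
    (two_rpow_ne_top _).lt_top hgn.lt_top))

theorem lintegral_maj_mul_le {k : ℤ} {p : ℝ} (hp : 1 ≤ p) (A : ℝ≥0) {g : Sp N → ℂ} (hg : Measurable g) (x : Sp N) :
    ∫⁻ z, A * maj k (x - z) * ‖g z‖ₑ ≤ A * (cMaj N * (2 : ℝ≥0∞) ^ ((k : ℝ) * (N / p))) * nrm p (fun z => ‖g z‖ₑ) := by
  simp_rw [mul_assoc (A : ℝ≥0∞)]
  rw [lintegral_const_mul _ (measurable_maj_mul k x hg), ← avg_eq k hg.enorm, mul_assoc]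
  exact mul_le_mul_right (avg_le_nrm k hp hg.enorm x) _

/-- Duhamel's formula with a coefficient `κ` frozen at each point in turn: the part of `V` selected by the kernels
`H i 0` is controlled by the initial value and by the error `e` made in freezing the coefficient. -/
theorem duhamel_estimate {k : ℤ} {p : ℝ} (hp : 1 < p) {T c₁ β : ℝ} (hc₁ : 0 ≤ c₁) (hβ : 0 ≤ β) {κ : ℝ → Sp N → ℝ} {D : ℝ≥0}
    (hκm : Measurable (uncurry κ)) (hκ1 : ∀ s x, c₁ ≤ κ s x) (hκ2 : ∀ s x, κ s x ≤ D)
    {H L : Fin N → ℝ → Sp N → ℂ} (hHL : ∀ i m z, HasDerivAt (fun m => H i m z) (L i m z) m)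
    (hHc : ∀ i, Continuous (uncurry (H i))) (hLc : ∀ i, Continuous (uncurry (L i)))
    {A B : ℝ≥0} (hA : ∀ i m, 0 ≤ m → ∀ z, ‖H i m z‖ₑ ≤ ofReal (Real.exp (-(β * m))) * A * maj k z)
    (hB : ∀ i m, 0 ≤ m → ∀ z, ‖L i m z‖ₑ ≤ B * maj k z)
    {g : Fin N → ℝ → Sp N → ℂ} (hg : ∀ i, Measurable (uncurry (g i)))
    (hgn : ∀ i, ∫⁻ s in Ioo 0 T, nrm p (fun z => ‖g i s z‖ₑ) ≠ ⊤)
    {v₀ : Fin N → Sp N → ℂ} (hv₀ : ∀ i, Measurable (v₀ i)) (hv₀n : ∀ i, nrm p (fun z => ‖v₀ i z‖ₑ) ≠ ⊤)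
    {V : ℝ → Fin N → Sp N → ℂ} (hVm : ∀ t i, Measurable (V t i)) (hVn : ∀ᵐ t ∂volume.restrict (Ioo 0 T), ∀ i, nrm p (fun z => ‖V t i z‖ₑ) ≠ ⊤)
    (hV : ∀ᵐ t ∂volume.restrict (Ioo 0 T), ∀ i, ∀ᵐ z, V t i z = v₀ i z + ∫ τ in (0 : ℝ)..t, g i τ z)
    {e : ℝ → ℝ≥0∞} (he : AEMeasurable e (volume.restrict (Ioo 0 T)))
    (hE : ∀ᵐ s ∂volume.restrict (Ioo 0 T), ∃ E : Sp N → ℝ≥0∞, nrm p E ≤ e s ∧ ∀ᵐ x, ∀ m, 0 ≤ m →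
      ‖∑ i, (∫ z, H i m (x - z) * g i s z) - κ s x * ∑ i, ∫ z, L i m (x - z) * V s i z‖ₑ ≤ ofReal (Real.exp (-(β * m))) * E x) :
    ∀ᵐ t ∂volume.restrict (Ioo 0 T), nrm p (fun x => ‖∑ i, ∫ z, H i 0 (x - z) * V t i z‖ₑ) ≤
      ofReal (Real.exp (-(β * (c₁ * t)))) * (A * cMaj N ^ 2 * ∑ i, nrm p (fun z => ‖v₀ i z‖ₑ)) +
        ∫⁻ s in Ioc 0 t, ofReal (Real.exp (-(β * (c₁ * (t - s))))) * e s := by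
  have hp0 : 0 < p := by linarith
  have hgm : ∀ i s, Measurable (g i s) := fun i s => (hg i).comp measurable_prodMk_left
  have hgfin : ∀ᵐ s ∂volume.restrict (Ioo 0 T), ∀ i, nrm p (fun z => ‖g i s z‖ₑ) ≠ ⊤ := by
    refine ae_all_iff.2 fun i => (ae_lt_top ?_ (hgn i)).mono fun s hs => hs.ne
    exact ((Measurable.lintegral_prod_right' (f := fun q : ℝ × Sp N => ‖g i q.1 q.2‖ₑ ^ p) ((hg i).enorm.pow_const p)).pow_const _)
  have hmem : ∀ᵐ t ∂volume.restrict (Ioo 0 T), t ∈ Ioo 0 T := ae_restrict_mem measurableSet_Ioo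
  filter_upwards [hV, hmem] with t hVt ht
  have hsub : Ioc 0 t ⊆ Ioo 0 T := fun s hs => ⟨hs.1, hs.2.trans_lt ht.2⟩
  have hres : ∀ {P : ℝ → Prop}, (∀ᵐ s ∂volume.restrict (Ioo 0 T), P s) → ∀ᵐ s ∂volume.restrict (Ioc 0 t), P s := fun h =>
    ae_mono (Measure.restrict_mono hsub le_rfl) h
  have hκ0 : ∀ s x, 0 ≤ κ s x := fun s x => hc₁.trans (hκ1 s x)
  have hκi : ∀ x a b, IntervalIntegrable (fun s => κ s x) volume a b := fun x => intervalIntegrable_of_abs_le (D := D)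
    (hκm.comp measurable_prodMk_right) fun s => by rw [abs_of_nonneg (hκ0 s x)]; exact hκ2 s x
  -- the time left until `t`, measured by the diffusivity at the centre `x` of the kernels
  set M : ℝ → Sp N → ℝ := fun s x => ∫ σ in s..t, κ σ x with hM
  have hMm : Measurable (uncurry M) := measurable_intervalIntegral (X := ℝ × Sp N) (g := fun σ q => κ σ q.2)
    (hκm.comp (measurable_fst.prodMk (measurable_snd.comp measurable_snd))) measurable_fst measurable_const
  have hMl : ∀ s x, s ≤ t → c₁ * (t - s) ≤ M s x := fun s x hs => by
    have := intervalIntegral.integral_mono_on hs (intervalIntegrable_const (c := c₁)) (hκi x s t) fun σ _ => hκ1 σ x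
    rw [intervalIntegral.integral_const, smul_eq_mul, mul_comm] at this
    exact this
  have hM0 : ∀ s x, s ≤ t → 0 ≤ M s x := fun s x hs => (mul_nonneg hc₁ (sub_nonneg.2 hs)).trans (hMl s x hs)
  have hexp : ∀ s x, s ≤ t → ofReal (Real.exp (-(β * M s x))) ≤ ofReal (Real.exp (-(β * (c₁ * (t - s))))) := fun s x hs =>
    ofReal_le_ofReal (Real.exp_le_exp.2 (neg_le_neg (mul_le_mul_of_nonneg_left (hMl s x hs) hβ)))
  have hexp1 : ∀ m, 0 ≤ m → ofReal (Real.exp (-(β * m))) ≤ 1 := fun m hm => by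
    rw [ENNReal.ofReal_le_one, Real.exp_le_one_iff]; nlinarith [mul_nonneg hβ hm]
  have hA' : ∀ i m, 0 ≤ m → ∀ z, ‖H i m z‖ₑ ≤ A * maj k z := fun i m hm z =>
    (hA i m hm z).trans (mul_le_mul_left (mul_le_of_le_one_left' (hexp1 m hm)) _)
  set q : Fin N → ℝ × Sp N → Sp N → ℂ := fun i y z => H i (M y.1 y.2) (y.2 - z) * g i y.1 z -
    L i (M y.1 y.2) (y.2 - z) * κ y.1 y.2 * (v₀ i z + ∫ τ in (0 : ℝ)..y.1, g i τ z) with hq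
  have hqm : ∀ i, Measurable (uncurry (q i)) := fun i => by
    have h1 : Measurable fun y : (ℝ × Sp N) × Sp N => (M y.1.1 y.1.2, y.1.2 - y.2) :=
      (hMm.comp measurable_fst).prodMk ((measurable_snd.comp measurable_fst).sub measurable_snd)
    have h2 : Measurable fun y : (ℝ × Sp N) × Sp N => (y.1.1, y.2) := (measurable_fst.comp measurable_fst).prodMk measurable_snd
    have h3 : Measurable fun y : (ℝ × Sp N) × Sp N => ∫ τ in (0 : ℝ)..y.1.1, g i τ y.2 :=
      measurable_intervalIntegral (g := fun τ (y : (ℝ × Sp N) × Sp N) => g i τ y.2)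
        ((hg i).comp (measurable_fst.prodMk (measurable_snd.comp measurable_snd))) measurable_const (measurable_fst.comp measurable_fst)
    exact (((hHc i).measurable.comp h1).mul ((hg i).comp h2)).sub ((((hLc i).measurable.comp h1).mul
      (Complex.measurable_ofReal.comp (hκm.comp measurable_fst))).mul (((hv₀ i).comp measurable_snd).add h3))
  set I : ℝ × Sp N → ℂ := fun y => ∑ i, ∫ z, q i y z with hI
  have hIm : Measurable I := Finset.measurable_sum _ fun i _ => ((hqm i).stronglyMeasurable.integral_prod_right (ν := volume)).measurable
  have hpt : ∀ x, ‖∑ i, ∫ z, H i 0 (x - z) * V t i z‖ₑ ≤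
      ofReal (Real.exp (-(β * (c₁ * t)))) * A * ∑ i, avg k (fun z => ‖v₀ i z‖ₑ) x + ∫⁻ s in Ioc 0 t, ‖I (s, x)‖ₑ := fun x => by
    have hD := fun i => duhamel_integral (κ := fun s => κ s x) (D := D) ht.1.le (hκm.comp measurable_prodMk_right) (fun s => hκ0 s x)
      (fun s => hκ2 s x) (h := fun m z => H i m (x - z)) (h' := fun m z => L i m (x - z)) (fun m z => hHL i m (x - z))
      ((hHc i).comp (continuous_fst.prodMk (continuous_const.sub continuous_snd)))
      ((hLc i).comp (continuous_fst.prodMk (continuous_const.sub continuous_snd)))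
      (w := fun z => (A + B + 1 : ℝ≥0) * maj k (x - z)) (by fun_prop)
      (fun z => mul_ne_zero (by simp) (maj_ne_zero k _))
      (fun m hm z => (hA' i m hm _).trans (mul_le_mul_left (by exact_mod_cast (by rw [add_assoc]; exact le_self_add : A ≤ A + B + 1)) _))
      (fun m hm z => (hB i m hm _).trans (mul_le_mul_left (by exact_mod_cast (by rw [add_comm A, add_assoc]; exact le_self_add : B ≤ A + B + 1)) _))
      (hg i) (hv₀ i)
      (ne_top_of_le_ne_top (mul_ne_top (mul_ne_top coe_ne_top (mul_ne_top cMaj_ne_top (two_rpow_ne_top _)))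
        (hv₀n i)) (lintegral_maj_mul_le hp.le _ (hv₀ i) x))
      (by
        refine ne_top_of_le_ne_top (mul_ne_top (mul_ne_top (coe_ne_top (r := A + B + 1))
          (mul_ne_top (cMaj_ne_top (N := N)) (two_rpow_ne_top ((k : ℝ) * (N / p))))) (hgn i)) ?_
        rw [← lintegral_const_mul' _ _ (mul_ne_top coe_ne_top (mul_ne_top cMaj_ne_top (two_rpow_ne_top _)))]
        exact (lintegral_mono_set hsub).trans (lintegral_mono fun s => lintegral_maj_mul_le hp.le _ (hgm i s) x))
    have e1 : ∑ i, ∫ z, H i 0 (x - z) * V t i z = (∑ i, ∫ z, H i (M 0 x) (x - z) * v₀ i z) + ∫ s in Ioc 0 t, I (s, x) := by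
      have e2 : ∫ s in Ioc 0 t, I (s, x) = ∑ i, ∫ s in Ioc 0 t, ∫ z, q i (s, x) z :=
        integral_finsetSum _ fun i _ => (hD i).1
      rw [e2, ← Finset.sum_add_distrib]
      refine Finset.sum_congr rfl fun i _ => ?_
      rw [← (hD i).2]
      exact integral_congr_ae ((hVt i).mono fun z hz => by simp only [hz])
    rw [e1]
    refine (enorm_add_le _ _).trans (add_le_add ((enorm_sum_le _ _).trans ?_) (enorm_integral_le_lintegral_enorm _))
    rw [Finset.mul_sum]
    refine Finset.sum_le_sum fun i _ => (enorm_integral_le_lintegral_enorm _).trans ?_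
    rw [avg_eq k (hv₀ i).enorm, ← lintegral_const_mul _ (measurable_maj_mul k x (hv₀ i))]
    refine lintegral_mono fun z => ?_
    simp only [enorm_mul]
    rw [← mul_assoc]
    refine mul_le_mul_left ((hA i _ (hM0 0 x ht.1.le) _).trans (mul_le_mul_left (mul_le_mul_left ?_ _) _)) _
    simpa using hexp 0 x ht.1.le
  have hav : ∀ i, Measurable (avg k fun z => ‖v₀ i z‖ₑ) := fun i => measurable_avg k (hv₀ i).enorm
  have havs : Measurable fun x => ∑ i, avg k (fun z => ‖v₀ i z‖ₑ) x := Finset.measurable_sum _ fun i _ => hav i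
  have hIl : Measurable fun x => ∫⁻ s in Ioc 0 t, ‖I (s, x)‖ₑ := Measurable.lintegral_prod_left' (f := fun y : ℝ × Sp N => ‖I y‖ₑ) hIm.enorm
  refine (nrm_mono hp0.le hpt).trans ((nrm_add_le hp.le (havs.const_mul _) hIl).trans (add_le_add ?_ ?_))
  · rw [nrm_const_mul hp0 _ havs, mul_assoc, mul_assoc]
    refine mul_le_mul_right (mul_le_mul_right ((nrm_sum_le hp.le hav).trans ?_) _) _
    rw [Finset.mul_sum]
    exact Finset.sum_le_sum fun i _ => nrm_avg_le k hp.le (hv₀ i).enorm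
  · refine nrm_lintegral_le (ν := volume.restrict (Ioc 0 t)) hp.le (f := fun s x => ‖I (s, x)‖ₑ) hIm.enorm.aemeasurable ?_ ?_
    · refine AEMeasurable.mul (Measurable.aemeasurable (by fun_prop)) (he.mono_measure (Measure.restrict_mono hsub le_rfl))
    · filter_upwards [hres hE, hres hgfin, hres hVn, hres hV, ae_restrict_mem measurableSet_Ioc] with s hEs hgs hVs hVe hs
      obtain ⟨E, hEn, hEb⟩ := hEs
      refine le_trans ?_ (mul_le_mul_right hEn _)
      refine le_trans (nrm_mono_ae hp0.le ?_) (nrm_const_mul_le hp0 ofReal_ne_top E)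
      filter_upwards [hEb] with x hx
      refine le_trans (le_of_eq ?_) ((hx (M s x) (hM0 s x hs.2)).trans (mul_le_mul_left (hexp s x hs.2) _))
      congr 1
      -- `κ s x` does not depend on `z` and leaves the integral
      have e3 : ∀ i, ∫ z, q i (s, x) z = (∫ z, H i (M s x) (x - z) * g i s z) - κ s x * ∫ z, L i (M s x) (x - z) * V s i z := fun i => by
        have i1 : Integrable fun z => H i (M s x) (x - z) * g i s z := integrable_maj_mul hp.le ((hHc i).comp (Continuous.prodMk_right (M s x))) (hA' i _ (hM0 s x hs.2)) (hgm i s) (hgs i) x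
        have i2 : Integrable fun z => L i (M s x) (x - z) * V s i z := integrable_maj_mul hp.le ((hLc i).comp (Continuous.prodMk_right (M s x))) (hB i _ (hM0 s x hs.2)) (hVm s i) (hVs i) x
        rw [← integral_const_mul, ← integral_sub i1 (i2.const_mul _)]
        refine integral_congr_ae ((hVe i).mono fun z hz => ?_)
        simp only [hq, hz]; ring
      simp only [hI, e3]
      rw [Finset.sum_sub_distrib, ← Finset.mul_sum]

/-! ### The heat kernels of the Lamé system -/

/-- The symbol of the fattened block, equal to `1` on the support of the symbol of the block. -/
def fatSymb : AnnSymb N where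
  toS := 𝓕 (∑ i ∈ ({-1, 0, 1} : Finset ℤ), kap Φ i)
  ann ξ h := by
    have := specIn_fatKap Φ 0 ξ (by rwa [fatKap, fourier_dil, zpow_zero, inv_one, one_smul])
    norm_num at this
    exact this

/-- The symbol of the fattened block composed with the `(a, i)` entry of the projection onto gradients
(`b = true`) or onto divergence free fields (`b = false`). -/
def lameSymb (b : Bool) (a i : Fin N) : AnnSymb N :=
  (fatSymb Φ).mul (fun ξ => ((bif b then inner ℝ ξ (basisVec a) * inner ℝ ξ (basisVec i) / ‖ξ‖ ^ 2 else (if a = i then 1 else 0) - inner ℝ ξ (basisVec a) * inner ℝ ξ (basisVec i) / ‖ξ‖ ^ 2 : ℝ) : ℂ)) fun ξ hξ => by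
    have h0 : ‖ξ‖ ^ 2 ≠ 0 := pow_ne_zero _ (norm_ne_zero_iff.2 hξ)
    have hc : ∀ j : Fin N, ContDiffAt ℝ ∞ (fun ξ : Sp N => (inner ℝ ξ (basisVec j) : ℝ)) ξ := fun j => contDiffAt_id.inner ℝ contDiffAt_const
    have h := ((hc a).mul (hc i)).div (contDiff_norm_sq ℝ (E := Sp N)).contDiffAt h0
    refine Complex.ofRealCLM.contDiff.contDiffAt.comp ξ ?_
    cases b
    · exact contDiffAt_const.sub h
    · exact h

/-- The kernel of `e^{m μ}`, `μ` the Laplacian, composed with the fattened `k`-th block and one of the two projections. -/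
def heatKap (b : Bool) (a : Fin N) (k : ℤ) (i : Fin N) (m : ℝ) : 𝓢(Sp N, ℂ) :=
  dil k ((lameSymb Φ b a i).kernel (((2 : ℝ) ^ k) ^ 2 * m))

theorem fourier_heatKap (b : Bool) (a : Fin N) (k : ℤ) (i : Fin N) (m : ℝ) (ξ : Sp N) :
    𝓕 (heatKap Φ b a k i m) ξ = ((lameSymb Φ b a i).heat (((2 : ℝ) ^ k) ^ 2 * m)).toS (((2 : ℝ) ^ k)⁻¹ • ξ) := by
  rw [heatKap, fourier_dil, AnnSymb.kernel, fourier_fourierInv_eq]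

theorem lameSymb_apply (b : Bool) (a i : Fin N) (ξ : Sp N) : (lameSymb Φ b a i).toS ξ =
    ((bif b then inner ℝ ξ (basisVec a) * inner ℝ ξ (basisVec i) / ‖ξ‖ ^ 2 else (if a = i then 1 else 0) - inner ℝ ξ (basisVec a) * inner ℝ ξ (basisVec i) / ‖ξ‖ ^ 2 : ℝ) : ℂ) * (fatSymb Φ).toS ξ := rfl

/-- The two projections add up to the identity. -/
theorem heatKap_zero_add (a : Fin N) (k : ℤ) (i : Fin N) :
    heatKap Φ false a k i 0 + heatKap Φ true a k i 0 = if a = i then fatKap Φ k else 0 := by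
  refine fourier_ext fun ξ => ?_
  rw [fourier_add_apply, fourier_heatKap, fourier_heatKap]
  simp only [AnnSymb.heat_apply, lameSymb_apply, cond_false, cond_true]
  have h : 𝓕 (if a = i then fatKap Φ k else 0) ξ = (if a = i then (1 : ℂ) else 0) * 𝓕 (fatKap Φ k) ξ := by
    split_ifs
    · rw [one_mul]
    · rw [FourierTransform.fourier_zero, zero_apply, zero_mul]
  rw [h, fatKap, fourier_dil, fatSymb]
  simp only [mul_zero, zero_mul, neg_zero, Complex.ofReal_zero, Complex.exp_zero, one_mul]
  split_ifs <;> push_cast <;> ring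

theorem fourier_lapl (α : 𝓢(Sp N, ℂ)) (ξ : Sp N) : 𝓕 (lapl α) ξ = (-((2 * π) ^ 2 * ‖ξ‖ ^ 2) : ℝ) * 𝓕 α ξ := by
  rw [lapl, fourier_sum_apply, ← sum_inner_basisVec_sq, Finset.mul_sum, ← Finset.sum_neg_distrib, Complex.ofReal_sum, Finset.sum_mul]
  refine Finset.sum_congr rfl fun j _ => ?_
  rw [fourier_lineDeriv, fourier_lineDeriv]
  push_cast
  linear_combination (2 * π) ^ 2 * ((inner ℝ ξ (basisVec j) : ℝ) : ℂ) ^ 2 * 𝓕 α ξ * Complex.I_sq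

theorem lapl_heatKap (b : Bool) (a : Fin N) (k : ℤ) (i : Fin N) (m : ℝ) :
    lapl (heatKap Φ b a k i m) = ((((2 : ℝ) ^ k) ^ 2 : ℝ) : ℂ) • dil k ((lameSymb Φ b a i).lap.kernel (((2 : ℝ) ^ k) ^ 2 * m)) := by
  refine fourier_ext fun ξ => ?_
  have h2 : (((2 : ℝ) ^ k : ℝ) : ℂ) ≠ 0 := by exact_mod_cast (by positivity : ((2 : ℝ) ^ k) ≠ 0)
  rw [fourier_lapl, fourier_smul_apply, fourier_heatKap, fourier_dil, AnnSymb.kernel, fourier_fourierInv_eq,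
    AnnSymb.heat_apply, AnnSymb.heat_apply, AnnSymb.lap_apply, norm_smul, norm_inv, Real.norm_of_nonneg (by positivity)]
  push_cast at h2 ⊢
  field_simp

/-- `∇ div` acts on the kernels as the Laplacian (`b = true`) or as zero (`b = false`). -/
theorem sum_lineDeriv_heatKap (b : Bool) (a : Fin N) (k : ℤ) (m : ℝ) (a' : Fin N) :
    ∑ i : Fin N, (∂_{basisVec a'} (∂_{basisVec i} (heatKap Φ b a k i m)) : 𝓢(Sp N, ℂ)) =
      (bif b then (1 : ℂ) else 0) • lapl (heatKap Φ b a k a' m) := by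
  refine fourier_ext fun ξ => ?_
  rw [fourier_sum_apply, fourier_smul_apply, fourier_lapl]
  simp only [fourier_lineDeriv, fourier_heatKap, AnnSymb.heat_apply, lameSymb_apply]
  rcases eq_or_ne ξ 0 with rfl | hξ
  · simp
  set η := ((2 : ℝ) ^ k)⁻¹ • ξ with hη
  have h2 : (0 : ℝ) < 2 ^ k := by positivity
  have hn : ‖η‖ ≠ 0 := norm_ne_zero_iff.2 (smul_ne_zero (inv_ne_zero h2.ne') hξ)
  have hin : ∀ j : Fin N, (inner ℝ ξ (basisVec j) : ℝ) = 2 ^ k * inner ℝ η (basisVec j) := fun j => by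
    rw [hη, real_inner_smul_left, mul_inv_cancel_left₀ h2.ne']
  have hnξ : ‖ξ‖ ^ 2 = (2 ^ k) ^ 2 * ‖η‖ ^ 2 := by
    rw [hη, norm_smul, norm_inv, Real.norm_of_nonneg h2.le]; field_simp
  set S := (fatSymb Φ).toS η
  set X := Complex.exp (-(((2 : ℝ) ^ k) ^ 2 * m * (2 * π * ‖η‖) ^ 2 : ℝ))
  have hQ : ∑ i : Fin N, (inner ℝ η (basisVec i) : ℝ) * (inner ℝ η (basisVec a) * inner ℝ η (basisVec i) / ‖η‖ ^ 2) = inner ℝ η (basisVec a) := by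
    calc _ = inner ℝ η (basisVec a) / ‖η‖ ^ 2 * ∑ i : Fin N, inner ℝ η (basisVec i) ^ 2 := by
          rw [Finset.mul_sum]; exact Finset.sum_congr rfl fun i _ => by ring
      _ = _ := by rw [sum_inner_basisVec_sq]; field_simp
  have hsum : ∀ f : Fin N → ℝ, ∑ i : Fin N, 2 * π * Complex.I * ((inner ℝ ξ (basisVec a') : ℝ) : ℂ) *
      (2 * π * Complex.I * ((inner ℝ ξ (basisVec i) : ℝ) : ℂ) * (X * ((f i : ℂ) * S))) =
      -((2 * π) ^ 2 * (2 ^ k) ^ 2 * inner ℝ η (basisVec a') * (∑ i : Fin N, inner ℝ η (basisVec i) * f i) : ℝ) * (X * S) := fun f => by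
    rw [Finset.mul_sum, Complex.ofReal_sum, ← Finset.sum_neg_distrib, Finset.sum_mul]
    refine Finset.sum_congr rfl fun i _ => ?_
    rw [hin a', hin i]
    push_cast
    linear_combination (2 * π) ^ 2 * (2 ^ k) ^ 2 * ((inner ℝ η (basisVec a') : ℝ) : ℂ) * ((inner ℝ η (basisVec i) : ℝ) : ℂ) * (f i) * X * S * Complex.I_sq
  rw [hsum, hnξ]
  cases b
  · simp only [cond_false, zero_mul, mul_sub, Finset.sum_sub_distrib, hQ]
    simp
  · simp only [cond_true, one_mul, hQ]
    have hn' : ((‖η‖ : ℝ) : ℂ) ≠ 0 := by exact_mod_cast hn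
    push_cast
    field_simp

theorem kerBd_dil {k : ℤ} {C : ℝ} (hC : 0 ≤ C) {α : 𝓢(Sp N, ℂ)} (h : ∀ z, ‖α z‖ ≤ C * ((1 + ‖z‖) ^ (N + 2))⁻¹) :
    KerBd k (ofReal C) (dil k α) := by
  refine kerBd_of_bound hC fun z => ?_
  have h2 : (0 : ℝ) < 2 ^ k := by positivity
  rw [dil_apply, norm_mul, Complex.norm_of_nonneg (by positivity)]
  have := h ((2 : ℝ) ^ k • z)
  rw [norm_smul, Real.norm_of_nonneg h2.le] at this
  rw [mul_comm C, mul_assoc]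
  gcongr

/-- The kernels `heatKap` decay exponentially in `m`, at the rate `2^{2k}`. -/
theorem exists_kerBd_heatKap : ∃ C : ℝ≥0, ∀ (b : Bool) (a : Fin N) (k : ℤ) (i : Fin N) (m : ℝ), 0 ≤ m →
    KerBd k ((Real.exp (-(((2 : ℝ) ^ k) ^ 2 / 32 * m))).toNNReal * C : ℝ≥0) (heatKap Φ b a k i m) ∧
    KerBd k (((((2 : ℝ) ^ k) ^ 2).toNNReal * C : ℝ≥0)) (lapl (heatKap Φ b a k i m)) := by
  choose C hC0 hC using fun q : Bool × Fin N × Fin N => (lameSymb Φ q.1 q.2.1 q.2.2).kernel_bound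
  choose D hD0 hD using fun q : Bool × Fin N × Fin N => (lameSymb Φ q.1 q.2.1 q.2.2).lap.kernel_bound
  refine ⟨(∑ q, C q + ∑ q, D q).toNNReal, fun b a k i m hm => ?_⟩
  have hCs : C (b, a, i) ≤ ∑ q, C q := Finset.single_le_sum (f := C) (fun q _ => hC0 q) (Finset.mem_univ _)
  have hDs : D (b, a, i) ≤ ∑ q, D q := Finset.single_le_sum (f := D) (fun q _ => hD0 q) (Finset.mem_univ _)
  have hC1 : 0 ≤ ∑ q, C q := Finset.sum_nonneg fun q _ => hC0 q
  have hD1 : 0 ≤ ∑ q, D q := Finset.sum_nonneg fun q _ => hD0 q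
  have hm' : 0 ≤ ((2 : ℝ) ^ k) ^ 2 * m := by positivity
  constructor
  · rw [← Real.toNNReal_mul (Real.exp_pos _).le]
    change KerBd k (ofReal _) _
    refine kerBd_dil (by positivity) fun z => (hC (b, a, i) _ hm' z).trans ?_
    refine mul_le_mul_of_nonneg_right ?_ (by positivity)
    rw [mul_comm, mul_div_right_comm]
    exact mul_le_mul_of_nonneg_left (by linarith) (Real.exp_pos _).le
  · rw [lapl_heatKap]
    have h1 := (kerBd_dil (k := k) (C := ∑ q, C q + ∑ q, D q) (by positivity) fun z => (hD (b, a, i) _ hm' z).trans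
      (mul_le_mul_of_nonneg_right (b := D (b, a, i) * Real.exp _) (c := ∑ q, C q + ∑ q, D q) ?_ (by positivity))).smul ((((2 : ℝ) ^ k) ^ 2 : ℝ) : ℂ)
    · rw [← ofReal_norm, Complex.norm_real, Real.norm_of_nonneg (by positivity)] at h1
      rw [ENNReal.coe_mul]
      exact h1
    · refine (mul_le_of_le_one_right (hD0 _) ?_).trans (by linarith)
      rw [Real.exp_le_one_iff]; linarith

theorem hasDerivAt_heatKap (b : Bool) (a : Fin N) (k : ℤ) (i : Fin N) (m : ℝ) (z : Sp N) :
    HasDerivAt (fun m => heatKap Φ b a k i m z) (lapl (heatKap Φ b a k i m) z) m := by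
  rw [lapl_heatKap]
  simp only [heatKap, dil_apply]
  have h := ((lameSymb Φ b a i).hasDerivAt_kernel (((2 : ℝ) ^ k) ^ 2 * m) ((2 : ℝ) ^ k • z)).scomp m
    ((hasDerivAt_id m).const_mul (((2 : ℝ) ^ k) ^ 2))
  refine (h.const_mul _).congr_deriv ?_
  change _ = ((((2 : ℝ) ^ k) ^ 2 : ℝ) : ℂ) * dil k _ z
  rw [dil_apply, Complex.real_smul]
  push_cast; ring

theorem continuous_dil_family {K : ℝ → 𝓢(Sp N, ℂ)} (hK : Continuous fun q : ℝ × Sp N => K q.1 q.2) (k : ℤ) (c : ℝ) :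
    Continuous fun q : ℝ × Sp N => dil k (K (c * q.1)) q.2 := by
  simp only [dil_apply]
  have h : Continuous fun q : ℝ × Sp N => (c * q.1, (2 : ℝ) ^ k • q.2) :=
    (continuous_const.mul continuous_fst).prodMk ((continuous_const_smul ((2 : ℝ) ^ k)).comp continuous_snd)
  exact continuous_const.mul (hK.comp h)

theorem continuous_heatKap (b : Bool) (a : Fin N) (k : ℤ) (i : Fin N) :
    Continuous (uncurry fun m z => heatKap Φ b a k i m z) :=
  continuous_dil_family (lameSymb Φ b a i).continuous_kernel k _

theorem continuous_lapl_heatKap (b : Bool) (a : Fin N) (k : ℤ) (i : Fin N) :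
    Continuous (uncurry fun m z => lapl (heatKap Φ b a k i m) z) := by
  have h := continuous_dil_family (lameSymb Φ b a i).lap.continuous_kernel k (((2 : ℝ) ^ k) ^ 2)
  have e : (uncurry fun m z => lapl (heatKap Φ b a k i m) z) = fun q : ℝ × Sp N =>
      ((((2 : ℝ) ^ k) ^ 2 : ℝ) : ℂ) * dil k ((lameSymb Φ b a i).lap.kernel (((2 : ℝ) ^ k) ^ 2 * q.1)) q.2 := by
    funext q
    rw [uncurry, lapl_heatKap]; rfl
  rw [e]
  exact continuous_const.mul h

/-! ### Weak solutions in time -/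

/-- A weak solution of `φ' = g`, `φ(0) = v₀` on `(0, T)` is an integral. -/
theorem ae_eq_integral_of_weak {T : ℝ} (hT : 0 < T) {φ g : ℝ → ℂ} (hφ : IntegrableOn φ (Ioo 0 T)) (hg : IntegrableOn g (Ioo 0 T)) (v₀ : ℂ)
    (h : ∀ θ : ℝ → ℝ, ContDiff ℝ ∞ θ → HasCompactSupport θ → tsupport θ ⊆ Iio T →
      -(∫ t in Ioo 0 T, ((deriv θ t : ℝ) : ℂ) * φ t) = ((θ 0 : ℝ) : ℂ) * v₀ + ∫ t in Ioo 0 T, ((θ t : ℝ) : ℂ) * g t) :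
    ∀ᵐ s ∂volume.restrict (Ioo 0 T), φ s = v₀ + ∫ τ in (0 : ℝ)..s, g τ := by
  have hgI : IntervalIntegrable g volume 0 T := (intervalIntegrable_iff_integrableOn_Ioo_of_le hT.le).2 hg
  set v : ℝ → ℂ := fun s => v₀ + ∫ τ in (0 : ℝ)..s, g τ with hv
  have hvc : ContinuousOn v (Icc 0 T) := by
    rw [← uIcc_of_le hT.le]
    exact continuousOn_const.add (intervalIntegral.continuousOn_primitive_interval' hgI left_mem_uIcc)
  have hvi : IntegrableOn v (Ioo 0 T) := (hvc.integrableOn_Icc).mono_set Ioo_subset_Icc_self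
  suffices H : ∀ᵐ s, s ∈ Ioo 0 T → φ s - v s = 0 by
    rw [ae_restrict_iff' measurableSet_Ioo]
    filter_upwards [H] with s hs hsI using sub_eq_zero.1 (hs hsI)
  refine isOpen_Ioo.ae_eq_zero_of_integral_contDiff_smul_eq_zero (hφ.sub hvi).locallyIntegrableOn fun ψ hψ hψc hψs => ?_
  have hψi : ∀ a b, IntervalIntegrable ψ volume a b := fun a b => hψ.continuous.intervalIntegrable a b
  set Θ : ℝ → ℝ := fun s => (∫ τ in (0 : ℝ)..s, ψ τ) - ∫ τ in (0 : ℝ)..T, ψ τ with hΘ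
  have hΘd : ∀ s, HasDerivAt Θ (ψ s) s := fun s =>
    (intervalIntegral.integral_hasDerivAt_right (hψi 0 s) (hψ.continuous.stronglyMeasurableAtFilter _ _) hψ.continuous.continuousAt).sub_const _
  have hΘs : ContDiff ℝ ∞ Θ := by
    refine contDiff_infty_iff_deriv.2 ⟨fun s => (hΘd s).differentiableAt, ?_⟩
    rw [show deriv Θ = ψ from funext fun s => (hΘd s).deriv]
    exact hψ
  -- `Θ` vanishes to the right of the support of `ψ`.
  obtain ⟨b, hb0, hbT, hΘ0⟩ : ∃ b, 0 ≤ b ∧ b < T ∧ ∀ s, b ≤ s → Θ s = 0 := by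
    have hK : IsCompact (tsupport ψ ∪ {0}) := hψc.isCompact.union isCompact_singleton
    obtain ⟨b, hb, hbm⟩ := hK.exists_isGreatest ⟨0, Or.inr rfl⟩
    have hb0 : 0 ≤ b := hbm (Or.inr rfl)
    have hbT : b < T := hb.elim (fun h => (hψs h).2) fun h => by rw [mem_singleton_iff.1 h]; exact hT
    have hz : ∀ τ, b < τ → ψ τ = 0 := fun τ hτ => by
      by_contra hne
      exact absurd (hbm (Or.inl (subset_tsupport ψ hne))) (not_le.2 hτ)
    refine ⟨b, hb0, hbT, fun s hs => ?_⟩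
    rw [hΘ]
    simp only
    rw [intervalIntegral.integral_interval_sub_left (hψi 0 s) (hψi 0 T)]
    refine intervalIntegral.integral_zero_ae (.of_forall fun τ hτ => hz τ ?_)
    exact (le_min hbT.le hs).trans_lt hτ.1
  set η : ContDiffBump (0 : ℝ) := ⟨T, T + 1, hT, by linarith⟩ with hη
  set θ : ℝ → ℝ := fun s => η s * Θ s with hθ
  have hη1 : ∀ s ∈ Icc 0 T, η s = 1 := fun s hs => η.one_of_mem_closedBall (by
    rw [mem_closedBall_zero_iff, Real.norm_of_nonneg hs.1]; exact hs.2)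
  have hθ1 : ∀ s ∈ Icc 0 T, θ s = Θ s := fun s hs => by rw [hθ]; simp only; rw [hη1 s hs, one_mul]
  have hθd : ∀ s ∈ Ioo 0 T, deriv θ s = ψ s := fun s hs => by
    have : θ =ᶠ[nhds s] Θ := Filter.eventually_of_mem (Icc_mem_nhds hs.1 hs.2) hθ1
    rw [this.deriv_eq, (hΘd s).deriv]
  have h1 := h θ (η.contDiff.mul hΘs) (η.hasCompactSupport.mul_right) (by
    refine (closure_minimal (t := Iic b) (fun s hs => ?_) isClosed_Iic).trans (Iic_subset_Iio.2 hbT)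
    by_contra hlt
    refine hs ?_
    change η s * Θ s = 0
    rw [hΘ0 s (not_le.1 hlt).le, mul_zero])
  have e1 : ∫ t in Ioo 0 T, ((deriv θ t : ℝ) : ℂ) * φ t = ∫ t in Ioo 0 T, (ψ t : ℂ) * φ t :=
    setIntegral_congr_fun measurableSet_Ioo fun t ht => by simp only [hθd t ht]
  have e2 : ∫ t in Ioo 0 T, ((θ t : ℝ) : ℂ) * g t = ∫ t in Ioo 0 T, (Θ t : ℂ) * g t :=
    setIntegral_congr_fun measurableSet_Ioo fun t ht => by simp only [hθ1 t (Ioo_subset_Icc_self ht)]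
  rw [e1, e2, hθ1 0 (left_mem_Icc.2 hT.le)] at h1
  have hd := duhamel_scalar (κ := fun _ => 1) (D := 1) (t := T) measurable_const (fun _ => by norm_num)
    (h := fun m => (Θ (T - m) : ℂ)) (h' := fun m => -(ψ (T - m) : ℂ))
    (fun m => by
      have := ((hΘd (T - m)).comp m ((hasDerivAt_id m).const_sub T)).ofReal_comp
      refine this.congr_deriv ?_
      push_cast; ring) (by have := hψ.continuous; fun_prop) hgI v₀
  simp only [intervalIntegral.integral_const, smul_eq_mul, mul_one, sub_sub_cancel, sub_zero, sub_self, Complex.ofReal_one, neg_mul, sub_neg_eq_add] at hd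
  rw [hΘ0 T hbT.le, Complex.ofReal_zero, zero_mul, intervalIntegral.integral_of_le hT.le, integral_Ioc_eq_integral_Ioo] at hd
  have hΘi : IntegrableOn (fun t => (Θ t : ℂ) * g t) (Ioo 0 T) := by
    have hcont : ContinuousOn (fun t => (Θ t : ℂ)) (Icc 0 T) := (Complex.continuous_ofReal.comp hΘs.continuous).continuousOn
    have := (hgI.continuousOn_mul (g := fun t => (Θ t : ℂ)) (by rw [uIcc_of_le hT.le]; exact hcont))
    exact (intervalIntegrable_iff_integrableOn_Ioo_of_le hT.le).1 this
  obtain ⟨Cψ, hCψ⟩ := hψc.exists_bound_of_continuous hψ.continuous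
  have hψm : AEStronglyMeasurable (fun t => (ψ t : ℂ)) (volume.restrict (Ioo 0 T)) :=
    (Complex.continuous_ofReal.comp hψ.continuous).aestronglyMeasurable
  have hψb : ∀ᵐ t ∂volume.restrict (Ioo 0 T), ‖(ψ t : ℂ)‖ ≤ Cψ := .of_forall fun t => by
    rw [Complex.norm_real]; exact hCψ t
  have hψv : IntegrableOn (fun t => (ψ t : ℂ) * v t) (Ioo 0 T) := hvi.bdd_mul hψm hψb
  have hψφ : IntegrableOn (fun t => (ψ t : ℂ) * φ t) (Ioo 0 T) := hφ.bdd_mul hψm hψb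
  rw [integral_add hΘi hψv] at hd
  have e3 : ∫ s, ψ s • (φ s - v s) = ∫ s in Ioo 0 T, ((ψ s : ℂ) * φ s - (ψ s : ℂ) * v s) := by
    rw [← setIntegral_eq_integral_of_forall_compl_eq_zero (s := Ioo 0 T)]
    · refine integral_congr_ae (.of_forall fun s => ?_)
      simp only [Complex.real_smul]; ring
    · intro s hs
      rw [image_eq_zero_of_notMem_tsupport fun hm => hs (hψs hm), zero_smul]
  rw [e3, integral_sub hψφ hψv]
  linear_combination -h1 + hd

/-! ### Joint measurability in time and space -/

theorem aestronglyMeasurable_uncurry {f : ℝ → Sp N → ℂ} {μ : Measure ℝ} [SFinite μ] (hc : ∀ t, Continuous (f t))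
    (hm : ∀ y, AEStronglyMeasurable (fun t => f t y) μ) : AEStronglyMeasurable (uncurry f) (μ.prod volume) := by
  set d := TopologicalSpace.denseSeq (Sp N)
  have hae : ∀ᵐ t ∂μ, ∀ n, f t (d n) = (hm (d n)).mk _ t := ae_all_iff.2 fun n => (hm (d n)).ae_eq_mk
  obtain ⟨S, hS, hSm, hSμ⟩ := mem_ae_iff.1 hae |> fun h => exists_measurable_superset_of_null h
  have hgood : ∀ t, t ∉ S → ∀ n, f t (d n) = (hm (d n)).mk _ t := fun t ht => by
    by_contra hne; exact ht (hS hne)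
  set f' : Sp N → ℝ → ℂ := fun y => Sᶜ.indicator fun t => f t y with hf'
  have hd : ∀ n, Measurable (f' (d n)) := fun n => by
    have : f' (d n) = Sᶜ.indicator ((hm (d n)).mk _) := by
      funext t
      by_cases ht : t ∈ S
      · simp [hf', ht]
      · simp only [hf', indicator_of_mem (show t ∈ Sᶜ from ht)]; exact hgood t ht n
    rw [this]
    exact (hm (d n)).stronglyMeasurable_mk.measurable.indicator hSm.compl
  have hf'c : ∀ t, Continuous fun y => f' y t := fun t => by
    by_cases ht : t ∈ S
    · simpa [hf', ht] using continuous_const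
    · simpa [hf', ht] using hc t
  have hf'm : ∀ y, Measurable (f' y) := fun y => by
    obtain ⟨x, hx, hlim⟩ := mem_closure_iff_seq_limit.1 (TopologicalSpace.denseRange_denseSeq (Sp N) y)
    choose n hn using hx
    refine measurable_of_tendsto_metrizable (fun j => hd (n j)) (tendsto_pi_nhds.2 fun t => ?_)
    have := ((hf'c t).tendsto y).comp hlim
    refine this.congr fun j => ?_
    simp only [Function.comp, ← hn j]; rfl
  have hjoint := (measurable_uncurry_of_continuous_of_measurable hf'c hf'm).comp measurable_swap
  refine ⟨_, hjoint.stronglyMeasurable, ?_⟩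
  have hSae : ∀ᵐ t ∂μ, t ∉ S := measure_eq_zero_iff_ae_notMem.1 hSμ
  filter_upwards [Measure.quasiMeasurePreserving_fst.ae hSae] with q hq
  simp [uncurry, hf', hq]

theorem measurable_tsum_complex {X : Type*} [MeasurableSpace X] {f : ℤ → X → ℂ} (hf : ∀ l, Measurable (f l)) :
    Measurable fun x => ∑' l, f l x := by
  have hset : MeasurableSet {x | ∑' l, ‖f l x‖ₑ < ⊤} :=
    measurableSet_lt (Measurable.tsum fun l => (hf l).enorm) measurable_const
  have hiff : ∀ x, ∑' l, ‖f l x‖ₑ < ⊤ ↔ Summable fun l => f l x := fun x => by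
    rw [← summable_norm_iff, lt_top_iff_ne_top]
    exact ⟨fun h => by
      have := ENNReal.tsum_coe_ne_top_iff_summable.1 h
      exact NNReal.summable_coe.2 this, fun h => ENNReal.tsum_coe_ne_top_iff_summable.2 (NNReal.summable_coe.1 h)⟩
  set g : ℤ → X → ℂ := fun l => {x | ∑' l, ‖f l x‖ₑ < ⊤}.indicator (f l) with hg
  have hgs : ∀ x, HasSum (fun l => g l x) (∑' l, f l x) := fun x => by
    by_cases h : ∑' l, ‖f l x‖ₑ < ⊤
    · have e : ∀ l, g l x = f l x := fun l => indicator_of_mem (show x ∈ {x | ∑' l, ‖f l x‖ₑ < ⊤} from h) _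
      simp_rw [e]
      exact ((hiff x).1 h).hasSum
    · have e : ∀ l, g l x = 0 := fun l => indicator_of_notMem (show x ∉ {x | ∑' l, ‖f l x‖ₑ < ⊤} from h) _
      simp_rw [e, tsum_eq_zero_of_not_summable fun hs => h ((hiff x).2 hs)]
      exact hasSum_zero
  refine measurable_of_tendsto_metrizable' Filter.atTop (f := fun s : Finset ℤ => fun x => ∑ l ∈ s, g l x)
    (fun s => Finset.measurable_fun_sum s fun l _ => (hf l).indicator hset) (tendsto_pi_nhds.2 fun x => hgs x)

theorem aestronglyMeasurable_productPairing {μ : Measure ℝ} [SFinite μ] {m : ℝ → Sp N → ℝ}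
    (hm : AEStronglyMeasurable (uncurry m) (μ.prod volume)) {w : ℝ → 𝓢'(Sp N, ℂ)}
    (hw : ∀ l y, AEStronglyMeasurable (fun t => cv (w t) (kap Φ l) y) μ) (α : 𝓢(Sp N, ℂ)) :
    AEStronglyMeasurable (uncurry fun t z => productPairing Φ (m t) (w t) (rt α z)) (μ.prod volume) := by
  have hW : ∀ l, AEStronglyMeasurable (uncurry fun t y => cv (w t) (kap Φ l) y) (μ.prod volume) := fun l =>
    aestronglyMeasurable_uncurry (fun t => continuous_cv _ _) (hw l)
  set m' := hm.mk _
  set W := fun l => (hW l).mk _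
  have hm' : Measurable m' := hm.stronglyMeasurable_mk.measurable
  have hW' : ∀ l, Measurable (W l) := fun l => (hW l).stronglyMeasurable_mk.measurable
  set F : ℝ × Sp N → ℂ := fun q => ∑' l : ℤ, ∫ y, ((m' (q.1, y) : ℝ) : ℂ) * (α (q.2 - y) * W l (q.1, y))
  have hF : Measurable F := by
    refine measurable_tsum_complex fun l => ?_
    have hi : Measurable fun v : (ℝ × Sp N) × Sp N => ((m' (v.1.1, v.2) : ℝ) : ℂ) * (α (v.1.2 - v.2) * W l (v.1.1, v.2)) := by
      have h1 : Measurable fun v : (ℝ × Sp N) × Sp N => (v.1.1, v.2) := (measurable_fst.comp measurable_fst).prodMk measurable_snd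
      have h2 : Measurable fun v : (ℝ × Sp N) × Sp N => v.1.2 - v.2 := (measurable_snd.comp measurable_fst).sub measurable_snd
      exact (Complex.measurable_ofReal.comp (hm'.comp h1)).mul ((α.continuous.measurable.comp h2).mul ((hW' l).comp h1))
    exact (hi.stronglyMeasurable.integral_prod_right' (ν := volume)).measurable
  refine ⟨F, hF.stronglyMeasurable, ?_⟩
  have h1 : ∀ᵐ t ∂μ, ∀ᵐ y, m t y = m' (t, y) := Measure.ae_ae_of_ae_prod hm.ae_eq_mk
  have h2 : ∀ᵐ t ∂μ, ∀ l, ∀ᵐ y, cv (w t) (kap Φ l) y = W l (t, y) := ae_all_iff.2 fun l => Measure.ae_ae_of_ae_prod (hW l).ae_eq_mk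
  filter_upwards [Measure.quasiMeasurePreserving_fst.ae h1, Measure.quasiMeasurePreserving_fst.ae h2] with q hq1 hq2
  simp only [uncurry, productPairing, F]
  refine tsum_congr fun l => integral_congr_ae ?_
  filter_upwards [hq1, hq2 l, density_block Φ l (w q.1)] with y e1 e2 e3
  rw [e1, e3, e2, rt_apply]

theorem aestronglyMeasurable_viscousPairing {μ : Measure ℝ} [SFinite μ] {m m' : ℝ → Sp N → ℝ}
    (hm : AEStronglyMeasurable (uncurry m) (μ.prod volume)) (hm' : AEStronglyMeasurable (uncurry m') (μ.prod volume))
    {u : ℝ → Fin N → 𝓢'(Sp N, ℂ)} (hu : ∀ i χ, IsZTest χ → AEStronglyMeasurable (fun t => u t i χ) μ) (i : Fin N) (α : 𝓢(Sp N, ℂ)) :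
    AEStronglyMeasurable (uncurry fun t z => viscousPairing Φ (m t) (m' t) (u t) i (rt α z)) (μ.prod volume) := by
  have hd : ∀ (i j : Fin N) (l : ℤ) (y : Sp N), AEStronglyMeasurable (fun t => cv (∂_{basisVec j} (u t i)) (kap Φ l) y) μ := fun i j l y => by
    have e : (fun t => cv (∂_{basisVec j} (u t i)) (kap Φ l) y) = fun t => cv (u t i) (∂_{basisVec j} (kap Φ l)) y :=
      funext fun t => congrFun (cv_lineDeriv _ _ _) y
    rw [e]
    exact hu i _ (((specIn_kap_self Φ l).lineDeriv _).isZTest y)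
  have hdiv : ∀ l y, AEStronglyMeasurable (fun t => cv (divergence (u t)) (kap Φ l) y) μ := fun l y => by
    simp_rw [cv_divergence]
    exact Finset.aestronglyMeasurable_fun_sum _ fun j _ => hd j j l y
  rw [show (uncurry fun t z => viscousPairing Φ (m t) (m' t) (u t) i (rt α z)) = fun q : ℝ × Sp N =>
      ∑ j : Fin N, productPairing Φ (m q.1) (∂_{basisVec j} (u q.1 i)) (rt (∂_{basisVec j} α) q.2) +
        productPairing Φ (m' q.1) (divergence (u q.1)) (rt (∂_{basisVec i} α) q.2) from funext fun q => viscousPairing_rt ..]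
  have h1 : ∀ j : Fin N, AEStronglyMeasurable (uncurry fun t z =>
      productPairing Φ (m t) (∂_{basisVec j} (u t i)) (rt (∂_{basisVec j} α) z)) (μ.prod volume) := fun j =>
    aestronglyMeasurable_productPairing Φ hm (hd i j) _
  exact (Finset.aestronglyMeasurable_fun_sum Finset.univ fun j _ => h1 j).add
    (aestronglyMeasurable_productPairing Φ hm' hdiv (∂_{basisVec i} α))

theorem aemeasurable_nrm {μ : Measure ℝ} [SFinite μ] {p : ℝ} {V : ℝ → Sp N → ℂ}
    (hV : AEStronglyMeasurable (uncurry V) (μ.prod volume)) : AEMeasurable (fun t => nrm p fun z => ‖V t z‖ₑ) μ := by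
  refine ⟨fun t => nrm p fun z => ‖hV.mk _ (t, z)‖ₑ, ?_, ?_⟩
  · exact (Measurable.lintegral_prod_right' (f := fun q : ℝ × Sp N => ‖hV.mk _ q‖ₑ ^ p)
      (hV.stronglyMeasurable_mk.measurable.enorm.pow_const p)).pow_const _
  · filter_upwards [Measure.ae_ae_of_ae_prod hV.ae_eq_mk] with t ht
    exact nrm_congr_ae (ht.mono fun z hz => by simp only [← hz]; rfl)

/-- An identity in time that holds at each point of space holds, at almost every time, almost everywhere in space. -/
theorem ae_ae_eq_integral {T : ℝ} {V g : ℝ → Sp N → ℂ} {g' : ℝ × Sp N → ℂ} {v₀ : Sp N → ℂ}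
    (hV : AEStronglyMeasurable (uncurry V) ((volume.restrict (Ioo 0 T)).prod volume)) (hg' : Measurable g')
    (hgg : uncurry g =ᵐ[(volume.restrict (Ioo 0 T)).prod volume] g') (hv₀ : Measurable v₀)
    (h : ∀ z, ∀ᵐ s ∂volume.restrict (Ioo 0 T), V s z = v₀ z + ∫ τ in (0 : ℝ)..s, g τ z) :
    ∀ᵐ s ∂volume.restrict (Ioo 0 T), ∀ᵐ z, V s z = v₀ z + ∫ τ in (0 : ℝ)..s, g' (τ, z) := by
  set μ : Measure ℝ := volume.restrict (Ioo 0 T) with hμ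
  have hswap : ∀ {P : ℝ × Sp N → Prop}, (∀ᵐ q ∂μ.prod volume, P q) → ∀ᵐ z : Sp N, ∀ᵐ s ∂μ, P (s, z) := fun {P} hP => by
    have : ∀ᵐ q ∂(volume : Measure (Sp N)).prod μ, P q.swap := by
      rw [← Measure.prod_swap] at hP
      exact ae_of_ae_map measurable_swap.aemeasurable hP
    exact Measure.ae_ae_of_ae_prod this
  set V' := hV.mk _
  have hV' : Measurable V' := hV.stronglyMeasurable_mk.measurable
  have hv' : Measurable fun q : ℝ × Sp N => v₀ q.2 + ∫ τ in (0 : ℝ)..q.1, g' (τ, q.2) :=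
    (hv₀.comp measurable_snd).add (measurable_intervalIntegral (g := fun τ (q : ℝ × Sp N) => g' (τ, q.2))
      (hg'.comp (measurable_fst.prodMk (measurable_snd.comp measurable_snd))) measurable_const measurable_fst)
  have hset : MeasurableSet {q : ℝ × Sp N | V' q = v₀ q.2 + ∫ τ in (0 : ℝ)..q.1, g' (τ, q.2)} := measurableSet_eq_fun hV' hv'
  have key : ∀ᵐ z : Sp N, ∀ᵐ s ∂μ, V' (s, z) = v₀ z + ∫ τ in (0 : ℝ)..s, g' (τ, z) := by
    filter_upwards [hswap hV.ae_eq_mk, hswap hgg] with z h1 h2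
    filter_upwards [h1, h z, ae_restrict_mem measurableSet_Ioo] with s e1 e2 hs
    rw [show V' (s, z) = V s z from e1.symm, e2]
    congr 1
    rw [intervalIntegral.integral_of_le hs.1.le, intervalIntegral.integral_of_le hs.1.le]
    have hsub : Ioc 0 s ⊆ Ioo 0 T := fun τ hτ => ⟨hτ.1, hτ.2.trans_lt hs.2⟩
    exact integral_congr_ae (ae_mono (Measure.restrict_mono hsub le_rfl) h2)
  have hprod := (Measure.ae_ae_comm (μ := μ) (ν := (volume : Measure (Sp N))) hset).2 key
  filter_upwards [hprod, Measure.ae_ae_of_ae_prod hV.ae_eq_mk] with s h1 h2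
  filter_upwards [h1, h2] with z e1 e2
  rw [show V s z = V' (s, z) from e2, e1]

/-- A function that is continuous on an open set, composed with a function that takes almost all its values there. -/
theorem aestronglyMeasurable_comp_of_continuousOn {T : ℝ} {ρ : ℝ → Sp N → ℝ}
    (hρ : AEStronglyMeasurable (uncurry ρ) ((volume.restrict (Ioo 0 T)).prod volume)) {J : Set ℝ} (hJ : IsOpen J)
    (hρJ : ∀ᵐ t ∂volume.restrict (Ioo 0 T), ∀ᵐ x : Sp N, ρ t x ∈ J) {F : ℝ → ℝ} (hF : ContinuousOn F J) :
    AEStronglyMeasurable (uncurry fun t x => F (ρ t x)) ((volume.restrict (Ioo 0 T)).prod (volume : Measure (Sp N))) := by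
  classical
  have hFm : Measurable (J.piecewise F 0) := hF.measurable_piecewise continuousOn_const hJ.measurableSet
  set ρ' := hρ.mk _
  have hρ' : Measurable ρ' := hρ.stronglyMeasurable_mk.measurable
  refine ⟨fun q => J.piecewise F 0 (ρ' q), (hFm.comp hρ').stronglyMeasurable, ?_⟩
  have hJ' : ∀ᵐ q ∂(volume.restrict (Ioo 0 T)).prod (volume : Measure (Sp N)), ρ' q ∈ J := by
    refine (Measure.ae_prod_iff_ae_ae (hρ' hJ.measurableSet)).2 ?_
    filter_upwards [hρJ, Measure.ae_ae_of_ae_prod hρ.ae_eq_mk] with t h1 h2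
    filter_upwards [h1, h2] with x e1 e2
    rw [show ρ' (t, x) = ρ t x from e2.symm]
    exact e1
  filter_upwards [hJ', hρ.ae_eq_mk] with q h1 h2
  rw [piecewise_eq_of_mem _ _ _ h1, show ρ' q = uncurry ρ q from h2.symm]; rfl

/-! ### The coefficients of the momentum equation -/

theorem ae_le_timeNorm_top (T : ℝ) (n : ℝ → ℝ≥0∞) : ∀ᵐ t ∂volume.restrict (Ioo 0 T), n t ≤ timeNorm T ⊤ n := by
  rw [timeNorm, eLpNorm_exponent_top]
  filter_upwards [ae_le_eLpNormEssSup (f := n) (μ := volume.restrict (Ioo 0 T))] with t ht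
  simpa using ht

theorem besovNorm_one_eq {p : ℝ} (hp : 1 ≤ p) (s : ℝ) (f : 𝓢'(Sp N, ℂ)) :
    besovNorm Φ oneWeight p s f = ∑' k : ℤ, 2 ^ ((k : ℝ) * s) * nrm p fun y => ‖cv f (kap Φ k) y‖ₑ :=
  tsum_congr fun k => by rw [lpNorm_block Φ k hp, oneWeight, mul_one, two_rpow_ofReal]

theorem SmoothBoundedOn.abs_sub_le {F : ℝ → ℝ} {J : Set ℝ} {m : ℕ} {K : ℝ} (h : SmoothBoundedOn F J m K) (hm : 1 ≤ m)
    (hJ : IsOpen J) (hJc : J.OrdConnected) {x y : ℝ} (hx : x ∈ J) (hy : y ∈ J) : |F x - F y| ≤ K * |x - y| := by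
  have := hJc.convex.norm_image_sub_le_of_norm_deriv_le (𝕜 := ℝ) (f := F) (C := K)
    (fun z hz => (h.1.contDiffAt (hJ.mem_nhds hz)).differentiableAt (by simp))
    (fun z hz => by have := h.2 1 le_rfl hm z hz; rwa [iteratedDeriv_one] at this) hy hx
  simpa only [Real.norm_eq_abs] using this

section

variable {Φ} {p s T c₁ K : ℝ} {J : Set ℝ} {mu lam : ℝ → ℝ} {ρ : ℝ → Sp N → ℝ} {ρc : ℝ} {a : ℝ → 𝓢'(Sp N, ℂ)}
  {u G : ℝ → Fin N → 𝓢'(Sp N, ℂ)} {u₀ : Fin N → 𝓢'(Sp N, ℂ)}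

theorem MomentumData.exists_abs_density_le (h : MomentumData Φ p s T c₁ K J mu lam ρ ρc a u G u₀) (hp : 1 ≤ p) :
    ∃ R : ℝ, ∀ᵐ t ∂volume.restrict (Ioo 0 T), ∀ᵐ x, |ρ t x| ≤ R := by
  obtain ⟨C, hC⟩ := exists_bddCts_represents Φ hp
  have hfin := h.fluctuation_mem
  rw [bochnerNorm] at hfin
  set B := timeNorm T ⊤ fun t => besovNorm Φ oneWeight p (N / p) (a t)
  have hCB : (C : ℝ≥0∞) * B ≠ ⊤ := mul_ne_top coe_ne_top hfin.ne
  refine ⟨(C * B).toReal + |ρc|, ?_⟩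
  filter_upwards [h.fluctuation, ae_le_timeNorm_top T fun t => besovNorm Φ oneWeight p (N / p) (a t)] with t h1 h2
  rw [besovNorm_one_eq Φ hp] at h2
  obtain ⟨A, -, hAr, hAb⟩ := hC (a t) h1.2 (ne_top_of_le_ne_top hfin.ne h2)
  filter_upwards [hAr.ae_eq h1.1] with x hx
  have h3 := toReal_mono hCB ((hAb x).trans (mul_le_mul_right h2 _))
  rw [hx, toReal_enorm, Complex.norm_real, Real.norm_eq_abs] at h3
  calc |ρ t x| = |(ρ t x - ρc) + ρc| := by rw [sub_add_cancel]
    _ ≤ _ := (abs_add_le _ _).trans (add_le_add h3 le_rfl)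

theorem MomentumData.exists_coefficients_le (h : MomentumData Φ p s T c₁ K J mu lam ρ ρc a u G u₀) (hp : 1 ≤ p) :
    ∃ D : ℝ≥0, ∀ᵐ t ∂volume.restrict (Ioo 0 T), ∀ᵐ x, |mu (ρ t x)| ≤ D ∧ |lam (ρ t x)| ≤ D := by
  obtain ⟨R, hR⟩ := h.exists_abs_density_le hp
  have hne : (ae (volume.restrict (Ioo 0 T))).NeBot := by
    rw [ae_neBot, Ne, Measure.restrict_eq_zero, Real.volume_Ioo]
    simpa using h.time_pos
  obtain ⟨t, ht, -⟩ := (h.lower_bound.and hR).exists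
  obtain ⟨x, hx⟩ := ht.exists
  set r := ρ t x
  have hK : 0 ≤ K := (abs_nonneg _).trans (h.smooth_mu.2 1 le_rfl (by omega) _ hx.1)
  refine ⟨(|mu r| + |lam r| + K * (R + |r|)).toNNReal, ?_⟩
  filter_upwards [h.lower_bound, hR] with t h1 h2
  filter_upwards [h1, h2] with x h3 h4
  have h5 : |ρ t x - r| ≤ R + |r| := (abs_sub _ _).trans (add_le_add h4 le_rfl)
  have key : ∀ F : ℝ → ℝ, SmoothBoundedOn F J (⌊(N : ℝ) / p⌋₊ + 4) K → |F (ρ t x)| ≤ |F r| + K * (R + |r|) := fun F hF => by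
    have h6 := (hF.abs_sub_le (by omega) h.isOpen h.ordConnected h3.1 hx.1).trans (mul_le_mul_of_nonneg_left h5 hK)
    calc |F (ρ t x)| = |F r + (F (ρ t x) - F r)| := by rw [add_sub_cancel]
      _ ≤ _ := (abs_add_le _ _).trans (add_le_add le_rfl h6)
  have := key mu h.smooth_mu
  have := key lam h.smooth_lam
  have := abs_nonneg (mu r)
  have := abs_nonneg (lam r)
  exact ⟨le_trans (by linarith) (Real.le_coe_toNNReal _), le_trans (by linarith) (Real.le_coe_toNNReal _)⟩

/-- The bound for the `L^p` norms of the blocks of the coefficients that comes from the composition estimate. -/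
def coeffBound (Φ : LPFunction N) (p T : ℝ) (C : ℝ≥0∞) (ρ : ℝ → Sp N → ℝ) (a : ℝ → 𝓢'(Sp N, ℂ)) (j : ℤ) : ℝ≥0∞ :=
  (C * densityFactor p T ρ) * ∑' i, gainCoef (⌊(N : ℝ) / p⌋₊ + 2) j i * timeNorm T ⊤ fun t => lpNorm p (block Φ i (a t))

/-- The coefficients `μ(ρ)` and `λ(ρ) + μ(ρ)` have the structure `Coeff`, with a bound that does not
depend on time. -/
theorem exists_coeff (Φ : LPFunction N) (hN : 0 < N) {p : ℝ} (hp : 1 ≤ p) (K : ℝ) : ∃ C : ℝ≥0, ∀ s T c₁ J mu lam ρ ρc a u G u₀,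
    MomentumData Φ p s T c₁ K J mu lam ρ ρc a u G u₀ → ∀ᵐ t ∂volume.restrict (Ioo 0 T), ∃ b b' : Sp N → ℂ,
      Coeff Φ p (coeffBound Φ p T C ρ a) (fun x => mu (ρ t x)) b ∧
      Coeff Φ p (coeffBound Φ p T C ρ a) (fun x => lam (ρ t x) + mu (ρ t x)) b' := by
  obtain ⟨C, hC⟩ := exists_coefficient Φ hp
  refine ⟨2 * (C * K.toNNReal), fun s T c₁ J mu lam ρ ρc a u G u₀ h => ?_⟩
  obtain ⟨R, hR⟩ := h.exists_abs_density_le hp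
  have hNp : 0 < (N : ℝ) / p := by positivity
  have hM : (N : ℝ) / p + 1 < (⌊(N : ℝ) / p⌋₊ + 2 : ℕ) := by
    push_cast; linarith [Nat.lt_floor_add_one ((N : ℝ) / p)]
  obtain ⟨C', hC'⟩ := exists_tsum_gainCoef_le N hNp hM
  have hslow : SlowWeight fun _ => 1 := fun j k hjk => ⟨le_rfl, by
    rw [mul_one]; exact rpow_zero.symm.le.trans (two_rpow_mono (sub_nonneg.2 (by exact_mod_cast hjk)))⟩
  filter_upwards [h.fluctuation, h.lower_bound, hR, ae_le_timeNorm_top T fun t => eLpNorm (ρ t) ⊤ volume,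
    ae_all_iff.2 fun i => ae_le_timeNorm_top T fun t => lpNorm p (block Φ i (a t)),
    ae_le_timeNorm_top T fun t => besovNorm Φ oneWeight p (N / p) (a t)] with t h1 h2 h3 h4 h5 h6
  have hbes : besovNorm Φ oneWeight p (N / p) (a t) ≠ ⊤ := ne_top_of_le_ne_top h.fluctuation_mem.ne h6
  have hJ : ∀ᵐ x, ρ t x ∈ J := h2.mono fun x hx => hx.1
  obtain ⟨b, hb, hbe, hbn⟩ := hC K J mu (ρ t) ρc (a t) h.isOpen h.ordConnected h.smooth_mu h1.1 h1.2 hJ hbes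
  obtain ⟨l, hl, hle, hln⟩ := hC K J lam (ρ t) ρc (a t) h.isOpen h.ordConnected h.smooth_lam h1.1 h1.2 hJ hbes
  have hρfin : eLpNorm (ρ t) ⊤ volume ≠ ⊤ := by
    rw [eLpNorm_exponent_top]
    refine ne_top_of_le_ne_top ofReal_ne_top (essSup_le_of_ae_le (ofReal R) (h3.mono fun x hx => ?_))
    change ‖ρ t x‖ₑ ≤ ofReal R
    rw [← ofReal_norm]
    exact ofReal_le_ofReal hx
  set P := C * (ofReal K * (1 + eLpNorm (ρ t) ⊤ volume) ^ (⌊(N : ℝ) / p⌋₊ + 2)) with hP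
  have hPfin : P ≠ ⊤ := mul_ne_top coe_ne_top (mul_ne_top ofReal_ne_top
    (ENNReal.pow_ne_top (ENNReal.add_ne_top.2 ⟨ENNReal.one_ne_top, hρfin⟩)))
  set α : ℤ → ℝ≥0∞ := fun i => nrm p fun x => ‖cv (a t) (kap Φ i) x‖ₑ with hα
  have hαsum : ∑' i : ℤ, 2 ^ ((i : ℝ) * (N / p)) * α i ≠ ⊤ := by rwa [besovNorm_one_eq Φ hp] at hbes
  -- the blocks of a coefficient are summable, with the weight `2^{jN/p}`
  have hsum : ∀ b : Sp N → ℂ, (∀ j, nrm p (fun x => ‖conv (kap Φ j) b x‖ₑ) ≤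
      P * ∑' i, gainCoef (⌊(N : ℝ) / p⌋₊ + 2) j i * α i) → ∑' j, blockSup Φ p b j ≠ ⊤ := fun b hb => by
    refine ne_top_of_le_ne_top (mul_ne_top hPfin (mul_ne_top (coe_ne_top (r := C')) hαsum)) ?_
    calc ∑' j, blockSup Φ p b j ≤ ∑' j : ℤ, ∑' i : ℤ, P * (2 ^ ((j : ℝ) * (N / p)) * 1 * gainCoef (⌊(N : ℝ) / p⌋₊ + 2) j i * α i) := by
          refine tsum_le_tsum fun j => (mul_le_mul_right (hb j) _).trans_eq ?_
          rw [← ENNReal.tsum_mul_left, ← ENNReal.tsum_mul_left]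
          exact tsum_congr fun i => by ring
      _ = P * ∑' i : ℤ, (∑' j : ℤ, 2 ^ ((j : ℝ) * (N / p)) * 1 * gainCoef (⌊(N : ℝ) / p⌋₊ + 2) j i) * α i := by
          rw [ENNReal.tsum_comm, ← ENNReal.tsum_mul_left]
          refine tsum_congr fun i => ?_
          rw [ENNReal.tsum_mul_left, ENNReal.tsum_mul_right]
      _ ≤ P * (C' * ∑' i : ℤ, 2 ^ ((i : ℝ) * (N / p)) * α i) := by
          refine mul_le_mul_right ?_ _
          rw [← ENNReal.tsum_mul_left]
          refine tsum_le_tsum fun i => (mul_le_mul_left (hC' _ hslow i) _).trans_eq ?_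
          ring
  have hbn' : ∀ j, nrm p (fun x => ‖conv (kap Φ j) b x‖ₑ) ≤ P * ∑' i, gainCoef (⌊(N : ℝ) / p⌋₊ + 2) j i * α i := fun j =>
    (hbn j).trans_eq (mul_assoc _ _ _).symm
  have hln' : ∀ j, nrm p (fun x => ‖conv (kap Φ j) l x‖ₑ) ≤ P * ∑' i, gainCoef (⌊(N : ℝ) / p⌋₊ + 2) j i * α i := fun j =>
    (hln j).trans_eq (mul_assoc _ _ _).symm
  have hcm : ∀ (b : Sp N → ℂ) (j : ℤ), BddCts b → Measurable fun x => ‖conv (kap Φ j) b x‖ₑ := fun b j hb => (hb.conv _).1.enorm.measurable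
  have hadd : ∀ j, nrm p (fun x => ‖conv (kap Φ j) (fun y => l y + b y) x‖ₑ) ≤
      2 * P * ∑' i, gainCoef (⌊(N : ℝ) / p⌋₊ + 2) j i * α i := fun j => by
    simp_rw [conv_add_right _ hl hb]
    refine (nrm_mono (by linarith) fun x => enorm_add_le _ _).trans ((nrm_add_le hp (hcm l j hl) (hcm b j hb)).trans ?_)
    exact (add_le_add (hln' j) (hbn' j)).trans_eq (by ring)
  have hbound : ∀ j, 2 * P * ∑' i, gainCoef (⌊(N : ℝ) / p⌋₊ + 2) j i * α i ≤
      coeffBound Φ p T (2 * (C * K.toNNReal) : ℝ≥0) ρ a j := fun j => by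
    rw [coeffBound]
    refine mul_le_mul' ?_ (tsum_le_tsum fun i => mul_le_mul_right ((lpNorm_block Φ i hp (a t)).symm.le.trans (h5 i)) _)
    rw [hP, densityFactor]
    push_cast
    rw [mul_assoc, mul_assoc]
    exact mul_le_mul_right (mul_le_mul_right (mul_le_mul_right (pow_le_pow_left' (add_le_add le_rfl h4) _) _) _) _
  have h2P : P ≤ 2 * P := le_mul_of_one_le_left' (by norm_num)
  refine ⟨b, fun y => l y + b y, ⟨hb, hbe, hsum b hbn', fun j => (hbn' j).trans ((mul_le_mul_left h2P _).trans (hbound j))⟩, ?_⟩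
  refine ⟨⟨hl.1.add hb.1, hl.2.choose + hb.2.choose, fun y => (norm_add_le _ _).trans (add_le_add (hl.2.choose_spec y) (hb.2.choose_spec y))⟩,
    ?_, ?_, fun j => (hadd j).trans (hbound j)⟩
  · filter_upwards [hbe, hle] with x e1 e2
    rw [e1, e2]; push_cast; ring
  · refine ne_top_of_le_ne_top (ENNReal.add_ne_top.2 ⟨hsum l hln', hsum b hbn'⟩) ?_
    rw [← ENNReal.tsum_add]
    refine tsum_le_tsum fun j => ?_
    rw [blockSup, blockSup, blockSup, ← mul_add]
    refine mul_le_mul_right ?_ _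
    simp_rw [conv_add_right _ hl hb]
    exact (nrm_mono (by linarith) fun x => enorm_add_le _ _).trans (nrm_add_le hp (hcm l j hl) (hcm b j hb))

end

/-! ### The localized momentum equation -/

section

variable {Φ} {p s T c₁ K : ℝ} {J : Set ℝ} {mu lam : ℝ → ℝ} {ρ : ℝ → Sp N → ℝ} {ρc : ℝ} {a : ℝ → 𝓢'(Sp N, ℂ)}
  {u G : ℝ → Fin N → 𝓢'(Sp N, ℂ)} {u₀ : Fin N → 𝓢'(Sp N, ℂ)}

theorem MomentumData.aestronglyMeasurable_comp (h : MomentumData Φ p s T c₁ K J mu lam ρ ρc a u G u₀) {F : ℝ → ℝ}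
    (hF : ContinuousOn F J) :
    AEStronglyMeasurable (uncurry fun t x => F (ρ t x)) ((volume.restrict (Ioo 0 T)).prod (volume : Measure (Sp N))) :=
  aestronglyMeasurable_comp_of_continuousOn h.measurable_density h.isOpen (h.lower_bound.mono fun _ ht => ht.mono fun _ hx => hx.1) hF

/-- The coefficients `μ` (`b = false`) and `λ + 2μ` (`b = true`), after a modification on a null set. -/
theorem MomentumData.exists_diffusivity (h : MomentumData Φ p s T c₁ K J mu lam ρ ρc a u G u₀) (hp : 1 ≤ p) :
    ∃ (κ : Bool → ℝ → Sp N → ℝ) (D : ℝ≥0), (∀ b, Measurable (uncurry (κ b))) ∧ (∀ b t x, c₁ ≤ κ b t x ∧ κ b t x ≤ D) ∧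
      ∀ᵐ t ∂volume.restrict (Ioo 0 T), ∀ᵐ x, ∀ b, κ b t x = mu (ρ t x) + (bif b then 1 else 0) * (lam (ρ t x) + mu (ρ t x)) := by
  obtain ⟨D, hD⟩ := h.exists_coefficients_le hp
  have hm : ∀ b : Bool, AEStronglyMeasurable (uncurry fun t x => mu (ρ t x) + (bif b then 1 else 0) * (lam (ρ t x) + mu (ρ t x)))
      ((volume.restrict (Ioo 0 T)).prod (volume : Measure (Sp N))) := fun b =>
    h.aestronglyMeasurable_comp (F := fun r => mu r + (bif b then 1 else 0) * (lam r + mu r))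
      (h.smooth_mu.1.continuousOn.add (continuousOn_const.mul (h.smooth_lam.1.continuousOn.add h.smooth_mu.1.continuousOn)))
  refine ⟨fun b t x => max c₁ (min ((hm b).mk _ (t, x)) (3 * D)), 3 * D + c₁.toNNReal, fun b => ?_, fun b t x => ⟨le_max_left _ _, ?_⟩, ?_⟩
  · exact measurable_const.max ((hm b).stronglyMeasurable_mk.measurable.min measurable_const)
  · push_cast
    refine max_le ?_ ((min_le_right _ _).trans ?_)
    · have := Real.le_coe_toNNReal c₁
      have : (0 : ℝ) ≤ D := D.2
      linarith
    · have : (0 : ℝ) ≤ c₁.toNNReal := NNReal.coe_nonneg _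
      linarith
  · filter_upwards [hD, h.lower_bound, ae_all_iff.2 fun b => Measure.ae_ae_of_ae_prod (hm b).ae_eq_mk] with t h1 h2 h3
    filter_upwards [h1, h2, ae_all_iff.2 h3] with x e1 e2 e3 b
    have e4 : (hm b).mk _ (t, x) = mu (ρ t x) + (bif b then 1 else 0) * (lam (ρ t x) + mu (ρ t x)) := (e3 b).symm
    rw [e4]
    have := abs_le.1 e1.1
    have := abs_le.1 e1.2
    have : (0 : ℝ) ≤ D := D.2
    cases b
    · simp only [cond_false, zero_mul, add_zero]
      rw [min_eq_left (by linarith), max_eq_right e2.2.1]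
    · simp only [cond_true, one_mul]
      rw [min_eq_left (by linarith), max_eq_right (by linarith [e2.2.2])]

theorem MomentumData.aestronglyMeasurable_cv (h : MomentumData Φ p s T c₁ K J mu lam ρ ρc a u G u₀) (i : Fin N) (k : ℤ) :
    AEStronglyMeasurable (uncurry fun t z => cv (u t i) (kap Φ k) z) ((volume.restrict (Ioo 0 T)).prod (volume : Measure (Sp N))) :=
  aestronglyMeasurable_uncurry (fun _ => continuous_cv _ _) fun z =>
    (h.solution.integrable_sol i _ ((specIn_kap_self Φ k).isZTest z)).aestronglyMeasurable

theorem MomentumData.aestronglyMeasurable_cv_source (h : MomentumData Φ p s T c₁ K J mu lam ρ ρc a u G u₀) (i : Fin N) (k : ℤ) :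
    AEStronglyMeasurable (uncurry fun t z => cv (G t i) (kap Φ k) z) ((volume.restrict (Ioo 0 T)).prod (volume : Measure (Sp N))) :=
  aestronglyMeasurable_uncurry (fun _ => continuous_cv _ _) fun z =>
    (h.solution.integrable_source i _ ((specIn_kap_self Φ k).isZTest z)).aestronglyMeasurable

theorem MomentumData.aemeasurable_freqNorm (h : MomentumData Φ p s T c₁ K J mu lam ρ ρc a u G u₀) (k : ℤ) :
    AEMeasurable (fun t => freqNorm Φ p (u t) k) (volume.restrict (Ioo 0 T)) :=
  Finset.aemeasurable_fun_sum _ fun i _ => aemeasurable_nrm (h.aestronglyMeasurable_cv i k)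

theorem MomentumData.aemeasurable_freqNorm_source (h : MomentumData Φ p s T c₁ K J mu lam ρ ρc a u G u₀) (k : ℤ) :
    AEMeasurable (fun t => freqNorm Φ p (G t) k) (volume.restrict (Ioo 0 T)) :=
  Finset.aemeasurable_fun_sum _ fun i _ => aemeasurable_nrm (h.aestronglyMeasurable_cv_source i k)

theorem MomentumData.aemeasurable_viscBound (h : MomentumData Φ p s T c₁ K J mu lam ρ ρc a u G u₀) (r : ℝ) (f : ℤ → ℝ≥0∞) (k : ℤ) :
    AEMeasurable (fun t => viscBound N p r f (freqNorm Φ p (u t)) k) (volume.restrict (Ioo 0 T)) :=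
  AEMeasurable.tsum fun _ => AEMeasurable.tsum fun l =>
    (((h.aemeasurable_freqNorm l).const_mul _).const_mul _).const_mul _

/-- The momentum equation, localized by a block and integrated in time; `g` is the right-hand side. -/
theorem MomentumData.exists_equation (h : MomentumData Φ p s T c₁ K J mu lam ρ ρc a u G u₀) (k : ℤ) :
    ∃ g : Fin N → ℝ → Sp N → ℂ, (∀ i, Measurable (uncurry (g i))) ∧
      (∀ᵐ t ∂volume.restrict (Ioo 0 T), ∀ i, ∀ᵐ z, viscousPairing Φ (fun x => mu (ρ t x)) (fun x => lam (ρ t x) + mu (ρ t x)) (u t) i (rt (kap Φ k) z) =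
        g i t z - cv (G t i) (kap Φ k) z) ∧
      ∀ᵐ t ∂volume.restrict (Ioo 0 T), ∀ i, ∀ᵐ z, cv (u t i) (kap Φ k) z = cv (u₀ i) (kap Φ k) z + ∫ τ in (0 : ℝ)..t, g i τ z := by
  have hZ := fun z => (specIn_kap_self Φ k).isZTest z
  have hv : ∀ i, AEStronglyMeasurable (uncurry fun t z =>
      viscousPairing Φ (fun x => mu (ρ t x)) (fun x => lam (ρ t x) + mu (ρ t x)) (u t) i (rt (kap Φ k) z))
      ((volume.restrict (Ioo 0 T)).prod (volume : Measure (Sp N))) := fun i =>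
    aestronglyMeasurable_viscousPairing Φ (h.aestronglyMeasurable_comp h.smooth_mu.1.continuousOn)
      (h.aestronglyMeasurable_comp (F := fun r => lam r + mu r) (h.smooth_lam.1.continuousOn.add h.smooth_mu.1.continuousOn))
      (fun i χ hχ => (h.solution.integrable_sol i χ hχ).aestronglyMeasurable) i _
  have hg : ∀ i, AEStronglyMeasurable (uncurry fun t z =>
      viscousPairing Φ (fun x => mu (ρ t x)) (fun x => lam (ρ t x) + mu (ρ t x)) (u t) i (rt (kap Φ k) z) + cv (G t i) (kap Φ k) z)
      ((volume.restrict (Ioo 0 T)).prod (volume : Measure (Sp N))) := fun i => (hv i).add (h.aestronglyMeasurable_cv_source i k)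
  refine ⟨fun i t z => (hg i).mk _ (t, z), fun i => (hg i).stronglyMeasurable_mk.measurable, ?_, ?_⟩
  · filter_upwards [ae_all_iff.2 fun i => Measure.ae_ae_of_ae_prod (hg i).ae_eq_mk] with t ht i
    filter_upwards [ht i] with z hz
    rw [← hz]
    simp [uncurry]
  · refine ae_all_iff.2 fun i => ?_
    refine ae_ae_eq_integral (h.aestronglyMeasurable_cv i k) (hg i).stronglyMeasurable_mk.measurable (hg i).ae_eq_mk
      (continuous_cv _ _).measurable fun z => ?_
    exact ae_eq_integral_of_weak h.time_pos (h.solution.integrable_sol i _ (hZ z))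
      ((h.solution.integrable_viscous i _ (hZ z)).add (h.solution.integrable_source i _ (hZ z))) _ (h.solution.equation i _ (hZ z))

end

/-! ### The estimate of a block -/


/-- The right-hand side of the localized equation, tested with a heat kernel: up to an error that decays like the
kernel, it is the Laplacian of the corresponding part of the solution times the coefficient at the centre of the kernel. -/
theorem exists_heatKap_error {p r : ℝ} (hp : 1 < p) (hpr : p ≤ r) (hr : p.conjExponent ≤ r) :
    ∃ C : ℝ≥0, ∀ (f : ℤ → ℝ≥0∞) (m m' : Sp N → ℝ) (b b' : Sp N → ℂ), Coeff Φ p f m b → Coeff Φ p f m' b' →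
      ∀ (u G : Fin N → 𝓢'(Sp N, ℂ)) (k : ℤ), viscBound N p r f (freqNorm Φ p u) k ≠ ⊤ →
      ∀ g : Fin N → Sp N → ℂ, (∀ i, Measurable (g i)) → (∀ i, nrm p (fun z => ‖g i z‖ₑ) ≠ ⊤) →
        (∀ i, ∀ᵐ z, viscousPairing Φ m m' u i (rt (kap Φ k) z) = g i z - cv (G i) (kap Φ k) z) →
        ∃ E : Sp N → ℝ≥0∞, nrm p E ≤ C * (freqNorm Φ p G k + 2 ^ (k : ℝ) * viscBound N p r f (freqNorm Φ p u) k) ∧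
          ∀ (d : Bool) (a : Fin N) (τ : ℝ), 0 ≤ τ → ∀ x,
            ‖∑ i, (∫ z, heatKap Φ d a k i τ (x - z) * g i z) -
              (b x + (bif d then 1 else 0) * b' x) * ∑ i, ∫ z, lapl (heatKap Φ d a k i τ) (x - z) * cv (u i) (kap Φ k) z‖ₑ ≤
              ofReal (Real.exp (-(((2 : ℝ) ^ k) ^ 2 / 32 * τ))) * E x := by
  obtain ⟨C₁, h₁⟩ := exists_frozen Φ hp hpr hr
  obtain ⟨C₂, h₂⟩ := exists_kerBd_heatKap Φ
  refine ⟨C₂ * (C₁ + (cMaj N ^ 2).toNNReal), fun f m m' b b' hb hb' u G k hfin g hg hgn hgv => ?_⟩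
  have hc2 : (((cMaj N ^ 2).toNNReal : ℝ≥0) : ℝ≥0∞) = cMaj N ^ 2 := coe_toNNReal (ENNReal.pow_ne_top cMaj_ne_top)
  have hcv : ∀ i, Measurable (cv (G i) (kap Φ k)) := fun i => (continuous_cv _ _).measurable
  have hmeas : ∀ i, AEStronglyMeasurable (fun z => viscousPairing Φ m m' u i (rt (kap Φ k) z)) volume := fun i =>
    ((hg i).sub (hcv i)).aestronglyMeasurable.congr ((hgv i).mono fun z hz => hz.symm)
  obtain ⟨E, hEm, hEn, hE⟩ := h₁ f m m' b b' hb hb' u k hfin hmeas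
  have ha : ∀ i, Measurable (avg k fun z => ‖cv (G i) (kap Φ k) z‖ₑ) := fun i => measurable_avg k (hcv i).enorm
  have hs : Measurable fun x => ∑ i, avg k (fun z => ‖cv (G i) (kap Φ k) z‖ₑ) x := Finset.measurable_fun_sum _ fun i _ => ha i
  refine ⟨fun x => C₂ * (E x + ∑ i, avg k (fun z => ‖cv (G i) (kap Φ k) z‖ₑ) x), ?_, fun d a τ hτ x => ?_⟩
  · have hEs : Measurable fun x => E x + ∑ i, avg k (fun z => ‖cv (G i) (kap Φ k) z‖ₑ) x := hEm.add hs
    rw [nrm_const_mul (zero_lt_one.trans hp) _ hEs]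
    push_cast
    rw [hc2, mul_assoc]
    refine mul_le_mul_right ((nrm_add_le hp.le hEm hs).trans ?_) _
    have h3 : nrm p (fun x => ∑ i, avg k (fun z => ‖cv (G i) (kap Φ k) z‖ₑ) x) ≤ cMaj N ^ 2 * freqNorm Φ p G k := by
      refine (nrm_sum_le hp.le ha).trans ?_
      rw [freqNorm, Finset.mul_sum]
      exact Finset.sum_le_sum fun i _ => nrm_avg_le k hp.le (hcv i).enorm
    calc _ ≤ C₁ * (2 ^ (k : ℝ) * viscBound N p r f (freqNorm Φ p u) k) + cMaj N ^ 2 * freqNorm Φ p G k := add_le_add hEn h3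
      _ ≤ C₁ * (freqNorm Φ p G k + 2 ^ (k : ℝ) * viscBound N p r f (freqNorm Φ p u) k) +
          cMaj N ^ 2 * (freqNorm Φ p G k + 2 ^ (k : ℝ) * viscBound N p r f (freqNorm Φ p u) k) :=
        add_le_add (mul_le_mul_right le_add_self _) (mul_le_mul_right le_self_add _)
      _ = _ := by ring
  · set A : ℝ≥0 := (Real.exp (-(((2 : ℝ) ^ k) ^ 2 / 32 * τ))).toNNReal * C₂ with hA
    have hK : ∀ i, KerBd k A (heatKap Φ d a k i τ) := fun i => (h₂ d a k i τ hτ).1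
    have h4 := hE (bif d then 1 else 0) A (heatKap Φ d a k · τ) hK (fun a' => sum_lineDeriv_heatKap Φ d a k τ a') x
    have h5 : ∀ i, ∫ z, heatKap Φ d a k i τ (x - z) * g i z =
        (∫ z, heatKap Φ d a k i τ (x - z) * viscousPairing Φ m m' u i (rt (kap Φ k) z)) +
          ∫ z, heatKap Φ d a k i τ (x - z) * cv (G i) (kap Φ k) z := fun i => by
      have e1 : ∫ z, heatKap Φ d a k i τ (x - z) * viscousPairing Φ m m' u i (rt (kap Φ k) z) =
          ∫ z, (heatKap Φ d a k i τ (x - z) * g i z - heatKap Φ d a k i τ (x - z) * cv (G i) (kap Φ k) z) :=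
        integral_congr_ae ((hgv i).mono fun z hz => by
          change heatKap Φ d a k i τ (x - z) * _ = _
          rw [hz, mul_sub])
      rw [e1, integral_sub (integrable_maj_mul hp.le (heatKap Φ d a k i τ).continuous (fun z => (hK i z).1) (hg i) (hgn i) x)
        (integrable_mul_cv _ _ _ _), sub_add_cancel]
    have h6 : ‖∑ i, ∫ z, heatKap Φ d a k i τ (x - z) * cv (G i) (kap Φ k) z‖ₑ ≤ A * ∑ i, avg k (fun z => ‖cv (G i) (kap Φ k) z‖ₑ) x := by
      refine (enorm_sum_le _ _).trans ?_
      rw [Finset.mul_sum]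
      exact Finset.sum_le_sum fun i _ => enorm_integral_mul_le (hK i) (hcv i).enorm x
    have h7 : ofReal (Real.exp (-(((2 : ℝ) ^ k) ^ 2 / 32 * τ))) * (C₂ * (E x + ∑ i, avg k (fun z => ‖cv (G i) (kap Φ k) z‖ₑ) x)) =
        A * E x + A * ∑ i, avg k (fun z => ‖cv (G i) (kap Φ k) z‖ₑ) x := by
      rw [hA, ofReal]; push_cast; ring
    rw [h7]
    simp_rw [h5]
    rw [Finset.sum_add_distrib, add_sub_right_comm]
    exact (enorm_add_le _ _).trans (add_le_add h4 h6)

/-- The parts of a block that the heat kernels at time `0` select add up to the block. -/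
theorem freqNorm_le_sum_heatKap {p : ℝ} (hp : 1 ≤ p) (u : Fin N → 𝓢'(Sp N, ℂ)) (k : ℤ) :
    freqNorm Φ p u k ≤ ∑ a, ∑ d : Bool, nrm p fun x => ‖∑ i, ∫ z, heatKap Φ d a k i 0 (x - z) * cv (u i) (kap Φ k) z‖ₑ := by
  refine Finset.sum_le_sum fun a _ => ?_
  have hI : ∀ (d : Bool) (i : Fin N) (x : Sp N), ∫ z, heatKap Φ d a k i 0 (x - z) * cv (u i) (kap Φ k) z =
      cv (u i) (mconv (heatKap Φ d a k i 0) (kap Φ k)) x := fun d i x => integral_mul_cv' _ _ _ _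
  have hm : ∀ d : Bool, Measurable fun x => ‖∑ i, ∫ z, heatKap Φ d a k i 0 (x - z) * cv (u i) (kap Φ k) z‖ₑ := fun d => by
    simp_rw [hI]
    exact (Finset.measurable_fun_sum _ fun i _ => (continuous_cv _ _).measurable).enorm
  refine (nrm_mono (by linarith) fun x => ?_).trans (nrm_sum_le hp hm)
  have e : cv (u a) (kap Φ k) x = ∑ d : Bool, ∑ i, ∫ z, heatKap Φ d a k i 0 (x - z) * cv (u i) (kap Φ k) z := by
    rw [Fintype.sum_bool, ← Finset.sum_add_distrib]
    have h1 : ∀ i, (∫ z, heatKap Φ true a k i 0 (x - z) * cv (u i) (kap Φ k) z) + (∫ z, heatKap Φ false a k i 0 (x - z) * cv (u i) (kap Φ k) z) =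
        if i = a then cv (u a) (kap Φ k) x else 0 := fun i => by
      rw [← integral_add (integrable_mul_cv _ _ _ _) (integrable_mul_cv _ _ _ _)]
      have h2 : ∀ z, heatKap Φ true a k i 0 (x - z) * cv (u i) (kap Φ k) z + heatKap Φ false a k i 0 (x - z) * cv (u i) (kap Φ k) z =
          (if a = i then fatKap Φ k else 0 : 𝓢(Sp N, ℂ)) (x - z) * cv (u i) (kap Φ k) z := fun z => by
        rw [← heatKap_zero_add, add_apply]; ring
      simp_rw [h2]
      rcases eq_or_ne a i with rfl | hne
      · simp only [if_true]
        rw [integral_mul_cv', mconv_fatKap_kap]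
      · rw [if_neg hne, if_neg hne.symm]; simp
    simp_rw [h1]
    simp
  rw [e]
  exact enorm_sum_le _ _

theorem timeNorm_one (T : ℝ) (n : ℝ → ℝ≥0∞) : timeNorm T 1 n = ∫⁻ t in Ioo 0 T, n t := by
  rw [timeNorm, eLpNorm_one_eq_lintegral_enorm]
  rfl

theorem lintegral_nrm_cv_ne_top {p : ℝ} (hp : 1 ≤ p) {T σ : ℝ} {v : ℝ → 𝓢'(Sp N, ℂ)} (h : bochnerNorm Φ T 1 p σ v ≠ ⊤)
    (k : ℤ) : ∫⁻ t in Ioo 0 T, nrm p (fun y => ‖cv (v t) (kap Φ k) y‖ₑ) ≠ ⊤ := by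
  rw [bochnerNorm, timeNorm_one] at h
  have h1 : 2 ^ ((k : ℝ) * σ) * ∫⁻ t in Ioo 0 T, nrm p (fun y => ‖cv (v t) (kap Φ k) y‖ₑ) ≤
      ∫⁻ t in Ioo 0 T, besovNorm Φ oneWeight p σ (v t) := by
    refine (lintegral_const_mul_le _ _).trans (lintegral_mono fun t => ?_)
    rw [besovNorm_one_eq Φ hp]
    exact ENNReal.le_tsum (f := fun k : ℤ => 2 ^ ((k : ℝ) * σ) * nrm p fun y => ‖cv (v t) (kap Φ k) y‖ₑ) k
  intro h2
  rw [h2, ENNReal.mul_top (ENNReal.rpow_pos (by norm_num) (by norm_num)).ne'] at h1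
  exact h (top_le_iff.1 h1)

section

variable {Φ} {p s T c₁ K : ℝ} {J : Set ℝ} {mu lam : ℝ → ℝ} {ρ : ℝ → Sp N → ℝ} {ρc : ℝ} {a : ℝ → 𝓢'(Sp N, ℂ)}
  {u G : ℝ → Fin N → 𝓢'(Sp N, ℂ)} {u₀ : Fin N → 𝓢'(Sp N, ℂ)}

theorem MomentumData.lintegral_freqNorm_eq_sum (h : MomentumData Φ p s T c₁ K J mu lam ρ ρc a u G u₀) (k : ℤ) :
    ∫⁻ t in Ioo 0 T, freqNorm Φ p (u t) k = ∑ i, ∫⁻ t in Ioo 0 T, nrm p (fun y => ‖cv (u t i) (kap Φ k) y‖ₑ) :=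
  lintegral_finsetSum' _ fun i _ => aemeasurable_nrm (h.aestronglyMeasurable_cv i k)

theorem MomentumData.lintegral_freqNorm_source_eq_sum (h : MomentumData Φ p s T c₁ K J mu lam ρ ρc a u G u₀) (k : ℤ) :
    ∫⁻ t in Ioo 0 T, freqNorm Φ p (G t) k = ∑ i, ∫⁻ t in Ioo 0 T, nrm p (fun y => ‖cv (G t i) (kap Φ k) y‖ₑ) :=
  lintegral_finsetSum' _ fun i _ => aemeasurable_nrm (h.aestronglyMeasurable_cv_source i k)

theorem MomentumData.lintegral_freqNorm_ne_top (h : MomentumData Φ p s T c₁ K J mu lam ρ ρc a u G u₀) (hp : 1 ≤ p) {σ : ℝ}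
    (hu : bochnerNormV Φ T 1 p σ u < ⊤) (k : ℤ) : ∫⁻ t in Ioo 0 T, freqNorm Φ p (u t) k ≠ ⊤ := by
  rw [h.lintegral_freqNorm_eq_sum, ENNReal.sum_ne_top]
  rw [bochnerNormV, ENNReal.sum_lt_top] at hu
  exact fun i _ => lintegral_nrm_cv_ne_top Φ hp (hu i (Finset.mem_univ i)).ne k

theorem MomentumData.lintegral_freqNorm_source_ne_top (h : MomentumData Φ p s T c₁ K J mu lam ρ ρc a u G u₀) (hp : 1 ≤ p) (k : ℤ) :
    ∫⁻ t in Ioo 0 T, freqNorm Φ p (G t) k ≠ ⊤ := by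
  have hG := h.source_mem
  rw [h.lintegral_freqNorm_source_eq_sum, ENNReal.sum_ne_top]
  rw [bochnerNormV, ENNReal.sum_lt_top] at hG
  exact fun i _ => lintegral_nrm_cv_ne_top Φ hp (hG i (Finset.mem_univ i)).ne k

theorem MomentumData.nrm_initial_ne_top (h : MomentumData Φ p s T c₁ K J mu lam ρ ρc a u G u₀) (hp : 1 ≤ p) (i : Fin N) (k : ℤ) :
    nrm p (fun y => ‖cv (u₀ i) (kap Φ k) y‖ₑ) ≠ ⊤ := by
  have h0 := h.initial_mem
  rw [besovNormV, ENNReal.sum_lt_top] at h0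
  have h1 := (h0 i (Finset.mem_univ i)).ne
  rw [besovNorm_one_eq Φ hp] at h1
  intro h2
  have h3 := ne_top_of_tsum_ne_top h1 k
  rw [h2, ENNReal.mul_top (ENNReal.rpow_pos (by norm_num) (by norm_num)).ne'] at h3
  exact h3 rfl

/-- The coefficients, with a bound for their suprema that does not depend on time. -/
theorem MomentumData.exists_coeff_le (h : MomentumData Φ p s T c₁ K J mu lam ρ ρc a u G u₀) (hp : 1 ≤ p) {f : ℤ → ℝ≥0∞}
    (hf : ∀ᵐ t ∂volume.restrict (Ioo 0 T), ∃ b b' : Sp N → ℂ, Coeff Φ p f (fun x => mu (ρ t x)) b ∧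
      Coeff Φ p f (fun x => lam (ρ t x) + mu (ρ t x)) b') :
    ∃ S : ℝ≥0, ∀ᵐ t ∂volume.restrict (Ioo 0 T), ∃ b b' : Sp N → ℂ, Coeff Φ p f (fun x => mu (ρ t x)) b ∧
      Coeff Φ p f (fun x => lam (ρ t x) + mu (ρ t x)) b' ∧ (∀ x, ‖b x‖ₑ ≤ S) ∧ ∀ x, ‖b' x‖ₑ ≤ S := by
  obtain ⟨D, hD⟩ := h.exists_coefficients_le hp
  refine ⟨2 * D, ?_⟩
  filter_upwards [hf, hD] with t h1 h2
  obtain ⟨b, b', hb, hb'⟩ := h1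
  have hD0 : (0 : ℝ) ≤ D := D.2
  have key : ∀ {b : Sp N → ℂ} {m : Sp N → ℝ}, Coeff Φ p f m b → (∀ᵐ x, |m x| ≤ 2 * D) → ∀ x, ‖b x‖ₑ ≤ (2 * D : ℝ≥0) := fun {b m} hb hm x => by
    rw [← ofReal_norm, ← ENNReal.ofReal_coe_nnreal]
    refine ofReal_le_ofReal (norm_le_of_ae_le hb.bdd.1 ?_ x)
    filter_upwards [hb.ae_eq, hm] with y e1 e2
    rw [e1, Complex.norm_real]
    push_cast
    exact e2
  refine ⟨b, b', hb, hb', key hb (h2.mono fun x hx => hx.1.trans (by linarith)), key hb' (h2.mono fun x hx => ?_)⟩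
  exact (abs_add_le _ _).trans (by linarith [hx.1, hx.2])

end

/-- Smoothing by the heat flow of the frozen operators: a block of the solution is controlled by its initial value, by the
source and by the commutators with the coefficients, all damped at the rate of the frequency. -/
theorem exists_block_estimate (hN : 0 < N) {p r : ℝ} (hp : 1 < p) (hpr : p ≤ r) (hr : p.conjExponent ≤ r) {c₁ : ℝ} (hc₁ : 0 < c₁) (K : ℝ) :
    ∃ C C₁ : ℝ≥0, ∀ s T J mu lam ρ ρc a u G u₀,
      MomentumData Φ p s T c₁ K J mu lam ρ ρc a u G u₀ → ∀ k : ℤ, (∫⁻ t in Ioo 0 T, freqNorm Φ p (u t) k) ≠ ⊤ →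
      (∫⁻ t in Ioo 0 T, viscBound N p r (coeffBound Φ p T C₁ ρ a) (freqNorm Φ p (u t)) k) ≠ ⊤ →
      ∀ᵐ t ∂volume.restrict (Ioo 0 T), freqNorm Φ p (u t) k ≤
        C * (ofReal (Real.exp (-(((2 : ℝ) ^ k) ^ 2 / 32 * (c₁ * t)))) * freqNorm Φ p u₀ k +
          ∫⁻ τ in Ioc 0 t, ofReal (Real.exp (-(((2 : ℝ) ^ k) ^ 2 / 32 * (c₁ * (t - τ))))) *
            (freqNorm Φ p (G τ) k + 2 ^ (k : ℝ) * viscBound N p r (coeffBound Φ p T C₁ ρ a) (freqNorm Φ p (u τ)) k)) := by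
  obtain ⟨C₁, h₁⟩ := exists_coeff Φ hN hp.le K
  obtain ⟨C₂, h₂⟩ := exists_heatKap_error Φ hp hpr hr
  obtain ⟨C₃, h₃⟩ := exists_kerBd_heatKap Φ
  obtain ⟨C₄, h₄⟩ := exists_nrm_visc_le Φ hp hpr hr
  have hc2 : (((cMaj N ^ 2).toNNReal : ℝ≥0) : ℝ≥0∞) = cMaj N ^ 2 := coe_toNNReal (ENNReal.pow_ne_top cMaj_ne_top)
  refine ⟨N * (2 * (C₃ * (cMaj N ^ 2).toNNReal + C₂)), C₁, fun s T J mu lam ρ ρc a u G u₀ h k hu hv => ?_⟩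
  set f := coeffBound Φ p T C₁ ρ a
  obtain ⟨κ, D, hκm, hκ, hκe⟩ := h.exists_diffusivity hp.le
  obtain ⟨g, hg, hgv, hgu⟩ := h.exists_equation k
  obtain ⟨S, hS⟩ := h.exists_coeff_le hp.le (h₁ s T c₁ J mu lam ρ ρc a u G u₀ h)
  have mF := h.aemeasurable_freqNorm k
  have mG := h.aemeasurable_freqNorm_source k
  have mV := h.aemeasurable_viscBound r f k
  have hcv : ∀ (t : ℝ) (i : Fin N), Measurable (cv (u t i) (kap Φ k)) := fun t i => (continuous_cv _ _).measurable
  have hcG : ∀ (t : ℝ) (i : Fin N), Measurable (cv (G t i) (kap Φ k)) := fun t i => (continuous_cv _ _).measurable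
  have hgm : ∀ i t, Measurable (g i t) := fun i t => (hg i).comp measurable_prodMk_left
  have hk2 : (2 : ℝ≥0∞) ^ (k : ℝ) ≠ ⊤ := two_rpow_ne_top _
  have hgn : ∀ i, ∫⁻ t in Ioo 0 T, nrm p (fun z => ‖g i t z‖ₑ) ≠ ⊤ := fun i => by
    have hle : ∀ᵐ t ∂volume.restrict (Ioo 0 T), nrm p (fun z => ‖g i t z‖ₑ) ≤
        (C₄ * (2 : ℝ≥0∞) ^ (k : ℝ)) * viscBound N p r f (freqNorm Φ p (u t)) k +
          ((C₄ * S * (2 ^ (k : ℝ) * (2 : ℝ≥0∞) ^ (k : ℝ))) * freqNorm Φ p (u t) k + freqNorm Φ p (G t) k) := by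
      filter_upwards [hS, hgv] with t h5 h6
      obtain ⟨b, b', hb, hb', hbS, hbS'⟩ := h5
      have h7 := h₄ f _ _ b b' hb hb' S hbS hbS' (u t) k i
      have h8 : nrm p (fun z => ‖g i t z - cv (G t i) (kap Φ k) z‖ₑ) =
          nrm p (fun z => ‖viscousPairing Φ (fun x => mu (ρ t x)) (fun x => lam (ρ t x) + mu (ρ t x)) (u t) i (rt (kap Φ k) z)‖ₑ) :=
        nrm_congr_ae ((h6 i).mono fun z hz => by simp only; rw [hz])
      have m1 : Measurable fun z => ‖g i t z - cv (G t i) (kap Φ k) z‖ₑ := ((hgm i t).sub (hcG t i)).enorm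
      have m2 : Measurable fun z => ‖cv (G t i) (kap Φ k) z‖ₑ := (hcG t i).enorm
      refine (nrm_mono (by linarith) fun z => ?_).trans ((nrm_add_le hp.le m1 m2).trans ?_)
      · have := enorm_add_le (g i t z - cv (G t i) (kap Φ k) z) (cv (G t i) (kap Φ k) z)
        rwa [sub_add_cancel] at this
      · rw [h8, ← add_assoc]
        refine add_le_add (h7.trans_eq (by ring)) ?_
        exact Finset.single_le_sum (f := fun i => nrm p fun z => ‖cv (G t i) (kap Φ k) z‖ₑ) (fun _ _ => zero_le) (Finset.mem_univ i)
    refine ne_top_of_le_ne_top ?_ (lintegral_mono_ae hle)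
    rw [lintegral_add_left' (mV.const_mul _), lintegral_add_left' (mF.const_mul _), lintegral_const_mul'' _ mV, lintegral_const_mul'' _ mF]
    refine ENNReal.add_ne_top.2 ⟨mul_ne_top (mul_ne_top coe_ne_top hk2) hv, ENNReal.add_ne_top.2
      ⟨mul_ne_top (mul_ne_top (mul_ne_top coe_ne_top coe_ne_top) (mul_ne_top hk2 hk2)) hu,
        h.lintegral_freqNorm_source_ne_top hp.le k⟩⟩
  have hgfin : ∀ᵐ t ∂volume.restrict (Ioo 0 T), ∀ i, nrm p (fun z => ‖g i t z‖ₑ) ≠ ⊤ :=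
    ae_all_iff.2 fun i => (ae_lt_top' (aemeasurable_nrm (hg i).aestronglyMeasurable) (hgn i)).mono fun t ht => ht.ne
  have hVn : ∀ᵐ t ∂volume.restrict (Ioo 0 T), ∀ i, nrm p (fun z => ‖cv (u t i) (kap Φ k) z‖ₑ) ≠ ⊤ := by
    filter_upwards [ae_lt_top' mF hu] with t ht i
    rw [freqNorm, ENNReal.sum_lt_top] at ht
    exact (ht i (Finset.mem_univ i)).ne
  have me : AEMeasurable (fun t => C₂ * (freqNorm Φ p (G t) k + 2 ^ (k : ℝ) * viscBound N p r f (freqNorm Φ p (u t)) k))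
      (volume.restrict (Ioo 0 T)) := (mG.add (mV.const_mul _)).const_mul _
  have hEst : ∀ (d : Bool) (a' : Fin N), ∀ᵐ t ∂volume.restrict (Ioo 0 T),
      nrm p (fun x => ‖∑ i, ∫ z, heatKap Φ d a' k i 0 (x - z) * cv (u t i) (kap Φ k) z‖ₑ) ≤
      ofReal (Real.exp (-(((2 : ℝ) ^ k) ^ 2 / 32 * (c₁ * t)))) * (C₃ * cMaj N ^ 2 * ∑ i, nrm p (fun z => ‖cv (u₀ i) (kap Φ k) z‖ₑ)) +
        ∫⁻ τ in Ioc 0 t, ofReal (Real.exp (-(((2 : ℝ) ^ k) ^ 2 / 32 * (c₁ * (t - τ))))) *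
          (C₂ * (freqNorm Φ p (G τ) k + 2 ^ (k : ℝ) * viscBound N p r f (freqNorm Φ p (u τ)) k)) := fun d a' => by
    refine duhamel_estimate (k := k) (H := fun i m z => heatKap Φ d a' k i m z) (L := fun i m z => lapl (heatKap Φ d a' k i m) z)
      (B := (((2 : ℝ) ^ k) ^ 2).toNNReal * C₃) (V := fun t i => cv (u t i) (kap Φ k)) (v₀ := fun i => cv (u₀ i) (kap Φ k)) (D := D) hp hc₁.le (by positivity) (hκm d) (fun t x => (hκ d t x).1) (fun t x => (hκ d t x).2)
      (fun i m z => hasDerivAt_heatKap Φ d a' k i m z) (fun i => continuous_heatKap Φ d a' k i) (fun i => continuous_lapl_heatKap Φ d a' k i)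
      (fun i m hm z => ?_) (fun i m hm z => ?_) hg hgn (fun i => (continuous_cv _ _).measurable) (fun i => h.nrm_initial_ne_top hp.le i k)
      hcv hVn hgu me ?_
    · have := ((h₃ d a' k i m hm).1 z).1
      rwa [ENNReal.coe_mul] at this
    · exact ((h₃ d a' k i m hm).2 z).1
    · filter_upwards [hS, hgv, hgfin, hκe, ae_lt_top' mV hv] with t h5 h6 h7 h8 h9
      obtain ⟨b, b', hb, hb', -, -⟩ := h5
      obtain ⟨E, hE, hEb⟩ := h₂ f _ _ b b' hb hb' (u t) (G t) k h9.ne (fun i => g i t) (fun i => hgm i t) h7 h6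
      refine ⟨E, hE, ?_⟩
      filter_upwards [h8, hb.ae_eq, hb'.ae_eq] with x e1 e2 e3 m hm
      have e4 : ((κ d t x : ℝ) : ℂ) = b x + (bif d then 1 else 0) * b' x := by
        rw [e1 d, e2, e3]
        cases d <;> simp
      rw [e4]
      exact hEb d a' m hm x
  filter_upwards [ae_all_iff.2 fun d => ae_all_iff.2 (hEst d)] with t ht
  refine (freqNorm_le_sum_heatKap Φ hp.le (u t) k).trans ((Finset.sum_le_sum fun a' _ => Finset.sum_le_sum fun d _ => ht d a').trans ?_)
  have e1 : ∀ τ, ofReal (Real.exp (-(((2 : ℝ) ^ k) ^ 2 / 32 * (c₁ * (t - τ))))) *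
          (C₂ * (freqNorm Φ p (G τ) k + 2 ^ (k : ℝ) * viscBound N p r f (freqNorm Φ p (u τ)) k)) =
      C₂ * (ofReal (Real.exp (-(((2 : ℝ) ^ k) ^ 2 / 32 * (c₁ * (t - τ))))) *
          (freqNorm Φ p (G τ) k + 2 ^ (k : ℝ) * viscBound N p r f (freqNorm Φ p (u τ)) k)) := fun τ => by ring
  simp_rw [e1]
  rw [lintegral_const_mul' _ _ coe_ne_top]
  simp only [Finset.sum_const, Finset.card_univ, Fintype.card_fin, Fintype.card_bool, nsmul_eq_mul]
  rw [← freqNorm]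
  push_cast
  rw [hc2, mul_assoc (N : ℝ≥0∞), mul_assoc (2 : ℝ≥0∞)]
  refine mul_le_mul_right (mul_le_mul_right ?_ _) _
  rw [mul_add, add_mul, add_mul]
  refine add_le_add ?_ ?_
  · exact le_add_of_le_left (by rw [mul_left_comm])
  · exact le_add_self

/-! ### Damping in time -/


theorem lintegral_exp_Icc {b T : ℝ} (hb : 0 < b) (hT : 0 ≤ T) :
    ∫⁻ x in Icc 0 T, ofReal (Real.exp (-(b * x))) = ofReal ((1 - Real.exp (-(b * T))) / b) := by
  have hc : Continuous fun x : ℝ => Real.exp (-(b * x)) := by fun_prop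
  rw [← ofReal_integral_eq_lintegral_ofReal (hc.integrableOn_Icc) (.of_forall fun x => (Real.exp_pos _).le),
    integral_Icc_eq_integral_Ioc, ← intervalIntegral.integral_of_le hT,
    intervalIntegral.integral_eq_sub_of_hasDerivAt (f := fun x => -Real.exp (-(b * x)) / b) (fun x _ => ?_) (hc.intervalIntegrable _ _)]
  · congr 1
    simp only [mul_zero, neg_zero, Real.exp_zero]
    ring
  · have h1 : HasDerivAt (fun x : ℝ => -(b * x)) (-b) x := by
      have := ((hasDerivAt_id x).const_mul (-b))
      simpa only [neg_mul, id, mul_one] using this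
    refine (h1.exp.neg.div_const b).congr_deriv ?_
    field_simp

/-- Damping of a quantity that satisfies a Duhamel inequality with the rate `b`. -/
theorem damped_lintegral_le {b T : ℝ} (hb : 0 < b) (hT : 0 ≤ T) {Y Q : ℝ → ℝ≥0∞} {C : ℝ≥0} {y : ℝ≥0∞}
    (hQ : AEMeasurable Q (volume.restrict (Ioo 0 T)))
    (h : ∀ᵐ t ∂volume.restrict (Ioo 0 T), Y t ≤ C * (ofReal (Real.exp (-(b * t))) * y +
      ∫⁻ τ in Ioc 0 t, ofReal (Real.exp (-(b * (t - τ)))) * Q τ)) :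
    (∀ᵐ t ∂volume.restrict (Ioo 0 T), Y t ≤ C * (y + ∫⁻ τ in Ioo 0 T, Q τ)) ∧
      ∫⁻ t in Ioo 0 T, Y t ≤ C * (y + ∫⁻ τ in Ioo 0 T, Q τ) * ofReal ((1 - Real.exp (-(b * T))) / b) := by
  have hmem : ∀ᵐ t ∂volume.restrict (Ioo 0 T), t ∈ Ioo 0 T := ae_restrict_mem measurableSet_Ioo
  have hexp1 : ∀ x, 0 ≤ x → ofReal (Real.exp (-(b * x))) ≤ 1 := fun x hx => by
    rw [ENNReal.ofReal_le_one, Real.exp_le_one_iff]; nlinarith [mul_nonneg hb.le hx]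
  refine ⟨?_, ?_⟩
  · filter_upwards [h, hmem] with t ht hm
    refine ht.trans (mul_le_mul_right (add_le_add (mul_le_of_le_one_left' (hexp1 t hm.1.le)) ?_) _)
    refine (setLIntegral_mono' measurableSet_Ioc fun τ hτ => mul_le_of_le_one_left' (hexp1 _ (sub_nonneg.2 hτ.2))).trans ?_
    exact lintegral_mono_set fun τ hτ => ⟨hτ.1, hτ.2.trans_lt hm.2⟩
  · set w : ℝ → ℝ≥0∞ := (Icc 0 T).indicator fun x => ofReal (Real.exp (-(b * x))) with hw
    have hwm : Measurable w := Measurable.indicator (by fun_prop) measurableSet_Icc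
    have hwI : ∫⁻ x, w x = ofReal ((1 - Real.exp (-(b * T))) / b) := by
      rw [hw, lintegral_indicator measurableSet_Icc, lintegral_exp_Icc hb hT]
    have hw1 : ∀ {x}, 0 ≤ x → x ≤ T → ofReal (Real.exp (-(b * x))) = w x := fun h0 h1 => by
      rw [hw, indicator_of_mem (mem_Icc.2 ⟨h0, h1⟩)]
    have h2 : ∀ᵐ t ∂volume.restrict (Ioo 0 T), Y t ≤ C * (w t * y + ∫⁻ τ in Ioo 0 T, w (t - τ) * Q τ) := by
      filter_upwards [h, hmem] with t ht hm
      refine ht.trans (mul_le_mul_right (add_le_add (by rw [hw1 hm.1.le hm.2.le]) ?_) _)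
      refine (setLIntegral_mono' measurableSet_Ioc fun τ hτ => ?_).trans (lintegral_mono_set fun τ hτ => ⟨hτ.1, hτ.2.trans_lt hm.2⟩)
      rw [hw1 (sub_nonneg.2 hτ.2) (by linarith [hτ.1, hm.2])]
    have hpm : AEMeasurable (uncurry fun t τ => w (t - τ) * Q τ) ((volume.restrict (Ioo 0 T)).prod (volume.restrict (Ioo 0 T))) :=
      (hwm.comp (measurable_fst.sub measurable_snd)).aemeasurable.mul hQ.comp_snd
    have hI : ∫⁻ t in Ioo 0 T, ∫⁻ τ in Ioo 0 T, w (t - τ) * Q τ ≤ (∫⁻ τ in Ioo 0 T, Q τ) * ∫⁻ x, w x := by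
      rw [lintegral_lintegral_swap hpm, ← lintegral_mul_const'' _ hQ]
      refine lintegral_mono fun τ => ?_
      have hm1 : Measurable fun t => w (t - τ) := hwm.comp (measurable_id.sub_const τ)
      rw [lintegral_mul_const _ hm1, mul_comm]
      refine mul_le_mul_right ((setLIntegral_le_lintegral _ _).trans_eq ?_) _
      exact lintegral_sub_right_eq_self w τ
    refine (lintegral_mono_ae h2).trans ?_
    rw [lintegral_const_mul' _ _ coe_ne_top, lintegral_add_left (hwm.mul_const y), lintegral_mul_const _ hwm, mul_assoc]
    refine mul_le_mul_right ?_ _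
    rw [add_mul, ← hwI]
    exact add_le_add ((mul_comm _ _).trans_le (mul_le_mul_right (setLIntegral_le_lintegral _ _) _)) hI

/-- Interpolation of `L^q(0,T)` between `L^1` and `L^∞`. -/
theorem timeNorm_le_rpow {T : ℝ} {Y : ℝ → ℝ≥0∞} {H A : ℝ≥0∞} (hA : A ≠ 0) (hA' : A ≠ ⊤)
    (h1 : ∀ᵐ t ∂volume.restrict (Ioo 0 T), Y t ≤ H) (h2 : ∫⁻ t in Ioo 0 T, Y t ≤ H * A) {q : ℝ≥0∞} (hq : 1 ≤ q) :
    timeNorm T q Y ≤ H * A ^ (q⁻¹).toReal := by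
  rcases eq_or_ne q ⊤ with rfl | hqt
  · rw [timeNorm, eLpNorm_exponent_top, ENNReal.inv_top, ENNReal.toReal_zero, rpow_zero, mul_one]
    exact essSup_le_of_ae_le H (h1.mono fun t ht => ht)
  have hr : 1 ≤ q.toReal := by
    rw [← ENNReal.toReal_one]; exact toReal_mono hqt hq
  have hr0 : 0 < q.toReal := by linarith
  rcases eq_or_ne H ⊤ with rfl | hH
  · rw [ENNReal.top_mul (ENNReal.rpow_pos (pos_iff_ne_zero.2 hA) hA').ne']
    exact le_top
  rw [timeNorm, eLpNorm_eq_lintegral_rpow_enorm_toReal (by positivity) hqt, ENNReal.toReal_inv, one_div]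
  have h3 : ∫⁻ t in Ioo 0 T, ‖Y t‖ₑ ^ q.toReal ≤ H ^ q.toReal * A := by
    have h4 : ∀ᵐ t ∂volume.restrict (Ioo 0 T), ‖Y t‖ₑ ^ q.toReal ≤ H ^ (q.toReal - 1) * Y t := h1.mono fun t ht => by
      change Y t ^ q.toReal ≤ _
      calc Y t ^ q.toReal = Y t ^ ((q.toReal - 1) + 1) := by rw [sub_add_cancel]
        _ = Y t ^ (q.toReal - 1) * Y t := by rw [rpow_add_of_nonneg _ _ (by linarith) zero_le_one, rpow_one]
        _ ≤ _ := mul_le_mul_left (rpow_le_rpow ht (by linarith)) _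
    refine (lintegral_mono_ae h4).trans ?_
    rw [lintegral_const_mul' _ _ (ENNReal.rpow_ne_top_of_nonneg (by linarith) hH)]
    refine (mul_le_mul_right h2 _).trans_eq ?_
    rw [← mul_assoc]
    congr 1
    conv_rhs => rw [← sub_add_cancel q.toReal 1, rpow_add_of_nonneg _ _ (by linarith) zero_le_one, rpow_one]
  refine (rpow_le_rpow h3 (by positivity)).trans_eq ?_
  rw [mul_rpow_of_nonneg _ _ (by positivity), ← rpow_mul, mul_inv_cancel₀ hr0.ne', rpow_one]

/-! ### The weights -/

theorem eWeight_nonneg (c : ℝ) (l : ℤ) (t : ℝ) : 0 ≤ eWeight c l t := Real.sqrt_nonneg _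

theorem eWeight_le_one (c : ℝ) (l : ℤ) (t : ℝ) : eWeight c l t ≤ 1 := by
  rw [eWeight, Real.sqrt_le_left zero_le_one]
  linarith [Real.exp_pos (-(c * (2 : ℝ) ^ (2 * l) * t))]

theorem eWeight_sq {c t : ℝ} (hc : 0 ≤ c) (ht : 0 ≤ t) (l : ℤ) : eWeight c l t ^ 2 = 1 - Real.exp (-(c * (2 : ℝ) ^ (2 * l) * t)) := by
  rw [eWeight, Real.sq_sqrt]
  rw [sub_nonneg, Real.exp_le_one_iff, neg_nonpos]
  positivity

theorem eWeight_pos {c t : ℝ} (hc : 0 < c) (ht : 0 < t) (l : ℤ) : 0 < eWeight c l t := by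
  rw [eWeight, Real.sqrt_pos, sub_pos, Real.exp_lt_one_iff, neg_lt_zero]
  positivity

theorem eWeight_mono {c t : ℝ} (hc : 0 ≤ c) (ht : 0 ≤ t) {j k : ℤ} (hjk : j ≤ k) : eWeight c j t ≤ eWeight c k t := by
  refine Real.sqrt_le_sqrt (sub_le_sub_left (Real.exp_le_exp.2 (neg_le_neg ?_)) _)
  gcongr
  norm_num

theorem summable_omegaWeight (c t : ℝ) (k : ℤ) : Summable fun n : ℕ => ((2 : ℝ) ^ n)⁻¹ * eWeight c (k + n) t := by
  refine Summable.of_nonneg_of_le (fun n => mul_nonneg (by positivity) (eWeight_nonneg _ _ _))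
    (fun n => mul_le_of_le_one_right (by positivity) (eWeight_le_one _ _ _)) ?_
  simpa only [one_div, inv_pow] using summable_geometric_two

theorem eWeight_le_omegaWeight (c t : ℝ) (k : ℤ) : eWeight c k t ≤ omegaWeight c t k := by
  have := (summable_omegaWeight c t k).le_tsum 0 fun n _ => mul_nonneg (by positivity) (eWeight_nonneg _ _ _)
  rw [omegaWeight]
  simpa using this

/-- `ω_k` increases with `k` because `e_ℓ` increases with `ℓ`, while `2^{-k} ω_k` is a sum over `ℓ ≥ k`
and decreases. -/
theorem slowWeight_omegaWeight {c t : ℝ} (hc : 0 ≤ c) (ht : 0 ≤ t) : SlowWeight fun k => ofReal (omegaWeight c t k) := fun j k hjk => by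
  refine ⟨ofReal_le_ofReal ((summable_omegaWeight c t j).tsum_le_tsum (fun n => ?_) (summable_omegaWeight c t k)), ?_⟩
  · exact mul_le_mul_of_nonneg_left (eWeight_mono hc ht (by linarith)) (by positivity)
  · obtain ⟨d, rfl⟩ := Int.le.dest hjk
    have e1 : ((j + d : ℤ) : ℝ) - j = d := by push_cast; ring
    rw [e1, ← two_rpow_ofReal, ← ofReal_mul (by positivity), Real.rpow_natCast]
    refine ofReal_le_ofReal ?_
    have h1 := (summable_omegaWeight c t j).sum_add_tsum_nat_add d
    have h2 : ∑' n : ℕ, ((2 : ℝ) ^ (n + d))⁻¹ * eWeight c (j + (n + d : ℕ)) t = ((2 : ℝ) ^ d)⁻¹ * omegaWeight c t (j + d) := by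
      rw [omegaWeight, ← tsum_mul_left]
      refine tsum_congr fun n => ?_
      rw [pow_add, mul_inv_rev, mul_assoc]
      have e2 : j + ((n + d : ℕ) : ℤ) = j + d + n := by push_cast; ring
      rw [e2]
    have h3 : 0 ≤ ∑ n ∈ Finset.range d, ((2 : ℝ) ^ n)⁻¹ * eWeight c (j + n) t :=
      Finset.sum_nonneg fun n _ => mul_nonneg (by positivity) (eWeight_nonneg _ _ _)
    rw [h2] at h1
    have h4 : ((2 : ℝ) ^ d)⁻¹ * omegaWeight c t (j + d) ≤ omegaWeight c t j := by
      rw [omegaWeight.eq_def c t j]; linarith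
    rwa [inv_mul_le_iff₀ (by positivity)] at h4

/-! ### Summation over the blocks -/


/-- The estimate of one block in `L^q(0,T; L^p)`. -/
theorem exists_timeNorm_le (hN : 0 < N) {p r : ℝ} (hp : 1 < p) (hpr : p ≤ r) (hr : p.conjExponent ≤ r) {c₁ : ℝ} (hc₁ : 0 < c₁) (K : ℝ) :
    ∃ C C₁ : ℝ≥0, ∀ s T J mu lam ρ ρc a u G u₀,
      MomentumData Φ p s T c₁ K J mu lam ρ ρc a u G u₀ → ∀ k : ℤ, (∫⁻ t in Ioo 0 T, freqNorm Φ p (u t) k) ≠ ⊤ →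
      ∀ q : ℝ≥0∞, 1 ≤ q → timeNorm T q (fun t => freqNorm Φ p (u t) k) ≤
        C * (2 ^ (-(2 * (k : ℝ) * (q⁻¹).toReal)) * ofReal (eWeight (c₁ / 32) k T ^ 2) ^ (q⁻¹).toReal) *
          (freqNorm Φ p u₀ k + (∫⁻ t in Ioo 0 T, freqNorm Φ p (G t) k) +
            2 ^ (k : ℝ) * ∫⁻ t in Ioo 0 T, viscBound N p r (coeffBound Φ p T C₁ ρ a) (freqNorm Φ p (u t)) k) := by
  obtain ⟨C, C₁, h⟩ := exists_block_estimate Φ hN hp hpr hr hc₁ K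
  set c : ℝ := c₁ / 32 with hc
  have hc0 : 0 < c := by positivity
  refine ⟨(C + 1) * (1 + c⁻¹.toNNReal), C₁, fun s T J mu lam ρ ρc a u G u₀ hd k hu q hq => ?_⟩
  set θ := (q⁻¹).toReal with hθ
  have hT := hd.time_pos
  have he : 0 < eWeight c k T ^ 2 := by have := eWeight_pos hc0 hT k; positivity
  have hk0 : (2 : ℝ≥0∞) ^ (k : ℝ) ≠ 0 := (ENNReal.rpow_pos (by norm_num) (by norm_num)).ne'
  by_cases hv : (∫⁻ t in Ioo 0 T, viscBound N p r (coeffBound Φ p T C₁ ρ a) (freqNorm Φ p (u t)) k) = ⊤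
  · rw [hv, ENNReal.mul_top hk0, add_top, ENNReal.mul_top]
    · exact le_top
    · refine mul_ne_zero ?_ (mul_ne_zero (ENNReal.rpow_pos (by norm_num) (by norm_num)).ne'
        (ENNReal.rpow_pos (ENNReal.ofReal_pos.2 he) ofReal_ne_top).ne')
      exact_mod_cast (by positivity : (C + 1) * (1 + c⁻¹.toNNReal) ≠ 0)
  have hb : 0 < c * (2 : ℝ) ^ (2 * k) := by positivity
  have hrate : ∀ x : ℝ, ((2 : ℝ) ^ k) ^ 2 / 32 * (c₁ * x) = c * (2 : ℝ) ^ (2 * k) * x := fun x => by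
    rw [hc, mul_comm 2 k, zpow_mul]
    norm_cast
    ring
  have h1 := h s T J mu lam ρ ρc a u G u₀ hd k hu hv
  simp only [hrate] at h1
  have hQ : AEMeasurable (fun t => freqNorm Φ p (G t) k + 2 ^ (k : ℝ) * viscBound N p r (coeffBound Φ p T C₁ ρ a) (freqNorm Φ p (u t)) k)
      (volume.restrict (Ioo 0 T)) := (hd.aemeasurable_freqNorm_source k).add ((hd.aemeasurable_viscBound r _ k).const_mul _)
  obtain ⟨h2, h3⟩ := damped_lintegral_le hb hT.le hQ h1
  rw [lintegral_add_left' (hd.aemeasurable_freqNorm_source k), lintegral_const_mul'' _ (hd.aemeasurable_viscBound r _ k), ← add_assoc] at h2 h3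
  rw [← eWeight_sq hc0.le hT.le] at h3
  refine (timeNorm_le_rpow (ENNReal.ofReal_pos.2 (div_pos he hb)).ne' ofReal_ne_top h2 h3 hq).trans ?_
  have hθ0 : 0 ≤ θ := toReal_nonneg
  have hθ1 : θ ≤ 1 := by
    rw [hθ, ← ENNReal.toReal_one]
    exact toReal_mono ENNReal.one_ne_top (ENNReal.inv_le_one.2 hq)
  have e1 : ofReal (eWeight c k T ^ 2 / (c * (2 : ℝ) ^ (2 * k))) ^ θ =
      ofReal c⁻¹ ^ θ * (2 ^ (-(2 * (k : ℝ) * θ)) * ofReal (eWeight c k T ^ 2) ^ θ) := by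
    have e2 : eWeight c k T ^ 2 / (c * (2 : ℝ) ^ (2 * k)) = c⁻¹ * ((2 : ℝ) ^ (-(2 * (k : ℝ))) * eWeight c k T ^ 2) := by
      have : (2 : ℝ) ^ (-(2 * (k : ℝ))) = ((2 : ℝ) ^ (2 * k))⁻¹ := by
        rw [Real.rpow_neg (by norm_num), ← Real.rpow_intCast]; push_cast; rfl
      rw [this]; field_simp
    rw [e2, ofReal_mul (by positivity), ofReal_mul (by positivity), mul_rpow_of_nonneg _ _ hθ0,
      mul_rpow_of_nonneg _ _ hθ0, two_rpow_ofReal, ← rpow_mul, neg_mul]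
  have e3 : ofReal c⁻¹ ^ θ ≤ 1 + (c⁻¹.toNNReal : ℝ≥0∞) := by
    calc ofReal c⁻¹ ^ θ ≤ (1 + (c⁻¹.toNNReal : ℝ≥0∞)) ^ θ := rpow_le_rpow le_add_self hθ0
      _ ≤ (1 + (c⁻¹.toNNReal : ℝ≥0∞)) ^ (1 : ℝ) := rpow_le_rpow_of_exponent_le le_self_add hθ1
      _ = _ := rpow_one _
  rw [e1]
  push_cast
  calc _ ≤ ((C : ℝ≥0∞) + 1) * _ * ((1 + (c⁻¹.toNNReal : ℝ≥0∞)) * _) := mul_le_mul' (mul_le_mul_left le_self_add _) (mul_le_mul_left e3 _)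
    _ = _ := by ring

section

variable {Φ} {p s T c₁ K : ℝ} {J : Set ℝ} {mu lam : ℝ → ℝ} {ρ : ℝ → Sp N → ℝ} {ρc : ℝ} {a : ℝ → 𝓢'(Sp N, ℂ)}
  {u G : ℝ → Fin N → 𝓢'(Sp N, ℂ)} {u₀ : Fin N → 𝓢'(Sp N, ℂ)}

theorem besovNormV_eq (Φ : LPFunction N) {p : ℝ} (hp : 1 ≤ p) (w : ℤ → ℝ) (σ : ℝ) (v : Fin N → 𝓢'(Sp N, ℂ)) :
    besovNormV Φ w p σ v = ∑' k : ℤ, 2 ^ ((k : ℝ) * σ) * ofReal (w k) * freqNorm Φ p v k := by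
  simp only [besovNormV, besovNorm, freqNorm, Finset.mul_sum, lpNorm_block Φ _ hp]
  rw [Summable.tsum_finsetSum fun _ _ => ENNReal.summable]
  refine Finset.sum_congr rfl fun i _ => tsum_congr fun k => ?_
  rw [ofReal_mul (by positivity), two_rpow_ofReal]

theorem MomentumData.cheminLernerNormV_one_eq (h : MomentumData Φ p s T c₁ K J mu lam ρ ρc a u G u₀) (hp : 1 ≤ p) (w : ℤ → ℝ) (σ : ℝ) :
    cheminLernerNormV Φ w T 1 p σ u = ∑' k : ℤ, 2 ^ ((k : ℝ) * σ) * ofReal (w k) * ∫⁻ t in Ioo 0 T, freqNorm Φ p (u t) k := by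
  simp only [cheminLernerNormV, cheminLernerNorm, h.lintegral_freqNorm_eq_sum, Finset.mul_sum, lpNorm_block Φ _ hp, timeNorm_one]
  rw [Summable.tsum_finsetSum fun _ _ => ENNReal.summable]
  refine Finset.sum_congr rfl fun i _ => tsum_congr fun k => ?_
  rw [ofReal_mul (by positivity), two_rpow_ofReal]

theorem MomentumData.cheminLernerNormV_source_eq (h : MomentumData Φ p s T c₁ K J mu lam ρ ρc a u G u₀) (hp : 1 ≤ p) (w : ℤ → ℝ) (σ : ℝ) :
    cheminLernerNormV Φ w T 1 p σ G = ∑' k : ℤ, 2 ^ ((k : ℝ) * σ) * ofReal (w k) * ∫⁻ t in Ioo 0 T, freqNorm Φ p (G t) k := by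
  simp only [cheminLernerNormV, cheminLernerNorm, h.lintegral_freqNorm_source_eq_sum, Finset.mul_sum, lpNorm_block Φ _ hp, timeNorm_one]
  rw [Summable.tsum_finsetSum fun _ _ => ENNReal.summable]
  refine Finset.sum_congr rfl fun i _ => tsum_congr fun k => ?_
  rw [ofReal_mul (by positivity), two_rpow_ofReal]

theorem cheminLernerNormV_one_le (Φ : LPFunction N) {p : ℝ} (hp : 1 ≤ p) (T : ℝ) (q : ℝ≥0∞) (σ : ℝ) (v : ℝ → Fin N → 𝓢'(Sp N, ℂ)) :
    cheminLernerNormV Φ oneWeight T q p σ v ≤ N * ∑' k : ℤ, 2 ^ ((k : ℝ) * σ) * timeNorm T q (fun t => freqNorm Φ p (v t) k) := by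
  have h : ∀ i ∈ Finset.univ, cheminLernerNorm Φ oneWeight T q p σ (fun t => v t i) ≤
      ∑' k : ℤ, 2 ^ ((k : ℝ) * σ) * timeNorm T q (fun t => freqNorm Φ p (v t) k) := fun i _ => by
    refine tsum_le_tsum fun k => ?_
    rw [oneWeight, mul_one, two_rpow_ofReal]
    refine mul_le_mul_right (eLpNorm_mono_enorm fun t => ?_) _
    change lpNorm p (block Φ k (v t i)) ≤ freqNorm Φ p (v t) k
    rw [lpNorm_block Φ k hp]
    exact Finset.single_le_sum (f := fun i => nrm p fun z => ‖cv (v t i) (kap Φ k) z‖ₑ) (fun _ _ => zero_le) (Finset.mem_univ i)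
  refine (Finset.sum_le_sum h).trans_eq ?_
  rw [Finset.sum_const, Finset.card_univ, Fintype.card_fin, nsmul_eq_mul]

/-- The bound for the commutators is linear in the solution, so that it commutes with the integral in time. -/
theorem MomentumData.lintegral_viscBound (h : MomentumData Φ p s T c₁ K J mu lam ρ ρc a u G u₀) (r : ℝ) (f : ℤ → ℝ≥0∞) (k : ℤ) :
    ∫⁻ t in Ioo 0 T, viscBound N p r f (freqNorm Φ p (u t)) k =
      viscBound N p r f (fun l => ∫⁻ t in Ioo 0 T, freqNorm Φ p (u t) l) k := by
  have m1 : ∀ j l : ℤ, AEMeasurable (fun t => commCoef N p r k j l * (f j * (2 ^ (l : ℝ) * freqNorm Φ p (u t) l)))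
      (volume.restrict (Ioo 0 T)) := fun j l => (((h.aemeasurable_freqNorm l).const_mul _).const_mul _).const_mul _
  simp only [viscBound]
  rw [lintegral_tsum fun j => AEMeasurable.tsum fun l => m1 j l]
  refine tsum_congr fun j => ?_
  rw [lintegral_tsum fun l => m1 j l]
  refine tsum_congr fun l => ?_
  rw [lintegral_const_mul'' _ (((h.aemeasurable_freqNorm l).const_mul _).const_mul _), lintegral_const_mul'' _ ((h.aemeasurable_freqNorm l).const_mul _),
    lintegral_const_mul'' _ (h.aemeasurable_freqNorm l)]

end

/-- Summation of the commutators over the frequencies. -/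
theorem exists_tsum_viscBound_le (hN : 0 < N) {p r σ : ℝ} (hp : 1 < p) (hr : 0 < r) (h1 : -(N / r) < σ) (C₁ : ℝ≥0) :
    ∃ C : ℝ≥0, σ ≤ N / p → ∀ s T c₁ K J mu lam ρ ρc a u G u₀,
      MomentumData Φ p s T c₁ K J mu lam ρ ρc a u G u₀ → ∀ w : ℤ → ℝ, (SlowWeight fun k => ofReal (w k)) →
        ∑' k : ℤ, 2 ^ ((k : ℝ) * σ) * ofReal (w k) *
          ∫⁻ t in Ioo 0 T, viscBound N p r (coeffBound Φ p T C₁ ρ a) (freqNorm Φ p (u t)) k ≤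
        C * (densityFactor p T ρ * cheminLernerNorm Φ w T ⊤ p (N / p) a * cheminLernerNormV Φ oneWeight T 1 p (σ + 1) u) := by
  have hNp : 0 < (N : ℝ) / p := by positivity
  have hM : (N : ℝ) / p + 1 < (⌊(N : ℝ) / p⌋₊ + 2 : ℕ) := by
    push_cast; linarith [Nat.lt_floor_add_one ((N : ℝ) / p)]
  by_cases h2 : σ ≤ N / p
  swap
  · exact ⟨0, fun h => absurd h h2⟩
  obtain ⟨C, hC⟩ := exists_tsum_commutator_le N (by linarith) hr h1 h2 hNp hM
  refine ⟨C * C₁, fun _ s T c₁ K J mu lam ρ ρc a u G u₀ h w hw => ?_⟩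
  simp only [h.lintegral_viscBound]
  refine (hC _ hw (C₁ * densityFactor p T ρ) (fun i => timeNorm T ⊤ fun t => lpNorm p (block Φ i (a t)))
    fun l => 2 ^ (l : ℝ) * ∫⁻ t in Ioo 0 T, freqNorm Φ p (u t) l).trans_eq ?_
  have e1 : ∑' i : ℤ, 2 ^ ((i : ℝ) * (N / p)) * ofReal (w i) * timeNorm T ⊤ (fun t => lpNorm p (block Φ i (a t))) =
      cheminLernerNorm Φ w T ⊤ p (N / p) a := tsum_congr fun i => by
    rw [ofReal_mul (by positivity), two_rpow_ofReal]
  have e2 : ∑' l : ℤ, 2 ^ ((l : ℝ) * σ) * (2 ^ (l : ℝ) * ∫⁻ t in Ioo 0 T, freqNorm Φ p (u t) l) =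
      cheminLernerNormV Φ oneWeight T 1 p (σ + 1) u := by
    rw [h.cheminLernerNormV_one_eq hp.le]
    refine tsum_congr fun l => ?_
    rw [oneWeight, ENNReal.ofReal_one, mul_one, ← mul_assoc, ← two_rpow_add]
    congr 2; ring
  rw [e1, e2]
  push_cast
  ring

/-- Summation of the estimates of the blocks, with a weight `w` that dominates the gain from the finite time span. -/
theorem exists_cheminLernerNormV_le (hN : 0 < N) {p r : ℝ} (hp : 1 < p) (hpr : p ≤ r) (hr : p.conjExponent ≤ r) {c₁ : ℝ} (hc₁ : 0 < c₁) (K : ℝ) :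
    ∃ C C₁ : ℝ≥0, ∀ s T J mu lam ρ ρc a u G u₀,
      MomentumData Φ p s T c₁ K J mu lam ρ ρc a u G u₀ → (∀ k : ℤ, (∫⁻ t in Ioo 0 T, freqNorm Φ p (u t) k) ≠ ⊤) →
      ∀ q : ℝ≥0∞, 1 ≤ q → ∀ w : ℤ → ℝ, (∀ k, (eWeight (c₁ / 32) k T ^ 2) ^ (q⁻¹).toReal ≤ w k) →
        cheminLernerNormV Φ oneWeight T q p (s - 1 + 2 * (q⁻¹).toReal) u ≤
          C * (besovNormV Φ w p (s - 1) u₀ + cheminLernerNormV Φ w T 1 p (s - 1) G +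
            ∑' k : ℤ, 2 ^ ((k : ℝ) * s) * ofReal (w k) *
              ∫⁻ t in Ioo 0 T, viscBound N p r (coeffBound Φ p T C₁ ρ a) (freqNorm Φ p (u t)) k) := by
  obtain ⟨C, C₁, h⟩ := exists_timeNorm_le Φ hN hp hpr hr hc₁ K
  refine ⟨N * C, C₁, fun s T J mu lam ρ ρc a u G u₀ hd hu q hq w hw => ?_⟩
  refine (cheminLernerNormV_one_le Φ hp.le T q _ u).trans ?_
  rw [besovNormV_eq Φ hp.le, hd.cheminLernerNormV_source_eq hp.le, ← ENNReal.tsum_add, ← ENNReal.tsum_add]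
  push_cast
  rw [mul_assoc]
  refine mul_le_mul_right ?_ _
  rw [← ENNReal.tsum_mul_left]
  refine tsum_le_tsum fun k => ?_
  refine (mul_le_mul_right (h s T J mu lam ρ ρc a u G u₀ hd k (hu k) q hq) _).trans ?_
  set θ := (q⁻¹).toReal
  have e1 : 2 ^ ((k : ℝ) * (s - 1 + 2 * θ)) * (2 : ℝ≥0∞) ^ (-(2 * (k : ℝ) * θ)) = (2 : ℝ≥0∞) ^ ((k : ℝ) * (s - 1)) := by
    rw [← two_rpow_add]; congr 1; ring
  have e2 : (2 : ℝ≥0∞) ^ ((k : ℝ) * s) = 2 ^ ((k : ℝ) * (s - 1)) * (2 : ℝ≥0∞) ^ (k : ℝ) := by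
    rw [← two_rpow_add]; congr 1; ring
  have e3 : ofReal (eWeight (c₁ / 32) k T ^ 2) ^ θ ≤ ofReal (w k) := by
    rw [ENNReal.ofReal_rpow_of_nonneg (by positivity) toReal_nonneg]
    exact ofReal_le_ofReal (hw k)
  rw [e2]
  set X := freqNorm Φ p u₀ k + (∫⁻ t in Ioo 0 T, freqNorm Φ p (G t) k) +
    2 ^ (k : ℝ) * ∫⁻ t in Ioo 0 T, viscBound N p r (coeffBound Φ p T C₁ ρ a) (freqNorm Φ p (u t)) k with hX
  calc _ = C * (2 ^ ((k : ℝ) * (s - 1 + 2 * θ)) * (2 : ℝ≥0∞) ^ (-(2 * (k : ℝ) * θ)) *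
        ofReal (eWeight (c₁ / 32) k T ^ 2) ^ θ * X) := by ring
    _ ≤ C * (2 ^ ((k : ℝ) * (s - 1)) * ofReal (w k) * X) := by
      rw [e1]
      exact mul_le_mul_right (mul_le_mul_left (mul_le_mul_right e3 _) _) _
    _ = _ := by rw [hX]; ring

theorem slowWeight_one : SlowWeight fun k => ofReal (oneWeight k) := fun j k hjk => by
  simp only [oneWeight, ENNReal.ofReal_one, mul_one, le_refl, true_and]
  exact rpow_zero.symm.le.trans (two_rpow_mono (sub_nonneg.2 (by exact_mod_cast hjk)))

/-- This weight turns a derivative of the solution into one of the coefficient. -/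
theorem slowWeight_two_rpow : SlowWeight fun k => ofReal ((2 : ℝ) ^ (k : ℝ)) := fun j k hjk => by
  simp only [two_rpow_ofReal]
  exact ⟨two_rpow_mono (by exact_mod_cast hjk), by rw [← two_rpow_add, sub_add_cancel]⟩

theorem cheminLernerNorm_two_rpow (T : ℝ) (q : ℝ≥0∞) (p s : ℝ) (f : ℝ → 𝓢'(Sp N, ℂ)) :
    cheminLernerNorm Φ (fun k => (2 : ℝ) ^ (k : ℝ)) T q p s f = cheminLernerNorm Φ oneWeight T q p (s + 1) f :=
  tsum_congr fun k => by
    rw [oneWeight, mul_one, ← Real.rpow_add (by norm_num)]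
    congr 3; ring

end LinMom

end

theorem mainTheorem2 (N : ℕ) (hN : 2 ≤ N) (p : ℝ) (hp : 1 < p) (c₁ : ℝ) (hc₁ : 0 < c₁) :
    ∃ c : ℝ, 0 < c ∧ ∀ (Φ : LinMom.LPFunction N) (s K : ℝ),
      -((N : ℝ) * min (1 / p) (1 - 1 / p)) + 1 < s →
      ∃ C : ℝ≥0, ∀ (T : ℝ) (J : Set ℝ) (mu lam : ℝ → ℝ) (ρ : ℝ → LinMom.Sp N → ℝ) (ρc : ℝ)
        (a : ℝ → 𝓢'(LinMom.Sp N, ℂ)) (u G : ℝ → Fin N → 𝓢'(LinMom.Sp N, ℂ))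
        (u₀ : Fin N → 𝓢'(LinMom.Sp N, ℂ)),
        LinMom.MomentumData Φ p s T c₁ K J mu lam ρ ρc a u G u₀ →
        -- (a), first estimate
        (p ≤ N → s ≤ N / p →
          LinMom.bochnerNormV Φ T 1 p (s + 1) u < ⊤ →
          ∀ q : ℝ≥0∞, 1 ≤ q →
            LinMom.cheminLernerNormV Φ LinMom.oneWeight T q p (s - 1 + 2 * (q⁻¹).toReal) u ≤
              C * (LinMom.besovNormV Φ LinMom.oneWeight p (s - 1) u₀
                + LinMom.cheminLernerNormV Φ LinMom.oneWeight T 1 p (s - 1) G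
                + LinMom.densityFactor p T ρ
                  * LinMom.cheminLernerNorm Φ LinMom.oneWeight T ⊤ p (N / p) a
                  * LinMom.cheminLernerNormV Φ LinMom.oneWeight T 1 p (s + 1) u)) ∧
        -- (a), second estimate
        (s ≤ N / p + 1 →
          LinMom.bochnerNorm Φ T ⊤ p (N / p + 1) a < ⊤ →
          LinMom.bochnerNormV Φ T 1 p s u < ⊤ →
          ∀ q : ℝ≥0∞, 1 ≤ q →
            LinMom.cheminLernerNormV Φ LinMom.oneWeight T q p (s - 1 + 2 * (q⁻¹).toReal) u ≤
              C * (LinMom.besovNormV Φ LinMom.oneWeight p (s - 1) u₀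
                + LinMom.cheminLernerNormV Φ LinMom.oneWeight T 1 p (s - 1) G
                + LinMom.densityFactor p T ρ
                  * LinMom.cheminLernerNorm Φ LinMom.oneWeight T ⊤ p (N / p + 1) a
                  * LinMom.cheminLernerNormV Φ LinMom.oneWeight T 1 p s u)) ∧
        -- (b)
        (p ≤ N → s ≤ N / p →
          LinMom.bochnerNormV Φ T 1 p (s + 1) u < ⊤ →
            LinMom.cheminLernerNormV Φ LinMom.oneWeight T 1 p (s + 1) u
              + LinMom.cheminLernerNormV Φ LinMom.oneWeight T 2 p s u ≤
              C * (LinMom.besovNormV Φ (LinMom.omegaWeight c T) p (s - 1) u₀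
                + LinMom.cheminLernerNormV Φ (LinMom.omegaWeight c T) T 1 p (s - 1) G
                + LinMom.densityFactor p T ρ
                  * LinMom.cheminLernerNorm Φ (LinMom.omegaWeight c T) T ⊤ p (N / p) a
                  * LinMom.cheminLernerNormV Φ LinMom.oneWeight T 1 p (s + 1) u)) := by
  have hN0 : 0 < N := by omega
  -- with this exponent `N / r = N min(1/p, 1/p')`
  set r : ℝ := max p p.conjExponent with hr
  have hr0 : 0 < r := lt_max_of_lt_left (by linarith)
  have hNr : (N : ℝ) / r = N * min (1 / p) (1 - 1 / p) := by
    have h1 : 1 - 1 / p = 1 / p.conjExponent := by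
      rw [Real.conjExponent]; field_simp
    have hc : 0 < p.conjExponent := div_pos (by linarith) (by linarith)
    rw [h1, hr, div_eq_mul_one_div]
    congr 1
    rcases le_total p p.conjExponent with h | h
    · rw [max_eq_right h, min_eq_right (one_div_le_one_div_of_le (by linarith) h)]
    · rw [max_eq_left h, min_eq_left (one_div_le_one_div_of_le hc h)]
  refine ⟨c₁ / 32, by positivity, fun Φ s K hs => ?_⟩
  rw [← hNr] at hs
  have hNr0 : 0 ≤ (N : ℝ) / r := by positivity
  obtain ⟨C, C₁, hC⟩ := LinMom.exists_cheminLernerNormV_le Φ hN0 hp (le_max_left _ _) (le_max_right _ _) hc₁ K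
  obtain ⟨C₂, hC₂⟩ := LinMom.exists_tsum_viscBound_le Φ hN0 (σ := s) hp hr0 (by linarith) C₁
  obtain ⟨C₃, hC₃⟩ := LinMom.exists_tsum_viscBound_le Φ hN0 (σ := s - 1) hp hr0 (by linarith) C₁
  have hle : ∀ {B X V Z : ℝ≥0∞} {D : ℝ≥0}, V ≤ D * Z → D ≤ C₂ + C₃ → (C : ℝ≥0∞) * (B + X + V) ≤ (C * (1 + (C₂ + C₃)) : ℝ≥0) * (B + X + Z) := by
    intro B X V Z D hV hD
    push_cast
    rw [mul_assoc]
    refine mul_le_mul_right ?_ _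
    have h1 : V ≤ (1 + (C₂ + C₃ : ℝ≥0∞)) * Z := hV.trans (mul_le_mul_left ((ENNReal.coe_le_coe.2 hD).trans (by push_cast; exact le_add_self)) _)
    rw [mul_add]
    exact add_le_add (le_mul_of_one_le_left' le_self_add) h1
  refine ⟨2 * (C * (1 + (C₂ + C₃))), fun T J mu lam ρ ρc a u G u₀ h => ?_⟩
  have hT := h.time_pos
  have hle2 : ∀ {Y Z : ℝ≥0∞}, Y ≤ (C * (1 + (C₂ + C₃)) : ℝ≥0) * Z → Y ≤ (2 * (C * (1 + (C₂ + C₃))) : ℝ≥0) * Z := fun hY =>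
    hY.trans (mul_le_mul_left (ENNReal.coe_le_coe.2 (le_mul_of_one_le_left' (by norm_num))) _)
  -- the gain from a finite time span is at most `1`; for `q ≤ 2` it is even at most `ω_k`, see `hw`
  have hone : ∀ (q : ℝ≥0∞) (k : ℤ), (LinMom.eWeight (c₁ / 32) k T ^ 2) ^ (q⁻¹).toReal ≤ LinMom.oneWeight k := fun q k =>
    Real.rpow_le_one (by positivity) (pow_le_one₀ (LinMom.eWeight_nonneg _ _ _) (LinMom.eWeight_le_one _ _ _)) toReal_nonneg
  refine ⟨fun _ hsp hu q hq => ?_, fun hsp _ hu q hq => ?_, fun _ hsp hu => ?_⟩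
  · refine hle2 ((hC s T J mu lam ρ ρc a u G u₀ h (h.lintegral_freqNorm_ne_top hp.le hu) q hq _ (hone q)).trans ?_)
    exact hle (hC₂ hsp s T c₁ K J mu lam ρ ρc a u G u₀ h _ LinMom.slowWeight_one) le_self_add
  · refine hle2 ((hC s T J mu lam ρ ρc a u G u₀ h (h.lintegral_freqNorm_ne_top hp.le hu) q hq _ (hone q)).trans ?_)
    refine hle (D := C₃) ?_ le_add_self
    -- the derivative moves from the solution to the coefficient by means of the weight `2^k`
    have h1 := hC₃ (by linarith) s T c₁ K J mu lam ρ ρc a u G u₀ h _ LinMom.slowWeight_two_rpow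
    rw [LinMom.cheminLernerNorm_two_rpow, sub_add_cancel] at h1
    refine le_trans (tsum_le_tsum fun k => mul_le_mul_left ?_ _) h1
    rw [LinMom.oneWeight, ENNReal.ofReal_one, mul_one, LinMom.two_rpow_ofReal, ← LinMom.two_rpow_add]
    exact (congrArg _ (by ring)).le
  · have hw : ∀ q : ℝ≥0∞, 1 / 2 ≤ (q⁻¹).toReal → ∀ k : ℤ, (LinMom.eWeight (c₁ / 32) k T ^ 2) ^ (q⁻¹).toReal ≤ LinMom.omegaWeight (c₁ / 32) T k := fun q hq k => by
      have he := LinMom.eWeight_pos (c := c₁ / 32) (by positivity) hT k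
      refine le_trans ?_ (LinMom.eWeight_le_omegaWeight (c₁ / 32) T k)
      refine (Real.rpow_le_rpow_of_exponent_ge (by positivity) (pow_le_one₀ he.le (LinMom.eWeight_le_one _ _ _)) hq).trans_eq ?_
      rw [← Real.sqrt_eq_rpow, Real.sqrt_sq he.le]
    have hv := hC₂ hsp s T c₁ K J mu lam ρ ρc a u G u₀ h _ (LinMom.slowWeight_omegaWeight (c := c₁ / 32) (by positivity) hT.le)
    have key := fun (q : ℝ≥0∞) (hq : 1 ≤ q) (hq' : 1 / 2 ≤ (q⁻¹).toReal) =>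
      (hC s T J mu lam ρ ρc a u G u₀ h (h.lintegral_freqNorm_ne_top hp.le hu) q hq _ (hw q hq')).trans (hle hv le_self_add)
    have k1 := key 1 le_rfl (by norm_num)
    have k2 := key 2 (by norm_num) (by norm_num)
    have e1 : s - 1 + 2 * ((1 : ℝ≥0∞)⁻¹).toReal = s + 1 := by norm_num; ring
    have e2 : s - 1 + 2 * ((2 : ℝ≥0∞)⁻¹).toReal = s := by norm_num
    rw [e1] at k1
    rw [e2] at k2
    refine (add_le_add k1 k2).trans_eq ?_
    push_cast
    ring
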